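/- **Conventions.** In a monoidal category (associativity and unit constraints are suppressed) a left dual of $X$ is an object ${}^\vee X$ with $\mathrm{ev}_X\colon {}^\vee X\otimes X\to \mathbb 1$ and $\mathrm{coev}_X\colon \mathbb 1\to X\otimes {}^\vee X$ satisfying the zigzag identities; a right dual $X^\vee$ has $\widetilde{\mathrm{ev}}_X\colon X\otimes X^\vee\to\mathbb 1$ and $\widetilde{\mathrm{coev}}_X\colon\mathbb 1\to X^\vee\otimes X$. For $f\colon X\to Y$, ${}^\vee f\colon {}^\vee Y\to{}^\vee X$ is the dual morphism, and ${}^{\vee\vee}f={}^\vee({}^\vee f)$. The canonical isomorphisms ${}^\vee(X\otimes Y)\cong {}^\vee Y\otimes{}^\vee X$, ${}^\vee\mathbb 1\cong\mathbb 1$, ${}^\vee(X^\vee)\cong X$ are suppressed. Composition is written from right to left. Let $\Bbbk$ be a commutative ring and $\mathcal C$ a *spherical fusion category* over $\Bbbk$, that is: - $\mathcal C$ is an additive $\Bbbk$-linear monoidal category with $\Bbbk$-bilinear tensor product in which every object has a left and a right dual, with a finite family $(V_i)_{i\in I}$ of objects such that $\mathrm{End}(V_i)=\Bbbk\,\mathrm{id}_{V_i}$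 is free of rank one, $\mathrm{Hom}(V_i,V_j)=0$ for $i\ne j$, every object is a finite direct sum of objects $V_i$, and some $V_i$ is isomorphic to $\mathbb 1$; - $\mathcal C$ has a sovereign structure, i.e. a monoidal natural isomorphism $\phi_X\colon X\to{}^{\vee\vee}X$, such that for every endomorphism $f\colon X\to X$ the left trace $\mathrm{ev}_X(\mathrm{id}\otimes f\phi_X^{-1})\mathrm{coev}_{{}^\vee X}$ equals the right trace $\mathrm{ev}_{{}^\vee X}(\phi_Xf\otimes\mathrm{id})\mathrm{coev}_X$. Then one can choose: a label $0\in I$ with an isomorphism $u\colon V_0\to\mathbb 1$; a map $i\mapsto{}^\vee i$ on $I$ with isomorphisms $u_i\colon V_{{}^\vee i}\to{}^\vee V_i$; and for each object $X$ integers $N^i_X\ge0$ and morphisms $p^{i,\alpha}_X\colon X\to V_i$, $q^{i,\alpha}_X\colon V_i\to X$ ($1\le\alpha\le N_X^i$) with $p_X^{i,\alpha}q_X^{j,\beta}=\delta_{ij}\delta_{\alpha\beta}\,\mathrm{id}_{V_i}$ and $\sum_{i,\alpha}q_X^{i,\alpha}p_X^{i,\alpha}=\mathrm{id}_X$. The formulas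 below hold for every such choice. **The center.** $\mathcal Z(\mathcal C)$ is the braided category of pairs $(M,\sigma)$ with $\sigma_Y\colon M\otimes Y\to Y\otimes M$ a half braiding, with braiding $\tau_{(M,\sigma),(N,\sigma')}=\sigma_N$. It has left duals whose underlying objects, evaluations and coevaluations are those of $\mathcal C$. For $(M,\sigma)\in\mathcal Z(\mathcal C)$ put $r_Y=(\mathrm{ev}_Y\otimes\mathrm{id}_M)(\mathrm{id}_{{}^\vee Y}\otimes\sigma_Y)\colon{}^\vee Y\otimes M\otimes Y\to M$. The isomorphisms $$\theta_{(M,\sigma)}=r_M\big((\mathrm{id}_{{}^\vee M}\otimes\phi_M^{-1})\mathrm{coev}_{{}^\vee M}\otimes\mathrm{id}_M\big)$$ form a self-dual twist, i.e. $\theta$ is natural, $\theta_{X\otimes Y}=(\theta_X\otimes\theta_Y)\tau_{Y,X}\tau_{X,Y}$ and ${}^\vee(\theta_X)=\theta_{{}^\vee X}$. So $\mathcal Z(\mathcal C)$ is ribbon. The isomorphisms $\phi_M$ also form a sovereign structure on $\mathcal Z(\mathcal C)$. **The coend.** Put $A_{ij}={}^\vee V_i\otimes{}^\vee V_j\otimes{}^{\vee\vee}V_i\otimes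 V_j$. The object $C=\bigoplus_{i,j\in I}A_{ij}$ carries a half braiding for which it is the coend $\int^{X\in\mathcal Z(\mathcal C)}{}^\vee X\otimes X$ in $\mathcal Z(\mathcal C)$, with universal dinatural transformation $$\iota_{(M,\sigma)}=\sum_{i,j\in I}\ \sum_{1\le\alpha\le N^j_M}{}^\vee\big(r_{V_i}(\mathrm{id}_{{}^\vee V_i}\otimes q_M^{j,\alpha}\otimes\mathrm{id}_{V_i})\big)\otimes p_M^{j,\alpha}\colon{}^\vee M\otimes M\to C .$$ As the coend of a braided category with duals, $C$ has the following structure in $\mathcal Z(\mathcal C)$, where $X,Y$ run over the objects of $\mathcal Z(\mathcal C)$. It is a Hopf algebra, with $\Delta_C\iota_X=(\iota_X\otimes\iota_X)(\mathrm{id}\otimes\mathrm{coev}_X\otimes\mathrm{id})$, $\varepsilon_C\iota_X=\mathrm{ev}_X$, $m_C(\iota_X\otimes\iota_Y)=\iota_{Y\otimes X}(\mathrm{id}_{{}^\vee X}\otimes\tau_{X,{}^\vee Y\otimes Y})$, $u_C=\iota_{\mathbb 1}$ and antipode $S_C$. It has the pairing $\omega_C(\iota_X\otimes\iota_Y)=(\mathrm{ev}_X\otimes\mathrm{ev}_Y)(\mathrm{id}_{{}^\vee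 X}\otimes\tau_{{}^\vee Y,X}\tau_{X,{}^\vee Y}\otimes\mathrm{id}_Y)$. It has the twist forms $\theta_C^\pm\colon C\to\mathbb 1$ determined by $\theta_X^{\pm1}=(\mathrm{id}_X\otimes\theta_C^\pm\iota_X)(\mathrm{coev}_X\otimes\mathrm{id}_X)$. In terms of $\mathcal C$ this structure is as follows. Subscripts such as ${}_{k,m}$ or ${}_{{}^\vee k,j,k}$ stand for the objects $V_k\otimes V_m$, ${}^\vee V_k\otimes V_j\otimes V_k$, and so on, with ${}^\vee k$ in a subscript read as ${}^\vee V_k$ and $k^\vee$ as $V_k^\vee$. We write $\mathrm{id}$ for the identities of the tensor factors not acted on. Each sum is over the indicated labels in $I$ and over all admissible Greek indices, and each summand is extended by zero to the other summands of $C$. 1. $\Delta_C$ is the sum over $i,j,k,m,n,\alpha,\beta$ of the morphisms $A_{ij}\to A_{mn}\otimes A_{kj}$ $$(\mathrm{id}\otimes{}^\vee P'\otimes\mathrm{id}_{V_j})(\mathrm{id}_{{}^\vee V_m\otimes{}^\vee V_n\otimes{}^{\vee\vee}V_m}\otimes\mathrm{coev}_{V_n}\otimes\mathrm{id}_{V_j})(\mathrm{id}_{{}^\vee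 V_m}\otimes{}^\vee Q'\otimes\mathrm{id}_{{}^{\vee\vee}V_m\otimes V_j})({}^\vee P\otimes\mathrm{id}_{{}^\vee V_j}\otimes{}^{\vee\vee}Q\otimes\mathrm{id}_{V_j}),$$ where $P=p^{i,\alpha}_{k,m}$, $Q=q^{i,\alpha}_{k,m}$, $P'=p^{n,\beta}_{{}^\vee k,j,k}$, $Q'=q^{n,\beta}_{{}^\vee k,j,k}$, and ${}^\vee P'$ acts on the factor ${}^\vee V_n$ created by $\mathrm{coev}_{V_n}$. 2. $\varepsilon_C$ is the sum over $j$ of $\mathrm{ev}_{V_j}\big({}^\vee(u^{-1})\otimes\mathrm{id}_{{}^\vee V_j}\otimes{}^{\vee\vee}u\otimes\mathrm{id}_{V_j}\big)\colon A_{0j}\to\mathbb 1$. 3. $S_C$ is the sum over $i,j,k,l,\alpha,\beta$ of the morphisms $A_{ij}\to A_{kl}$ given as follows, where $P=u_ip^{{}^\vee i,\alpha}_{j,k,j^\vee}$, $Q=q^{{}^\vee i,\alpha}_{j,k,j^\vee}u_i^{-1}$, $P'=p^{l,\beta}_{{}^\vee j,{}^\vee i,{}^\vee j,{}^{\vee\vee}i,j}$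 and $Q'=q^{l,\beta}_{{}^\vee j,{}^\vee i,{}^\vee j,{}^{\vee\vee}i,j}$. Insert $\big(\mathrm{id}_{{}^\vee V_j}\otimes\mathrm{coev}_{{}^{\vee\vee}V_i}\otimes\mathrm{id}_{{}^{\vee\vee}V_j}\big)\mathrm{coev}_{{}^\vee V_j}\otimes\mathrm{coev}_{{}^{\vee\vee}V_i}$ to the left of $A_{ij}$, which gives $${}^\vee V_j\otimes{}^{\vee\vee}V_i\otimes{}^{\vee\vee\vee}V_i\otimes{}^{\vee\vee}V_j\otimes{}^{\vee\vee}V_i\otimes{}^{\vee\vee\vee}V_i\otimes A_{ij}.$$ Apply ${}^\vee P\colon{}^{\vee\vee}V_i\to V_j\otimes{}^\vee V_k\otimes{}^\vee V_j$ to the second factor and ${}^{\vee\vee}Q\colon{}^{\vee\vee\vee}V_i\to{}^{\vee\vee}V_j\otimes{}^{\vee\vee}V_k\otimes{}^\vee V_j$ to the sixth. Apply $\mathrm{ev}_{V_j}$ to the first two factors, which leaves $${}^\vee V_k\otimes\big({}^\vee V_j\otimes{}^{\vee\vee\vee}V_i\otimes{}^{\vee\vee}V_j\otimes{}^{\vee\vee}V_i\otimes{}^{\vee\vee}V_j\big)\otimes{}^{\vee\vee}V_k\otimes\big({}^\vee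 V_j\otimes A_{ij}\big).$$ Finally apply $\mathrm{id}_{{}^\vee V_k}\otimes{}^\vee Q'\otimes\mathrm{id}_{{}^{\vee\vee}V_k}\otimes P'$. 4. $\omega_C$ is the sum over $i,j,k,l,\alpha,\beta$ of the morphisms $A_{ij}\otimes A_{kl}\to\mathbb 1$ $$\mathrm{ev}_{V_l}(\mathrm{id}_{{}^\vee V_l}\otimes\mathrm{ev}_{{}^\vee V_k}\otimes\mathrm{id}_{V_l})(\mathrm{ev}_{{}^\vee V_k}\otimes\mathrm{id})(\mathrm{id}_{{}^{\vee\vee}V_k}\otimes Q'\otimes P\otimes\mathrm{id}_{V_l})(\mathrm{id}_{{}^{\vee\vee}V_k}\otimes\mathrm{coev}_{V_i}\otimes\mathrm{id})({}^\vee Q\otimes\mathrm{id}_{V_j}\otimes P'\otimes\mathrm{id}_{V_l}),$$ where $P=u_kp^{{}^\vee k,\alpha}_{{}^\vee i,j,i}$, $Q=q^{{}^\vee k,\alpha}_{{}^\vee i,j,i}u_k^{-1}$, $P'=p^{i,\beta}_{{}^\vee k,{}^\vee l,{}^{\vee\vee}k}$, $Q'=q^{i,\beta}_{{}^\vee k,{}^\vee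 l,{}^{\vee\vee}k}$. 5. $\theta_C^+$ is the sum over $i$ of $\mathrm{ev}_{V_i}\big(\mathrm{id}_{{}^\vee V_i}\otimes\mathrm{ev}_{{}^{\vee\vee}V_i}(\phi_{{}^\vee V_i}\otimes\mathrm{id}_{{}^{\vee\vee}V_i})\otimes\mathrm{id}_{V_i}\big)\colon A_{ii}\to\mathbb 1$. 6. $\theta_C^-$ is the sum over $i$ of $\mathrm{ev}_{{}^{\vee\vee}V_i}\big(\phi_{{}^\vee V_i}\otimes{}^\vee(u_i^{-1})\big)\otimes\mathrm{ev}_{{}^\vee V_i}(\mathrm{id}_{{}^{\vee\vee}V_i}\otimes u_i)\colon A_{i,{}^\vee i}\to\mathbb 1$. 7. $\tau_{C,C}$ is the sum over $i,j,k,l,a,b,m,\alpha,\beta,\gamma$ of the morphisms $A_{ij}\otimes A_{kl}\to A_{kl}\otimes A_{ab}$ $$(Q\otimes\mathrm{id}_{A_{ab}})(\mathrm{id}_{V_m\otimes{}^\vee V_a\otimes{}^\vee V_b\otimes{}^{\vee\vee}V_a}\otimes P_1)(\mathrm{id}_{V_m\otimes{}^\vee V_a}\otimes{}^\vee Q_1\otimes\mathrm{id})({}^\vee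 P_2\otimes\mathrm{id}_{{}^\vee V_j}\otimes{}^{\vee\vee}Q_2\otimes\mathrm{id}_{V_j\otimes V_m})(\mathrm{id}_{A_{ij}}\otimes P),$$ where $P=p^{m,\alpha}_{{}^\vee k,{}^\vee l,{}^{\vee\vee}k,l}$, $Q=q^{m,\alpha}_{{}^\vee k,{}^\vee l,{}^{\vee\vee}k,l}$, $P_1=p^{b,\beta}_{{}^\vee m,j,m}$, $Q_1=q^{b,\beta}_{{}^\vee m,j,m}$, $P_2=p^{i,\gamma}_{m,a,m^\vee}$, $Q_2=q^{i,\gamma}_{m,a,m^\vee}$. **Dimension.** The dimension of a sovereign category with a coend is the common value, if they agree, of the left and right traces of the identity of its coend. Then $\mathcal C$ has a coend and a dimension $\dim\mathcal C\in\mathrm{End}(\mathbb 1)$; the category $\mathcal Z(\mathcal C)$ has a dimension, the same for every sovereign structure on it; and $$\dim\mathcal Z(\mathcal C)=(\dim\mathcal C)^2 .$$ -/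

import Mathlib

open CategoryTheory MonoidalCategory
universe v u w w'


namespace CenterCoend

section
variable {C : Type u} [Category.{v} C] [MonoidalCategory.{v} C]

/-- The left dual of `X`, i.e. the dual with evaluation `ld X ⊗ X ⟶ 𝟙_` and coevaluation
`𝟙_ ⟶ X ⊗ ld X`. (Mathlib calls this object the right dual `Xᘁ`.) -/
abbrev ld [RightRigidCategory C] (X : C) : C := Xᘁ

/-- The right dual of `X`, i.e. the dual with evaluation `X ⊗ rd X ⟶ 𝟙_` and coevaluation
`𝟙_ ⟶ rd X ⊗ X`. (Mathlib calls this object the left dual `ᘁX`.) -/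
abbrev rd [LeftRigidCategory C] (X : C) : C := (ᘁX : C)

/-! ### The center of a rigid category is rigid -/

/-- Natural and multiplicative families `N ⊗ Y ⟶ Y ⊗ N`, a tool to construct half braidings. -/
structure LaxHB (N : C) where
  f : ∀ Y, N ⊗ Y ⟶ Y ⊗ N
  nat : ∀ {Y Y' : C} (g : Y ⟶ Y'), N ◁ g ≫ f Y' = f Y ≫ g ▷ N
  mon : ∀ Y Y', f (Y ⊗ Y') = 𝟙 _ ⊗≫ f Y ▷ Y' ⊗≫ Y ◁ f Y' ⊗≫ 𝟙 _
  one : f (𝟙_ C) = (ρ_ N).hom ≫ (λ_ N).inv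

/-- The inverse of a lax half braiding, by means of right duals. -/
def laxInv [LeftRigidCategory C] {N : C} (h : LaxHB N) (Y : C) : Y ⊗ N ⟶ N ⊗ Y :=
  𝟙 _ ⊗≫ (Y ⊗ N) ◁ η_ (rd Y) Y ⊗≫ Y ◁ h.f (rd Y) ▷ Y ⊗≫ ε_ (rd Y) Y ▷ (N ⊗ Y) ⊗≫ 𝟙 _

lemma lax_hom_inv [LeftRigidCategory C] {N : C} (h : LaxHB N) (Y : C) :
    h.f Y ≫ laxInv h Y = 𝟙 _ := by
  calc h.f Y ≫ laxInv h Y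
      = 𝟙 _ ⊗≫ (h.f Y ▷ 𝟙_ C ≫ (Y ⊗ N) ◁ η_ (rd Y) Y) ⊗≫ Y ◁ h.f (rd Y) ▷ Y ⊗≫
          ε_ (rd Y) Y ▷ (N ⊗ Y) ⊗≫ 𝟙 _ := by
        unfold laxInv; monoidal
    _ = 𝟙 _ ⊗≫ (N ⊗ Y) ◁ η_ (rd Y) Y ⊗≫ (𝟙 (N ⊗ (Y ⊗ rd Y)) ⊗≫ h.f Y ▷ rd Y ⊗≫ Y ◁ h.f (rd Y) ⊗≫
            𝟙 ((Y ⊗ rd Y) ⊗ N)) ▷ Y ⊗≫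
          ε_ (rd Y) Y ▷ (N ⊗ Y) ⊗≫ 𝟙 _ := by
        rw [← whisker_exchange]; monoidal
    _ = 𝟙 _ ⊗≫ (N ⊗ Y) ◁ η_ (rd Y) Y ⊗≫ (h.f (Y ⊗ rd Y) ≫ ε_ (rd Y) Y ▷ N) ▷ Y ⊗≫ 𝟙 _ := by
        rw [h.mon]; monoidal
    _ = 𝟙 _ ⊗≫ N ◁ (Y ◁ η_ (rd Y) Y ⊗≫ ε_ (rd Y) Y ▷ Y) ⊗≫ 𝟙 _ := by
        rw [← h.nat, h.one]; monoidal
    _ = _ := by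
        rw [ExactPairing.coevaluation_evaluation'']; monoidal

lemma lax_inv_hom [LeftRigidCategory C] {N : C} (h : LaxHB N) (Y : C) :
    laxInv h Y ≫ h.f Y = 𝟙 _ := by
  calc laxInv h Y ≫ h.f Y
      = 𝟙 _ ⊗≫ (Y ⊗ N) ◁ η_ (rd Y) Y ⊗≫ Y ◁ h.f (rd Y) ▷ Y ⊗≫
          (ε_ (rd Y) Y ▷ (N ⊗ Y) ≫ 𝟙_ C ◁ h.f Y) ⊗≫ 𝟙 _ := by
        unfold laxInv; monoidal
    _ = 𝟙 _ ⊗≫ (Y ⊗ N) ◁ η_ (rd Y) Y ⊗≫ Y ◁ (𝟙 (N ⊗ (rd Y ⊗ Y)) ⊗≫ h.f (rd Y) ▷ Y ⊗≫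
            rd Y ◁ h.f Y ⊗≫ 𝟙 ((rd Y ⊗ Y) ⊗ N)) ⊗≫
          ε_ (rd Y) Y ▷ (Y ⊗ N) ⊗≫ 𝟙 _ := by
        rw [← whisker_exchange]; monoidal
    _ = 𝟙 _ ⊗≫ Y ◁ (N ◁ η_ (rd Y) Y ≫ h.f (rd Y ⊗ Y)) ⊗≫ ε_ (rd Y) Y ▷ (Y ⊗ N) ⊗≫ 𝟙 _ := by
        rw [h.mon]; monoidal
    _ = 𝟙 _ ⊗≫ (Y ◁ η_ (rd Y) Y ⊗≫ ε_ (rd Y) Y ▷ Y) ▷ N ⊗≫ 𝟙 _ := by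
        rw [h.nat, h.one]; monoidal
    _ = _ := by
        rw [ExactPairing.coevaluation_evaluation'']; monoidal


/-- The half braiding `ld M ⊗ Y ⟶ Y ⊗ ld M` of the left dual of `(M, σ)`: rotate `σ_Y⁻¹`. -/
def dualBraidHom [RightRigidCategory C] (M : Center C) (Y : C) : ld M.1 ⊗ Y ⟶ Y ⊗ ld M.1 :=
  𝟙 _ ⊗≫ (ld M.1 ⊗ Y) ◁ η_ M.1 (ld M.1) ⊗≫ ld M.1 ◁ (M.2.β Y).inv ▷ ld M.1 ⊗≫
    ε_ M.1 (ld M.1) ▷ (Y ⊗ ld M.1) ⊗≫ 𝟙 _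

lemma inv_nat (M : Center C) {Y Y' : C} (g : Y ⟶ Y') :
    (g ▷ M.1) ≫ (M.2.β Y').inv = (M.2.β Y).inv ≫ M.1 ◁ g := by
  rw [Iso.comp_inv_eq, Category.assoc, Iso.eq_inv_comp, M.2.naturality]

lemma inv_mon (M : Center C) (Y Y' : C) :
    (M.2.β (Y ⊗ Y')).inv =
      𝟙 _ ⊗≫ Y ◁ (M.2.β Y').inv ⊗≫ (M.2.β Y).inv ▷ Y' ⊗≫ 𝟙 _ := by
  rw [← cancel_mono (M.2.β (Y ⊗ Y')).hom, Iso.inv_hom_id, M.2.monoidal]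
  symm
  calc _ = 𝟙 _ ⊗≫ Y ◁ (M.2.β Y').inv ⊗≫ ((M.2.β Y).inv ≫ (M.2.β Y).hom) ▷ Y' ⊗≫
          Y ◁ (M.2.β Y').hom ⊗≫ 𝟙 _ := by monoidal
    _ = 𝟙 _ ⊗≫ Y ◁ ((M.2.β Y').inv ≫ (M.2.β Y').hom) ⊗≫ 𝟙 _ := by
        rw [Iso.inv_hom_id]; monoidal
    _ = _ := by rw [Iso.inv_hom_id]; monoidal

lemma hom_one (M : Center C) : (M.2.β (𝟙_ C)).hom = (ρ_ M.1).hom ≫ (λ_ M.1).inv := by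
  have n := M.2.naturality (λ_ (𝟙_ C)).hom
  rw [M.2.monoidal] at n
  have hid : ((ρ_ M.1).inv ≫ (M.2.β (𝟙_ C)).hom ≫ (λ_ M.1).hom) ≫
      ((ρ_ M.1).inv ≫ (M.2.β (𝟙_ C)).hom ≫ (λ_ M.1).hom) =
      (ρ_ M.1).inv ≫ (M.2.β (𝟙_ C)).hom ≫ (λ_ M.1).hom := by
    symm
    calc _ = (ρ_ M.1).inv ≫ (M.1 ◁ (λ_ (𝟙_ C)).inv) ≫ (M.1 ◁ (λ_ (𝟙_ C)).hom ≫
            (M.2.β (𝟙_ C)).hom) ≫ (λ_ M.1).hom := by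
          rw [← Category.assoc (M.1 ◁ _), ← Category.assoc (M.1 ◁ _), ← MonoidalCategory.whiskerLeft_comp]
          rw [Iso.inv_hom_id]; monoidal
      _ = (ρ_ M.1).inv ≫ (M.1 ◁ (λ_ (𝟙_ C)).inv) ≫ (α_ _ _ _).inv ≫
            ((M.2.β (𝟙_ C)).hom ▷ 𝟙_ C) ≫ (ρ_ _).hom ≫ (λ_ _).hom ≫ (ρ_ _).inv ≫
              (M.2.β (𝟙_ C)).hom ≫ (λ_ M.1).hom := by rw [n]; monoidal
      _ = _ := by rw [rightUnitor_naturality_assoc]; monoidal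
  have h1 : (ρ_ M.1).inv ≫ (M.2.β (𝟙_ C)).hom ≫ (λ_ M.1).hom = 𝟙 _ := by
    rw [← cancel_epi ((ρ_ M.1).inv ≫ (M.2.β (𝟙_ C)).hom ≫ (λ_ M.1).hom), hid, Category.comp_id]
  rw [Iso.inv_comp_eq, Category.comp_id] at h1
  rw [← h1]; simp

lemma inv_one (M : Center C) : (M.2.β (𝟙_ C)).inv = (λ_ M.1).hom ≫ (ρ_ M.1).inv := by
  rw [← cancel_epi (M.2.β (𝟙_ C)).hom, Iso.hom_inv_id, hom_one]; simp

lemma dualKey [RightRigidCategory C] (M : Center C) (Y : C) :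
    dualBraidHom M Y ▷ M.1 ⊗≫ Y ◁ ε_ M.1 (ld M.1) =
      𝟙 _ ⊗≫ ld M.1 ◁ (M.2.β Y).inv ⊗≫ ε_ M.1 (ld M.1) ▷ Y ⊗≫ 𝟙 _ := by
  calc _ = 𝟙 ((ld M.1 ⊗ Y) ⊗ M.1) ⊗≫ (ld M.1 ⊗ Y) ◁ η_ M.1 (ld M.1) ▷ M.1 ⊗≫
          ld M.1 ◁ (M.2.β Y).inv ▷ (ld M.1 ⊗ M.1) ⊗≫
          (ε_ M.1 (ld M.1) ▷ (Y ⊗ (ld M.1 ⊗ M.1)) ≫ 𝟙_ C ◁ (Y ◁ ε_ M.1 (ld M.1))) ⊗≫ 𝟙 _ := by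
        unfold dualBraidHom; monoidal
    _ = 𝟙 ((ld M.1 ⊗ Y) ⊗ M.1) ⊗≫ (ld M.1 ⊗ Y) ◁ η_ M.1 (ld M.1) ▷ M.1 ⊗≫
          ld M.1 ◁ ((M.2.β Y).inv ▷ (ld M.1 ⊗ M.1) ≫ (M.1 ⊗ Y) ◁ ε_ M.1 (ld M.1)) ⊗≫
          ε_ M.1 (ld M.1) ▷ Y ⊗≫ 𝟙 _ := by
        rw [← whisker_exchange]; monoidal
    _ = 𝟙 ((ld M.1 ⊗ Y) ⊗ M.1) ⊗≫ (ld M.1 ⊗ Y) ◁ (η_ M.1 (ld M.1) ▷ M.1 ⊗≫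
          M.1 ◁ ε_ M.1 (ld M.1)) ⊗≫ ld M.1 ◁ (M.2.β Y).inv ⊗≫
          ε_ M.1 (ld M.1) ▷ Y ⊗≫ 𝟙 _ := by
        rw [← whisker_exchange]; monoidal
    _ = _ := by rw [ExactPairing.evaluation_coevaluation'']; monoidal

lemma dualExt [RightRigidCategory C] (M : Center C) {W Y : C} {a b : W ⟶ Y ⊗ ld M.1}
    (h : a ▷ M.1 ⊗≫ Y ◁ ε_ M.1 (ld M.1) = b ▷ M.1 ⊗≫ Y ◁ ε_ M.1 (ld M.1)) : a = b := by
  apply (tensorRightHomEquiv W M.1 (ld M.1) Y).symm.injective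
  change a ▷ _ ≫ (α_ _ _ _).hom ≫ _ ◁ ε_ _ _ ≫ (ρ_ _).hom =
    b ▷ _ ≫ (α_ _ _ _).hom ≫ _ ◁ ε_ _ _ ≫ (ρ_ _).hom
  have e (z : W ⟶ Y ⊗ ld M.1) : z ▷ _ ≫ (α_ _ _ _).hom ≫ _ ◁ ε_ _ _ ≫ (ρ_ _).hom =
    (z ▷ M.1 ⊗≫ Y ◁ ε_ M.1 (ld M.1)) ≫ (ρ_ _).hom := by monoidal
  rw [e, e, h]

/-- The family `dualBraidHom` is natural and multiplicative. -/
def dualLax [RightRigidCategory C] (M : Center C) : LaxHB (ld M.1) where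
  f := dualBraidHom M
  nat {Y Y'} g := by
    calc _ = 𝟙 (ld M.1 ⊗ Y) ⊗≫ ((ld M.1 ◁ g) ▷ 𝟙_ C ≫ (ld M.1 ⊗ Y') ◁ η_ M.1 (ld M.1)) ⊗≫
          ld M.1 ◁ (M.2.β Y').inv ▷ ld M.1 ⊗≫
          ε_ M.1 (ld M.1) ▷ (Y' ⊗ ld M.1) ⊗≫ 𝟙 _ := by unfold dualBraidHom; monoidal
      _ = 𝟙 _ ⊗≫ (ld M.1 ⊗ Y) ◁ η_ M.1 (ld M.1) ⊗≫
          ld M.1 ◁ (g ▷ M.1 ≫ (M.2.β Y').inv) ▷ ld M.1 ⊗≫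
          ε_ M.1 (ld M.1) ▷ (Y' ⊗ ld M.1) ⊗≫ 𝟙 _ := by
        rw [← whisker_exchange]; monoidal
      _ = 𝟙 _ ⊗≫ (ld M.1 ⊗ Y) ◁ η_ M.1 (ld M.1) ⊗≫
          ld M.1 ◁ (M.2.β Y).inv ▷ ld M.1 ⊗≫
          ((ld M.1 ⊗ M.1) ◁ g ≫ ε_ M.1 (ld M.1) ▷ Y') ▷ ld M.1 ⊗≫ 𝟙 _ := by
        rw [inv_nat]; monoidal
      _ = _ := by
        rw [whisker_exchange]; unfold dualBraidHom; monoidal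
  mon Y Y' := by
    apply dualExt M
    rw [dualKey, inv_mon]
    symm
    calc _ = 𝟙 ((ld M.1 ⊗ (Y ⊗ Y')) ⊗ M.1) ⊗≫ dualBraidHom M Y ▷ (Y' ⊗ M.1) ⊗≫
          Y ◁ (dualBraidHom M Y' ▷ M.1 ⊗≫ Y' ◁ ε_ M.1 (ld M.1)) ⊗≫ 𝟙 _ := by monoidal
      _ = 𝟙 _ ⊗≫ (dualBraidHom M Y ▷ (Y' ⊗ M.1) ≫
          (Y ⊗ ld M.1) ◁ (M.2.β Y').inv) ⊗≫ Y ◁ ε_ M.1 (ld M.1) ▷ Y' ⊗≫ 𝟙 _ := by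
          rw [dualKey]; monoidal
      _ = 𝟙 _ ⊗≫ (ld M.1 ⊗ Y) ◁ (M.2.β Y').inv ⊗≫ (dualBraidHom M Y ▷ M.1 ⊗≫
          Y ◁ ε_ M.1 (ld M.1)) ▷ Y' ⊗≫ 𝟙 _ := by
          rw [← whisker_exchange]; monoidal
      _ = _ := by rw [dualKey]; monoidal
  one := by
    calc dualBraidHom M (𝟙_ C) = 𝟙 (ld M.1 ⊗ 𝟙_ C) ⊗≫ (ld M.1 ◁ η_ M.1 (ld M.1) ⊗≫
            ε_ M.1 (ld M.1) ▷ ld M.1) ⊗≫ 𝟙 (𝟙_ C ⊗ ld M.1) := by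
          unfold dualBraidHom; rw [inv_one]; monoidal
      _ = _ := by rw [ExactPairing.coevaluation_evaluation'']; monoidal

/-- The half braiding of the left dual. -/
def dualHalfBraiding [RigidCategory C] (M : Center C) : HalfBraiding (ld M.1) where
  β Y := ⟨dualBraidHom M Y, laxInv (dualLax M) Y, lax_hom_inv (dualLax M) Y,
    lax_inv_hom (dualLax M) Y⟩
  monoidal Y Y' := by
    change (dualLax M).f _ = _ ≫ (dualLax M).f _ ▷ _ ≫ _ ≫ _ ◁ (dualLax M).f _ ≫ _
    rw [(dualLax M).mon]; monoidal
  naturality g := (dualLax M).nat g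

/-- The left dual of an object of the center. -/
def centerLd [RigidCategory C] (M : Center C) : Center C := ⟨ld M.1, dualHalfBraiding M⟩

/-- The evaluation of the center, which is that of the underlying object. -/
def centerEv [RigidCategory C] (M : Center C) : centerLd M ⊗ M ⟶ 𝟙_ (Center C) where
  f := ε_ M.1 (ld M.1)
  comm Y := by
    change ε_ M.1 (ld M.1) ▷ Y ≫ (λ_ Y).hom ≫ (ρ_ Y).inv =
      ((α_ _ _ _).hom ≫ (ld M.1 ◁ (M.2.β Y).hom) ≫ (α_ _ _ _).inv ≫
        dualBraidHom M Y ▷ M.1 ≫ (α_ _ _ _).hom) ≫ Y ◁ ε_ M.1 (ld M.1)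
    symm
    calc _ = (α_ _ _ _).hom ≫ (ld M.1 ◁ (M.2.β Y).hom) ≫ (α_ _ _ _).inv ≫
        (dualBraidHom M Y ▷ M.1 ⊗≫ Y ◁ ε_ M.1 (ld M.1)) := by monoidal
      _ = 𝟙 _ ⊗≫ ld M.1 ◁ ((M.2.β Y).hom ≫ (M.2.β Y).inv) ⊗≫ ε_ M.1 (ld M.1) ▷ Y ⊗≫ 𝟙 _ := by
        rw [dualKey]; monoidal
      _ = _ := by rw [Iso.hom_inv_id]; monoidal

/-- The coevaluation of the center, which is that of the underlying object. -/
def centerCoev [RigidCategory C] (M : Center C) : 𝟙_ (Center C) ⟶ M ⊗ centerLd M where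
  f := η_ M.1 (ld M.1)
  comm Y := by
    change η_ M.1 (ld M.1) ▷ Y ≫ ((α_ _ _ _).hom ≫ (M.1 ◁ dualBraidHom M Y) ≫ (α_ _ _ _).inv ≫
        (M.2.β Y).hom ▷ ld M.1 ≫ (α_ _ _ _).hom) =
      ((λ_ Y).hom ≫ (ρ_ Y).inv) ≫ Y ◁ η_ M.1 (ld M.1)
    calc _ = 𝟙 _ ⊗≫ (η_ M.1 (ld M.1) ▷ (Y ⊗ 𝟙_ C) ≫
            (M.1 ⊗ ld M.1) ◁ (Y ◁ η_ M.1 (ld M.1))) ⊗≫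
            (M.1 ⊗ ld M.1) ◁ (M.2.β Y).inv ▷ ld M.1 ⊗≫
            M.1 ◁ ε_ M.1 (ld M.1) ▷ (Y ⊗ ld M.1) ⊗≫ (M.2.β Y).hom ▷ ld M.1 ⊗≫ 𝟙 _ := by
          unfold dualBraidHom; monoidal
      _ = 𝟙 _ ⊗≫ Y ◁ η_ M.1 (ld M.1) ⊗≫ (η_ M.1 (ld M.1) ▷ (Y ⊗ M.1) ≫
            (M.1 ⊗ ld M.1) ◁ (M.2.β Y).inv) ▷ ld M.1 ⊗≫
            M.1 ◁ ε_ M.1 (ld M.1) ▷ (Y ⊗ ld M.1) ⊗≫ (M.2.β Y).hom ▷ ld M.1 ⊗≫ 𝟙 _ := by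
          rw [← whisker_exchange]; monoidal
      _ = 𝟙 _ ⊗≫ Y ◁ η_ M.1 (ld M.1) ⊗≫ (M.2.β Y).inv ▷ ld M.1 ⊗≫
            (η_ M.1 (ld M.1) ▷ M.1 ⊗≫ M.1 ◁ ε_ M.1 (ld M.1)) ▷ (Y ⊗ ld M.1) ⊗≫
            (M.2.β Y).hom ▷ ld M.1 ⊗≫ 𝟙 _ := by
          rw [← whisker_exchange]; monoidal
      _ = 𝟙 _ ⊗≫ Y ◁ η_ M.1 (ld M.1) ⊗≫ ((M.2.β Y).inv ≫ (M.2.β Y).hom) ▷ ld M.1 ⊗≫ 𝟙 _ := by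
          rw [ExactPairing.evaluation_coevaluation'']; monoidal
      _ = _ := by rw [Iso.inv_hom_id]; monoidal

/-- The center of a rigid category has left duals, evaluations and coevaluations as in the
underlying category. -/
instance centerRightRigid [RigidCategory C] : RightRigidCategory (Center C) where
  rightDual M :=
    { rightDual := centerLd M
      exact :=
        { coevaluation' := centerCoev M
          evaluation' := centerEv M
          coevaluation_evaluation' := by
            apply Center.ext
            change _ = (ρ_ (ld M.1)).hom ≫ (Center.Hom.f (λ_ (centerLd M)).inv)
            rw [Center.leftUnitor_inv_f]
            change ld M.1 ◁ η_ M.1 (ld M.1) ≫ Center.Hom.f (α_ (centerLd M) M (centerLd M)).inv ≫ ε_ M.1 (ld M.1) ▷ ld M.1 = _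
            rw [Center.associator_inv_f]
            exact ExactPairing.coevaluation_evaluation M.1 (ld M.1)
          evaluation_coevaluation' := by
            apply Center.ext
            change _ = (λ_ M.1).hom ≫ (Center.Hom.f (ρ_ M).inv)
            rw [Center.rightUnitor_inv_f]
            exact ExactPairing.evaluation_coevaluation M.1 (ld M.1) } }
end


/-! ### Dual morphisms, sovereign and ribbon structures, coends -/

section Duality
variable {D : Type u} [Category.{v} D] [MonoidalCategory.{v} D]

/-- The left dual morphism `ᵛf : Y' ⟶ X'` of `f : X ⟶ Y`, where `X'` and `Y'` are given left duals
of `X` and `Y`. For a tensor product `X ⊗ Y` the left dual used is `Y' ⊗ X'`. -/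
def dualMap {X Y : D} (X' Y' : D) [ExactPairing X X'] [ExactPairing Y Y'] (f : X ⟶ Y) : Y' ⟶ X' :=
  @rightAdjointMate D _ _ X Y ⟨X'⟩ ⟨Y'⟩ f

/-- The canonical isomorphism `ld Y ⊗ ld X ⟶ ld (X ⊗ Y)`. -/
def ldTensor [RightRigidCategory D] (X Y : D) : ld Y ⊗ ld X ⟶ ld (X ⊗ Y) :=
  dualMap (ld (X ⊗ Y)) (ld Y ⊗ ld X) (𝟙 (X ⊗ Y))

/-- The canonical isomorphism `𝟙_ ⟶ ld 𝟙_`. -/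
def ldUnit [RightRigidCategory D] : 𝟙_ D ⟶ ld (𝟙_ D) :=
  dualMap (ld (𝟙_ D)) (𝟙_ D) (𝟙 (𝟙_ D))

/-- The canonical isomorphism `ld (ld (X ⊗ Y)) ⟶ ld (ld X) ⊗ ld (ld Y)`. -/
def lldTensor [RightRigidCategory D] (X Y : D) : ld (ld (X ⊗ Y)) ⟶ ld (ld X) ⊗ ld (ld Y) :=
  dualMap (ld (ld X) ⊗ ld (ld Y)) (ld (ld (X ⊗ Y))) (ldTensor X Y)

/-- The canonical isomorphism `ld (ld 𝟙_) ⟶ 𝟙_`. -/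
def lldUnit [RightRigidCategory D] : ld (ld (𝟙_ D)) ⟶ 𝟙_ D :=
  dualMap (𝟙_ D) (ld (ld (𝟙_ D))) (ldUnit (D := D))

/-- A sovereign structure: a monoidal natural isomorphism `X ⟶ ld (ld X)`. -/
structure SovereignStructure (D : Type u) [Category.{v} D] [MonoidalCategory.{v} D]
    [RightRigidCategory D] where
  /-- The component at `X`. -/
  iso : ∀ X : D, X ≅ ld (ld X)
  naturality : ∀ {X Y : D} (f : X ⟶ Y),
    f ≫ (iso Y).hom = (iso X).hom ≫ dualMap (ld (ld Y)) (ld (ld X)) (dualMap (ld X) (ld Y) f)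
  tensor : ∀ X Y : D, (iso (X ⊗ Y)).hom ≫ lldTensor X Y = (iso X).hom ⊗ₘ (iso Y).hom
  unit : (iso (𝟙_ D)).hom ≫ lldUnit = 𝟙 (𝟙_ D)

variable [RightRigidCategory D]

/-- The left trace `ev_X (id ⊗ f φ_X⁻¹) coev_{ld X}`. -/
def SovereignStructure.leftTrace (φ : SovereignStructure D) {X : D} (f : X ⟶ X) : 𝟙_ D ⟶ 𝟙_ D :=
  η_ (ld X) (ld (ld X)) ≫ ld X ◁ ((φ.iso X).inv ≫ f) ≫ ε_ X (ld X)

/-- The right trace. The right dual of `X` is `ld X`, with evaluation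
`ev_{ld X} (φ_X ⊗ id) : X ⊗ ld X ⟶ 𝟙_`. -/
def SovereignStructure.rightTrace (φ : SovereignStructure D) {X : D} (f : X ⟶ X) : 𝟙_ D ⟶ 𝟙_ D :=
  η_ X (ld X) ≫ (f ≫ (φ.iso X).hom) ▷ ld X ≫ ε_ (ld X) (ld (ld X))

/-- Left and right traces of endomorphisms coincide. -/
def SovereignStructure.IsSpherical (φ : SovereignStructure D) : Prop :=
  ∀ (X : D) (f : X ⟶ X), φ.leftTrace f = φ.rightTrace f

/-- A ribbon structure on a braided category with duals: a self-dual twist. -/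
structure RibbonStructure (D : Type u) [Category.{v} D] [MonoidalCategory.{v} D]
    [BraidedCategory D] [RightRigidCategory D] where
  /-- The twist. -/
  twist : ∀ X : D, X ≅ X
  naturality : ∀ {X Y : D} (f : X ⟶ Y), f ≫ (twist Y).hom = (twist X).hom ≫ f
  tensor : ∀ X Y : D, (twist (X ⊗ Y)).hom =
    (β_ X Y).hom ≫ (β_ Y X).hom ≫ ((twist X).hom ⊗ₘ (twist Y).hom)
  self_dual : ∀ X : D, dualMap (ld X) (ld X) (twist X).hom = (twist (ld X)).hom

variable (D) in
/-- The contravariant functor `X ↦ ld X`. -/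
def ldFunctor : Dᵒᵖ ⥤ D where
  obj X := ld X.unop
  map f := dualMap (ld _) (ld _) f.unop
  map_id X := by exact rightAdjointMate_id (X := X.unop)
  map_comp f g := by exact comp_rightAdjointMate (f := g.unop) (g := f.unop)

variable (D) in
/-- The functor `(X, Y) ↦ ld X ⊗ Y`. -/
def coendBifunctor : Dᵒᵖ ⥤ D ⥤ D := ldFunctor D ⋙ curriedTensor D

/-- The family `ι X : ld X ⊗ X ⟶ K` exhibits `K` as the coend of the category `D`: it is a
universal dinatural transformation. -/
def IsCoend {K : D} (ι : ∀ X : D, ld X ⊗ X ⟶ K) : Prop :=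
  ∃ h, Nonempty (Limits.IsColimit (Limits.Cowedge.mk (F := coendBifunctor D) K ι h))

/-- The sovereign category `D` has a coend, whose left and right dimensions are both equal
to `d`. -/
def SovereignStructure.HasDimension (φ : SovereignStructure D) (d : 𝟙_ D ⟶ 𝟙_ D) : Prop :=
  (∃ (K : D) (ι : ∀ X : D, ld X ⊗ X ⟶ K), IsCoend ι) ∧
  ∀ (K : D) (ι : ∀ X : D, ld X ⊗ X ⟶ K), IsCoend ι →
    φ.leftTrace (𝟙 K) = d ∧ φ.rightTrace (𝟙 K) = d

/-- The coaction `X ⟶ X ⊗ K` of the coend. -/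
def coaction {K : D} (ι : ∀ X : D, ld X ⊗ X ⟶ K) (X : D) : X ⟶ X ⊗ K :=
  𝟙 X ⊗≫ η_ X (ld X) ▷ X ⊗≫ X ◁ ι X

/-- The given Hopf monoid structure on `K` is the canonical one of the coend `(K, ι)` of a braided
category: these four equations determine the coproduct, the counit, the product and the unit, and
hence the antipode. -/
structure IsCoendHopf [BraidedCategory D] {K : D} [HopfObj K]
    (ι : ∀ X : D, ld X ⊗ X ⟶ K) : Prop where
  comul : ∀ X, ι X ≫ ComonObj.comul =
    𝟙 (ld X ⊗ X) ⊗≫ ld X ◁ (η_ X (ld X) ▷ X) ⊗≫ (ι X ⊗ₘ ι X)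
  counit : ∀ X, ι X ≫ ComonObj.counit = ε_ X (ld X)
  mul : ∀ X Y, (ι X ⊗ₘ ι Y) ≫ MonObj.mul =
    𝟙 ((ld X ⊗ X) ⊗ (ld Y ⊗ Y)) ⊗≫ ld X ◁ (β_ X (ld Y ⊗ Y)).hom ⊗≫
      ldTensor Y X ▷ (Y ⊗ X) ≫ ι (Y ⊗ X)
  one : MonObj.one = 𝟙 (𝟙_ D) ⊗≫ ldUnit ▷ 𝟙_ D ≫ ι (𝟙_ D)

/-- `ω` is the canonical pairing of the coend `(K, ι)` of a braided category. -/
def IsCoendPairing [BraidedCategory D] {K : D} (ι : ∀ X : D, ld X ⊗ X ⟶ K)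
    (ω : K ⊗ K ⟶ 𝟙_ D) : Prop :=
  ∀ X Y, (ι X ⊗ₘ ι Y) ≫ ω =
    𝟙 ((ld X ⊗ X) ⊗ (ld Y ⊗ Y)) ⊗≫
      ld X ◁ (((β_ X (ld Y)).hom ≫ (β_ (ld Y) X).hom) ▷ Y) ⊗≫
        (ε_ X (ld X) ⊗ₘ ε_ Y (ld Y)) ≫ (λ_ (𝟙_ D)).hom

/-- The form `θ` on the coend encodes the family of endomorphisms `t`. -/
def IsFormOf {K : D} (ι : ∀ X : D, ld X ⊗ X ⟶ K) (t : ∀ X : D, X ⟶ X) (θ : K ⟶ 𝟙_ D) : Prop :=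
  ∀ X, coaction ι X ≫ X ◁ θ ≫ (ρ_ X).hom = t X

end Duality

/-! ### Fusion categories and the explicit morphisms -/

section Fusion
open Limits
variable {C : Type u} [Category.{v} C] [Preadditive C] [MonoidalCategory.{v} C] [RigidCategory C]
  {I : Type w} [Fintype I]

/-- The family `V` makes the additive `k`-linear rigid category `C` a fusion category. -/
structure IsFusion (k : Type w') [CommRing k] [Linear k C] [HasFiniteBiproducts C]
    (V : I → C) : Prop where
  scalar : ∀ i, Function.Bijective (fun a : k => a • 𝟙 (V i))
  hom_ne : ∀ i j, i ≠ j → ∀ f : V i ⟶ V j, f = 0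
  sum : ∀ X : C, ∃ (n : ℕ) (s : Fin n → I), Nonempty (X ≅ ⨁ fun t => V (s t))
  unit : ∃ i, Nonempty (V i ≅ 𝟙_ C)

/-- A decomposition of `X` as a direct sum of members of the family `V`: morphisms
`p i α : X ⟶ V i` and `q i α : V i ⟶ X` for `α < N i`. -/
structure Decomp (V : I → C) (X : C) where
  /-- The multiplicities. -/
  N : I → ℕ
  /-- The projections. -/
  p : ∀ i, Fin (N i) → (X ⟶ V i)
  /-- The inclusions. -/
  q : ∀ i, Fin (N i) → (V i ⟶ X)
  q_p : ∀ i α β, q i α ≫ p i β = if α = β then 𝟙 (V i) else 0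
  q_p_ne : ∀ i j, i ≠ j → ∀ α β, q i α ≫ p j β = 0
  sum_p_q : ∑ i, ∑ α, p i α ≫ q i α = 𝟙 X

/-- The choices on which the formulas are written: an isomorphism of some `V o` with the unit, the
map `i ↦ ᵛi` on labels with isomorphisms `V (ᵛi) ≅ ld (V i)`, and a decomposition of each object. -/
structure FusionChoices (V : I → C) where
  /-- The label of the unit object. -/
  o : I
  /-- The identification of `V o` with the unit object. -/
  unitIso : V o ≅ 𝟙_ C
  /-- The action of left duality on labels. -/
  dual : I → I
  /-- The identification of `V (dual i)` with the left dual of `V i`. -/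
  dualIso : ∀ i, V (dual i) ≅ ld (V i)
  /-- The decompositions. -/
  dec : ∀ X : C, Decomp V X

/-- The object `ᵛVᵢ ⊗ ᵛVⱼ ⊗ ᵛᵛVᵢ ⊗ Vⱼ`. -/
abbrev summand (V : I → C) (i j : I) : C := ld (V i) ⊗ ld (V j) ⊗ ld (ld (V i)) ⊗ V j

/-- The action `ld Y ⊗ M ⊗ Y ⟶ M` corresponding to the half braiding of an object of the center. -/
def centerAction (M : Center C) (Y : C) : ld Y ⊗ (M.1 ⊗ Y) ⟶ M.1 :=
  ld Y ◁ (M.2.β Y).hom ⊗≫ ε_ Y (ld Y) ▷ M.1 ⊗≫ 𝟙 M.1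

/-- The twist of the center defined by a sovereign structure `φ`:
`(ev_M ⊗ id) (id ⊗ σ_M) ((id ⊗ φ_M⁻¹) coev_{ld M} ⊗ id) : M ⟶ M`. -/
def canonicalTwist (φ : SovereignStructure C) (M : Center C) : M.1 ⟶ M.1 :=
  𝟙 M.1 ⊗≫ (η_ (ld M.1) (ld (ld M.1)) ≫ ld M.1 ◁ (φ.iso M.1).inv) ▷ M.1 ⊗≫ centerAction M M.1

variable {V : I → C} (F : FusionChoices V)

/-- The component `ᵛ(r_i (id ⊗ q ⊗ id)) ⊗ p` of the universal dinatural transformation, where `r_i`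
is the action `ᵛVᵢ ⊗ M ⊗ Vᵢ ⟶ M`. -/
def coendMapAux (M : Center C) (i j : I) : ld M.1 ⊗ M.1 ⟶ summand V i j :=
  ∑ α : Fin ((F.dec M.1).N j),
    ((dualMap ((ld (V i) ⊗ ld (V j)) ⊗ ld (ld (V i))) (ld M.1)
        (ld (V i) ◁ ((F.dec M.1).q j α ▷ V i) ≫ centerAction M (V i)) ⊗ₘ (F.dec M.1).p j α) ⊗≫
      𝟙 (summand V i j))

/-- The component `(i,j) ⟶ (m,n), (k,j)` of the coproduct. -/
def comulAux (i j m n k : I) : summand V i j ⟶ summand V m n ⊗ summand V k j :=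
  ∑ α : Fin ((F.dec (V k ⊗ V m)).N i), ∑ β : Fin ((F.dec (ld (V k) ⊗ V j ⊗ V k)).N n),
    (dualMap (ld (V m) ⊗ ld (V k)) (ld (V i)) ((F.dec (V k ⊗ V m)).p i α) ⊗ₘ
      ld (V j) ◁ (dualMap (ld (ld (V k)) ⊗ ld (ld (V m))) (ld (ld (V i)))
        (dualMap (ld (V i)) (ld (V m) ⊗ ld (V k)) ((F.dec (V k ⊗ V m)).q i α)) ▷ V j)) ⊗≫
    ld (V m) ◁ (dualMap (ld (V n)) ((ld (V k) ⊗ ld (V j)) ⊗ ld (ld (V k)))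
      ((F.dec (ld (V k) ⊗ V j ⊗ V k)).q n β) ▷ (ld (ld (V m)) ⊗ V j)) ⊗≫
    (ld (V m) ⊗ ld (V n) ⊗ ld (ld (V m))) ◁ (η_ (V n) (ld (V n)) ▷ V j) ⊗≫
    (ld (V m) ⊗ ld (V n) ⊗ ld (ld (V m)) ⊗ V n) ◁
      (dualMap ((ld (V k) ⊗ ld (V j)) ⊗ ld (ld (V k))) (ld (V n))
        ((F.dec (ld (V k) ⊗ V j ⊗ V k)).p n β) ▷ V j) ⊗≫
    𝟙 (summand V m n ⊗ summand V k j)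

/-- The component of the counit at `(o,j)`. -/
def counitAux (j : I) : summand V F.o j ⟶ 𝟙_ C :=
  (dualMap (𝟙_ C) (ld (V F.o)) F.unitIso.inv ⊗ₘ
    ld (V j) ◁ (dualMap (𝟙_ C) (ld (ld (V F.o)))
      (dualMap (ld (V F.o)) (𝟙_ C) F.unitIso.hom) ▷ V j)) ⊗≫
  ε_ (V j) (ld (V j))

/-- The component `(i,j) ⟶ (k,l)` of the antipode, for given
`p : Vⱼ ⊗ Vₖ ⊗ Vⱼᵛ ⟶ ᵛVᵢ`, `q : ᵛVᵢ ⟶ Vⱼ ⊗ Vₖ ⊗ Vⱼᵛ`,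
`p' : ᵛVⱼ ⊗ ᵛVᵢ ⊗ ᵛVⱼ ⊗ ᵛᵛVᵢ ⊗ Vⱼ ⟶ Vₗ` and `q' : Vₗ ⟶ ᵛVⱼ ⊗ ᵛVᵢ ⊗ ᵛVⱼ ⊗ ᵛᵛVᵢ ⊗ Vⱼ`. -/
def antipodeTerm {i j k l : I}
    (p : V j ⊗ V k ⊗ rd (V j) ⟶ ld (V i)) (q : ld (V i) ⟶ V j ⊗ V k ⊗ rd (V j))
    (p' : ld (V j) ⊗ summand V i j ⟶ V l) (q' : V l ⟶ ld (V j) ⊗ summand V i j) :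
    summand V i j ⟶ summand V k l :=
  𝟙 (summand V i j) ⊗≫
  (η_ (ld (V j)) (ld (ld (V j))) ⊗ₘ η_ (ld (ld (V i))) (ld (ld (ld (V i))))) ▷ summand V i j ⊗≫
  ld (V j) ◁ (η_ (ld (ld (V i))) (ld (ld (ld (V i)))) ▷
    (ld (ld (V j)) ⊗ ld (ld (V i)) ⊗ ld (ld (ld (V i))) ⊗ summand V i j)) ⊗≫
  (ld (V j) ◁ (dualMap ((V j ⊗ ld (V k)) ⊗ ld (V j)) (ld (ld (V i))) p ▷
      (ld (ld (ld (V i))) ⊗ ld (ld (V j)) ⊗ ld (ld (V i)))) ⊗ₘ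
    dualMap (ld (ld (V j)) ⊗ (ld (ld (V k)) ⊗ ld (V j))) (ld (ld (ld (V i))))
      (dualMap (ld (ld (V i))) ((V j ⊗ ld (V k)) ⊗ ld (V j)) q) ▷ summand V i j) ⊗≫
  ε_ (V j) (ld (V j)) ▷ (ld (V k) ⊗ ld (V j) ⊗ ld (ld (ld (V i))) ⊗ ld (ld (V j)) ⊗
    ld (ld (V i)) ⊗ ld (ld (V j)) ⊗ ld (ld (V k)) ⊗ ld (V j) ⊗ summand V i j) ⊗≫
  (ld (V k) ◁ dualMap (ld (V l))
      ((((ld (V j) ⊗ ld (ld (ld (V i)))) ⊗ ld (ld (V j))) ⊗ ld (ld (V i))) ⊗ ld (ld (V j))) q' ⊗ₘ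
    ld (ld (V k)) ◁ p') ⊗≫
  𝟙 (summand V k l)

/-- The component `(i,j) ⟶ (k,l)` of the antipode. -/
def antipodeAux (i j k l : I) : summand V i j ⟶ summand V k l :=
  ∑ α : Fin ((F.dec (V j ⊗ V k ⊗ rd (V j))).N (F.dual i)),
  ∑ β : Fin ((F.dec (ld (V j) ⊗ summand V i j)).N l),
    antipodeTerm
      ((F.dec (V j ⊗ V k ⊗ rd (V j))).p (F.dual i) α ≫ (F.dualIso i).hom)
      ((F.dualIso i).inv ≫ (F.dec (V j ⊗ V k ⊗ rd (V j))).q (F.dual i) α)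
      ((F.dec (ld (V j) ⊗ summand V i j)).p l β)
      ((F.dec (ld (V j) ⊗ summand V i j)).q l β)

/-- The component of the pairing at `(i,j), (k,l)`, for given `p : ᵛVᵢ ⊗ Vⱼ ⊗ Vᵢ ⟶ ᵛVₖ`,
`q : ᵛVₖ ⟶ ᵛVᵢ ⊗ Vⱼ ⊗ Vᵢ`, `p' : ᵛVₖ ⊗ ᵛVₗ ⊗ ᵛᵛVₖ ⟶ Vᵢ` and `q' : Vᵢ ⟶ ᵛVₖ ⊗ ᵛVₗ ⊗ ᵛᵛVₖ`. -/
def pairingTerm {i j k l : I}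
    (p : ld (V i) ⊗ V j ⊗ V i ⟶ ld (V k)) (q : ld (V k) ⟶ ld (V i) ⊗ V j ⊗ V i)
    (p' : ld (V k) ⊗ ld (V l) ⊗ ld (ld (V k)) ⟶ V i)
    (q' : V i ⟶ ld (V k) ⊗ ld (V l) ⊗ ld (ld (V k))) :
    summand V i j ⊗ summand V k l ⟶ 𝟙_ C :=
  𝟙 (summand V i j ⊗ summand V k l) ⊗≫
  (dualMap (ld (ld (V k))) ((ld (V i) ⊗ ld (V j)) ⊗ ld (ld (V i))) q ⊗ₘ
    V j ◁ (p' ▷ V l)) ⊗≫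
  ld (ld (V k)) ◁ (η_ (V i) (ld (V i)) ▷ (V j ⊗ V i ⊗ V l)) ⊗≫
  ld (ld (V k)) ◁ (q' ⊗ₘ p ▷ V l) ⊗≫
  ε_ (ld (V k)) (ld (ld (V k))) ▷ (ld (V l) ⊗ ld (ld (V k)) ⊗ ld (V k) ⊗ V l) ⊗≫
  ld (V l) ◁ (ε_ (ld (V k)) (ld (ld (V k))) ▷ V l) ⊗≫
  ε_ (V l) (ld (V l))

/-- The component of the pairing at `(i,j), (k,l)`. -/
def pairingAux (i j k l : I) : summand V i j ⊗ summand V k l ⟶ 𝟙_ C :=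
  ∑ α : Fin ((F.dec (ld (V i) ⊗ V j ⊗ V i)).N (F.dual k)),
  ∑ β : Fin ((F.dec (ld (V k) ⊗ ld (V l) ⊗ ld (ld (V k)))).N i),
    pairingTerm
      ((F.dec (ld (V i) ⊗ V j ⊗ V i)).p (F.dual k) α ≫ (F.dualIso k).hom)
      ((F.dualIso k).inv ≫ (F.dec (ld (V i) ⊗ V j ⊗ V i)).q (F.dual k) α)
      ((F.dec (ld (V k) ⊗ ld (V l) ⊗ ld (ld (V k)))).p i β)
      ((F.dec (ld (V k) ⊗ ld (V l) ⊗ ld (ld (V k)))).q i β)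

/-- The component at `(i,i)` of the form encoding the twist. -/
def twistPosAux (φ : SovereignStructure C) (V : I → C) (i : I) : summand V i i ⟶ 𝟙_ C :=
  𝟙 (summand V i i) ⊗≫
  ld (V i) ◁ (((φ.iso (ld (V i))).hom ▷ ld (ld (V i)) ≫
    ε_ (ld (ld (V i))) (ld (ld (ld (V i))))) ▷ V i) ⊗≫
  ε_ (V i) (ld (V i))

/-- The component at `(i,ᵛi)` of the form encoding the inverse of the twist. -/
def twistNegAux (φ : SovereignStructure C) (i : I) : summand V i (F.dual i) ⟶ 𝟙_ C :=
  𝟙 (summand V i (F.dual i)) ⊗≫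
  ((((φ.iso (ld (V i))).hom ⊗ₘ
      dualMap (ld (ld (V i))) (ld (V (F.dual i))) (F.dualIso i).inv) ≫
      ε_ (ld (ld (V i))) (ld (ld (ld (V i))))) ⊗ₘ
    (ld (ld (V i)) ◁ (F.dualIso i).hom ≫ ε_ (ld (V i)) (ld (ld (V i))))) ≫
  (λ_ (𝟙_ C)).hom

/-- The component `(i,j), (k,l) ⟶ (k,l), (a,b)` of the braiding, for given
`p : ᵛVₖ ⊗ ᵛVₗ ⊗ ᵛᵛVₖ ⊗ Vₗ ⟶ Vₘ`, `q : Vₘ ⟶ ᵛVₖ ⊗ ᵛVₗ ⊗ ᵛᵛVₖ ⊗ Vₗ`,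
`p₁ : ᵛVₘ ⊗ Vⱼ ⊗ Vₘ ⟶ V_b`, `q₁ : V_b ⟶ ᵛVₘ ⊗ Vⱼ ⊗ Vₘ`,
`p₂ : Vₘ ⊗ Vₐ ⊗ Vₘᵛ ⟶ Vᵢ` and `q₂ : Vᵢ ⟶ Vₘ ⊗ Vₐ ⊗ Vₘᵛ`. -/
def braidTerm {i j k l a b m : I}
    (p : summand V k l ⟶ V m) (q : V m ⟶ summand V k l)
    (p₁ : ld (V m) ⊗ V j ⊗ V m ⟶ V b) (q₁ : V b ⟶ ld (V m) ⊗ V j ⊗ V m)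
    (p₂ : V m ⊗ V a ⊗ rd (V m) ⟶ V i) (q₂ : V i ⟶ V m ⊗ V a ⊗ rd (V m)) :
    summand V i j ⊗ summand V k l ⟶ summand V k l ⊗ summand V a b :=
  summand V i j ◁ p ⊗≫
  (dualMap ((V m ⊗ ld (V a)) ⊗ ld (V m)) (ld (V i)) p₂ ⊗ₘ
    ld (V j) ◁ (dualMap (ld (ld (V m)) ⊗ (ld (ld (V a)) ⊗ ld (V m))) (ld (ld (V i)))
      (dualMap (ld (V i)) ((V m ⊗ ld (V a)) ⊗ ld (V m)) q₂) ▷ (V j ⊗ V m))) ⊗≫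
  (V m ⊗ ld (V a)) ◁ (dualMap (ld (V b)) ((ld (V m) ⊗ ld (V j)) ⊗ ld (ld (V m))) q₁ ▷
    (ld (ld (V a)) ⊗ ld (V m) ⊗ V j ⊗ V m)) ⊗≫
  (V m ⊗ ld (V a) ⊗ ld (V b) ⊗ ld (ld (V a))) ◁ p₁ ⊗≫
  q ▷ summand V a b

/-- The component `(i,j), (k,l) ⟶ (k,l), (a,b)` of the braiding. -/
def braidAux (i j k l a b : I) :
    summand V i j ⊗ summand V k l ⟶ summand V k l ⊗ summand V a b :=
  ∑ m : I, ∑ α : Fin ((F.dec (summand V k l)).N m),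
  ∑ β : Fin ((F.dec (ld (V m) ⊗ V j ⊗ V m)).N b),
  ∑ γ : Fin ((F.dec (V m ⊗ V a ⊗ rd (V m))).N i),
    braidTerm
      ((F.dec (summand V k l)).p m α) ((F.dec (summand V k l)).q m α)
      ((F.dec (ld (V m) ⊗ V j ⊗ V m)).p b β) ((F.dec (ld (V m) ⊗ V j ⊗ V m)).q b β)
      ((F.dec (V m ⊗ V a ⊗ rd (V m))).p i γ) ((F.dec (V m ⊗ V a ⊗ rd (V m))).q i γ)

section Assembled
variable [HasFiniteBiproducts C]

/-- The underlying object of the coend of the center. -/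
noncomputable abbrev coendObj (V : I → C) : C := ⨁ fun x : I × I => summand V x.1 x.2

/-- The object of the center given by `coendObj V` and a half braiding on it. -/
noncomputable abbrev coendCenter (V : I → C) (σ : HalfBraiding (coendObj V)) : Center C :=
  ⟨coendObj V, σ⟩

/-- The inclusion of the summand `(i,j)`. -/
noncomputable def inc (V : I → C) (i j : I) : summand V i j ⟶ coendObj V :=
  biproduct.ι (fun x : I × I => summand V x.1 x.2) (i, j)

/-- The projection to the summand `(i,j)`. -/
noncomputable def prj (V : I → C) (i j : I) : coendObj V ⟶ summand V i j :=
  biproduct.π (fun x : I × I => summand V x.1 x.2) (i, j)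

/-- The universal dinatural transformation. -/
noncomputable def coendMap (M : Center C) : ld M.1 ⊗ M.1 ⟶ coendObj V :=
  ∑ i, ∑ j, coendMapAux F M i j ≫ inc V i j

/-- The coproduct. -/
noncomputable def comulFormula : coendObj V ⟶ coendObj V ⊗ coendObj V :=
  ∑ i, ∑ j, ∑ k, ∑ m, ∑ n, prj V i j ≫ comulAux F i j m n k ≫ (inc V m n ⊗ₘ inc V k j)

/-- The counit. -/
noncomputable def counitFormula : coendObj V ⟶ 𝟙_ C :=
  ∑ j, prj V F.o j ≫ counitAux F j

/-- The antipode. -/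
noncomputable def antipodeFormula : coendObj V ⟶ coendObj V :=
  ∑ i, ∑ j, ∑ k, ∑ l, prj V i j ≫ antipodeAux F i j k l ≫ inc V k l

/-- The pairing. -/
noncomputable def pairingFormula : coendObj V ⊗ coendObj V ⟶ 𝟙_ C :=
  ∑ i, ∑ j, ∑ k, ∑ l, (prj V i j ⊗ₘ prj V k l) ≫ pairingAux F i j k l

/-- The form encoding the twist. -/
noncomputable def twistPosFormula (φ : SovereignStructure C) (V : I → C) : coendObj V ⟶ 𝟙_ C :=
  ∑ i, prj V i i ≫ twistPosAux φ V i

/-- The form encoding the inverse of the twist. -/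
noncomputable def twistNegFormula (φ : SovereignStructure C) : coendObj V ⟶ 𝟙_ C :=
  ∑ i, prj V i (F.dual i) ≫ twistNegAux F φ i

/-- The self-braiding. -/
noncomputable def braidFormula : coendObj V ⊗ coendObj V ⟶ coendObj V ⊗ coendObj V :=
  ∑ i, ∑ j, ∑ k, ∑ l, ∑ a, ∑ b,
    (prj V i j ⊗ₘ prj V k l) ≫ braidAux F i j k l a b ≫ (inc V k l ⊗ₘ inc V a b)

end Assembled

end Fusion

end CenterCoend

open CenterCoend

namespace CenterCoend

/-! ### Calculus of duals: mates, their uniqueness, duals of tensor products -/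

section DualMaps
variable {D : Type u} [Category.{v} D] [MonoidalCategory.{v} D]

/-! Rotating the factor `ld X` turns a dinatural family `ld X ⊗ X ⟶ K` into a natural coaction `X ⟶
X ⊗ K`, and a coend into a universal coaction. The proof works with coactions throughout: a morphism
out of `K` is known once its composites with all coactions are known, so each identity of the
theorem is an identity between natural transformations.

Existence. An object of the center is a module over the monad sending `X` to the coend of `ld W ⊗ X
⊗ W` over `W`, the action being the half braiding with `W` rotated. Morphisms between members of `V`
are scalars or zero, so this coend is the finite sum `freeObj V X`; the mechanism is
`IsFusion.exchange`, the dinaturality of `∑ q ⊗ p`. By the unit and counit of the free construction,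
a natural transformation from the forgetful functor to its tensor product with `Z` is determined by
its values on free objects, there by its restriction along the unit, and finally by the objects `V
j`. What remains is a family `V j ⟶ (ld (V i) ⊗ V j ⊗ V i) ⊗ Z`, that is, a morphism out of the sum
of the objects `summand V i j`. This is `isUniversalCoaction_forget`. Conjugating the coaction of
`M` by the half braiding of `M` gives another natural family, whose factorization is the half
braiding of the coend; the universal property then lifts to the center.

Structure. In a braided category with duals, a universal coaction carries a Hopf structure: the
coaction on a tensor product gives the product, the iterated coaction the coproduct, and the
coaction on duals the antipode. The double braiding descends to the pairing, and natural
endomorphisms of the identity descend to forms. All axioms are checked after composing with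
coactions.

Formulas. The coaction of `M` is a sum over labels `i` of a part depending only on the underlying
object, followed by the action of `V i`. Composed with an explicit formula, the sums over
decompositions collapse by `∑ p ≫ q = 𝟙` or by dinaturality. Tensor products of labels act as
iterated actions, labels of duals exhaust all labels, and what is left is the abstract definition.
The result does not depend on the choices, since dinatural families are determined by their values
on `V`.

Twist. Every object has two right evaluations, one from the sovereign structure and one from the
braiding; the twist is the automorphism comparing them. Its naturality and tensor rule follow from
those of the evaluations. Self-duality holds because the trace form is nondegenerate and because,
composed with the twist, an endomorphism and its dual give the same closed diagram
(`SovereignStructure.trace_twist`); sphericality identifies the left and right traces.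

Dimension. Two sovereign structures differ by a monoidal automorphism of the identity functor, and
naturality with respect to the coaction makes it trivial on a coend. The dimension of the coend
therefore does not depend on the sovereign structure. If `V i` has dimension `a i`, the coend of `C`
has dimension `∑ a i ^ 2` and that of the center `∑ (a i) ^ 2 * (a j) ^ 2`, which is the square. -/

lemma dualMap_eval {X Y : D} (X' Y' : D) [ExactPairing X X'] [ExactPairing Y Y'] (f : X ⟶ Y) :
    dualMap X' Y' f ▷ X ≫ ε_ X X' = Y' ◁ f ≫ ε_ Y Y' :=
  @rightAdjointMate_comp_evaluation D _ _ X Y ⟨X'⟩ ⟨Y'⟩ f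

lemma coeval_dualMap {X Y : D} (X' Y' : D) [ExactPairing X X'] [ExactPairing Y Y'] (f : X ⟶ Y) :
    η_ Y Y' ≫ Y ◁ dualMap X' Y' f = η_ X X' ≫ f ▷ X' :=
  @coevaluation_comp_rightAdjointMate D _ _ X Y ⟨X'⟩ ⟨Y'⟩ f

lemma dualMap_comp {X Y Z : D} (X' Y' Z' : D) [ExactPairing X X'] [ExactPairing Y Y']
    [ExactPairing Z Z'] (f : X ⟶ Y) (g : Y ⟶ Z) :
    dualMap X' Z' (f ≫ g) = dualMap Y' Z' g ≫ dualMap X' Y' f :=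
  @comp_rightAdjointMate D _ _ X Y Z ⟨X'⟩ ⟨Y'⟩ ⟨Z'⟩ f g

lemma dualMap_id {X : D} (X' : D) [ExactPairing X X'] : dualMap X' X' (𝟙 X) = 𝟙 X' :=
  @rightAdjointMate_id D _ _ X ⟨X'⟩

/-- Morphisms into a dual are determined by their pairing. -/
lemma dual_ext {X W : D} (X' : D) [ExactPairing X X'] {a b : W ⟶ X'}
    (h : a ▷ X ≫ ε_ X X' = b ▷ X ≫ ε_ X X') : a = b := by
  have e (z : W ⟶ X') : z = 𝟙 W ⊗≫ W ◁ η_ X X' ⊗≫ (z ▷ X ≫ ε_ X X') ▷ X' ⊗≫ 𝟙 X' := by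
    symm
    calc _ = 𝟙 W ⊗≫ (W ◁ η_ X X' ≫ z ▷ (X ⊗ X')) ⊗≫ ε_ X X' ▷ X' ⊗≫ 𝟙 X' := by monoidal
      _ = z ⊗≫ (X' ◁ η_ X X' ⊗≫ ε_ X X' ▷ X') ⊗≫ 𝟙 X' := by
        rw [whisker_exchange]; monoidal
      _ = z := by rw [ExactPairing.coevaluation_evaluation'']; monoidal
  rw [e a, e b, h]

/-- Pairings are nondegenerate, so a candidate for a dual morphism needs only one equation against
the evaluation. Most identifications of dual morphisms below are made this way. -/
lemma dualMap_unique {X Y : D} (X' Y' : D) [ExactPairing X X'] [ExactPairing Y Y'] (f : X ⟶ Y)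
    (g : Y' ⟶ X') (h : g ▷ X ≫ ε_ X X' = Y' ◁ f ≫ ε_ Y Y') : g = dualMap X' Y' f :=
  dual_ext X' (by rw [h, dualMap_eval])

lemma eval_tensor {X Y : D} (X' Y' : D) [ExactPairing X X'] [ExactPairing Y Y'] :
    ε_ (X ⊗ Y) (Y' ⊗ X') = 𝟙 _ ⊗≫ Y' ◁ ε_ X X' ▷ Y ⊗≫ ε_ Y Y' := by
  rw [ExactPairing.tensor_evaluation]

lemma coeval_tensor {X Y : D} (X' Y' : D) [ExactPairing X X'] [ExactPairing Y Y'] :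
    η_ (X ⊗ Y) (Y' ⊗ X') = η_ X X' ⊗≫ X ◁ η_ Y Y' ▷ X' ⊗≫ 𝟙 _ := by
  rw [ExactPairing.tensor_coevaluation]; monoidal

lemma dualMap_whiskerRight {X Y Z : D} (X' Y' Z' : D) [ExactPairing X X'] [ExactPairing Y Y']
    [ExactPairing Z Z'] (f : X ⟶ Y) :
    dualMap (Z' ⊗ X') (Z' ⊗ Y') (f ▷ Z) = Z' ◁ dualMap X' Y' f := by
  symm
  apply dualMap_unique
  rw [eval_tensor, eval_tensor]
  calc _ = 𝟙 _ ⊗≫ Z' ◁ (dualMap X' Y' f ▷ X ≫ ε_ X X') ▷ Z ⊗≫ ε_ Z Z' := by monoidal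
    _ = _ := by rw [dualMap_eval]; monoidal

lemma dualMap_whiskerLeft {X Y Z : D} (X' Y' Z' : D) [ExactPairing X X'] [ExactPairing Y Y']
    [ExactPairing Z Z'] (f : X ⟶ Y) :
    dualMap (X' ⊗ Z') (Y' ⊗ Z') (Z ◁ f) = dualMap X' Y' f ▷ Z' := by
  symm
  apply dualMap_unique
  rw [eval_tensor, eval_tensor]
  calc _ = 𝟙 ((Y' ⊗ Z') ⊗ Z ⊗ X) ⊗≫ (dualMap X' Y' f ▷ ((Z' ⊗ Z) ⊗ X) ≫ _ ◁ (ε_ Z Z' ▷ X)) ⊗≫ ε_ X X' := by monoidal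
    _ = 𝟙 ((Y' ⊗ Z') ⊗ Z ⊗ X) ⊗≫ Y' ◁ (ε_ Z Z' ▷ X) ⊗≫ (dualMap X' Y' f ▷ X ≫ ε_ X X') := by
      rw [← whisker_exchange]; monoidal
    _ = 𝟙 ((Y' ⊗ Z') ⊗ Z ⊗ X) ⊗≫ Y' ◁ (ε_ Z Z' ▷ X ≫ _ ◁ f) ⊗≫ ε_ Y Y' := by
      rw [dualMap_eval]; monoidal
    _ = _ := by rw [← whisker_exchange]; monoidal

/-- The coaction from a family of morphisms `X' ⊗ X ⟶ K`. -/
lemma coev_ev_coaction [RightRigidCategory D] {K : D} (ι : ∀ X : D, ld X ⊗ X ⟶ K) (X : D) :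
    ι X = ld X ◁ coaction ι X ⊗≫ ε_ X (ld X) ▷ K ⊗≫ 𝟙 K := by
  symm
  calc _ = 𝟙 _ ⊗≫ (ld X ◁ η_ X (ld X)) ▷ X ⊗≫ (((ld X ⊗ X) ◁ ι X) ≫ ε_ X (ld X) ▷ K) ⊗≫ 𝟙 K := by
        unfold coaction; monoidal
    _ = 𝟙 _ ⊗≫ (ld X ◁ η_ X (ld X) ⊗≫ ε_ X (ld X) ▷ ld X) ▷ X ⊗≫ ι X := by
        rw [whisker_exchange]; monoidal
    _ = _ := by rw [ExactPairing.coevaluation_evaluation'']; monoidal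

lemma ldTensor_eval [RightRigidCategory D] (X Y : D) : ldTensor X Y ▷ (X ⊗ Y) ≫ ε_ (X ⊗ Y) (ld (X ⊗ Y)) =
    𝟙 _ ⊗≫ ld Y ◁ ε_ X (ld X) ▷ Y ⊗≫ ε_ Y (ld Y) := by
  unfold ldTensor
  rw [dualMap_eval, eval_tensor]; monoidal

end DualMaps

/-! ### Linearity of dualization -/

section Additive
variable {D : Type u} [Category.{v} D] [Preadditive D] [MonoidalCategory.{v} D]
  [MonoidalPreadditive D]

lemma dualMap_add {X Y : D} (X' Y' : D) [ExactPairing X X'] [ExactPairing Y Y'] (f g : X ⟶ Y) :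
    dualMap X' Y' (f + g) = dualMap X' Y' f + dualMap X' Y' g := by
  symm
  apply dualMap_unique
  simp [MonoidalPreadditive.add_whiskerRight, dualMap_eval, Preadditive.add_comp,
    MonoidalPreadditive.whiskerLeft_add]

lemma dualMap_zero {X Y : D} (X' Y' : D) [ExactPairing X X'] [ExactPairing Y Y'] :
    dualMap X' Y' (0 : X ⟶ Y) = 0 := by
  symm
  apply dualMap_unique
  simp

/-- Dualization as an additive map. -/
def dualMapHom {X Y : D} (X' Y' : D) [ExactPairing X X'] [ExactPairing Y Y'] :
    (X ⟶ Y) →+ (Y' ⟶ X') where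
  toFun f := dualMap X' Y' f
  map_zero' := dualMap_zero X' Y'
  map_add' := dualMap_add X' Y'

lemma dualMap_sum {X Y : D} (X' Y' : D) [ExactPairing X X'] [ExactPairing Y Y'] {J : Type*}
    (s : Finset J) (f : J → (X ⟶ Y)) :
    dualMap X' Y' (∑ j ∈ s, f j) = ∑ j ∈ s, dualMap X' Y' (f j) :=
  map_sum (dualMapHom X' Y') f s

lemma dualMap_smul {k : Type w'} [CommRing k] [Linear k D] [MonoidalLinear k D]
    {X Y : D} (X' Y' : D) [ExactPairing X X'] [ExactPairing Y Y'] (a : k) (f : X ⟶ Y) :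
    dualMap X' Y' (a • f) = a • dualMap X' Y' f := by
  symm
  apply dualMap_unique
  simp [MonoidalLinear.smul_whiskerRight, dualMap_eval, MonoidalLinear.whiskerLeft_smul]

end Additive

/-! ### Universal coactions and their universal property with a parameter -/

section Coactions
variable {E : Type*} [Category* E] {D : Type u} [Category.{v} D] [MonoidalCategory.{v} D]

/-- A universal natural transformation from `G` to `G ⊗ K`. -/
structure IsUniversalCoaction (G : E ⥤ D) {K : D} (δ : ∀ e, G.obj e ⟶ G.obj e ⊗ K) : Prop where
  nat : ∀ {X Y : E} (f : X ⟶ Y), G.map f ≫ δ Y = δ X ≫ G.map f ▷ K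
  desc : ∀ (Z : D) (t : ∀ e, G.obj e ⟶ G.obj e ⊗ Z),
    (∀ {X Y : E} (f : X ⟶ Y), G.map f ≫ t Y = t X ≫ G.map f ▷ Z) →
    ∃ f : K ⟶ Z, ∀ e, δ e ≫ G.obj e ◁ f = t e
  ext : ∀ (Z : D) (f g : K ⟶ Z), (∀ e, δ e ≫ G.obj e ◁ f = δ e ≫ G.obj e ◁ g) → f = g

namespace IsUniversalCoaction
variable {G : E ⥤ D} {K : D} {δ : ∀ e, G.obj e ⟶ G.obj e ⊗ K}

/-- Bending the strand `W` to the right makes a morphism out of `K ⊗ W` into one out of `K`, to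
which uniqueness without parameter applies. -/
lemma extRight (h : IsUniversalCoaction G δ) {W W' Z : D} [ExactPairing W W'] {f g : K ⊗ W ⟶ Z}
    (H : ∀ e, δ e ▷ W ⊗≫ G.obj e ◁ f = δ e ▷ W ⊗≫ G.obj e ◁ g) : f = g := by
  apply (tensorRightHomEquiv K W W' Z).injective
  apply h.ext
  intro e
  have key (f : K ⊗ W ⟶ Z) : δ e ≫ G.obj e ◁ tensorRightHomEquiv K W W' Z f =
      𝟙 _ ⊗≫ G.obj e ◁ η_ W W' ⊗≫ (δ e ▷ W ⊗≫ G.obj e ◁ f) ▷ W' ⊗≫ 𝟙 _ := by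
    change δ e ≫ G.obj e ◁ ((ρ_ _).inv ≫ _ ◁ η_ W W' ≫ (α_ _ _ _).inv ≫ f ▷ W') = _
    calc _ = 𝟙 _ ⊗≫ (δ e ▷ 𝟙_ D ≫ (G.obj e ⊗ K) ◁ η_ W W') ⊗≫ G.obj e ◁ f ▷ W' ⊗≫ 𝟙 _ := by
          monoidal
      _ = _ := by rw [← whisker_exchange]; monoidal
  rw [key, key, H]

/-- The family is bent into one with values in `Z ⊗ W'`, factored there, and bent back; the zigzag
identity removes the detour. -/
lemma descRight (h : IsUniversalCoaction G δ) {W W' Z : D} [ExactPairing W W']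
    (t : ∀ e, G.obj e ⊗ W ⟶ G.obj e ⊗ Z)
    (ht : ∀ {X Y : E} (f : X ⟶ Y), G.map f ▷ W ≫ t Y = t X ≫ G.map f ▷ Z) :
    ∃ f : K ⊗ W ⟶ Z, ∀ e, δ e ▷ W ⊗≫ G.obj e ◁ f = t e := by
  obtain ⟨f, hf⟩ := h.desc (Z ⊗ W') (fun e => 𝟙 _ ⊗≫ G.obj e ◁ η_ W W' ⊗≫ t e ▷ W' ⊗≫ 𝟙 _) (by
    intro X Y f
    calc _ = 𝟙 _ ⊗≫ (G.map f ▷ 𝟙_ D ≫ G.obj Y ◁ η_ W W') ⊗≫ t Y ▷ W' ⊗≫ 𝟙 _ := by monoidal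
      _ = 𝟙 _ ⊗≫ G.obj X ◁ η_ W W' ⊗≫ (G.map f ▷ W ≫ t Y) ▷ W' ⊗≫ 𝟙 _ := by
          rw [← whisker_exchange]; monoidal
      _ = _ := by rw [ht]; monoidal)
  refine ⟨f ▷ W ⊗≫ Z ◁ ε_ W W' ⊗≫ 𝟙 Z, fun e => ?_⟩
  calc _ = (δ e ≫ G.obj e ◁ f) ▷ W ⊗≫ (G.obj e ⊗ Z) ◁ ε_ W W' ⊗≫ 𝟙 _ := by monoidal
    _ = 𝟙 _ ⊗≫ G.obj e ◁ η_ W W' ▷ W ⊗≫ (t e ▷ (W' ⊗ W) ≫ (G.obj e ⊗ Z) ◁ ε_ W W') ⊗≫ 𝟙 _ := by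
        rw [hf]; monoidal
    _ = 𝟙 _ ⊗≫ G.obj e ◁ (η_ W W' ▷ W ⊗≫ W ◁ ε_ W W') ⊗≫ t e := by
        rw [← whisker_exchange]; monoidal
    _ = _ := by rw [ExactPairing.evaluation_coevaluation'']; monoidal

end IsUniversalCoaction
end Coactions

end CenterCoend


namespace CenterCoend

/-! ### The bialgebra structure carried by a universal coaction in a braided category -/

section Braided
variable {D : Type u} [Category.{v} D] [MonoidalCategory.{v} D] [BraidedCategory D]

lemma braiding_tensor_left (X Y Z : D) : (β_ (X ⊗ Y) Z).hom =
    𝟙 _ ⊗≫ X ◁ (β_ Y Z).hom ⊗≫ (β_ X Z).hom ▷ Y ⊗≫ 𝟙 _ := by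
  rw [BraidedCategory.braiding_tensor_left_hom]; monoidal

lemma braiding_tensor_right (X Y Z : D) : (β_ X (Y ⊗ Z)).hom =
    𝟙 _ ⊗≫ (β_ X Y).hom ▷ Z ⊗≫ Y ◁ (β_ X Z).hom ⊗≫ 𝟙 _ := by
  rw [BraidedCategory.braiding_tensor_right_hom]; monoidal

variable [RightRigidCategory D]

/-- The data of the Hopf structure on the base of a universal coaction `δ`, by means of the
comparison `a` of the coactions on `Y ⊗ X` and on `Y`. -/
structure CoendData (K : D) where
  δ : ∀ X : D, X ⟶ X ⊗ K
  univ : IsUniversalCoaction (𝟭 D) (K := K) (fun X => δ X)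
  -- For fixed `X` the coaction of `Y ⊗ X` is natural in `Y`, so it factors through the coaction of
  -- `Y`; the factor is `a X`. The product is then the factorization of `a X` preceded by the
  -- braiding of `X` with `K`.
  a : ∀ X : D, K ⊗ X ⟶ X ⊗ K
  a_spec : ∀ Y X : D, δ Y ▷ X ⊗≫ Y ◁ a X = δ (Y ⊗ X) ⊗≫ 𝟙 (Y ⊗ X ⊗ K)
  μ : K ⊗ K ⟶ K
  μ_spec : ∀ X, δ X ▷ K ⊗≫ X ◁ μ = (β_ X K).hom ≫ a X
  u : 𝟙_ D ⟶ K
  u_spec : u = δ (𝟙_ D) ≫ (λ_ K).hom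
  Δ : K ⟶ K ⊗ K
  Δ_spec : ∀ X, δ X ≫ X ◁ Δ = δ X ≫ δ X ▷ K ≫ (α_ X K K).hom
  e : K ⟶ 𝟙_ D
  e_spec : ∀ X, δ X ≫ X ◁ e = (ρ_ X).inv
  -- The antipode records the coaction of the dual: open a pair `X ⊗ ld X`, let `ld X` coact, braid
  -- `K` past the incoming `X`, and close `ld X` with it.
  S : K ⟶ K
  S_spec : ∀ X, δ X ≫ X ◁ S = 𝟙 X ⊗≫ η_ X (ld X) ▷ X ⊗≫
    X ◁ (δ (ld X) ▷ X ⊗≫ ld X ◁ (β_ K X).hom ⊗≫ ε_ X (ld X) ▷ K ⊗≫ 𝟙 K)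

/-- A universal coaction determines all the data of the Hopf structure. -/
lemma exists_coendData {K : D} {δ : ∀ X : D, X ⟶ X ⊗ K}
    (h : IsUniversalCoaction (𝟭 D) (K := K) (fun X => δ X)) : ∃ H : CoendData K, H.δ = δ := by
  have n {X Y : D} (f : X ⟶ Y) : f ≫ δ Y = δ X ≫ f ▷ K := h.nat f
  have ha (X : D) : ∃ f : K ⊗ X ⟶ X ⊗ K, ∀ Y, δ Y ▷ X ⊗≫ Y ◁ f = δ (Y ⊗ X) ⊗≫ 𝟙 (Y ⊗ X ⊗ K) := by
    refine h.descRight (W := X) (W' := ld X) (Z := X ⊗ K)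
      (fun Y => δ (Y ⊗ X) ⊗≫ 𝟙 (Y ⊗ X ⊗ K)) ?_
    intro Y Z f
    change f ▷ X ≫ (δ (Z ⊗ X) ⊗≫ 𝟙 (Z ⊗ X ⊗ K)) = (δ (Y ⊗ X) ⊗≫ 𝟙 (Y ⊗ X ⊗ K)) ≫ f ▷ (X ⊗ K)
    calc _ = (f ▷ X ≫ δ (Z ⊗ X)) ⊗≫ 𝟙 (Z ⊗ X ⊗ K) := by monoidal
      _ = _ := by rw [n]; monoidal
  choose a ha using ha
  -- Naturality of `a` is what lets the family `(β_ X K).hom ≫ a X` descend to the product.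
  have an {X X' : D} (f : X ⟶ X') : K ◁ f ≫ a X' = a X ≫ f ▷ K := by
    refine h.extRight (W := X) (W' := ld X) (Z := X' ⊗ K) ?_
    intro Y
    change δ Y ▷ X ⊗≫ Y ◁ (K ◁ f ≫ a X') = δ Y ▷ X ⊗≫ Y ◁ (a X ≫ f ▷ K)
    calc _ = (δ Y ▷ X ≫ (Y ⊗ K) ◁ f) ⊗≫ Y ◁ a X' := by monoidal
      _ = Y ◁ f ≫ (δ Y ▷ X' ⊗≫ Y ◁ a X') := by rw [← whisker_exchange]; monoidal
      _ = (Y ◁ f ≫ δ (Y ⊗ X')) ⊗≫ 𝟙 _ := by rw [ha]; monoidal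
      _ = (δ (Y ⊗ X) ⊗≫ 𝟙 (Y ⊗ X ⊗ K)) ≫ Y ◁ f ▷ K := by rw [n]; monoidal
      _ = _ := by rw [← ha]; monoidal
  obtain ⟨μ, hμ⟩ := h.descRight (W := K) (W' := ld K) (Z := K) (fun X => (β_ X K).hom ≫ a X) (by
    intro X Y f
    change f ▷ K ≫ (β_ Y K).hom ≫ a Y = ((β_ X K).hom ≫ a X) ≫ f ▷ K
    rw [BraidedCategory.braiding_naturality_left_assoc, an, Category.assoc])
  obtain ⟨Δ, hΔ⟩ := h.desc (K ⊗ K) (fun X => δ X ≫ δ X ▷ K ≫ (α_ X K K).hom) (by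
    intro X Y f
    change f ≫ δ Y ≫ δ Y ▷ K ≫ (α_ Y K K).hom = (δ X ≫ δ X ▷ K ≫ (α_ X K K).hom) ≫ f ▷ (K ⊗ K)
    rw [← Category.assoc, n]
    calc _ = δ X ≫ (f ≫ δ Y) ▷ K ≫ (α_ Y K K).hom := by monoidal
      _ = _ := by rw [n]; monoidal)
  obtain ⟨e, he⟩ := h.desc (𝟙_ D) (fun X => (ρ_ X).inv) (by
    intro X Y f
    change f ≫ (ρ_ Y).inv = (ρ_ X).inv ≫ f ▷ 𝟙_ D
    simp)
  obtain ⟨S, hS⟩ := h.desc K (fun X => 𝟙 X ⊗≫ η_ X (ld X) ▷ X ⊗≫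
    X ◁ (δ (ld X) ▷ X ⊗≫ ld X ◁ (β_ K X).hom ⊗≫ ε_ X (ld X) ▷ K ⊗≫ 𝟙 K)) (by
    intro X Y f
    change f ≫ (𝟙 Y ⊗≫ η_ Y (ld Y) ▷ Y ⊗≫
      Y ◁ (δ (ld Y) ▷ Y ⊗≫ ld Y ◁ (β_ K Y).hom ⊗≫ ε_ Y (ld Y) ▷ K ⊗≫ 𝟙 K)) =
      (𝟙 X ⊗≫ η_ X (ld X) ▷ X ⊗≫
      X ◁ (δ (ld X) ▷ X ⊗≫ ld X ◁ (β_ K X).hom ⊗≫ ε_ X (ld X) ▷ K ⊗≫ 𝟙 K)) ≫ f ▷ K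
    let g := dualMap (ld X) (ld Y) f
    calc _ = 𝟙 X ⊗≫ (𝟙_ D ◁ f ≫ η_ Y (ld Y) ▷ Y) ⊗≫
          Y ◁ (δ (ld Y) ▷ Y ⊗≫ ld Y ◁ (β_ K Y).hom ⊗≫ ε_ Y (ld Y) ▷ K ⊗≫ 𝟙 K) := by monoidal
      _ = 𝟙 X ⊗≫ η_ Y (ld Y) ▷ X ⊗≫ Y ◁ ((ld Y ◁ f ≫ δ (ld Y) ▷ Y) ⊗≫ ld Y ◁ (β_ K Y).hom ⊗≫
          ε_ Y (ld Y) ▷ K ⊗≫ 𝟙 K) := by rw [whisker_exchange]; monoidal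
      _ = 𝟙 X ⊗≫ η_ Y (ld Y) ▷ X ⊗≫ Y ◁ (δ (ld Y) ▷ X ⊗≫ ld Y ◁ (K ◁ f ≫ (β_ K Y).hom) ⊗≫
          ε_ Y (ld Y) ▷ K ⊗≫ 𝟙 K) := by rw [whisker_exchange]; monoidal
      _ = 𝟙 X ⊗≫ η_ Y (ld Y) ▷ X ⊗≫ Y ◁ (δ (ld Y) ▷ X ⊗≫ ld Y ◁ (β_ K X).hom ⊗≫
          (ld Y ◁ f ≫ ε_ Y (ld Y)) ▷ K ⊗≫ 𝟙 K) := by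
        rw [BraidedCategory.braiding_naturality_right]; monoidal
      _ = 𝟙 X ⊗≫ η_ Y (ld Y) ▷ X ⊗≫ Y ◁ (δ (ld Y) ▷ X ⊗≫ (ld Y ◁ (β_ K X).hom ≫
          g ▷ (X ⊗ K)) ⊗≫ ε_ X (ld X) ▷ K ⊗≫ 𝟙 K) := by
        rw [← dualMap_eval (ld X) (ld Y)]; monoidal
      _ = 𝟙 X ⊗≫ η_ Y (ld Y) ▷ X ⊗≫ Y ◁ ((δ (ld Y) ≫ g ▷ K) ▷ X ⊗≫ ld X ◁ (β_ K X).hom ⊗≫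
          ε_ X (ld X) ▷ K ⊗≫ 𝟙 K) := by
        rw [whisker_exchange]; monoidal
      _ = 𝟙 X ⊗≫ (η_ Y (ld Y) ≫ Y ◁ g) ▷ X ⊗≫ Y ◁ (δ (ld X) ▷ X ⊗≫ ld X ◁ (β_ K X).hom ⊗≫
          ε_ X (ld X) ▷ K ⊗≫ 𝟙 K) := by
        rw [← n g]; monoidal
      _ = 𝟙 X ⊗≫ η_ X (ld X) ▷ X ⊗≫ (f ▷ (ld X ⊗ X) ≫ Y ◁ (δ (ld X) ▷ X ⊗≫ ld X ◁ (β_ K X).hom ⊗≫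
          ε_ X (ld X) ▷ K ⊗≫ 𝟙 K)) := by
        rw [coeval_dualMap]; monoidal
      _ = _ := by rw [← whisker_exchange]; monoidal)
  exact ⟨⟨δ, h, a, fun Y X => ha X Y, μ, hμ, _, rfl, Δ, hΔ, e, he, S, hS⟩, rfl⟩

namespace CoendData
variable {K : D} (H : CoendData K)

lemma nat {X Y : D} (f : X ⟶ Y) : f ≫ H.δ Y = H.δ X ≫ f ▷ K := H.univ.nat f

lemma ext {Z : D} {f g : K ⟶ Z} (h : ∀ X, H.δ X ≫ X ◁ f = H.δ X ≫ X ◁ g) : f = g :=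
  H.univ.ext Z f g h

lemma extRight {W Z : D} {f g : K ⊗ W ⟶ Z}
    (h : ∀ X, H.δ X ▷ W ⊗≫ X ◁ f = H.δ X ▷ W ⊗≫ X ◁ g) : f = g :=
  H.univ.extRight (W' := ld W) h

lemma δ_assoc (X Y Z : D) :
    H.δ ((X ⊗ Y) ⊗ Z) = (α_ X Y Z).hom ≫ H.δ (X ⊗ Y ⊗ Z) ≫ (α_ X Y Z).inv ▷ K := by
  rw [← Category.assoc, H.nat, Category.assoc, ← comp_whiskerRight, Iso.hom_inv_id,
    id_whiskerRight, Category.comp_id]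

lemma a_spec' (Y X : D) :
    H.δ Y ▷ X ≫ (α_ Y K X).hom ≫ Y ◁ H.a X = H.δ (Y ⊗ X) ≫ (α_ Y X K).hom := by
  calc _ = H.δ Y ▷ X ⊗≫ Y ◁ H.a X := by monoidal
    _ = _ := by rw [H.a_spec]; monoidal

lemma μ_spec' (X : D) : H.δ X ▷ K ≫ (α_ X K K).hom ≫ X ◁ H.μ = (β_ X K).hom ≫ H.a X := by
  calc _ = H.δ X ▷ K ⊗≫ X ◁ H.μ := by monoidal
    _ = _ := by rw [H.μ_spec]

/-- Both sides compute the coaction of `Z ⊗ X ⊗ Y` from that of `Z`, adjoining `X ⊗ Y` at once or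
one factor at a time. -/
lemma a_tensor (X Y : D) : H.a (X ⊗ Y) = 𝟙 _ ⊗≫ H.a X ▷ Y ⊗≫ X ◁ H.a Y ⊗≫ 𝟙 _ := by
  apply H.extRight
  intro Z
  rw [H.a_spec]
  symm
  calc _ = 𝟙 _ ⊗≫ (H.δ Z ▷ X ⊗≫ Z ◁ H.a X) ▷ Y ⊗≫ (Z ⊗ X) ◁ H.a Y ⊗≫ 𝟙 _ := by monoidal
    _ = 𝟙 _ ⊗≫ (H.δ (Z ⊗ X) ▷ Y ≫ (α_ _ _ _).hom ≫ (Z ⊗ X) ◁ H.a Y) ⊗≫ 𝟙 _ := by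
        rw [H.a_spec]; monoidal
    _ = _ := by rw [H.a_spec', H.δ_assoc]; monoidal

lemma a_unit : H.a (𝟙_ D) = (ρ_ K).hom ≫ (λ_ K).inv := by
  apply H.extRight
  intro Z
  rw [H.a_spec]
  calc _ = (ρ_ Z).hom ≫ ((ρ_ Z).inv ≫ H.δ (Z ⊗ 𝟙_ D)) ⊗≫ 𝟙 (Z ⊗ 𝟙_ D ⊗ K) := by monoidal
    _ = _ := by rw [H.nat]; monoidal

lemma u_a (X : D) : H.u ▷ X ≫ H.a X = (λ_ X).hom ≫ H.δ X := by
  rw [H.u_spec]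
  calc _ = (H.δ (𝟙_ D) ▷ X ≫ (α_ _ _ _).hom ≫ 𝟙_ D ◁ H.a X) ⊗≫ 𝟙 (X ⊗ K) := by monoidal
    _ = (H.δ (𝟙_ D ⊗ X) ≫ (λ_ X).hom ▷ K) := by rw [H.a_spec']; monoidal
    _ = _ := by rw [H.nat]

lemma a_comul (X : D) : H.a X ≫ X ◁ H.Δ =
    H.Δ ▷ X ⊗≫ K ◁ H.a X ⊗≫ H.a X ▷ K ⊗≫ 𝟙 (X ⊗ (K ⊗ K)) := by
  apply H.extRight
  intro Y
  symm
  calc _ = (H.δ Y ≫ Y ◁ H.Δ) ▷ X ⊗≫ (Y ⊗ K) ◁ H.a X ⊗≫ Y ◁ H.a X ▷ K ⊗≫ 𝟙 _ := by monoidal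
    _ = H.δ Y ▷ X ⊗≫ (H.δ Y ▷ (K ⊗ X) ≫ (Y ⊗ K) ◁ H.a X) ⊗≫ Y ◁ H.a X ▷ K ⊗≫ 𝟙 _ := by
        rw [H.Δ_spec]; monoidal
    _ = (H.δ Y ▷ X ⊗≫ Y ◁ H.a X) ⊗≫ (H.δ Y ▷ X ⊗≫ Y ◁ H.a X) ▷ K ⊗≫ 𝟙 _ := by
        rw [← whisker_exchange]; monoidal
    _ = (H.δ (Y ⊗ X) ≫ H.δ (Y ⊗ X) ▷ K ≫ (α_ _ _ _).hom) ⊗≫ 𝟙 _ := by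
        rw [H.a_spec]; monoidal
    _ = (H.δ (Y ⊗ X) ⊗≫ 𝟙 (Y ⊗ X ⊗ K)) ≫ Y ◁ X ◁ H.Δ := by
        rw [← H.Δ_spec]; monoidal
    _ = _ := by rw [← H.a_spec]; monoidal

lemma a_counit (X : D) : H.a X ≫ X ◁ H.e = H.e ▷ X ≫ (λ_ X).hom ≫ (ρ_ X).inv := by
  apply H.extRight
  intro Y
  calc _ = (H.δ Y ▷ X ⊗≫ Y ◁ H.a X) ≫ Y ◁ X ◁ H.e := by monoidal
    _ = (H.δ (Y ⊗ X) ≫ (Y ⊗ X) ◁ H.e) ⊗≫ 𝟙 _ := by rw [H.a_spec]; monoidal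
    _ = (ρ_ Y).inv ▷ X ⊗≫ 𝟙 (Y ⊗ X ⊗ 𝟙_ D) := by rw [H.e_spec]; monoidal
    _ = _ := by rw [← H.e_spec]; monoidal

/-- This is the defining equation of the product at `Y ⊗ X`, with the hexagon splitting the braiding
and `a_tensor` splitting the comparison. Associativity rests on it. -/
lemma a_mul (X : D) : H.a X ▷ K ⊗≫ X ◁ H.μ =
    𝟙 ((K ⊗ X) ⊗ K) ⊗≫ K ◁ (β_ X K).hom ⊗≫ H.μ ▷ X ≫ H.a X := by
  have h : 𝟙 (K ⊗ X ⊗ K) ⊗≫ H.a X ▷ K ⊗≫ X ◁ H.μ =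
      K ◁ (β_ X K).hom ⊗≫ H.μ ▷ X ≫ H.a X := by
    apply H.extRight
    intro Y
    calc _ = 𝟙 _ ⊗≫ (H.δ Y ▷ X ⊗≫ Y ◁ H.a X) ▷ K ⊗≫ (Y ⊗ X) ◁ H.μ ⊗≫ 𝟙 _ := by monoidal
      _ = 𝟙 _ ⊗≫ (H.δ (Y ⊗ X) ▷ K ≫ (α_ _ _ _).hom ≫ (Y ⊗ X) ◁ H.μ) ⊗≫ 𝟙 _ := by
          rw [H.a_spec]; monoidal
      _ = 𝟙 _ ⊗≫ Y ◁ (β_ X K).hom ⊗≫ ((β_ Y K).hom ≫ H.a Y) ▷ X ⊗≫ Y ◁ H.a X := by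
          rw [H.μ_spec', braiding_tensor_left, a_tensor]; monoidal
      _ = 𝟙 _ ⊗≫ (Y ◁ (β_ X K).hom ≫ H.δ Y ▷ (K ⊗ X)) ⊗≫ Y ◁ (H.μ ▷ X ≫ H.a X) := by
          rw [← H.μ_spec]; monoidal
      _ = _ := by rw [whisker_exchange]; monoidal
  calc _ = 𝟙 _ ⊗≫ (𝟙 (K ⊗ X ⊗ K) ⊗≫ H.a X ▷ K ⊗≫ X ◁ H.μ) := by monoidal
    _ = _ := by rw [h]

/-- After a coaction of `X`, each product becomes a braiding followed by `a`. The bracketings agree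
by `a_mul` and by naturality of the braiding of `X` with `K ⊗ K`. -/
lemma mul_assoc' : H.μ ▷ K ≫ H.μ = (α_ K K K).hom ≫ K ◁ H.μ ≫ H.μ := by
  have h : (α_ K K K).inv ≫ H.μ ▷ K ≫ H.μ = K ◁ H.μ ≫ H.μ := by
    apply H.extRight
    intro X
    calc _ = 𝟙 _ ⊗≫ (H.δ X ▷ K ⊗≫ X ◁ H.μ) ▷ K ⊗≫ X ◁ H.μ := by monoidal
      _ = 𝟙 _ ⊗≫ (β_ X K).hom ▷ K ⊗≫ (H.a X ▷ K ⊗≫ X ◁ H.μ) := by rw [H.μ_spec]; monoidal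
      _ = (𝟙 _ ⊗≫ (β_ X K).hom ▷ K ⊗≫ K ◁ (β_ X K).hom ⊗≫ 𝟙 _) ≫ H.μ ▷ X ≫ H.a X := by
          rw [a_mul]; monoidal
      _ = X ◁ H.μ ≫ (β_ X K).hom ≫ H.a X := by
          rw [← braiding_tensor_right, ← BraidedCategory.braiding_naturality_right_assoc]
      _ = (X ◁ H.μ ≫ H.δ X ▷ K) ⊗≫ X ◁ H.μ := by rw [← H.μ_spec]; monoidal
      _ = _ := by rw [whisker_exchange]; monoidal
  rw [← h]; simp

lemma one_mul' : H.u ▷ K ≫ H.μ = (λ_ K).hom := by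
  rw [H.u_spec]
  calc _ = 𝟙 _ ⊗≫ (H.δ (𝟙_ D) ▷ K ≫ (α_ _ _ _).hom ≫ 𝟙_ D ◁ H.μ) ⊗≫ 𝟙 _ := by monoidal
    _ = _ := by rw [H.μ_spec', a_unit, braiding_tensorUnit_left]; monoidal

lemma mul_one' : K ◁ H.u ≫ H.μ = (ρ_ K).hom := by
  have h : (ρ_ K).inv ≫ K ◁ H.u ≫ H.μ = 𝟙 K := by
    apply H.ext
    intro X
    calc _ = 𝟙 _ ⊗≫ (H.δ X ▷ 𝟙_ D ≫ (X ⊗ K) ◁ H.u) ⊗≫ X ◁ H.μ := by monoidal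
      _ = 𝟙 _ ⊗≫ X ◁ H.u ⊗≫ (H.δ X ▷ K ⊗≫ X ◁ H.μ) := by rw [← whisker_exchange]; monoidal
      _ = 𝟙 _ ⊗≫ (X ◁ H.u ≫ (β_ X K).hom) ≫ H.a X := by rw [H.μ_spec]; monoidal
      _ = (ρ_ X).inv ≫ (β_ X (𝟙_ D)).hom ≫ H.u ▷ X ≫ H.a X := by
          rw [BraidedCategory.braiding_naturality_right]; monoidal
      _ = _ := by rw [u_a, braiding_tensorUnit_right]; monoidal
  rw [Iso.inv_comp_eq, Category.comp_id] at h
  exact h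

lemma counit_comul' : H.Δ ≫ H.e ▷ K = (λ_ K).inv := by
  apply H.ext
  intro X
  calc _ = (H.δ X ≫ X ◁ H.Δ) ≫ X ◁ H.e ▷ K := by monoidal
    _ = H.δ X ≫ (H.δ X ≫ X ◁ H.e) ▷ K ⊗≫ 𝟙 _ := by rw [H.Δ_spec]; monoidal
    _ = _ := by rw [H.e_spec]; monoidal

lemma comul_counit' : H.Δ ≫ K ◁ H.e = (ρ_ K).inv := by
  apply H.ext
  intro X
  calc _ = (H.δ X ≫ X ◁ H.Δ) ≫ X ◁ K ◁ H.e := by monoidal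
    _ = H.δ X ≫ (H.δ X ▷ K ≫ (X ⊗ K) ◁ H.e) ⊗≫ 𝟙 _ := by rw [H.Δ_spec]; monoidal
    _ = (H.δ X ≫ X ◁ H.e) ⊗≫ H.δ X ▷ 𝟙_ D ⊗≫ 𝟙 _ := by rw [← whisker_exchange]; monoidal
    _ = _ := by rw [H.e_spec]; monoidal

lemma comul_assoc' : H.Δ ≫ K ◁ H.Δ = H.Δ ≫ H.Δ ▷ K ≫ (α_ K K K).hom := by
  apply H.ext
  intro X
  calc _ = (H.δ X ≫ X ◁ H.Δ) ≫ X ◁ K ◁ H.Δ := by monoidal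
    _ = H.δ X ≫ (H.δ X ▷ K ≫ (X ⊗ K) ◁ H.Δ) ⊗≫ 𝟙 _ := by rw [H.Δ_spec]; monoidal
    _ = (H.δ X ≫ X ◁ H.Δ) ⊗≫ H.δ X ▷ (K ⊗ K) ⊗≫ 𝟙 _ := by rw [← whisker_exchange]; monoidal
    _ = H.δ X ≫ (H.δ X ≫ H.δ X ▷ K ≫ (α_ _ _ _).hom) ▷ K ⊗≫ 𝟙 _ := by rw [H.Δ_spec]; monoidal
    _ = H.δ X ≫ (H.δ X ≫ X ◁ H.Δ) ▷ K ⊗≫ 𝟙 _ := by rw [H.Δ_spec]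
    _ = (H.δ X ≫ H.δ X ▷ K ≫ (α_ _ _ _).hom) ⊗≫ X ◁ H.Δ ▷ K ⊗≫ 𝟙 _ := by monoidal
    _ = _ := by rw [← H.Δ_spec]; monoidal

/-- Unfolding the two products against the coaction of `X` leaves two comparisons `a X`, merged by
`a_comul`; the middle braiding of the bialgebra axiom is absorbed by sliding the coaction through a
crossing. -/
lemma mul_comul' : H.μ ≫ H.Δ = (H.Δ ⊗ₘ H.Δ) ≫ tensorμ K K K K ≫ (H.μ ⊗ₘ H.μ) := by
  have e : (H.Δ ⊗ₘ H.Δ) ≫ tensorμ K K K K ≫ (H.μ ⊗ₘ H.μ) =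
      H.Δ ▷ K ⊗≫ (K ⊗ K) ◁ H.Δ ⊗≫ K ◁ (β_ K K).hom ▷ K ⊗≫ (K ⊗ K) ◁ H.μ ⊗≫ H.μ ▷ K := by
    rw [MonoidalCategory.tensorHom_def, MonoidalCategory.tensorHom_def']; unfold tensorμ; monoidal
  rw [e]
  apply H.extRight
  intro X
  symm
  calc _ = (H.δ X ≫ X ◁ H.Δ) ▷ K ⊗≫ X ◁ ((K ⊗ K) ◁ H.Δ ⊗≫ K ◁ (β_ K K).hom ▷ K ⊗≫
        (K ⊗ K) ◁ H.μ ⊗≫ H.μ ▷ K) := by monoidal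
    _ = H.δ X ▷ K ⊗≫ (H.δ X ▷ (K ⊗ K) ≫ (X ⊗ K) ◁ (K ◁ H.Δ)) ⊗≫ X ◁ (K ◁ (β_ K K).hom ▷ K ⊗≫
        (K ⊗ K) ◁ H.μ ⊗≫ H.μ ▷ K) := by rw [H.Δ_spec]; monoidal
    _ = (H.δ X ▷ K ≫ (X ⊗ K) ◁ H.Δ) ⊗≫ (H.δ X ▷ (K ⊗ (K ⊗ K)) ≫ (X ⊗ K) ◁ (𝟙 _ ⊗≫
        (β_ K K).hom ▷ K ⊗≫ K ◁ H.μ)) ⊗≫ X ◁ H.μ ▷ K := by rw [← whisker_exchange]; monoidal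
    _ = X ◁ H.Δ ⊗≫ H.δ X ▷ (K ⊗ K) ⊗≫ X ◁ (β_ K K).hom ▷ K ⊗≫ (X ⊗ K) ◁ H.μ ⊗≫
        (H.δ X ▷ K ⊗≫ X ◁ H.μ) ▷ K ⊗≫ 𝟙 _ := by
        rw [← whisker_exchange, ← whisker_exchange]; monoidal
    _ = X ◁ H.Δ ⊗≫ H.δ X ▷ (K ⊗ K) ⊗≫ X ◁ (β_ K K).hom ▷ K ⊗≫ ((X ⊗ K) ◁ H.μ ≫
        (β_ X K).hom ▷ K) ⊗≫ H.a X ▷ K ⊗≫ 𝟙 _ := by rw [H.μ_spec]; monoidal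
    _ = X ◁ H.Δ ⊗≫ (H.δ X ▷ K ≫ (𝟙 ((X ⊗ K) ⊗ K) ⊗≫ X ◁ (β_ K K).hom ⊗≫ (β_ X K).hom ▷ K ⊗≫
          𝟙 (K ⊗ (X ⊗ K)))) ▷ K ⊗≫
        K ◁ X ◁ H.μ ⊗≫ H.a X ▷ K ⊗≫ 𝟙 _ := by rw [whisker_exchange]; monoidal
    _ = X ◁ H.Δ ⊗≫ (β_ X K).hom ▷ K ⊗≫ K ◁ (H.δ X ▷ K ⊗≫ X ◁ H.μ) ⊗≫
        H.a X ▷ K ⊗≫ 𝟙 _ := by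
        rw [← braiding_tensor_left, BraidedCategory.braiding_naturality_left]; monoidal
    _ = (X ◁ H.Δ ≫ (𝟙 (X ⊗ (K ⊗ K)) ⊗≫ (β_ X K).hom ▷ K ⊗≫ K ◁ (β_ X K).hom ⊗≫
          𝟙 ((K ⊗ K) ⊗ X))) ⊗≫
        K ◁ H.a X ⊗≫ H.a X ▷ K ⊗≫ 𝟙 _ := by rw [H.μ_spec]; monoidal
    _ = (β_ X K).hom ⊗≫ (H.Δ ▷ X ⊗≫ K ◁ H.a X ⊗≫ H.a X ▷ K ⊗≫ 𝟙 (X ⊗ (K ⊗ K))) := by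
        rw [← braiding_tensor_right, BraidedCategory.braiding_naturality_right]; monoidal
    _ = ((β_ X K).hom ≫ H.a X) ≫ X ◁ H.Δ := by rw [← a_comul]; monoidal
    _ = _ := by rw [← H.μ_spec]; monoidal

lemma one_comul' : H.u ≫ H.Δ = (λ_ (𝟙_ D)).inv ≫ (H.u ⊗ₘ H.u) := by
  have h := H.Δ_spec (𝟙_ D)
  rw [H.u_spec, MonoidalCategory.tensorHom_def']
  calc _ = (H.δ (𝟙_ D) ≫ 𝟙_ D ◁ H.Δ) ⊗≫ 𝟙 (K ⊗ K) := by monoidal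
    _ = 𝟙 _ ⊗≫ 𝟙_ D ◁ H.δ (𝟙_ D) ⊗≫ H.δ (𝟙_ D) ▷ K ⊗≫ 𝟙 (K ⊗ K) := by rw [h]; monoidal
    _ = _ := by monoidal

lemma mul_counit' : H.μ ≫ H.e = (H.e ⊗ₘ H.e) ≫ (λ_ (𝟙_ D)).hom := by
  apply H.extRight
  intro X
  rw [MonoidalCategory.tensorHom_def]
  calc _ = (H.δ X ▷ K ⊗≫ X ◁ H.μ) ≫ X ◁ H.e := by monoidal
    _ = (β_ X K).hom ≫ H.e ▷ X ⊗≫ 𝟙 (X ⊗ 𝟙_ D) := by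
        rw [H.μ_spec, Category.assoc, a_counit]; monoidal
    _ = X ◁ H.e ⊗≫ 𝟙 _ := by
        have h := BraidedCategory.braiding_naturality_right X H.e
        calc _ = ((β_ X K).hom ≫ H.e ▷ X) ⊗≫ 𝟙 (X ⊗ 𝟙_ D) := by monoidal
          _ = _ := by rw [← h, braiding_tensorUnit_right]; monoidal
    _ = (ρ_ X).inv ▷ K ⊗≫ X ◁ H.e := by monoidal
    _ = _ := by rw [← H.e_spec]; monoidal

lemma one_counit' : H.u ≫ H.e = 𝟙 (𝟙_ D) := by
  have h := H.e_spec (𝟙_ D)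
  rw [H.u_spec]
  calc _ = (H.δ (𝟙_ D) ≫ 𝟙_ D ◁ H.e) ⊗≫ 𝟙 _ := by monoidal
    _ = _ := by rw [h]; monoidal

end CoendData
end Braided
end CenterCoend


namespace CenterCoend

/-! ### Antipode, Hopf structure, canonical pairing and forms -/

section Braided
variable {D : Type u} [Category.{v} D] [MonoidalCategory.{v} D] [BraidedCategory D]
variable [RightRigidCategory D]

namespace CoendData
variable {K : D} (H : CoendData K)

/-- The coactions of `ld X` and `X` meet in the product and merge into the coaction of `X ⊗ ld X`.
The braided evaluation `X ⊗ ld X ⟶ 𝟙_ D` is a morphism, so naturality reduces this to the coaction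
of the unit object, which is `H.u`. -/
lemma antipode_left' : H.Δ ≫ H.S ▷ K ≫ H.μ = H.e ≫ H.u := by
  apply H.ext
  intro X
  have B : 𝟙 (ld X ⊗ X) ⊗≫ ld X ◁ H.δ X ⊗≫ H.δ (ld X) ▷ (X ⊗ K) ⊗≫ ld X ◁ (β_ K X).hom ▷ K ⊗≫
      ε_ X (ld X) ▷ (K ⊗ K) ⊗≫ H.μ = ε_ X (ld X) ≫ H.u := by
    calc _ = 𝟙 (ld X ⊗ X) ⊗≫ ld X ◁ H.δ X ⊗≫ H.δ (ld X) ▷ (X ⊗ K) ⊗≫ ld X ◁ (β_ K X).hom ▷ K ⊗≫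
          (ε_ X (ld X) ▷ (K ⊗ K) ≫ 𝟙_ D ◁ H.μ) ⊗≫ 𝟙 K := by monoidal
      -- A crossing and its inverse are inserted: the first brings the strands into the position
      -- required by the defining equation of the product at `ld X`, the second becomes part of the
      -- evaluation.
      _ = 𝟙 (ld X ⊗ X) ⊗≫ ld X ◁ H.δ X ⊗≫ H.δ (ld X) ▷ (X ⊗ K) ⊗≫ ld X ◁ (β_ K X).hom ▷ K ⊗≫
          (ld X ⊗ X) ◁ H.μ ⊗≫ ((β_ (ld X) X).hom ≫ (β_ (ld X) X).inv ≫ ε_ X (ld X)) ▷ K ⊗≫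
          𝟙 K := by
          rw [← whisker_exchange, Iso.hom_inv_id_assoc]; monoidal
      _ = 𝟙 (ld X ⊗ X) ⊗≫ ld X ◁ H.δ X ⊗≫ H.δ (ld X) ▷ (X ⊗ K) ⊗≫ ld X ◁ (β_ K X).hom ▷ K ⊗≫
          ((ld X ⊗ X) ◁ H.μ ≫ (β_ (ld X) X).hom ▷ K) ⊗≫
          ((β_ (ld X) X).inv ≫ ε_ X (ld X)) ▷ K ⊗≫ 𝟙 K := by monoidal
      _ = 𝟙 (ld X ⊗ X) ⊗≫ ld X ◁ H.δ X ⊗≫ (H.δ (ld X) ▷ X ≫ (𝟙 ((ld X ⊗ K) ⊗ X) ⊗≫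
            ld X ◁ (β_ K X).hom ⊗≫ (β_ (ld X) X).hom ▷ K ⊗≫ 𝟙 (X ⊗ (ld X ⊗ K)))) ▷ K ⊗≫
          (X ⊗ ld X) ◁ H.μ ⊗≫
          ((β_ (ld X) X).inv ≫ ε_ X (ld X)) ▷ K ⊗≫ 𝟙 K := by
          rw [whisker_exchange]; monoidal
      _ = 𝟙 (ld X ⊗ X) ⊗≫ ld X ◁ H.δ X ⊗≫ (β_ (ld X) X).hom ▷ K ⊗≫
          X ◁ (H.δ (ld X) ▷ K ⊗≫ ld X ◁ H.μ) ⊗≫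
          ((β_ (ld X) X).inv ≫ ε_ X (ld X)) ▷ K ⊗≫ 𝟙 K := by
          rw [← braiding_tensor_left, BraidedCategory.braiding_naturality_left]; monoidal
      _ = 𝟙 (ld X ⊗ X) ⊗≫ (ld X ◁ H.δ X ≫ (𝟙 (ld X ⊗ (X ⊗ K)) ⊗≫ (β_ (ld X) X).hom ▷ K ⊗≫
            X ◁ (β_ (ld X) K).hom ⊗≫ 𝟙 ((X ⊗ K) ⊗ ld X))) ⊗≫ X ◁ H.a (ld X) ⊗≫
          ((β_ (ld X) X).inv ≫ ε_ X (ld X)) ▷ K ⊗≫ 𝟙 K := by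
          rw [H.μ_spec]; monoidal
      _ = (β_ (ld X) X).hom ⊗≫ (H.δ X ▷ ld X ⊗≫ X ◁ H.a (ld X)) ⊗≫
          ((β_ (ld X) X).inv ≫ ε_ X (ld X)) ▷ K ⊗≫ 𝟙 K := by
          rw [← braiding_tensor_right, BraidedCategory.braiding_naturality_right]; monoidal
      _ = (β_ (ld X) X).hom ⊗≫ (H.δ (X ⊗ ld X) ≫
          ((β_ (ld X) X).inv ≫ ε_ X (ld X)) ▷ K) ⊗≫ 𝟙 K := by
          rw [H.a_spec]; monoidal
      _ = (β_ (ld X) X).hom ≫ ((β_ (ld X) X).inv ≫ ε_ X (ld X)) ≫ H.δ (𝟙_ D) ⊗≫ 𝟙 K := by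
          rw [← H.nat]; monoidal
      _ = _ := by
          rw [H.u_spec, Category.assoc, Iso.hom_inv_id_assoc]; monoidal
  calc _ = (H.δ X ≫ X ◁ H.Δ) ⊗≫ X ◁ H.S ▷ K ⊗≫ X ◁ H.μ := by monoidal
    _ = H.δ X ≫ (H.δ X ≫ X ◁ H.S) ▷ K ⊗≫ X ◁ H.μ := by rw [H.Δ_spec]; monoidal
    _ = 𝟙 X ⊗≫ (𝟙_ D ◁ H.δ X ≫ η_ X (ld X) ▷ (X ⊗ K)) ⊗≫
          X ◁ (H.δ (ld X) ▷ X ⊗≫ ld X ◁ (β_ K X).hom ⊗≫ ε_ X (ld X) ▷ K ⊗≫ 𝟙 K) ▷ K ⊗≫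
          X ◁ H.μ := by
        rw [H.S_spec]; monoidal
    _ = 𝟙 X ⊗≫ η_ X (ld X) ▷ X ⊗≫ X ◁ (𝟙 (ld X ⊗ X) ⊗≫ ld X ◁ H.δ X ⊗≫ H.δ (ld X) ▷ (X ⊗ K) ⊗≫
        ld X ◁ (β_ K X).hom ▷ K ⊗≫ ε_ X (ld X) ▷ (K ⊗ K) ⊗≫ H.μ) := by
        rw [whisker_exchange]; monoidal
    _ = 𝟙 X ⊗≫ (η_ X (ld X) ▷ X ⊗≫ X ◁ ε_ X (ld X)) ⊗≫ X ◁ H.u := by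
        rw [B]; monoidal
    _ = (ρ_ X).inv ≫ X ◁ H.u := by rw [ExactPairing.evaluation_coevaluation'']; monoidal
    _ = _ := by rw [← H.e_spec]; monoidal

/-- Mirror argument: the coactions merge into that of `ld X ⊗ X`, and naturality is applied to the
braided coevaluation `𝟙_ D ⟶ ld X ⊗ X`. -/
lemma antipode_right' : H.Δ ≫ K ◁ H.S ≫ H.μ = H.e ≫ H.u := by
  apply H.ext
  intro X
  calc _ = (H.δ X ≫ X ◁ H.Δ) ⊗≫ X ◁ K ◁ H.S ⊗≫ X ◁ H.μ := by monoidal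
    _ = H.δ X ≫ (H.δ X ▷ K ≫ (X ⊗ K) ◁ H.S) ⊗≫ X ◁ H.μ := by rw [H.Δ_spec]; monoidal
    _ = (H.δ X ≫ X ◁ H.S) ≫ (H.δ X ▷ K ⊗≫ X ◁ H.μ) := by
        rw [← whisker_exchange]; monoidal
    _ = 𝟙 X ⊗≫ η_ X (ld X) ▷ X ⊗≫ (X ◁ (H.δ (ld X) ▷ X ⊗≫ ld X ◁ (β_ K X).hom ⊗≫
          ε_ X (ld X) ▷ K ⊗≫ 𝟙 K) ≫ (β_ X K).hom) ≫ H.a X := by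
        rw [H.S_spec, H.μ_spec]; monoidal
    _ = 𝟙 X ⊗≫ η_ X (ld X) ▷ X ⊗≫ (β_ X (ld X)).hom ▷ X ⊗≫ ld X ◁ (β_ X X).hom ⊗≫
          H.δ (ld X) ▷ (X ⊗ X) ⊗≫ ld X ◁ (β_ K X).hom ▷ X ⊗≫
          (ε_ X (ld X) ▷ (K ⊗ X) ≫ 𝟙_ D ◁ H.a X) ⊗≫ 𝟙 (X ⊗ K) := by
        rw [BraidedCategory.braiding_naturality_right, braiding_tensor_right]; monoidal
    _ = 𝟙 X ⊗≫ (η_ X (ld X) ≫ (β_ X (ld X)).hom) ▷ X ⊗≫ (ld X ◁ (β_ X X).hom ≫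
          H.δ (ld X) ▷ (X ⊗ X)) ⊗≫ ld X ◁ ((β_ K X).hom ▷ X ⊗≫ X ◁ H.a X) ⊗≫
          ε_ X (ld X) ▷ (X ⊗ K) ⊗≫ 𝟙 (X ⊗ K) := by
        rw [← whisker_exchange]; monoidal
    _ = 𝟙 X ⊗≫ (η_ X (ld X) ≫ (β_ X (ld X)).hom) ▷ X ⊗≫ H.δ (ld X) ▷ (X ⊗ X) ⊗≫
          ld X ◁ ((𝟙 ((K ⊗ X) ⊗ X) ⊗≫ K ◁ (β_ X X).hom ⊗≫ (β_ K X).hom ▷ X ⊗≫ 𝟙 (X ⊗ (K ⊗ X))) ≫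
          X ◁ H.a X) ⊗≫
          ε_ X (ld X) ▷ (X ⊗ K) ⊗≫ 𝟙 (X ⊗ K) := by
        rw [whisker_exchange]; monoidal
    _ = 𝟙 X ⊗≫ (η_ X (ld X) ≫ (β_ X (ld X)).hom) ▷ X ⊗≫ (H.δ (ld X) ▷ X ⊗≫ ld X ◁ H.a X) ▷ X ⊗≫
          ld X ◁ (β_ (X ⊗ K) X).hom ⊗≫ ε_ X (ld X) ▷ (X ⊗ K) ⊗≫ 𝟙 (X ⊗ K) := by
        rw [← braiding_tensor_left, ← BraidedCategory.braiding_naturality_left]; monoidal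
    _ = 𝟙 X ⊗≫ ((η_ X (ld X) ≫ (β_ X (ld X)).hom) ≫ H.δ (ld X ⊗ X)) ▷ X ⊗≫
          ld X ◁ (β_ (X ⊗ K) X).hom ⊗≫ ε_ X (ld X) ▷ (X ⊗ K) ⊗≫ 𝟙 (X ⊗ K) := by
        rw [H.a_spec]; monoidal
    _ = 𝟙 X ⊗≫ H.δ (𝟙_ D) ▷ X ⊗≫ (η_ X (ld X) ≫ (β_ X (ld X)).hom) ▷ (K ⊗ X) ⊗≫
          ld X ◁ (β_ (X ⊗ K) X).hom ⊗≫ ε_ X (ld X) ▷ (X ⊗ K) ⊗≫ 𝟙 (X ⊗ K) := by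
        rw [H.nat]; monoidal
    _ = 𝟙 X ⊗≫ (𝟙_ D ◁ (H.u ▷ X) ≫ (η_ X (ld X) ≫ (β_ X (ld X)).hom) ▷ (K ⊗ X)) ⊗≫
          ld X ◁ (β_ (X ⊗ K) X).hom ⊗≫ ε_ X (ld X) ▷ (X ⊗ K) ⊗≫ 𝟙 (X ⊗ K) := by
        rw [H.u_spec]; monoidal
    _ = 𝟙 X ⊗≫ (η_ X (ld X) ≫ (β_ X (ld X)).hom) ▷ X ⊗≫ ld X ◁ ((X ◁ H.u) ▷ X ≫
          (β_ (X ⊗ K) X).hom) ⊗≫ ε_ X (ld X) ▷ (X ⊗ K) ⊗≫ 𝟙 (X ⊗ K) := by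
        rw [whisker_exchange]; monoidal
    _ = 𝟙 X ⊗≫ (η_ X (ld X) ≫ (β_ X (ld X)).hom) ▷ X ⊗≫ ld X ◁ (β_ X X).hom ⊗≫
          (((ld X ⊗ X) ◁ (X ◁ H.u)) ≫ ε_ X (ld X) ▷ (X ⊗ K)) ⊗≫ 𝟙 (X ⊗ K) := by
        rw [BraidedCategory.braiding_naturality_left, braiding_tensor_left,
          braiding_tensorUnit_left]; monoidal
    _ = 𝟙 X ⊗≫ η_ X (ld X) ▷ X ⊗≫ ((𝟙 (X ⊗ (ld X ⊗ X)) ⊗≫ (β_ X (ld X)).hom ▷ X ⊗≫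
          ld X ◁ (β_ X X).hom ⊗≫ 𝟙 ((ld X ⊗ X) ⊗ X)) ≫ ε_ X (ld X) ▷ X) ⊗≫ X ◁ H.u := by
        rw [whisker_exchange]; monoidal
    _ = 𝟙 X ⊗≫ (η_ X (ld X) ▷ X ⊗≫ X ◁ ε_ X (ld X)) ⊗≫ (β_ X (𝟙_ D)).hom ⊗≫ X ◁ H.u := by
        rw [← braiding_tensor_right, ← BraidedCategory.braiding_naturality_right]; monoidal
    _ = (ρ_ X).inv ≫ X ◁ H.u := by
        rw [ExactPairing.evaluation_coevaluation'', braiding_tensorUnit_right]; monoidal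
    _ = _ := by rw [← H.e_spec]; monoidal

/-- The Hopf monoid structure on the coend. -/
@[reducible]
def hopfObj : HopfObj K where
  one := H.u
  mul := H.μ
  one_mul := H.one_mul'
  mul_one := H.mul_one'
  mul_assoc := H.mul_assoc'
  counit := H.e
  comul := H.Δ
  counit_comul := H.counit_comul'
  comul_counit := H.comul_counit'
  comul_assoc := H.comul_assoc'
  mul_comul := H.mul_comul'
  one_comul := by
    rw [H.one_comul']; rfl
  mul_counit := by
    rw [H.mul_counit']; rfl
  one_counit := H.one_counit'
  antipode := H.S
  antipode_left := H.antipode_left'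
  antipode_right := H.antipode_right'

variable {ι : ∀ X : D, ld X ⊗ X ⟶ K}

lemma ι_eq (hι : H.δ = coaction ι) (X : D) :
    ι X = ld X ◁ H.δ X ⊗≫ ε_ X (ld X) ▷ K ⊗≫ 𝟙 K := by
  rw [hι, ← coev_ev_coaction]

lemma isCoendHopf (hι : H.δ = coaction ι) : letI := H.hopfObj; IsCoendHopf ι := by
  letI := H.hopfObj
  refine ⟨fun X => ?_, fun X => ?_, fun X Y => ?_, ?_⟩
  · change ι X ≫ H.Δ = _
    calc _ = ld X ◁ H.δ X ⊗≫ (ε_ X (ld X) ▷ K ≫ 𝟙_ D ◁ H.Δ) ⊗≫ 𝟙 (K ⊗ K) := by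
          rw [H.ι_eq hι]; monoidal
      _ = ld X ◁ (H.δ X ≫ X ◁ H.Δ) ⊗≫ ε_ X (ld X) ▷ (K ⊗ K) ⊗≫ 𝟙 (K ⊗ K) := by
          rw [← whisker_exchange]; monoidal
      _ = ld X ◁ H.δ X ⊗≫ (ld X ◁ H.δ X ⊗≫ ε_ X (ld X) ▷ K ⊗≫ 𝟙 K) ▷ K := by
          rw [H.Δ_spec]; monoidal
      _ = ld X ◁ coaction ι X ⊗≫ ι X ▷ K := by
          rw [← H.ι_eq hι, hι]
      _ = 𝟙 (ld X ⊗ X) ⊗≫ ld X ◁ (η_ X (ld X) ▷ X) ⊗≫ ((ld X ⊗ X) ◁ ι X ≫ ι X ▷ K) := by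
          unfold coaction; monoidal
      _ = _ := by rw [MonoidalCategory.tensorHom_def, whisker_exchange]
  · change ι X ≫ H.e = _
    calc _ = ld X ◁ H.δ X ⊗≫ (ε_ X (ld X) ▷ K ≫ 𝟙_ D ◁ H.e) ⊗≫ 𝟙 _ := by
          rw [H.ι_eq hι]; monoidal
      _ = ld X ◁ (H.δ X ≫ X ◁ H.e) ⊗≫ ε_ X (ld X) ⊗≫ 𝟙 _ := by
          rw [← whisker_exchange]; monoidal
      _ = _ := by rw [H.e_spec]; monoidal
  · change (ι X ⊗ₘ ι Y) ≫ H.μ = _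
    calc _ = (ld X ⊗ X) ◁ ι Y ⊗≫ ld X ◁ H.δ X ▷ K ⊗≫ (ε_ X (ld X) ▷ (K ⊗ K) ≫ 𝟙_ D ◁ H.μ) ⊗≫
          𝟙 K := by
          rw [MonoidalCategory.tensorHom_def', H.ι_eq hι X]; monoidal
      _ = (ld X ⊗ X) ◁ ι Y ⊗≫ ld X ◁ (H.δ X ▷ K ⊗≫ X ◁ H.μ) ⊗≫ ε_ X (ld X) ▷ K ⊗≫
          𝟙 K := by
          rw [← whisker_exchange]; monoidal
      _ = 𝟙 ((ld X ⊗ X) ⊗ (ld Y ⊗ Y)) ⊗≫ ld X ◁ (X ◁ ι Y ≫ (β_ X K).hom) ⊗≫ ld X ◁ H.a X ⊗≫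
          ε_ X (ld X) ▷ K ⊗≫ 𝟙 K := by
          rw [H.μ_spec]; monoidal
      _ = 𝟙 ((ld X ⊗ X) ⊗ (ld Y ⊗ Y)) ⊗≫ ld X ◁ (β_ X (ld Y ⊗ Y)).hom ⊗≫
          ld X ◁ (ld Y ◁ H.δ Y ▷ X ⊗≫ (ε_ Y (ld Y) ▷ (K ⊗ X) ≫ 𝟙_ D ◁ H.a X)) ⊗≫
          ε_ X (ld X) ▷ K ⊗≫ 𝟙 K := by
          rw [BraidedCategory.braiding_naturality_right, H.ι_eq hι Y]; monoidal
      _ = 𝟙 ((ld X ⊗ X) ⊗ (ld Y ⊗ Y)) ⊗≫ ld X ◁ (β_ X (ld Y ⊗ Y)).hom ⊗≫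
          ld X ◁ (ld Y ◁ (H.δ Y ▷ X ⊗≫ Y ◁ H.a X) ⊗≫ ε_ Y (ld Y) ▷ (X ⊗ K)) ⊗≫
          ε_ X (ld X) ▷ K ⊗≫ 𝟙 K := by
          rw [← whisker_exchange]; monoidal
      _ = 𝟙 ((ld X ⊗ X) ⊗ (ld Y ⊗ Y)) ⊗≫ ld X ◁ (β_ X (ld Y ⊗ Y)).hom ⊗≫
          (ld X ⊗ ld Y) ◁ H.δ (Y ⊗ X) ⊗≫ (𝟙 ((ld X ⊗ ld Y) ⊗ (Y ⊗ X)) ⊗≫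
            ld X ◁ ε_ Y (ld Y) ▷ X ⊗≫ ε_ X (ld X)) ▷ K ⊗≫ 𝟙 K := by
          rw [H.a_spec]; monoidal
      _ = 𝟙 ((ld X ⊗ X) ⊗ (ld Y ⊗ Y)) ⊗≫ ld X ◁ (β_ X (ld Y ⊗ Y)).hom ⊗≫
          ((ld X ⊗ ld Y) ◁ H.δ (Y ⊗ X) ≫ ldTensor Y X ▷ ((Y ⊗ X) ⊗ K)) ⊗≫
          ε_ (Y ⊗ X) (ld (Y ⊗ X)) ▷ K ⊗≫ 𝟙 K := by
          rw [← ldTensor_eval]; monoidal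
      _ = 𝟙 ((ld X ⊗ X) ⊗ (ld Y ⊗ Y)) ⊗≫ ld X ◁ (β_ X (ld Y ⊗ Y)).hom ⊗≫
          ldTensor Y X ▷ (Y ⊗ X) ≫ (ld (Y ⊗ X) ◁ H.δ (Y ⊗ X) ⊗≫
          ε_ (Y ⊗ X) (ld (Y ⊗ X)) ▷ K ⊗≫ 𝟙 K) := by
          rw [whisker_exchange]; monoidal
      _ = _ := by rw [← H.ι_eq hι (Y ⊗ X)]
  · change H.u = _
    have h : ldUnit ▷ 𝟙_ D ≫ ε_ (𝟙_ D) (ld (𝟙_ D)) = (ρ_ (𝟙_ D)).hom := by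
      unfold ldUnit
      rw [dualMap_eval, whiskerLeft_id, Category.id_comp]; rfl
    symm
    calc _ = 𝟙 (𝟙_ D) ⊗≫ (ldUnit ▷ 𝟙_ D ≫ ld (𝟙_ D) ◁ H.δ (𝟙_ D)) ⊗≫
          ε_ (𝟙_ D) (ld (𝟙_ D)) ▷ K ⊗≫ 𝟙 K := by
          rw [H.ι_eq hι]; monoidal
      _ = 𝟙 (𝟙_ D) ⊗≫ 𝟙_ D ◁ H.δ (𝟙_ D) ⊗≫ (ldUnit ▷ 𝟙_ D ≫ ε_ (𝟙_ D) (ld (𝟙_ D))) ▷ K ⊗≫ 𝟙 K := by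
          rw [← whisker_exchange]; monoidal
      _ = _ := by rw [h, H.u_spec]; monoidal

/-- Descent along `W ⊗ ι`. -/
lemma descLeft (hι : H.δ = coaction ι) {W Z : D} (f : ∀ Y, W ⊗ (ld Y ⊗ Y) ⟶ Z)
    (hf : ∀ {X Y : D} (g : X ⟶ Y),
      W ◁ (dualMap (ld X) (ld Y) g ▷ X) ≫ f X = W ◁ (ld Y ◁ g) ≫ f Y) :
    ∃ ω : W ⊗ K ⟶ Z, ∀ Y, W ◁ ι Y ≫ ω = f Y := by
  -- The braiding carries `W` to the right of the coend variable, where descent with a right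
  -- parameter is available; it is undone in the final `ω`.
  let s : ∀ Y, Y ⊗ W ⟶ Y ⊗ Z := fun Y => 𝟙 _ ⊗≫ η_ Y (ld Y) ▷ (Y ⊗ W) ⊗≫
    Y ◁ ((β_ W (ld Y ⊗ Y)).inv ≫ f Y)
  have hs {X Y : D} (g : X ⟶ Y) : g ▷ W ≫ s Y = s X ≫ g ▷ Z := by
    let g' := dualMap (ld X) (ld Y) g
    calc _ = 𝟙 _ ⊗≫ (𝟙_ D ◁ (g ▷ W) ≫ η_ Y (ld Y) ▷ (Y ⊗ W)) ⊗≫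
          Y ◁ ((β_ W (ld Y ⊗ Y)).inv ≫ f Y) := by monoidal
      _ = 𝟙 _ ⊗≫ η_ Y (ld Y) ▷ (X ⊗ W) ⊗≫ Y ◁ ((ld Y ◁ g) ▷ W ≫ (β_ W (ld Y ⊗ Y)).inv ≫ f Y) := by
          rw [whisker_exchange]; monoidal
      _ = 𝟙 _ ⊗≫ (η_ Y (ld Y) ≫ Y ◁ g') ▷ (X ⊗ W) ⊗≫ Y ◁ ((β_ W (ld X ⊗ X)).inv ≫ f X) := by
          rw [BraidedCategory.braiding_inv_naturality_left_assoc, ← hf,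
            ← BraidedCategory.braiding_inv_naturality_left_assoc]; monoidal
      _ = 𝟙 _ ⊗≫ η_ X (ld X) ▷ (X ⊗ W) ⊗≫ (g ▷ ((ld X ⊗ X) ⊗ W) ≫
            Y ◁ ((β_ W (ld X ⊗ X)).inv ≫ f X)) := by
          rw [coeval_dualMap]; monoidal
      _ = _ := by rw [← whisker_exchange]; monoidal
  obtain ⟨ω, hω⟩ := H.univ.descRight (W := W) (W' := ld W) (Z := Z) (fun Y => s Y) hs
  replace hω (Y : D) : H.δ Y ▷ W ⊗≫ Y ◁ ω = s Y := hω Y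
  refine ⟨(β_ W K).hom ≫ ω, fun Y => ?_⟩
  rw [BraidedCategory.braiding_naturality_right_assoc]
  calc _ = (β_ W (ld Y ⊗ Y)).hom ⊗≫ ld Y ◁ H.δ Y ▷ W ⊗≫ (ε_ Y (ld Y) ▷ (K ⊗ W) ≫ 𝟙_ D ◁ ω) ⊗≫
        𝟙 Z := by rw [H.ι_eq hι]; monoidal
    _ = (β_ W (ld Y ⊗ Y)).hom ⊗≫ ld Y ◁ (H.δ Y ▷ W ⊗≫ Y ◁ ω) ⊗≫ ε_ Y (ld Y) ▷ Z ⊗≫ 𝟙 Z := by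
        rw [← whisker_exchange]; monoidal
    _ = (β_ W (ld Y ⊗ Y)).hom ⊗≫ ld Y ◁ η_ Y (ld Y) ▷ (Y ⊗ W) ⊗≫
        ((ld Y ⊗ Y) ◁ ((β_ W (ld Y ⊗ Y)).inv ≫ f Y) ≫ ε_ Y (ld Y) ▷ Z) ⊗≫ 𝟙 Z := by
        rw [hω]; dsimp only [s]; monoidal
    _ = (β_ W (ld Y ⊗ Y)).hom ⊗≫ (ld Y ◁ η_ Y (ld Y) ⊗≫ ε_ Y (ld Y) ▷ ld Y) ▷ (Y ⊗ W) ⊗≫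
        ((β_ W (ld Y ⊗ Y)).inv ≫ f Y) := by
        rw [whisker_exchange]; monoidal
    _ = ((β_ W (ld Y ⊗ Y)).hom ≫ (β_ W (ld Y ⊗ Y)).inv) ≫ f Y := by
        rw [ExactPairing.coevaluation_evaluation'']; monoidal
    _ = _ := by rw [Iso.hom_inv_id, Category.id_comp]

/-- The double braiding of `X` with `Y` is natural in `X`, hence comes from an action `b Y` of `K`
on `Y`. That action is natural in `Y`, so `b (ld Y)` followed by evaluation is dinatural in `Y` and
descends in the second variable as well. -/
lemma exists_pairing (hι : H.δ = coaction ι) : ∃ ω : K ⊗ K ⟶ 𝟙_ D, IsCoendPairing ι ω := by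
  obtain ⟨b, hb⟩ : ∃ b : ∀ Y : D, K ⊗ Y ⟶ Y, ∀ Y X, H.δ X ▷ Y ⊗≫ X ◁ b Y =
      (β_ X Y).hom ≫ (β_ Y X).hom := by
    have := fun Y : D => H.univ.descRight (W := Y) (W' := ld Y) (Z := Y)
      (fun X => (β_ X Y).hom ≫ (β_ Y X).hom) (by
        intro X X' f
        change f ▷ Y ≫ (β_ X' Y).hom ≫ (β_ Y X').hom = ((β_ X Y).hom ≫ (β_ Y X).hom) ≫ f ▷ Y
        rw [BraidedCategory.braiding_naturality_left_assoc,
          BraidedCategory.braiding_naturality_right, Category.assoc])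
    choose b hb using this
    exact ⟨b, hb⟩
  have bn {X Y : D} (g : X ⟶ Y) : K ◁ g ≫ b Y = b X ≫ g := by
    apply H.extRight
    intro Z
    calc _ = (H.δ Z ▷ X ≫ (Z ⊗ K) ◁ g) ⊗≫ Z ◁ b Y := by monoidal
      _ = Z ◁ g ≫ (H.δ Z ▷ Y ⊗≫ Z ◁ b Y) := by rw [← whisker_exchange]; monoidal
      _ = (H.δ Z ▷ X ⊗≫ Z ◁ b X) ≫ Z ◁ g := by
          rw [hb, hb, BraidedCategory.braiding_naturality_right_assoc,
            BraidedCategory.braiding_naturality_left, Category.assoc]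
      _ = _ := by monoidal
  obtain ⟨ω, hω⟩ := H.descLeft hι (W := K) (Z := 𝟙_ D)
    (fun Y => (α_ _ _ _).inv ≫ b (ld Y) ▷ Y ≫ ε_ Y (ld Y)) (by
      intro X Y g
      calc _ = (α_ _ _ _).inv ≫ (K ◁ dualMap (ld X) (ld Y) g ≫ b (ld X)) ▷ X ≫ ε_ X (ld X) := by
            monoidal
        _ = (α_ _ _ _).inv ≫ b (ld Y) ▷ X ≫ (dualMap (ld X) (ld Y) g ▷ X ≫ ε_ X (ld X)) := by
            rw [bn]; monoidal
        _ = (α_ _ _ _).inv ≫ (b (ld Y) ▷ X ≫ ld Y ◁ g) ≫ ε_ Y (ld Y) := by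
            rw [dualMap_eval]; monoidal
        _ = _ := by rw [← whisker_exchange]; monoidal)
  refine ⟨ω, fun X Y => ?_⟩
  calc _ = ι X ▷ (ld Y ⊗ Y) ≫ (K ◁ ι Y ≫ ω) := by
        rw [MonoidalCategory.tensorHom_def]; monoidal
    _ = 𝟙 _ ⊗≫ ld X ◁ H.δ X ▷ (ld Y ⊗ Y) ⊗≫ (ε_ X (ld X) ▷ ((K ⊗ ld Y) ⊗ Y) ≫
        𝟙_ D ◁ (b (ld Y) ▷ Y ≫ ε_ Y (ld Y))) ⊗≫ 𝟙 _ := by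
        rw [hω, H.ι_eq hι]; monoidal
    _ = 𝟙 _ ⊗≫ ld X ◁ ((H.δ X ▷ ld Y ⊗≫ X ◁ b (ld Y)) ▷ Y) ⊗≫ ((ld X ⊗ X) ◁ ε_ Y (ld Y) ≫
        ε_ X (ld X) ▷ 𝟙_ D) ⊗≫ 𝟙 _ := by
        rw [← whisker_exchange]; monoidal
    _ = _ := by
        rw [hb, whisker_exchange, MonoidalCategory.tensorHom_def]; monoidal

/-- A natural endomorphism of the identity functor is a coaction with values in the unit object. -/
lemma exists_form (hι : H.δ = coaction ι) (t : ∀ X : D, X ⟶ X)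
    (ht : ∀ {X Y : D} (f : X ⟶ Y), f ≫ t Y = t X ≫ f) : ∃ θ : K ⟶ 𝟙_ D, IsFormOf ι t θ := by
  obtain ⟨θ, hθ⟩ := H.univ.desc (𝟙_ D) (fun X => t X ≫ (ρ_ X).inv) (by
    intro X Y f
    change f ≫ t Y ≫ (ρ_ Y).inv = (t X ≫ (ρ_ X).inv) ≫ f ▷ 𝟙_ D
    rw [← Category.assoc, ht]; simp)
  refine ⟨θ, fun X => ?_⟩
  have h : H.δ X ≫ X ◁ θ = t X ≫ (ρ_ X).inv := hθ X
  rw [← hι, reassoc_of% h, Iso.inv_hom_id, Category.comp_id]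

end CoendData
end Braided
end CenterCoend


set_option linter.unusedSectionVars false

namespace CenterCoend
open Limits

/-! ### Dualization is full and faithful -/

section RigidExtra
variable {D : Type u} [Category.{v} D] [MonoidalCategory.{v} D]

/-- Dualization is full. -/
lemma exists_dualMap_eq {X Y : D} (X' Y' : D) [ExactPairing X X'] [ExactPairing Y Y']
    (f : Y' ⟶ X') : ∃ g : X ⟶ Y, dualMap X' Y' g = f := by
  refine ⟨𝟙 X ⊗≫ η_ Y Y' ▷ X ⊗≫ Y ◁ (f ▷ X ≫ ε_ X X') ⊗≫ 𝟙 Y, ?_⟩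
  symm
  apply dualMap_unique
  symm
  calc _ = 𝟙 (Y' ⊗ X) ⊗≫ Y' ◁ η_ Y Y' ▷ X ⊗≫ ((Y' ⊗ Y) ◁ (f ▷ X ≫ ε_ X X') ≫
        ε_ Y Y' ▷ 𝟙_ D) ⊗≫ 𝟙 _ := by monoidal
    _ = 𝟙 (Y' ⊗ X) ⊗≫ (Y' ◁ η_ Y Y' ⊗≫ ε_ Y Y' ▷ Y') ▷ X ⊗≫ (f ▷ X ≫ ε_ X X') := by
        rw [whisker_exchange]; monoidal
    _ = _ := by rw [ExactPairing.coevaluation_evaluation'']; monoidal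

/-- A morphism is recovered from its dual by rotating back; despite the name, a single dualization
is involved. -/
lemma dualMap_dualMap_injective {X Y : D} (X' Y' : D) [ExactPairing X X'] [ExactPairing Y Y']
    {f g : X ⟶ Y} (h : dualMap X' Y' f = dualMap X' Y' g) : f = g := by
  have e (f : X ⟶ Y) : f = 𝟙 X ⊗≫ η_ Y Y' ▷ X ⊗≫ Y ◁ (dualMap X' Y' f ▷ X ≫ ε_ X X') ⊗≫ 𝟙 Y := by
    symm
    calc _ = 𝟙 X ⊗≫ (η_ Y Y' ▷ X ≫ (Y ⊗ Y') ◁ f) ⊗≫ Y ◁ ε_ Y Y' ⊗≫ 𝟙 Y := by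
          rw [dualMap_eval]; monoidal
      _ = f ⊗≫ (η_ Y Y' ▷ Y ⊗≫ Y ◁ ε_ Y Y') ⊗≫ 𝟙 Y := by rw [← whisker_exchange]; monoidal
      _ = _ := by rw [ExactPairing.evaluation_coevaluation'']; monoidal
  rw [e f, e g, h]

end RigidExtra

/-- A map of two variables that is bilinear over `k`. -/
structure IsBilin (k : Type*) [CommRing k] {M N A : Type*} [AddCommGroup M] [AddCommGroup N]
    [AddCommGroup A] [Module k M] [Module k N] [Module k A] (G : M → N → A) : Prop where
  add_left : ∀ x y z, G (x + y) z = G x z + G y z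
  add_right : ∀ x y z, G x (y + z) = G x y + G x z
  smul_left : ∀ (a : k) x y, G (a • x) y = a • G x y
  smul_right : ∀ (a : k) x y, G x (a • y) = a • G x y

namespace IsBilin
variable {k : Type*} [CommRing k] {M N A : Type*} [AddCommGroup M] [AddCommGroup N]
    [AddCommGroup A] [Module k M] [Module k N] [Module k A] {G : M → N → A}

lemma sum_left (h : IsBilin k G) {J : Type*} (s : Finset J) (f : J → M) (y : N) :
    G (∑ j ∈ s, f j) y = ∑ j ∈ s, G (f j) y :=
  map_sum (AddMonoidHom.mk' (fun x => G x y) (fun a b => h.add_left a b y)) f s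

lemma sum_right (h : IsBilin k G) {J : Type*} (s : Finset J) (x : M) (f : J → N) :
    G x (∑ j ∈ s, f j) = ∑ j ∈ s, G x (f j) :=
  map_sum (AddMonoidHom.mk' (fun y => G x y) (fun a b => h.add_right x a b)) f s

lemma zero_right (h : IsBilin k G) (x : M) : G x 0 = 0 := by
  have := h.smul_right 0 x 0
  simpa using this

end IsBilin

/-! ### Decompositions in a fusion category and the duals of its simple objects -/

section Fusion
variable {k : Type w'} [CommRing k] {C : Type u} [Category.{v} C] [Preadditive C]
    [Linear k C] [MonoidalCategory.{v} C] [MonoidalPreadditive C] [MonoidalLinear k C]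
    [RigidCategory C] [HasFiniteBiproducts C] {I : Type w} [Fintype I] {V : I → C}

lemma IsFusion.exists_smul (hV : IsFusion k V) {i : I} (f : V i ⟶ V i) :
    ∃ a : k, f = a • 𝟙 (V i) := by
  obtain ⟨a, ha⟩ := (hV.scalar i).2 f
  exact ⟨a, ha.symm⟩

lemma IsFusion.smul_eq_zero (hV : IsFusion k V) {i : I} {a : k} (h : a • 𝟙 (V i) = 0) : a = 0 :=
  (hV.scalar i).1 (by simpa using h)

/-- The tensor `∑ q ⊗ p` of a decomposition is dinatural. -/
lemma IsFusion.exchange (hV : IsFusion k V) {X Y : C} (f : X ⟶ Y) (d : Decomp V X)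
    (d' : Decomp V Y) (i : I) {A : Type*} [AddCommGroup A] [Module k A]
    {G : (V i ⟶ Y) → (X ⟶ V i) → A} (hG : IsBilin k G) :
    ∑ α, G (d.q i α ≫ f) (d.p i α) = ∑ β, G (d'.q i β) (f ≫ d'.p i β) := by
  -- The block of `f` at the label `i` is a matrix of scalars `c`, and blocks between different
  -- labels vanish. The same matrix expands `q ≫ f` and `f ≫ p`, so bilinearity moves it across `G`.
  choose c hc using fun α β => hV.exists_smul (d.q i α ≫ f ≫ d'.p i β)
  have h1 (α) : d.q i α ≫ f = ∑ β, c α β • d'.q i β := by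
    calc d.q i α ≫ f = d.q i α ≫ f ≫ ∑ j, ∑ β, d'.p j β ≫ d'.q j β := by
          rw [d'.sum_p_q, Category.comp_id]
      _ = ∑ j, ∑ β, (d.q i α ≫ f ≫ d'.p j β) ≫ d'.q j β := by
          simp only [Preadditive.comp_sum, Category.assoc]
      _ = ∑ β, (d.q i α ≫ f ≫ d'.p i β) ≫ d'.q i β := by
          apply Finset.sum_eq_single i
          · intro j _ hj
            apply Finset.sum_eq_zero
            intro β _
            rw [hV.hom_ne i j hj.symm (d.q i α ≫ f ≫ d'.p j β), zero_comp]
          · simp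
      _ = _ := by simp [hc]
  have h2 (β) : f ≫ d'.p i β = ∑ α, c α β • d.p i α := by
    calc f ≫ d'.p i β = (∑ j, ∑ α, d.p j α ≫ d.q j α) ≫ f ≫ d'.p i β := by
          rw [d.sum_p_q, Category.id_comp]
      _ = ∑ j, ∑ α, d.p j α ≫ (d.q j α ≫ f ≫ d'.p i β) := by
          simp only [Preadditive.sum_comp, Category.assoc]
      _ = ∑ α, d.p i α ≫ (d.q i α ≫ f ≫ d'.p i β) := by
          apply Finset.sum_eq_single i
          · intro j _ hj
            apply Finset.sum_eq_zero
            intro α _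
            rw [hV.hom_ne j i hj (d.q j α ≫ f ≫ d'.p i β), comp_zero]
          · simp
      _ = _ := by simp [hc]
  simp only [h1, h2, hG.sum_left, hG.sum_right, hG.smul_left, hG.smul_right]
  exact Finset.sum_comm

/-- Each `q` is a scalar and moves to the other argument, where the sum becomes `∑ p ≫ q = 𝟙`. The
number of indices is never computed, so the zero ring needs no separate treatment. -/
lemma IsFusion.sum_self (hV : IsFusion k V) (i : I) (d : Decomp V (V i)) {A : Type*}
    [AddCommGroup A] [Module k A] {G : (V i ⟶ V i) → (V i ⟶ V i) → A} (hG : IsBilin k G) :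
    ∑ α, G (d.q i α) (d.p i α) = G (𝟙 _) (𝟙 _) := by
  have h : 𝟙 (V i) = ∑ α, d.p i α ≫ d.q i α := by
    rw [← d.sum_p_q]
    symm
    symm
    apply Finset.sum_eq_single i
    · intro j _ hj
      apply Finset.sum_eq_zero
      intro α _
      rw [hV.hom_ne i j hj.symm (d.p j α), zero_comp]
    · simp
  choose c hc using fun α => hV.exists_smul (d.q i α)
  calc _ = ∑ α, G (𝟙 _) (d.p i α ≫ d.q i α) := by
        apply Finset.sum_congr rfl
        intro α _
        rw [hc α, hG.smul_left, ← hG.smul_right]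
        simp
    _ = _ := by rw [← hG.sum_right, ← h]

lemma IsFusion.sum_ne (hV : IsFusion k V) {i j : I} (hij : j ≠ i) (d : Decomp V (V i)) {A : Type*}
    [AddCommGroup A] [Module k A] {G : (V j ⟶ V i) → (V i ⟶ V j) → A} (hG : IsBilin k G) :
    ∑ α, G (d.q j α) (d.p j α) = 0 := by
  apply Finset.sum_eq_zero
  intro α _
  rw [hV.hom_ne i j hij.symm (d.p j α), hG.zero_right]

open Classical in
lemma IsFusion.nonempty_decomp (hV : IsFusion k V) (X : C) : Nonempty (Decomp V X) := by
  obtain ⟨n, s, ⟨e⟩⟩ := hV.sum X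
  -- The multiplicity of `i` is the number of positions in the given direct sum that carry the label
  -- `i`; `E i` numbers these positions.
  let E (i : I) := (Fintype.equivFin {t : Fin n // s t = i}).symm
  have hsum (i : I) (g : {t : Fin n // s t = i} → (X ⟶ X)) :
      ∑ α, g (E i α) = ∑ t, g t := Equiv.sum_comp (E i) g
  refine ⟨⟨fun i => Fintype.card {t : Fin n // s t = i},
    fun i α => e.hom ≫ biproduct.π _ (E i α).1 ≫ eqToHom (by rw [(E i α).2]),
    fun i α => eqToHom (by rw [(E i α).2]) ≫ biproduct.ι (fun t => V (s t)) (E i α).1 ≫ e.inv,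
    ?_, ?_, ?_⟩⟩
  · intro i α β
    split_ifs with h
    · subst h; simp
    · have h' : (E i α).1 ≠ (E i β).1 := fun h' => h ((E i).injective (Subtype.ext h'))
      simp [biproduct.ι_π_ne_assoc _ h']
  · intro i j hij α β
    exact hV.hom_ne i j hij _
  · have (i : I) : ∑ α, (e.hom ≫ biproduct.π _ (E i α).1 ≫ eqToHom (by rw [(E i α).2])) ≫
        (eqToHom (by rw [(E i α).2]) ≫ biproduct.ι (fun t => V (s t)) (E i α).1 ≫ e.inv) =
        ∑ t : {t : Fin n // s t = i}, e.hom ≫ (biproduct.π _ t.1 ≫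
          biproduct.ι (fun t => V (s t)) t.1) ≫ e.inv := by
      rw [← hsum i (fun t => e.hom ≫ (biproduct.π _ t.1 ≫
          biproduct.ι (fun t => V (s t)) t.1) ≫ e.inv)]
      apply Finset.sum_congr rfl
      intro α _
      simp
    rw [Finset.sum_congr rfl fun i _ => this i]
    calc _ = ∑ i, ∑ t ∈ Finset.univ.filter (fun t => s t = i), e.hom ≫ (biproduct.π _ t ≫
          biproduct.ι (fun t => V (s t)) t) ≫ e.inv := by
          apply Finset.sum_congr rfl
          intro i _
          symm
          apply Finset.sum_subtype
          simp
      _ = ∑ t, e.hom ≫ (biproduct.π _ t ≫ biproduct.ι (fun t => V (s t)) t) ≫ e.inv :=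
          Finset.sum_fiberwise _ _ _
      _ = _ := by
          rw [← Preadditive.comp_sum, ← Preadditive.sum_comp, biproduct.total]; simp

/-- Since dualization is full and linear, endomorphisms of `ld (V i)` are scalars. A decomposition
of this nonzero object contains some `V j`; the idempotent `p ≫ q` is a scalar, and `q ≫ p = 𝟙`
forces that scalar to be `1`. Over the zero ring all objects are zero. -/
lemma IsFusion.exists_ld_iso (hV : IsFusion k V) (i : I) : ∃ j, Nonempty (V j ≅ ld (V i)) := by
  rcases subsingleton_or_nontrivial k with hk | hk
  · have z (X : C) : 𝟙 X = 0 := by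
      rw [← one_smul k (𝟙 X), Subsingleton.elim (1 : k) 0, zero_smul]
    exact ⟨i, ⟨⟨0, 0, by rw [z, zero_comp], by rw [z, zero_comp]⟩⟩⟩
  · have sc (f : ld (V i) ⟶ ld (V i)) : ∃ a : k, f = a • 𝟙 _ := by
      obtain ⟨g, rfl⟩ := exists_dualMap_eq (X := V i) (Y := V i) (ld (V i)) (ld (V i)) f
      obtain ⟨a, rfl⟩ := hV.exists_smul g
      exact ⟨a, by rw [dualMap_smul, dualMap_id]⟩
    have nz : 𝟙 (ld (V i)) ≠ 0 := by
      intro h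
      rw [← dualMap_id (X := V i) (ld (V i)),
        ← dualMap_zero (X := V i) (Y := V i) (ld (V i)) (ld (V i))] at h
      have := dualMap_dualMap_injective (X := V i) (Y := V i) (ld (V i)) (ld (V i)) h
      exact one_ne_zero (hV.smul_eq_zero (i := i) (a := (1 : k)) (by simpa using this))
    obtain ⟨d⟩ := hV.nonempty_decomp (ld (V i))
    have : ∃ j, ∃ α : Fin (d.N j), True := by
      by_contra hcon
      push Not at hcon
      apply nz
      rw [← d.sum_p_q]
      exact Finset.sum_eq_zero fun j _ => Finset.sum_eq_zero fun α _ => (hcon j α).elim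
    obtain ⟨j, α, -⟩ := this
    refine ⟨j, ⟨⟨d.q j α, d.p j α, by simpa using d.q_p j α α, ?_⟩⟩⟩
    obtain ⟨a, ha⟩ := sc (d.p j α ≫ d.q j α)
    have h1 : d.q j α ≫ d.p j α = 𝟙 _ := by simpa using d.q_p j α α
    have h2 : a • 𝟙 (V j) = 𝟙 (V j) := by
      calc a • 𝟙 (V j) = d.q j α ≫ (a • 𝟙 _) ≫ d.p j α := by simp [h1]
        _ = _ := by rw [← ha]; simp [h1]
    have h3 : a = 1 := (hV.scalar j).1 (by simpa using h2)
    rw [ha, h3, one_smul]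

lemma IsFusion.nonempty_choices (hV : IsFusion k V) : Nonempty (FusionChoices V) := by
  obtain ⟨o, ⟨uo⟩⟩ := hV.unit
  choose dual hd using hV.exists_ld_iso
  exact ⟨⟨o, uo, dual, fun i => (hd i).some, fun X => (hV.nonempty_decomp X).some⟩⟩

/-- The label of the dual determines the label. -/
lemma IsFusion.dual_injective [Nontrivial k] (hV : IsFusion k V) (F : FusionChoices V) :
    Function.Injective F.dual := by
  intro i j hij
  by_contra hne
  let e : ld (V j) ⟶ ld (V i) := (F.dualIso j).inv ≫ eqToHom (by rw [hij]) ≫ (F.dualIso i).hom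
  let e' : ld (V i) ⟶ ld (V j) := (F.dualIso i).inv ≫ eqToHom (by rw [hij]) ≫ (F.dualIso j).hom
  have he : e ≫ e' = 𝟙 _ := by simp [e, e']
  obtain ⟨g, hg⟩ := exists_dualMap_eq (X := V i) (Y := V j) (ld (V i)) (ld (V j)) e
  rw [hV.hom_ne i j hne g, dualMap_zero] at hg
  rw [← hg, zero_comp, ← dualMap_id (X := V j) (ld (V j)),
    ← dualMap_zero (X := V j) (Y := V j) (ld (V j)) (ld (V j))] at he
  have := dualMap_dualMap_injective (X := V j) (Y := V j) (ld (V j)) (ld (V j)) he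
  exact one_ne_zero (hV.smul_eq_zero (i := j) (a := (1 : k)) (by simpa using this.symm))

end Fusion

/-- The projections and inclusions of a biproduct sum up to the identity. -/
lemma sum_π_ι {C : Type u} [Category.{v} C] [Preadditive C] {J : Type w} [Fintype J] (f : J → C)
    [HasBiproduct f] : ∑ j, biproduct.π f j ≫ biproduct.ι f j = 𝟙 (⨁ f) := by
  classical
  apply biproduct.hom_ext'
  intro i
  rw [Preadditive.comp_sum, Finset.sum_eq_single i]
  · simp
  · intro j _ hj
    rw [biproduct.ι_π_ne_assoc _ hj.symm, zero_comp]
  · simp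

/-! ### The finite coend of `W' ⊗ X ⊗ W` -/

section FreeObject
variable {k : Type w'} [CommRing k] {C : Type u} [Category.{v} C] [Preadditive C]
    [Linear k C] [MonoidalCategory.{v} C] [MonoidalPreadditive C] [MonoidalLinear k C]
    [RigidCategory C] [HasFiniteBiproducts C] {I : Type w} [Fintype I] {V : I → C}

variable (V) in
/-- The object underlying the free object of the center on `X`. -/
noncomputable abbrev freeObj (X : C) : C := ⨁ fun i => ld (V i) ⊗ (X ⊗ V i)

variable (F : FusionChoices V)

/-- The universal dinatural transformation of `freeObj V X`. -/
noncomputable def freeIn (X W W' : C) [ExactPairing W W'] : W' ⊗ (X ⊗ W) ⟶ freeObj V X :=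
  ∑ i, ∑ α, (dualMap (ld (V i)) W' ((F.dec W).q i α) ⊗ₘ X ◁ (F.dec W).p i α) ≫
    biproduct.ι (fun i => ld (V i) ⊗ (X ⊗ V i)) i

lemma isBilin_freeIn (X W W' Y : C) [ExactPairing W W'] (i : I) :
    IsBilin k (fun (x : V i ⟶ W) (y : Y ⟶ V i) => (dualMap (ld (V i)) W' x ⊗ₘ X ◁ y) ≫
      biproduct.ι (fun i => ld (V i) ⊗ (X ⊗ V i)) i) where
  add_left x y z := by
    simp only [dualMap_add, MonoidalPreadditive.add_tensor, Preadditive.add_comp]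
  add_right x y z := by
    simp only [MonoidalPreadditive.whiskerLeft_add, MonoidalPreadditive.tensor_add,
      Preadditive.add_comp]
  smul_left a x y := by
    simp only [dualMap_smul, MonoidalCategory.tensorHom_def, MonoidalLinear.smul_whiskerRight,
      Linear.smul_comp]
  smul_right a x y := by
    simp only [MonoidalLinear.whiskerLeft_smul, MonoidalCategory.tensorHom_def, Linear.smul_comp,
      Linear.comp_smul]

/-- This is `IsFusion.exchange` for the tensor of dualized inclusions and projections. Stated for
arbitrary dual pairs, it also compares different duals of one object. -/
lemma freeIn_dinat (hV : IsFusion k V) (X : C) {W W₁ : C} (W' W₁' : C) [ExactPairing W W']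
    [ExactPairing W₁ W₁'] (f : W ⟶ W₁) :
    dualMap W' W₁' f ▷ (X ⊗ W) ≫ freeIn F X W W' = W₁' ◁ (X ◁ f) ≫ freeIn F X W₁ W₁' := by
  simp only [freeIn, Preadditive.comp_sum]
  apply Finset.sum_congr rfl
  intro i _
  have := hV.exchange f (F.dec W) (F.dec W₁) i (isBilin_freeIn (k := k) X W₁ W₁' W i)
  simp only [dualMap_comp (ld (V i)) W' W₁', MonoidalCategory.whiskerLeft_comp] at this
  refine Eq.trans (Finset.sum_congr rfl fun α _ => ?_)
    (this.trans (Finset.sum_congr rfl fun α _ => ?_))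
  · simp [MonoidalCategory.tensorHom_def]
  · simp [MonoidalCategory.tensorHom_def']

lemma freeIn_self (hV : IsFusion k V) (X : C) (i : I) :
    freeIn F X (V i) (ld (V i)) = biproduct.ι (fun i => ld (V i) ⊗ (X ⊗ V i)) i := by
  unfold freeIn
  rw [Finset.sum_eq_single i]
  · rw [hV.sum_self i (F.dec (V i)) (isBilin_freeIn (k := k) X (V i) (ld (V i)) (V i) i),
      dualMap_id]
    simp
  · intro j _ hj
    exact hV.sum_ne hj (F.dec (V i)) (isBilin_freeIn (k := k) X (V i) (ld (V i)) (V i) j)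
  · simp

lemma free_ext (hV : IsFusion k V) (X : C) {Y Z : C} {a b : freeObj V X ⊗ Y ⟶ Z}
    (h : ∀ i, freeIn F X (V i) (ld (V i)) ▷ Y ≫ a = freeIn F X (V i) (ld (V i)) ▷ Y ≫ b) :
    a = b := by
  have e (a : freeObj V X ⊗ Y ⟶ Z) : a = ∑ i, biproduct.π (fun i => ld (V i) ⊗ (X ⊗ V i)) i ▷ Y ≫
      freeIn F X (V i) (ld (V i)) ▷ Y ≫ a := by
    simp only [freeIn_self F hV, ← comp_whiskerRight_assoc]
    rw [← Preadditive.sum_comp, ← sum_whiskerRight, sum_π_ι, id_whiskerRight,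
      Category.id_comp]
  rw [e a, e b]
  simp only [h]

end FreeObject
end CenterCoend


set_option linter.unusedSectionVars false

namespace CenterCoend
open Limits

/-! ### Half braidings as actions of all objects -/

section Action
variable {C : Type u} [Category.{v} C] [MonoidalCategory.{v} C]

/-- A multiplicative family on a rigid category is a half braiding. -/
def LaxHB.toHalfBraiding [LeftRigidCategory C] {N : C} (h : LaxHB N) : HalfBraiding N where
  β Y := ⟨h.f Y, laxInv h Y, lax_hom_inv h Y, lax_inv_hom h Y⟩
  monoidal Y Y' := by
    change h.f _ = _ ≫ h.f _ ▷ _ ≫ _ ≫ _ ◁ h.f _ ≫ _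
    rw [h.mon]; monoidal
  naturality g := h.nat g

/-- The action `Y' ⊗ M ⊗ Y ⟶ M` for a dual `Y'` of `Y`. -/
def act (M : Center C) (Y Y' : C) [ExactPairing Y Y'] : Y' ⊗ (M.1 ⊗ Y) ⟶ M.1 :=
  Y' ◁ (M.2.β Y).hom ⊗≫ ε_ Y Y' ▷ M.1 ⊗≫ 𝟙 M.1

lemma act_dinat (M : Center C) {Y Z : C} (Y' Z' : C) [ExactPairing Y Y'] [ExactPairing Z Z']
    (f : Y ⟶ Z) : dualMap Y' Z' f ▷ (M.1 ⊗ Y) ≫ act M Y Y' = Z' ◁ (M.1 ◁ f) ≫ act M Z Z' := by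
  unfold act
  calc _ = (dualMap Y' Z' f ▷ (M.1 ⊗ Y) ≫ Y' ◁ (M.2.β Y).hom) ⊗≫ ε_ Y Y' ▷ M.1 ⊗≫ 𝟙 M.1 := by
        monoidal
    _ = Z' ◁ (M.2.β Y).hom ⊗≫ (dualMap Y' Z' f ▷ Y ≫ ε_ Y Y') ▷ M.1 ⊗≫ 𝟙 M.1 := by
        rw [← whisker_exchange]; monoidal
    _ = Z' ◁ ((M.2.β Y).hom ≫ f ▷ M.1) ⊗≫ ε_ Z Z' ▷ M.1 ⊗≫ 𝟙 M.1 := by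
        rw [dualMap_eval]; monoidal
    _ = _ := by rw [← M.2.naturality]; monoidal

/-- The hexagon of the half braiding, rotated, is associativity of the action. With `act_unit`, it
makes an object of the center a module over the monad of the coends of `W' ⊗ X ⊗ W`. -/
lemma act_tensor (M : Center C) (Y Y' Z Z' : C) [ExactPairing Y Y'] [ExactPairing Z Z'] :
    act M (Y ⊗ Z) (Z' ⊗ Y') = 𝟙 _ ⊗≫ Z' ◁ (act M Y Y' ▷ Z) ⊗≫ act M Z Z' := by
  unfold act
  rw [eval_tensor, M.2.monoidal]
  calc _ = 𝟙 ((Z' ⊗ Y') ⊗ (M.1 ⊗ Y ⊗ Z)) ⊗≫ Z' ◁ Y' ◁ ((M.2.β Y).hom ▷ Z) ⊗≫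
        Z' ◁ ((Y' ⊗ Y) ◁ (M.2.β Z).hom ≫ ε_ Y Y' ▷ (Z ⊗ M.1)) ⊗≫ ε_ Z Z' ▷ M.1 ⊗≫ 𝟙 M.1 := by
        monoidal
    _ = _ := by rw [whisker_exchange]; monoidal

lemma eval_unit : ε_ (𝟙_ C) (𝟙_ C) = (ρ_ (𝟙_ C)).hom := rfl

lemma coeval_unit : η_ (𝟙_ C) (𝟙_ C) = (ρ_ (𝟙_ C)).inv := rfl

lemma act_unit (M : Center C) : act M (𝟙_ C) (𝟙_ C) = (λ_ _).hom ≫ (ρ_ _).hom := by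
  unfold act
  rw [hom_one, eval_unit]
  monoidal

lemma act_hom {M N : Center C} (f : M ⟶ N) (Y Y' : C) [ExactPairing Y Y'] :
    Y' ◁ (f.f ▷ Y) ≫ act N Y Y' = act M Y Y' ≫ f.f := by
  unfold act
  calc _ = Y' ◁ (f.f ▷ Y ≫ (N.2.β Y).hom) ⊗≫ ε_ Y Y' ▷ N.1 ⊗≫ 𝟙 N.1 := by monoidal
    _ = Y' ◁ (M.2.β Y).hom ⊗≫ ((Y' ⊗ Y) ◁ f.f ≫ ε_ Y Y' ▷ N.1) ⊗≫ 𝟙 N.1 := by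
        rw [f.comm]; monoidal
    _ = _ := by rw [whisker_exchange]; monoidal

lemma braid_eq_act (M : Center C) (Y Y' : C) [ExactPairing Y Y'] :
    (M.2.β Y).hom = 𝟙 _ ⊗≫ η_ Y Y' ▷ (M.1 ⊗ Y) ⊗≫ Y ◁ act M Y Y' ⊗≫ 𝟙 _ := by
  symm
  calc _ = 𝟙 (M.1 ⊗ Y) ⊗≫ (η_ Y Y' ▷ (M.1 ⊗ Y) ≫ _ ◁ (M.2.β Y).hom) ⊗≫
        Y ◁ ε_ Y Y' ▷ M.1 ⊗≫ 𝟙 _ := by unfold act; monoidal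
    _ = (M.2.β Y).hom ⊗≫ (η_ Y Y' ▷ Y ⊗≫ Y ◁ ε_ Y Y') ▷ M.1 ⊗≫ 𝟙 _ := by
        rw [← whisker_exchange]; monoidal
    _ = _ := by rw [ExactPairing.evaluation_coevaluation'']; monoidal

lemma act_braid (M : Center C) (W W' Y Y' : C) [ExactPairing W W'] [ExactPairing Y Y'] :
    act M W W' ▷ Y ≫ (M.2.β Y).hom = 𝟙 _ ⊗≫ η_ Y Y' ▷ (W' ⊗ (M.1 ⊗ W ⊗ Y)) ⊗≫
      Y ◁ act M (W ⊗ Y) (Y' ⊗ W') ⊗≫ 𝟙 _ := by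
  rw [braid_eq_act M Y Y', act_tensor]
  calc _ = 𝟙 ((W' ⊗ (M.1 ⊗ W)) ⊗ Y) ⊗≫ (𝟙_ C ◁ (act M W W' ▷ Y) ≫ η_ Y Y' ▷ (M.1 ⊗ Y)) ⊗≫
        Y ◁ act M Y Y' ⊗≫ 𝟙 _ := by monoidal
    _ = _ := by rw [whisker_exchange]; monoidal

end Action

section DualCoherence
variable {D : Type u} [Category.{v} D] [MonoidalCategory.{v} D]

lemma dualMap_assoc (X X' Y Y' Z Z' : D) [ExactPairing X X'] [ExactPairing Y Y']
    [ExactPairing Z Z'] :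
    dualMap (Z' ⊗ (Y' ⊗ X')) ((Z' ⊗ Y') ⊗ X') (α_ X Y Z).hom = (α_ Z' Y' X').hom := by
  symm
  apply dualMap_unique
  simp only [eval_tensor]
  monoidal

lemma dualMap_rightUnitor (X X' : D) [ExactPairing X X'] :
    dualMap (𝟙_ D ⊗ X') X' (ρ_ X).hom = (λ_ X').inv := by
  symm
  apply dualMap_unique
  simp only [eval_tensor, eval_unit]
  monoidal

lemma dualMap_leftUnitor (X X' : D) [ExactPairing X X'] :
    dualMap (X' ⊗ 𝟙_ D) X' (λ_ X).hom = (ρ_ X').inv := by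
  symm
  apply dualMap_unique
  simp only [eval_tensor, eval_unit]
  monoidal

end DualCoherence

/-! ### Free objects of the center -/

section FreeObject
variable {k : Type w'} [CommRing k] {C : Type u} [Category.{v} C] [Preadditive C]
    [Linear k C] [MonoidalCategory.{v} C] [MonoidalPreadditive C] [MonoidalLinear k C]
    [RigidCategory C] [HasFiniteBiproducts C] {I : Type w} [Fintype I] {V : I → C}
    (F : FusionChoices V)

/-- Dinaturality along morphisms from the members of `V` suffices: inserting `∑ p ≫ q = 𝟙` at `W`
reduces everything to them. -/
lemma freeIn_desc (X W W' Y Z : C) [ExactPairing W W']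
    (g : ∀ i, (ld (V i) ⊗ (X ⊗ V i)) ⊗ Y ⟶ Z) (G : (W' ⊗ (X ⊗ W)) ⊗ Y ⟶ Z)
    (h : ∀ i (f : V i ⟶ W), dualMap (ld (V i)) W' f ▷ (X ⊗ V i) ▷ Y ≫ g i =
      (W' ◁ (X ◁ f)) ▷ Y ≫ G) :
    freeIn F X W W' ▷ Y ≫ ∑ i, biproduct.π (fun i => ld (V i) ⊗ (X ⊗ V i)) i ▷ Y ≫ g i = G := by
  classical
  have h1 (i : I) : biproduct.ι (fun i => ld (V i) ⊗ (X ⊗ V i)) i ▷ Y ≫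
      ∑ i, biproduct.π (fun i => ld (V i) ⊗ (X ⊗ V i)) i ▷ Y ≫ g i = g i := by
    rw [Preadditive.comp_sum, Finset.sum_eq_single i]
    · rw [← comp_whiskerRight_assoc]; simp
    · intro j _ hj
      rw [← comp_whiskerRight_assoc, biproduct.ι_π_ne _ hj.symm]; simp
    · simp
  rw [freeIn, sum_whiskerRight, Preadditive.sum_comp]
  calc _ = ∑ i, ∑ α, (W' ◁ (X ◁ ((F.dec W).p i α ≫ (F.dec W).q i α))) ▷ Y ≫ G := by
        apply Finset.sum_congr rfl
        intro i _
        rw [sum_whiskerRight, Preadditive.sum_comp]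
        apply Finset.sum_congr rfl
        intro α _
        rw [comp_whiskerRight, Category.assoc, h1, MonoidalCategory.tensorHom_def',
          comp_whiskerRight, Category.assoc, h]
        simp
    _ = (W' ◁ (X ◁ (∑ i, ∑ α, (F.dec W).p i α ≫ (F.dec W).q i α))) ▷ Y ≫ G := by
        simp only [whiskerLeft_sum, sum_whiskerRight, Preadditive.sum_comp]
    _ = G := by rw [(F.dec W).sum_p_q]; simp

/-- The component of the half braiding of the free object. -/
noncomputable def freeShift (X W W' Y Y' : C) [ExactPairing W W'] [ExactPairing Y Y'] :
    (W' ⊗ (X ⊗ W)) ⊗ Y ⟶ Y ⊗ freeObj V X :=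
  𝟙 _ ⊗≫ η_ Y Y' ▷ (W' ⊗ (X ⊗ (W ⊗ Y))) ⊗≫ Y ◁ freeIn F X (W ⊗ Y) (Y' ⊗ W') ⊗≫ 𝟙 _

lemma freeShift_dinat (hV : IsFusion k V) (X W W' W₁ W₁' Y Y' : C) [ExactPairing W W']
    [ExactPairing W₁ W₁'] [ExactPairing Y Y'] (f : W ⟶ W₁) :
    (dualMap W' W₁' f ▷ (X ⊗ W)) ▷ Y ≫ freeShift F X W W' Y Y' =
      (W₁' ◁ (X ◁ f)) ▷ Y ≫ freeShift F X W₁ W₁' Y Y' := by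
  unfold freeShift
  have h := freeIn_dinat F hV X (Y' ⊗ W') (Y' ⊗ W₁') (f ▷ Y)
  rw [dualMap_whiskerRight] at h
  calc _ = 𝟙 ((W₁' ⊗ (X ⊗ W)) ⊗ Y) ⊗≫ (𝟙_ C ◁ (dualMap W' W₁' f ▷ (X ⊗ W ⊗ Y)) ≫
        η_ Y Y' ▷ (W' ⊗ (X ⊗ (W ⊗ Y)))) ⊗≫ Y ◁ freeIn F X (W ⊗ Y) (Y' ⊗ W') ⊗≫ 𝟙 _ := by monoidal
    _ = 𝟙 ((W₁' ⊗ (X ⊗ W)) ⊗ Y) ⊗≫ η_ Y Y' ▷ (W₁' ⊗ (X ⊗ (W ⊗ Y))) ⊗≫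
        Y ◁ ((Y' ◁ dualMap W' W₁' f) ▷ (X ⊗ (W ⊗ Y)) ≫ freeIn F X (W ⊗ Y) (Y' ⊗ W')) ⊗≫ 𝟙 _ := by
        rw [whisker_exchange]; monoidal
    _ = 𝟙 ((W₁' ⊗ (X ⊗ W)) ⊗ Y) ⊗≫ (η_ Y Y' ▷ (W₁' ⊗ (X ⊗ (W ⊗ Y))) ≫
        (Y ⊗ Y') ◁ (W₁' ◁ (X ◁ (f ▷ Y)))) ⊗≫ Y ◁ freeIn F X (W₁ ⊗ Y) (Y' ⊗ W₁') ⊗≫ 𝟙 _ := by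
        rw [h]; monoidal
    _ = _ := by rw [← whisker_exchange]; monoidal

lemma freeShift_nat (hV : IsFusion k V) (X W W' Y Y' Z Z' : C) [ExactPairing W W']
    [ExactPairing Y Y'] [ExactPairing Z Z'] (g : Y ⟶ Z) :
    (W' ⊗ (X ⊗ W)) ◁ g ≫ freeShift F X W W' Z Z' = freeShift F X W W' Y Y' ≫ g ▷ _ := by
  unfold freeShift
  have h := freeIn_dinat F hV X (Y' ⊗ W') (Z' ⊗ W') (W ◁ g)
  rw [dualMap_whiskerLeft] at h
  calc _ = 𝟙 ((W' ⊗ (X ⊗ W)) ⊗ Y) ⊗≫ (𝟙_ C ◁ (W' ◁ (X ◁ (W ◁ g))) ≫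
        η_ Z Z' ▷ (W' ⊗ (X ⊗ (W ⊗ Z)))) ⊗≫ Z ◁ freeIn F X (W ⊗ Z) (Z' ⊗ W') ⊗≫ 𝟙 _ := by monoidal
    _ = 𝟙 ((W' ⊗ (X ⊗ W)) ⊗ Y) ⊗≫ η_ Z Z' ▷ (W' ⊗ (X ⊗ (W ⊗ Y))) ⊗≫
        Z ◁ ((Z' ⊗ W') ◁ (X ◁ (W ◁ g)) ≫ freeIn F X (W ⊗ Z) (Z' ⊗ W')) ⊗≫ 𝟙 _ := by
        rw [whisker_exchange]; monoidal
    _ = 𝟙 ((W' ⊗ (X ⊗ W)) ⊗ Y) ⊗≫ (η_ Z Z' ≫ Z ◁ dualMap Y' Z' g) ▷ (W' ⊗ (X ⊗ (W ⊗ Y))) ⊗≫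
        Z ◁ freeIn F X (W ⊗ Y) (Y' ⊗ W') ⊗≫ 𝟙 _ := by
        rw [← h]; monoidal
    _ = 𝟙 ((W' ⊗ (X ⊗ W)) ⊗ Y) ⊗≫ η_ Y Y' ▷ (W' ⊗ (X ⊗ (W ⊗ Y))) ⊗≫
        (g ▷ (Y' ⊗ (W' ⊗ (X ⊗ (W ⊗ Y)))) ≫
        Z ◁ (𝟙 _ ⊗≫ freeIn F X (W ⊗ Y) (Y' ⊗ W'))) ⊗≫ 𝟙 _ := by
        rw [coeval_dualMap]; monoidal
    _ = _ := by rw [← whisker_exchange]; monoidal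

/-- The half braiding of the free object. -/
noncomputable def freeBraid (X Y : C) : freeObj V X ⊗ Y ⟶ Y ⊗ freeObj V X :=
  ∑ i, biproduct.π (fun i => ld (V i) ⊗ (X ⊗ V i)) i ▷ Y ≫
    freeShift F X (V i) (ld (V i)) Y (ld Y)

/-- The half braiding with `Y` lengthens the label `W` to `W ⊗ Y`. Allowing any dual `Y'` lets the
unit axiom use `𝟙_ C` as its own dual and multiplicativity use `ld Z ⊗ ld Y`. -/
lemma freeIn_freeBraid (hV : IsFusion k V) (X W W' Y Y' : C) [ExactPairing W W']
    [ExactPairing Y Y'] :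
    freeIn F X W W' ▷ Y ≫ freeBraid F X Y = freeShift F X W W' Y Y' := by
  -- Naturality along the identity of `Y`, with different duals on the two sides, replaces `ld Y` by
  -- `Y'`.
  have := freeShift_nat F hV X W W' Y (ld Y) Y Y' (𝟙 Y)
  simp only [MonoidalCategory.whiskerLeft_id, id_whiskerRight, Category.id_comp,
    Category.comp_id] at this
  rw [this]
  exact freeIn_desc F X W W' Y _ _ _ fun i f => freeShift_dinat F hV X _ _ _ _ _ _ f

lemma freeIn_freeBraid_assoc' (hV : IsFusion k V) (X W W' Y Y' Z : C) [ExactPairing W W']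
    [ExactPairing Y Y'] (g : Y ⊗ freeObj V X ⟶ Z):
    freeIn F X W W' ▷ Y ≫ freeBraid F X Y ≫ g = freeShift F X W W' Y Y' ≫ g := by
  rw [← freeIn_freeBraid F hV, Category.assoc]

/-- The half braiding of the free object as a natural and multiplicative family. -/
noncomputable def freeLax (hV : IsFusion k V) (X : C) : LaxHB (freeObj V X) where
  f := freeBraid F X
  nat {Y Z} g := by
    apply free_ext F hV
    intro i
    calc _ = _ ◁ g ≫ freeIn F X (V i) (ld (V i)) ▷ Z ≫ freeBraid F X Z := by
          rw [whisker_exchange_assoc]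
      _ = _ := by
          rw [freeIn_freeBraid F hV _ _ _ Z (ld Z), freeIn_freeBraid_assoc' F hV _ _ _ Y (ld Y),
            freeShift_nat F hV X (V i) (ld (V i)) Y (ld Y) Z (ld Z)]
  mon Y Z := by
    apply free_ext F hV
    intro i
    rw [freeIn_freeBraid F hV _ _ _ (Y ⊗ Z) (ld Z ⊗ ld Y)]
    symm
    -- Extending the label by `Y` and then `Z` ends in `(V i ⊗ Y) ⊗ Z`, extending it by `Y ⊗ Z` in
    -- `V i ⊗ (Y ⊗ Z)`; dinaturality along the associator identifies the two.
    have h := freeIn_dinat F hV X (ld Z ⊗ (ld Y ⊗ ld (V i))) ((ld Z ⊗ ld Y) ⊗ ld (V i))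
      (α_ (V i) Y Z).hom
    rw [dualMap_assoc] at h
    calc _ = 𝟙 _ ⊗≫ (freeIn F X (V i) (ld (V i)) ▷ Y ≫ freeBraid F X Y) ▷ Z ⊗≫
          Y ◁ freeBraid F X Z ⊗≫ 𝟙 _ := by monoidal
      _ = 𝟙 _ ⊗≫ η_ Y (ld Y) ▷ (ld (V i) ⊗ X ⊗ V i ⊗ Y ⊗ Z) ⊗≫
          Y ◁ (freeIn F X (V i ⊗ Y) (ld Y ⊗ ld (V i)) ▷ Z ≫ freeBraid F X Z) ⊗≫ 𝟙 _ := by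
          rw [freeIn_freeBraid F hV _ _ _ Y (ld Y), freeShift]; monoidal
      _ = 𝟙 ((ld (V i) ⊗ X ⊗ V i) ⊗ (Y ⊗ Z)) ⊗≫
          (η_ Y (ld Y) ⊗≫ Y ◁ η_ Z (ld Z) ▷ ld Y ⊗≫ 𝟙 ((Y ⊗ Z) ⊗ (ld Z ⊗ ld Y))) ▷
            (ld (V i) ⊗ X ⊗ (V i ⊗ Y) ⊗ Z) ⊗≫
          (Y ⊗ Z) ◁ ((α_ _ _ _).hom ▷ (X ⊗ ((V i ⊗ Y) ⊗ Z)) ≫ freeIn F X ((V i ⊗ Y) ⊗ Z)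
            (ld Z ⊗ (ld Y ⊗ ld (V i)))) ⊗≫ 𝟙 _ := by
          rw [freeIn_freeBraid F hV _ _ _ Z (ld Z), freeShift]; monoidal
      _ = _ := by rw [h, freeShift, coeval_tensor]; monoidal
  one := by
    apply free_ext F hV
    intro i
    rw [freeIn_freeBraid F hV _ _ _ (𝟙_ C) (𝟙_ C)]
    have h := freeIn_dinat F hV X (𝟙_ C ⊗ ld (V i)) (ld (V i)) (ρ_ (V i)).hom
    rw [dualMap_rightUnitor] at h
    calc _ = 𝟙 _ ⊗≫ ((λ_ (ld (V i))).inv ▷ (X ⊗ (V i ⊗ 𝟙_ C)) ≫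
          freeIn F X (V i ⊗ 𝟙_ C) (𝟙_ C ⊗ ld (V i))) ⊗≫ 𝟙 _ := by
          rw [freeShift, coeval_unit]; monoidal
      _ = _ := by rw [h]; monoidal

/-- The free object of the center on `X`. -/
noncomputable def free (hV : IsFusion k V) (X : C) : Center C :=
  ⟨freeObj V X, (freeLax F hV X).toHalfBraiding⟩

/-- The unit `X ⟶ free X`. -/
noncomputable def freeUnit (X : C) : X ⟶ freeObj V X :=
  𝟙 X ⊗≫ freeIn F X (𝟙_ C) (𝟙_ C)

/-- Freeness in computational form: acting on the image of the unit produces the universal maps into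
the coend, because the label `𝟙_ C ⊗ Y` is identified with `Y`. -/
lemma freeUnit_act (hV : IsFusion k V) (X Y Y' : C) [ExactPairing Y Y'] :
    Y' ◁ (freeUnit F X ▷ Y) ≫ act (free F hV X) Y Y' = freeIn F X Y Y' := by
  have h := freeIn_dinat F hV X (Y' ⊗ 𝟙_ C) Y' (λ_ Y).hom
  rw [dualMap_leftUnitor] at h
  have h1 : freeUnit F X ▷ Y ≫ freeBraid F X Y =
      𝟙 _ ⊗≫ η_ Y Y' ▷ (X ⊗ Y) ⊗≫ Y ◁ freeIn F X Y Y' := by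
    calc _ = 𝟙 _ ⊗≫ (freeIn F X (𝟙_ C) (𝟙_ C) ▷ Y ≫ freeBraid F X Y) := by
          unfold freeUnit; monoidal
      _ = 𝟙 _ ⊗≫ η_ Y Y' ▷ (X ⊗ Y) ⊗≫ Y ◁ ((ρ_ Y').inv ▷ (X ⊗ (𝟙_ C ⊗ Y)) ≫
          freeIn F X (𝟙_ C ⊗ Y) (Y' ⊗ 𝟙_ C)) := by
          rw [freeIn_freeBraid F hV _ _ _ Y Y', freeShift]; monoidal
      _ = _ := by rw [h]; monoidal
  change _ ≫ (Y' ◁ freeBraid F X Y ⊗≫ ε_ Y Y' ▷ freeObj V X ⊗≫ 𝟙 (freeObj V X)) = _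
  calc _ = Y' ◁ (freeUnit F X ▷ Y ≫ freeBraid F X Y) ⊗≫ ε_ Y Y' ▷ freeObj V X ⊗≫ 𝟙 _ := by
        monoidal
    _ = 𝟙 _ ⊗≫ Y' ◁ η_ Y Y' ▷ (X ⊗ Y) ⊗≫ ((Y' ⊗ Y) ◁ freeIn F X Y Y' ≫
        ε_ Y Y' ▷ freeObj V X) ⊗≫ 𝟙 _ := by rw [h1]; monoidal
    _ = 𝟙 _ ⊗≫ (Y' ◁ η_ Y Y' ⊗≫ ε_ Y Y' ▷ Y') ▷ (X ⊗ Y) ⊗≫ freeIn F X Y Y' := by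
        rw [whisker_exchange]; monoidal
    _ = _ := by rw [ExactPairing.coevaluation_evaluation'']; monoidal

/-- The counit `free M ⟶ M` on underlying objects. -/
noncomputable def freeCounit (V : I → C) (M : Center C) : freeObj V M.1 ⟶ M.1 :=
  ∑ i, biproduct.π (fun i => ld (V i) ⊗ (M.1 ⊗ V i)) i ≫ act M (V i) (ld (V i))

lemma freeIn_freeCounit (M : Center C) (W W' : C) [ExactPairing W W'] :
    freeIn F M.1 W W' ≫ freeCounit V M = act M W W' := by
  have := freeIn_desc F M.1 W W' (𝟙_ C) M.1 (fun i => (ρ_ _).hom ≫ act M (V i) (ld (V i)))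
    ((ρ_ _).hom ≫ act M W W') (by
      intro i f
      simp only [rightUnitor_naturality_assoc]
      rw [act_dinat])
  rw [← cancel_epi (ρ_ _).hom, ← this]
  simp [freeCounit, Preadditive.comp_sum]

/-- The triangle identity through which any natural family on the center is recovered from its
values on free objects. -/
lemma freeUnit_freeCounit (M : Center C) : freeUnit F M.1 ≫ freeCounit V M = 𝟙 M.1 := by
  calc _ = 𝟙 M.1 ⊗≫ (freeIn F M.1 (𝟙_ C) (𝟙_ C) ≫ freeCounit V M) := by
        unfold freeUnit; monoidal
    _ = _ := by rw [freeIn_freeCounit, act_unit]; monoidal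

/-- The counit `free M ⟶ M`. -/
noncomputable def freeCounitHom (hV : IsFusion k V) (M : Center C) : free F hV M.1 ⟶ M where
  f := freeCounit V M
  comm Y := by
    change freeCounit V M ▷ Y ≫ (M.2.β Y).hom = freeBraid F M.1 Y ≫ Y ◁ freeCounit V M
    apply free_ext F hV
    intro i
    rw [freeIn_freeBraid_assoc' F hV _ _ _ Y (ld Y), ← comp_whiskerRight_assoc, freeIn_freeCounit,
      act_braid M _ _ Y (ld Y)]
    symm
    calc _ = 𝟙 _ ⊗≫ η_ Y (ld Y) ▷ (ld (V i) ⊗ (M.1 ⊗ V i ⊗ Y)) ⊗≫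
          Y ◁ (freeIn F M.1 (V i ⊗ Y) (ld Y ⊗ ld (V i)) ≫ freeCounit V M) ⊗≫ 𝟙 _ := by
          unfold freeShift; monoidal
      _ = _ := by rw [freeIn_freeCounit]

/-- Functoriality of the free object on underlying objects. -/
noncomputable def freeMap (V : I → C) {X Y : C} (f : X ⟶ Y) : freeObj V X ⟶ freeObj V Y :=
  biproduct.map fun i => ld (V i) ◁ (f ▷ V i)

lemma freeIn_freeMap {X Y : C} (f : X ⟶ Y) (W W' : C) [ExactPairing W W'] :
    freeIn F X W W' ≫ freeMap V f = W' ◁ (f ▷ W) ≫ freeIn F Y W W' := by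
  simp only [freeIn, Preadditive.comp_sum, Preadditive.sum_comp, freeMap]
  refine Finset.sum_congr rfl fun i _ => Finset.sum_congr rfl fun α _ => ?_
  simp only [Category.assoc, biproduct.ι_map]
  simp only [MonoidalCategory.tensorHom_def, Category.assoc, ← MonoidalCategory.whiskerLeft_comp_assoc,
    whisker_exchange]
  simp only [MonoidalCategory.whiskerLeft_comp, Category.assoc, whisker_exchange_assoc]

lemma freeUnit_freeMap {X Y : C} (f : X ⟶ Y) : freeUnit F X ≫ freeMap V f = f ≫ freeUnit F Y := by
  calc _ = 𝟙 X ⊗≫ (freeIn F X (𝟙_ C) (𝟙_ C) ≫ freeMap V f) := by unfold freeUnit; monoidal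
    _ = _ := by rw [freeIn_freeMap]; unfold freeUnit; monoidal

/-- Functoriality of the free object. -/
noncomputable def freeMapHom (hV : IsFusion k V) {X Y : C} (f : X ⟶ Y) :
    free F hV X ⟶ free F hV Y where
  f := freeMap V f
  comm Z := by
    change freeMap V f ▷ Z ≫ freeBraid F Y Z = freeBraid F X Z ≫ Z ◁ freeMap V f
    apply free_ext F hV
    intro i
    rw [freeIn_freeBraid_assoc' F hV _ _ _ Z (ld Z), ← comp_whiskerRight_assoc, freeIn_freeMap,
      comp_whiskerRight, Category.assoc, freeIn_freeBraid F hV _ _ _ Z (ld Z)]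
    unfold freeShift
    calc _ = 𝟙 _ ⊗≫ (𝟙_ C ◁ (ld (V i) ◁ (f ▷ (V i ⊗ Z))) ≫
          η_ Z (ld Z) ▷ (ld (V i) ⊗ (Y ⊗ (V i ⊗ Z)))) ⊗≫
          Z ◁ freeIn F Y (V i ⊗ Z) (ld Z ⊗ ld (V i)) ⊗≫ 𝟙 _ := by monoidal
      _ = 𝟙 _ ⊗≫ η_ Z (ld Z) ▷ (ld (V i) ⊗ (X ⊗ (V i ⊗ Z))) ⊗≫
          Z ◁ ((ld Z ⊗ ld (V i)) ◁ (f ▷ (V i ⊗ Z)) ≫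
            freeIn F Y (V i ⊗ Z) (ld Z ⊗ ld (V i))) ⊗≫ 𝟙 _ := by
          rw [whisker_exchange]; monoidal
      _ = _ := by rw [← freeIn_freeMap]; monoidal

end FreeObject
end CenterCoend


set_option linter.unusedSectionVars false

namespace CenterCoend
open Limits

/-! ### Rotation of a dual factor -/

section Hat
variable {D : Type u} [Category.{v} D] [MonoidalCategory.{v} D]

/-- The morphism `X ⟶ A ⊗ Z` corresponding to `A' ⊗ X ⟶ Z`, for a dual `A'` of `A`. -/
def hat (A A' : D) [ExactPairing A A'] {X Z : D} (g : A' ⊗ X ⟶ Z) : X ⟶ A ⊗ Z :=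
  𝟙 X ⊗≫ η_ A A' ▷ X ⊗≫ A ◁ g

lemma hat_eq (A A' : D) [ExactPairing A A'] {X Z : D} (g : A' ⊗ X ⟶ Z) :
    hat A A' g = tensorLeftHomEquiv X A A' Z g := by
  change _ = (λ_ _).inv ≫ η_ _ _ ▷ _ ≫ (α_ _ _ _).hom ≫ _ ◁ g
  unfold hat; monoidal

lemma hat_injective (A A' : D) [ExactPairing A A'] {X Z : D} :
    Function.Injective (hat A A' : (A' ⊗ X ⟶ Z) → _) := by
  intro f g h
  simpa only [hat_eq, EmbeddingLike.apply_eq_iff_eq] using h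

lemma exists_hat_eq (A A' : D) [ExactPairing A A'] {X Z : D} (f : X ⟶ A ⊗ Z) :
    ∃ g : A' ⊗ X ⟶ Z, hat A A' g = f :=
  ⟨(tensorLeftHomEquiv X A A' Z).symm f, by rw [hat_eq]; simp⟩

lemma hat_comp (A A' : D) [ExactPairing A A'] {X Z Z₁ : D} (g : A' ⊗ X ⟶ Z) (h : Z ⟶ Z₁) :
    hat A A' g ≫ A ◁ h = hat A A' (g ≫ h) := by
  unfold hat; monoidal

lemma comp_hat (A A' : D) [ExactPairing A A'] {X X₁ Z : D} (f : X₁ ⟶ X) (g : A' ⊗ X ⟶ Z) :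
    f ≫ hat A A' g = hat A A' (A' ◁ f ≫ g) := by
  unfold hat
  calc _ = 𝟙 X₁ ⊗≫ (𝟙_ D ◁ f ≫ η_ A A' ▷ X) ⊗≫ A ◁ g := by monoidal
    _ = _ := by rw [whisker_exchange]; monoidal

/-- A morphism on the created factor slides around the coevaluation and reappears as its dual on the
input. -/
lemma hat_whiskerRight (A A' B B' : D) [ExactPairing A A'] [ExactPairing B B'] {X Z : D}
    (g : A' ⊗ X ⟶ Z) (a : A ⟶ B) :
    hat A A' g ≫ a ▷ Z = hat B B' (dualMap A' B' a ▷ X ≫ g) := by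
  unfold hat
  calc _ = 𝟙 X ⊗≫ η_ A A' ▷ X ⊗≫ (A ◁ g ≫ a ▷ Z) := by monoidal
    _ = 𝟙 X ⊗≫ (η_ A A' ≫ a ▷ A') ▷ X ⊗≫ B ◁ g := by rw [whisker_exchange]; monoidal
    _ = _ := by rw [← coeval_dualMap A' B' a]; monoidal

lemma hat_add [Preadditive D] [MonoidalPreadditive D] (A A' : D) [ExactPairing A A'] {X Z : D}
    (f g : A' ⊗ X ⟶ Z) : hat A A' (f + g) = hat A A' f + hat A A' g := by
  have e (f : A' ⊗ X ⟶ Z) : hat A A' f = ((λ_ _).inv ≫ η_ _ _ ▷ _ ≫ (α_ _ _ _).hom) ≫ _ ◁ f := by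
    unfold hat; monoidal
  simp only [e, MonoidalPreadditive.whiskerLeft_add, Preadditive.comp_add]

lemma hat_sum [Preadditive D] [MonoidalPreadditive D] (A A' : D) [ExactPairing A A'] {X Z : D}
    {J : Type*} (s : Finset J) (f : J → (A' ⊗ X ⟶ Z)) :
    hat A A' (∑ j ∈ s, f j) = ∑ j ∈ s, hat A A' (f j) :=
  map_sum (AddMonoidHom.mk' (hat A A') (hat_add A A')) f s

end Hat

/-! ### The universal coaction on the forgetful functor and the half braiding of the coend -/

section Coend
variable {k : Type w'} [CommRing k] {C : Type u} [Category.{v} C] [Preadditive C]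
    [Linear k C] [MonoidalCategory.{v} C] [MonoidalPreadditive C] [MonoidalLinear k C]
    [RigidCategory C] [HasFiniteBiproducts C] {I : Type w} [Fintype I] {V : I → C}
    (F : FusionChoices V)

/-- The summand `i` of the universal dinatural transformation of the coend, before the action. -/
noncomputable def kap (i : I) (X X' : C) [ExactPairing X X'] :
    ((ld (V i) ⊗ X') ⊗ ld (ld (V i))) ⊗ X ⟶ coendObj V :=
  ∑ j, ∑ α, ((dualMap ((ld (V i) ⊗ ld (V j)) ⊗ ld (ld (V i))) ((ld (V i) ⊗ X') ⊗ ld (ld (V i)))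
    (ld (V i) ◁ ((F.dec X).q j α ▷ V i)) ⊗ₘ (F.dec X).p j α) ⊗≫ 𝟙 (summand V i j)) ≫ inc V i j

lemma isBilin_kap (i j : I) (X X' Y : C) [ExactPairing X X'] :
    IsBilin k (fun (x : V j ⟶ X) (y : Y ⟶ V j) =>
      ((dualMap ((ld (V i) ⊗ ld (V j)) ⊗ ld (ld (V i))) ((ld (V i) ⊗ X') ⊗ ld (ld (V i)))
    (ld (V i) ◁ (x ▷ V i)) ⊗ₘ y) ⊗≫ 𝟙 (summand V i j)) ≫ inc V i j) where
  add_left x y z := by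
    simp only [dualMap_add, MonoidalPreadditive.add_tensor, Preadditive.add_comp, monoidalComp,
      MonoidalPreadditive.add_whiskerRight, MonoidalPreadditive.whiskerLeft_add]
  add_right x y z := by
    simp only [MonoidalPreadditive.tensor_add, Preadditive.add_comp, monoidalComp]
  smul_left a x y := by
    simp only [dualMap_smul, MonoidalCategory.tensorHom_def, MonoidalLinear.smul_whiskerRight,
      MonoidalLinear.whiskerLeft_smul, monoidalComp, Linear.smul_comp]
  smul_right a x y := by
    simp only [MonoidalLinear.whiskerLeft_smul, MonoidalCategory.tensorHom_def, Linear.smul_comp,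
      Linear.comp_smul, monoidalComp]

lemma kap_dinat (hV : IsFusion k V) (i : I) {X Y : C} (X' Y' : C) [ExactPairing X X']
    [ExactPairing Y Y'] (f : X ⟶ Y) :
    dualMap ((ld (V i) ⊗ X') ⊗ ld (ld (V i))) ((ld (V i) ⊗ Y') ⊗ ld (ld (V i)))
      (ld (V i) ◁ (f ▷ V i)) ▷ X ≫ kap F i X X' = _ ◁ f ≫ kap F i Y Y' := by
  simp only [kap, Preadditive.comp_sum]
  apply Finset.sum_congr rfl
  intro j _
  have := hV.exchange f (F.dec X) (F.dec Y) j (isBilin_kap (k := k) i j Y Y' X)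
  simp only [dualMap_comp _ ((ld (V i) ⊗ X') ⊗ ld (ld (V i))) _, comp_whiskerRight,
    MonoidalCategory.whiskerLeft_comp] at this
  refine Eq.trans (Finset.sum_congr rfl fun α _ => ?_)
    (this.trans (Finset.sum_congr rfl fun α _ => ?_))
  · simp [MonoidalCategory.tensorHom_def, monoidalComp]
  · simp [MonoidalCategory.tensorHom_def', monoidalComp]

lemma kap_self (hV : IsFusion k V) (i j : I) :
    kap F i (V j) (ld (V j)) = 𝟙 _ ⊗≫ inc V i j := by
  unfold kap
  rw [Finset.sum_eq_single j]
  · rw [hV.sum_self j (F.dec (V j)) (isBilin_kap (k := k) i j (V j) (ld (V j)) (V j))]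
    rw [id_whiskerRight, MonoidalCategory.whiskerLeft_id, dualMap_id]
    monoidal
  · intro l _ hl
    exact hV.sum_ne hl (F.dec (V j)) (isBilin_kap (k := k) i l (V j) (ld (V j)) (V j))
  · simp

/-- Morphisms are determined by their restrictions to the members of the family. -/
lemma Decomp.hom_ext {X Z : C} (d : Decomp V X) {f g : X ⟶ Z}
    (h : ∀ i α, d.q i α ≫ f = d.q i α ≫ g) : f = g := by
  have e (f : X ⟶ Z) : f = ∑ i, ∑ α, d.p i α ≫ d.q i α ≫ f := by
    calc f = (∑ i, ∑ α, d.p i α ≫ d.q i α) ≫ f := by rw [d.sum_p_q, Category.id_comp]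
      _ = _ := by simp only [Preadditive.sum_comp, Category.assoc]
  rw [e f, e g]
  simp only [h]

lemma Decomp.whiskerLeft_hom_ext {X Y Z : C} (d : Decomp V X) {f g : Y ⊗ X ⟶ Z}
    (h : ∀ i α, Y ◁ d.q i α ≫ f = Y ◁ d.q i α ≫ g) : f = g := by
  have e (f : Y ⊗ X ⟶ Z) : f = ∑ i, ∑ α, Y ◁ d.p i α ≫ Y ◁ d.q i α ≫ f := by
    calc f = Y ◁ (∑ i, ∑ α, d.p i α ≫ d.q i α) ≫ f := by rw [d.sum_p_q]; simp
      _ = _ := by simp only [Preadditive.sum_comp, Category.assoc, whiskerLeft_sum,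
        MonoidalCategory.whiskerLeft_comp]
  rw [e f, e g]
  simp only [h]

/-- Dinaturality and the values at `V j`, which are inclusions of summands, determine the family.
This is why the coend does not depend on the chosen decompositions. -/
lemma kap_congr (hV : IsFusion k V) (F' : FusionChoices V) (i : I) (X X' : C)
    [ExactPairing X X'] : kap F i X X' = kap F' i X X' := by
  apply (F.dec X).whiskerLeft_hom_ext
  intro j α
  rw [← kap_dinat F hV i (ld (V j)) X', ← kap_dinat F' hV i (ld (V j)) X', kap_self F hV,
    kap_self F' hV]

/-- The coaction corresponding to `kap`. -/
noncomputable def kapHat (i : I) (X X' : C) [ExactPairing X X'] :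
    X ⟶ (ld (V i) ⊗ (X ⊗ V i)) ⊗ coendObj V :=
  hat (ld (V i) ⊗ (X ⊗ V i)) ((ld (V i) ⊗ X') ⊗ ld (ld (V i))) (kap F i X X')

lemma kapHat_nat (hV : IsFusion k V) (i : I) {X Y : C} (X' Y' : C) [ExactPairing X X']
    [ExactPairing Y Y'] (f : X ⟶ Y) :
    f ≫ kapHat F i Y Y' = kapHat F i X X' ≫ (ld (V i) ◁ (f ▷ V i)) ▷ coendObj V := by
  rw [kapHat, kapHat, comp_hat, hat_whiskerRight _ _ (ld (V i) ⊗ (Y ⊗ V i))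
    ((ld (V i) ⊗ Y') ⊗ ld (ld (V i))), kap_dinat F hV]

/-- The morphism `V j ⟶ (ᵛVᵢ ⊗ Vⱼ ⊗ Vᵢ) ⊗ Z` corresponding to a morphism on a summand. -/
def hatS {i j : I} {Z : C} (g : summand V i j ⟶ Z) :
    V j ⟶ (ld (V i) ⊗ (V j ⊗ V i)) ⊗ Z :=
  hat (ld (V i) ⊗ (V j ⊗ V i)) ((ld (V i) ⊗ ld (V j)) ⊗ ld (ld (V i))) (𝟙 _ ⊗≫ g)

lemma hatS_injective {i j : I} {Z : C} {f g : summand V i j ⟶ Z} (h : hatS f = hatS g) :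
    f = g := by
  have h1 := hat_injective _ _ h
  calc f = 𝟙 (summand V i j) ⊗≫ (𝟙 (((ld (V i) ⊗ ld (V j)) ⊗ ld (ld (V i))) ⊗ V j) ⊗≫ f) := by
        monoidal
    _ = 𝟙 (summand V i j) ⊗≫ (𝟙 (((ld (V i) ⊗ ld (V j)) ⊗ ld (ld (V i))) ⊗ V j) ⊗≫ g) := by
        rw [h1]
    _ = g := by monoidal

lemma exists_hatS_eq {i j : I} {Z : C} (f : V j ⟶ (ld (V i) ⊗ (V j ⊗ V i)) ⊗ Z) :
    ∃ g : summand V i j ⟶ Z, hatS g = f := by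
  obtain ⟨g, hg⟩ := exists_hat_eq (ld (V i) ⊗ (V j ⊗ V i))
    ((ld (V i) ⊗ ld (V j)) ⊗ ld (ld (V i))) f
  refine ⟨𝟙 (summand V i j) ⊗≫ g, ?_⟩
  rw [← hg, hatS]
  congr 1
  monoidal

lemma hatS_comp {i j : I} {Z Z₁ : C} (g : summand V i j ⟶ Z) (h : Z ⟶ Z₁) :
    hatS g ≫ _ ◁ h = hatS (g ≫ h) := by
  rw [hatS, hat_comp, hatS]
  congr 1
  monoidal

lemma kapHat_self (hV : IsFusion k V) (i j : I) :
    kapHat F i (V j) (ld (V j)) = hatS (inc V i j) := by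
  rw [kapHat, kap_self F hV]; rfl

/-- The coaction of the coend. -/
noncomputable def coendCoact (M : Center C) : M.1 ⟶ M.1 ⊗ coendObj V :=
  hat M.1 (ld M.1) (coendMap F M)

/-- The half braiding enters only through the dual of the action; the remaining factor `kap` is
dinatural for all morphisms of `C`, not just for those of the center. -/
lemma coendMap_eq (M : Center C) : coendMap F M = ∑ i,
    dualMap ((ld (V i) ⊗ ld M.1) ⊗ ld (ld (V i))) (ld M.1) (act M (V i) (ld (V i))) ▷ M.1 ≫
      kap F i M.1 (ld M.1) := by
  simp only [coendMap, coendMapAux, kap, Preadditive.sum_comp, Preadditive.comp_sum]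
  refine Finset.sum_congr rfl fun i _ => Finset.sum_congr rfl fun j _ =>
    Finset.sum_congr rfl fun α _ => ?_
  rw [dualMap_comp _ ((ld (V i) ⊗ ld M.1) ⊗ ld (ld (V i)))]
  simp [MonoidalCategory.tensorHom_def, monoidalComp, act, centerAction]

lemma coendMap_congr (hV : IsFusion k V) (F' : FusionChoices V) (M : Center C) :
    coendMap F M = coendMap F' M := by
  simp only [coendMap_eq, kap_congr F hV F']

lemma coendCoact_congr (hV : IsFusion k V) (F' : FusionChoices V) (M : Center C) :
    coendCoact F M = coendCoact F' M := by
  rw [coendCoact, coendMap_congr F hV F', coendCoact]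

lemma coendCoact_eq (M : Center C) : coendCoact F M = ∑ i,
    kapHat F i M.1 (ld M.1) ≫ act M (V i) (ld (V i)) ▷ coendObj V := by
  rw [coendCoact, coendMap_eq, hat_sum]
  apply Finset.sum_congr rfl
  intro i _
  rw [kapHat, hat_whiskerRight _ _ M.1 (ld M.1)]

lemma coendCoact_nat (hV : IsFusion k V) {M N : Center C} (f : M ⟶ N) :
    f.f ≫ coendCoact F N = coendCoact F M ≫ f.f ▷ coendObj V := by
  simp only [coendCoact_eq, Preadditive.comp_sum, Preadditive.sum_comp]
  apply Finset.sum_congr rfl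
  intro i _
  rw [reassoc_of% kapHat_nat F hV i (ld M.1) (ld N.1) f.f, Category.assoc, ← comp_whiskerRight,
    ← comp_whiskerRight, act_hom]

/-- The coaction of the coend on a free object. -/
noncomputable def freeCoact (hV : IsFusion k V) (X : C) :
    freeObj V X ⟶ freeObj V X ⊗ coendObj V :=
  coendCoact F (free F hV X)

/-- On the image of the unit, the action of `V j` becomes the inclusion of the summand `j`, so
projecting to `i` isolates one term of the coaction. -/
lemma freeUnit_freeCoact (hV : IsFusion k V) (X : C) (i : I) :
    freeUnit F X ≫ freeCoact F hV X ≫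
      biproduct.π (fun i => ld (V i) ⊗ (X ⊗ V i)) i ▷ coendObj V = kapHat F i X (ld X) := by
  classical
  obtain ⟨a, ha⟩ : ∃ a : ∀ Y, ld Y ⊗ (freeObj V X ⊗ Y) ⟶ freeObj V X,
    ∀ Y, a Y = act (free F hV X) Y (ld Y) := ⟨_, fun _ => rfl⟩
  have h1 : freeCoact F hV X = ∑ i, kapHat F i (freeObj V X) (ld (freeObj V X)) ≫
      a (V i) ▷ coendObj V := by
    simp only [ha]
    exact coendCoact_eq F (free F hV X)
  have h2 (Y : C) : ld Y ◁ (freeUnit F X ▷ Y) ≫ a Y = freeIn F X Y (ld Y) := by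
    rw [ha]
    exact freeUnit_act F hV X Y (ld Y)
  have h3 (j : I) : freeUnit F X ≫ (kapHat F j (freeObj V X) (ld (freeObj V X)) ≫
      a (V j) ▷ coendObj V) ≫ biproduct.π (fun i => ld (V i) ⊗ (X ⊗ V i)) i ▷ coendObj V =
      kapHat F j X (ld X) ≫ (biproduct.ι (fun i => ld (V i) ⊗ (X ⊗ V i)) j ≫
        biproduct.π (fun i => ld (V i) ⊗ (X ⊗ V i)) i) ▷ coendObj V := by
    rw [Category.assoc, ← Category.assoc (freeUnit F X), kapHat_nat F hV j (ld X), Category.assoc,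
      ← comp_whiskerRight_assoc, h2, freeIn_self F hV, ← comp_whiskerRight]
  rw [h1, Preadditive.sum_comp, Preadditive.comp_sum, Finset.sum_eq_single i]
  · rw [h3]
    simp
  · intro j _ hj
    rw [h3, biproduct.ι_π_ne _ hj]
    simp
  · simp

lemma coendObj_hom_ext {Z : C} {f g : coendObj V ⟶ Z} (h : ∀ i j, inc V i j ≫ f = inc V i j ≫ g) :
    f = g :=
  biproduct.hom_ext' _ _ fun x => h x.1 x.2

/-- The coaction is universal among the families indexed by the center with values in the
underlying category. -/
lemma isUniversalCoaction_forget (hV : IsFusion k V) :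
    IsUniversalCoaction (Center.forget C) (K := coendObj V) (fun M => coendCoact F M) where
  nat f := coendCoact_nat F hV f
  desc Z t ht := by
    obtain ⟨tm, htm⟩ : ∃ tm : ∀ M : Center C, M.1 ⟶ M.1 ⊗ Z, ∀ M, tm M = t M := ⟨_, fun _ => rfl⟩
    obtain ⟨tf, htf⟩ : ∃ tf : ∀ X : C, freeObj V X ⟶ freeObj V X ⊗ Z,
      ∀ X, tf X = t (free F hV X) := ⟨_, fun _ => rfl⟩
    have h2 {X Y : C} (f : X ⟶ Y) : freeMap V f ≫ tf Y = tf X ≫ freeMap V f ▷ Z := by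
      rw [htf, htf]
      exact ht (freeMapHom F hV f)
    have h3 (M : Center C) : freeCounit V M ≫ tm M = tf M.1 ≫ freeCounit V M ▷ Z := by
      rw [htf, htm]
      exact ht (freeCounitHom F hV M)
    -- The factorization is forced: its component at `(i,j)` is the given family on the free object
    -- of `V j`, restricted along the unit, projected to `i` and rotated.
    choose f hf using fun i j => exists_hatS_eq (freeUnit F (V j) ≫ tf (V j) ≫
      biproduct.π (fun i => ld (V i) ⊗ (V j ⊗ V i)) i ▷ Z)
    let g : coendObj V ⟶ Z := biproduct.desc fun x => f x.1 x.2
    have hg (i j) : inc V i j ≫ g = f i j := by simp [inc, g]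
    -- Both sides are natural in `X`, so the equation need only be tested on the members of `V`,
    -- where it defines `f`.
    have key (i : I) (X : C) : kapHat F i X (ld X) ≫ _ ◁ g = freeUnit F X ≫ tf X ≫
        biproduct.π (fun i => ld (V i) ⊗ (X ⊗ V i)) i ▷ Z := by
      apply (F.dec X).hom_ext
      intro j α
      rw [reassoc_of% kapHat_nat F hV i (ld (V j)), ← whisker_exchange, kapHat_self F hV,
        reassoc_of% hatS_comp, hg, hf, ← reassoc_of% freeUnit_freeMap F, reassoc_of% h2,
        ← comp_whiskerRight, freeMap, biproduct.map_π]
      simp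
    refine ⟨g, fun M => ?_⟩
    change coendCoact F M ≫ M.1 ◁ g = t M
    -- The family at `M` is unit, family at the free object, counit: naturality along the counit and
    -- the triangle identity give it back.
    calc _ = ∑ i, (kapHat F i M.1 (ld M.1) ≫ _ ◁ g) ≫ act M (V i) (ld (V i)) ▷ Z := by
          rw [coendCoact_eq, Preadditive.sum_comp]
          apply Finset.sum_congr rfl
          intro i _
          rw [Category.assoc, Category.assoc, whisker_exchange]
      _ = freeUnit F M.1 ≫ tf M.1 ≫ freeCounit V M ▷ Z := by
          simp only [key, freeCounit, sum_whiskerRight, Preadditive.comp_sum, Category.assoc,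
            comp_whiskerRight]
      _ = _ := by rw [← h3, reassoc_of% freeUnit_freeCounit F M, htm]
  ext Z f g h := by
    apply coendObj_hom_ext
    intro i j
    apply hatS_injective
    have h1 : freeCoact F hV (V j) ≫ freeObj V (V j) ◁ f =
      freeCoact F hV (V j) ≫ freeObj V (V j) ◁ g := h (free F hV (V j))
    -- The free object on `V j` already detects every summand with second label `j`.
    rw [← hatS_comp, ← hatS_comp, ← kapHat_self F hV, ← freeUnit_freeCoact F hV]
    simp only [Category.assoc, ← whisker_exchange]
    rw [reassoc_of% h1]

/-- A half braiding on the coend for which the coaction is a morphism of the center. -/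
lemma exists_halfBraiding (hV : IsFusion k V) : ∃ σ : HalfBraiding (coendObj V),
    ∀ (M : Center C) (Y : C), coendCoact F M ▷ Y ⊗≫ M.1 ◁ (σ.β Y).hom =
      (M.2.β Y).hom ≫ Y ◁ coendCoact F M ⊗≫ (M.2.β Y).inv ▷ coendObj V ⊗≫ 𝟙 _ := by
  have U := isUniversalCoaction_forget F hV
  have n {M N : Center C} (f : M ⟶ N) := coendCoact_nat F hV f
  -- For the coaction to be central, `σ` after it must be its conjugate by the half braiding of `M`.
  -- This conjugate is natural in `M`, so it factors through the universal coaction with parameter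
  -- `Y`.
  have h1 (Y : C) : ∃ f : coendObj V ⊗ Y ⟶ Y ⊗ coendObj V, ∀ M : Center C,
      coendCoact F M ▷ Y ⊗≫ M.1 ◁ f =
      (M.2.β Y).hom ≫ Y ◁ coendCoact F M ⊗≫ (M.2.β Y).inv ▷ coendObj V ⊗≫ 𝟙 _ := by
    refine U.descRight (W := Y) (W' := ld Y) (Z := Y ⊗ coendObj V)
      (fun M => (M.2.β Y).hom ≫ Y ◁ coendCoact F M ⊗≫ (M.2.β Y).inv ▷ coendObj V ⊗≫
        𝟙 (M.1 ⊗ Y ⊗ coendObj V)) ?_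
    intro M N f
    change f.f ▷ Y ≫ (N.2.β Y).hom ≫ Y ◁ coendCoact F N ⊗≫ (N.2.β Y).inv ▷ coendObj V ⊗≫
        𝟙 (N.1 ⊗ Y ⊗ coendObj V) = ((M.2.β Y).hom ≫ Y ◁ coendCoact F M ⊗≫
        (M.2.β Y).inv ▷ coendObj V ⊗≫ 𝟙 (M.1 ⊗ Y ⊗ coendObj V)) ≫ f.f ▷ _
    have hinv : Y ◁ f.f ≫ (N.2.β Y).inv = (M.2.β Y).inv ≫ f.f ▷ Y := by
      rw [Iso.comp_inv_eq, Category.assoc, f.comm, Iso.inv_hom_id_assoc]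
    calc _ = (f.f ▷ Y ≫ (N.2.β Y).hom) ≫ Y ◁ coendCoact F N ⊗≫ (N.2.β Y).inv ▷ coendObj V ⊗≫
        𝟙 (N.1 ⊗ Y ⊗ coendObj V) := by monoidal
      _ = (M.2.β Y).hom ≫ Y ◁ (f.f ≫ coendCoact F N) ⊗≫ (N.2.β Y).inv ▷ coendObj V ⊗≫
        𝟙 (N.1 ⊗ Y ⊗ coendObj V) := by rw [f.comm]; monoidal
      _ = (M.2.β Y).hom ≫ Y ◁ coendCoact F M ⊗≫ (Y ◁ f.f ≫ (N.2.β Y).inv) ▷ coendObj V ⊗≫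
        𝟙 (N.1 ⊗ Y ⊗ coendObj V) := by rw [n]; monoidal
      _ = _ := by rw [hinv]; monoidal
  choose σ hσ using h1
  refine ⟨LaxHB.toHalfBraiding ⟨σ, ?_, ?_, ?_⟩, fun M Y => hσ Y M⟩
  · intro Y Y' g
    refine U.extRight (W := Y) (W' := ld Y) ?_
    intro M
    change coendCoact F M ▷ Y ⊗≫ M.1 ◁ (_ ◁ g ≫ σ Y') = coendCoact F M ▷ Y ⊗≫ M.1 ◁ (σ Y ≫ g ▷ _)
    calc _ = (coendCoact F M ▷ Y ≫ _ ◁ g) ⊗≫ M.1 ◁ σ Y' := by monoidal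
      _ = M.1 ◁ g ≫ (coendCoact F M ▷ Y' ⊗≫ M.1 ◁ σ Y') := by rw [← whisker_exchange]; monoidal
      _ = (M.1 ◁ g ≫ (M.2.β Y').hom) ≫ Y' ◁ coendCoact F M ⊗≫
          (M.2.β Y').inv ▷ coendObj V ⊗≫ 𝟙 _ := by rw [hσ]; monoidal
      _ = (M.2.β Y).hom ≫ (g ▷ M.1 ≫ Y' ◁ coendCoact F M) ⊗≫
          (M.2.β Y').inv ▷ coendObj V ⊗≫ 𝟙 _ := by rw [M.2.naturality]; monoidal
      _ = (M.2.β Y).hom ≫ Y ◁ coendCoact F M ⊗≫ (g ▷ M.1 ≫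
          (M.2.β Y').inv) ▷ coendObj V ⊗≫ 𝟙 _ := by rw [← whisker_exchange]; monoidal
      _ = ((M.2.β Y).hom ≫ Y ◁ coendCoact F M ⊗≫ (M.2.β Y).inv ▷ coendObj V ⊗≫ 𝟙 _) ≫
          (M.1 ◁ (g ▷ _)) := by rw [inv_nat]; monoidal
      _ = _ := by rw [← hσ]; monoidal
  · intro Y Z
    refine U.extRight (W := Y ⊗ Z) (W' := ld Z ⊗ ld Y) ?_
    intro M
    change coendCoact F M ▷ (Y ⊗ Z) ⊗≫ M.1 ◁ σ (Y ⊗ Z) = coendCoact F M ▷ (Y ⊗ Z) ⊗≫ M.1 ◁ _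
    rw [hσ, M.2.monoidal, inv_mon]
    symm
    calc _ = 𝟙 _ ⊗≫ (coendCoact F M ▷ Y ⊗≫ M.1 ◁ σ Y) ▷ Z ⊗≫ (M.1 ⊗ Y) ◁ σ Z ⊗≫ 𝟙 _ := by
          monoidal
      _ = 𝟙 _ ⊗≫ ((M.2.β Y).hom ≫ Y ◁ coendCoact F M) ▷ Z ⊗≫
          ((M.2.β Y).inv ▷ (coendObj V ⊗ Z) ≫ (M.1 ⊗ Y) ◁ σ Z) ⊗≫ 𝟙 _ := by
          rw [hσ]; monoidal
      _ = 𝟙 _ ⊗≫ (M.2.β Y).hom ▷ Z ⊗≫ Y ◁ (coendCoact F M ▷ Z ⊗≫ M.1 ◁ σ Z) ⊗≫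
          (M.2.β Y).inv ▷ (Z ⊗ coendObj V) ⊗≫ 𝟙 _ := by
          rw [← whisker_exchange]; monoidal
      _ = _ := by rw [hσ]; monoidal
  · refine U.extRight (W := 𝟙_ C) (W' := 𝟙_ C) ?_
    intro M
    change coendCoact F M ▷ 𝟙_ C ⊗≫ M.1 ◁ σ (𝟙_ C) = coendCoact F M ▷ 𝟙_ C ⊗≫ M.1 ◁ _
    rw [hσ, hom_one, inv_one]
    monoidal

end Coend

/-! ### Universal coactions and coends -/

section Conversion
variable {D : Type u} [Category.{v} D] [MonoidalCategory.{v} D] [RightRigidCategory D]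

lemma coaction_eq_hat {K : D} (ι : ∀ X : D, ld X ⊗ X ⟶ K) (X : D) :
    coaction ι X = hat X (ld X) (ι X) := rfl

/-- Rotation is a bijection that matches dinaturality of a family with naturality of its coaction,
so the universal properties correspond. -/
lemma isCoend_of_isUniversalCoaction {K : D} (ι : ∀ X : D, ld X ⊗ X ⟶ K)
    (h : IsUniversalCoaction (𝟭 D) (K := K) (fun X => coaction ι X)) : IsCoend ι := by
  have e {Z : D} (π : ∀ X : D, ld X ⊗ X ⟶ Z) :
      (∀ {X Y : D} (f : X ⟶ Y), f ≫ coaction π Y = coaction π X ≫ f ▷ Z) ↔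
      ∀ {X Y : D} (f : X ⟶ Y), dualMap (ld X) (ld Y) f ▷ X ≫ π X = ld Y ◁ f ≫ π Y := by
    refine forall_congr' fun X => forall_congr' fun Y => forall_congr' fun f => ?_
    rw [coaction_eq_hat, coaction_eq_hat, comp_hat, hat_whiskerRight _ _ Y (ld Y)]
    exact ⟨fun h => (hat_injective _ _ h).symm, fun h => by rw [h]⟩
  have hι : ∀ {X Y : D} (f : X ⟶ Y), dualMap (ld X) (ld Y) f ▷ X ≫ ι X = ld Y ◁ f ≫ ι Y :=
    (e ι).1 fun f => h.nat f
  refine ⟨fun {X Y} f => hι f, ⟨?_⟩⟩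
  have hd (s : Cowedge (coendBifunctor D)) : ∃ f : K ⟶ s.pt, ∀ X, ι X ≫ f = s.π X := by
    obtain ⟨f, hf⟩ := h.desc s.pt (fun X => hat X (ld X) (s.π X)) ((e (fun X => s.π X)).2
      fun {X Y} f => s.condition f)
    refine ⟨f, fun X => hat_injective X (ld X) ?_⟩
    rw [← hat_comp]
    exact hf X
  choose f hf using hd
  refine Multicofork.IsColimit.mk _ f hf ?_
  intro s m hm
  apply h.ext
  intro X
  change coaction ι X ≫ X ◁ m = coaction ι X ≫ X ◁ f s
  refine (hat_comp X (ld X) (ι X) m).trans (Eq.trans ?_ (hat_comp X (ld X) (ι X) (f s)).symm)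
  rw [hf]
  exact congrArg (hat X (ld X)) (hm X)

/-- Two coends are isomorphic. -/
lemma IsCoend.nonempty_iso {K L : D} {ι : ∀ X : D, ld X ⊗ X ⟶ K} {κ : ∀ X : D, ld X ⊗ X ⟶ L}
    (h : IsCoend ι) (h' : IsCoend κ) : Nonempty (K ≅ L) := by
  obtain ⟨_, ⟨a⟩⟩ := h
  obtain ⟨_, ⟨b⟩⟩ := h'
  exact ⟨a.coconePointUniqueUpToIso b⟩

end Conversion
end CenterCoend


set_option linter.unusedSectionVars false

namespace CenterCoend
open Limits

section Tensor
variable {C : Type u} [Category.{v} C] [MonoidalCategory.{v} C]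

lemma center_tensor_braid (M N : Center C) (Y : C) : ((M ⊗ N).2.β Y).hom =
    𝟙 ((M.1 ⊗ N.1) ⊗ Y) ⊗≫ M.1 ◁ (N.2.β Y).hom ⊗≫ (M.2.β Y).hom ▷ N.1 ⊗≫
      𝟙 (Y ⊗ (M.1 ⊗ N.1)) := by
  rw [Center.tensor_β]
  simp only [Iso.trans_hom, whiskerLeftIso_hom, Iso.symm_hom, whiskerRightIso_hom]
  change (α_ M.1 N.1 Y).hom ≫ _ ≫ (α_ _ _ _).inv ≫ _ ≫ (α_ Y M.1 N.1).hom = _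
  monoidal

lemma center_comm {M N : Center C} (f : M ⟶ N) (Y : C) :
    f.f ▷ Y ≫ (N.2.β Y).hom = (M.2.β Y).hom ≫ Y ◁ f.f := f.comm Y

end Tensor

/-! ### The coend in the center -/

section Coend
variable {k : Type w'} [CommRing k] {C : Type u} [Category.{v} C] [Preadditive C]
    [Linear k C] [MonoidalCategory.{v} C] [MonoidalPreadditive C] [MonoidalLinear k C]
    [RigidCategory C] [HasFiniteBiproducts C] {I : Type w} [Fintype I] {V : I → C}
    (F : FusionChoices V)

/-- The coaction as a morphism of the center. -/
noncomputable def coactHom {σ : HalfBraiding (coendObj V)}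
    (hσ : ∀ (M : Center C) (Y : C), coendCoact F M ▷ Y ⊗≫ M.1 ◁ (σ.β Y).hom =
      (M.2.β Y).hom ≫ Y ◁ coendCoact F M ⊗≫ (M.2.β Y).inv ▷ coendObj V ⊗≫ 𝟙 _) (M : Center C) :
    M ⟶ M ⊗ coendCenter V σ where
  f := coendCoact F M
  comm Y := by
    rw [center_tensor_braid]
    change coendCoact F M ▷ Y ≫ (_ ⊗≫ M.1 ◁ (σ.β Y).hom ⊗≫ (M.2.β Y).hom ▷ coendObj V ⊗≫
      𝟙 (Y ⊗ (M.1 ⊗ coendObj V))) = _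
    calc _ = (coendCoact F M ▷ Y ⊗≫ M.1 ◁ (σ.β Y).hom) ⊗≫ (M.2.β Y).hom ▷ coendObj V ⊗≫
          𝟙 (Y ⊗ (M.1 ⊗ coendObj V)) := by monoidal
      _ = (M.2.β Y).hom ≫ Y ◁ coendCoact F M ⊗≫ ((M.2.β Y).inv ≫ (M.2.β Y).hom) ▷ coendObj V ⊗≫
          𝟙 (Y ⊗ (M.1 ⊗ coendObj V)) := by rw [hσ]; monoidal
      _ = _ := by rw [Iso.inv_hom_id]; monoidal

/-- Uniqueness is inherited from `C`. For existence, the factorization in `C` is shown to commute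
with half braidings: both composites agree after every coaction, because the given family is central
and `σ` was defined by conjugation. -/
lemma isUniversalCoaction_center (hV : IsFusion k V) {σ : HalfBraiding (coendObj V)}
    (hσ : ∀ (M : Center C) (Y : C), coendCoact F M ▷ Y ⊗≫ M.1 ◁ (σ.β Y).hom =
      (M.2.β Y).hom ≫ Y ◁ coendCoact F M ⊗≫ (M.2.β Y).inv ▷ coendObj V ⊗≫ 𝟙 _) :
    IsUniversalCoaction (𝟭 (Center C)) (K := coendCenter V σ) (fun M => coactHom F hσ M) where
  nat f := Center.ext _ _ (coendCoact_nat F hV f)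
  desc Z t ht := by
    obtain ⟨s, hs⟩ : ∃ s : ∀ M : Center C, M.1 ⟶ M.1 ⊗ Z.1, ∀ M, s M = (t M).f :=
      ⟨_, fun _ => rfl⟩
    obtain ⟨f, hf⟩ := (isUniversalCoaction_forget F hV).desc Z.1 (fun M => (t M).f)
      (fun f => congrArg Center.Hom.f (ht f))
    have hf' (M : Center C) : coendCoact F M ≫ M.1 ◁ f = s M := (hf M).trans (hs M).symm
    refine ⟨⟨f, fun Y => ?_⟩, fun M => Center.ext _ _ (hf M)⟩
    refine (isUniversalCoaction_forget F hV).extRight (W := Y) (W' := ld Y) fun M => ?_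
    change coendCoact F M ▷ Y ⊗≫ M.1 ◁ (f ▷ Y ≫ (Z.2.β Y).hom) =
      coendCoact F M ▷ Y ⊗≫ M.1 ◁ ((σ.β Y).hom ≫ Y ◁ f)
    have h1 : s M ▷ Y ≫ (𝟙 ((M.1 ⊗ Z.1) ⊗ Y) ⊗≫ M.1 ◁ (Z.2.β Y).hom ⊗≫
        (M.2.β Y).hom ▷ Z.1 ⊗≫ 𝟙 (Y ⊗ (M.1 ⊗ Z.1))) = (M.2.β Y).hom ≫ Y ◁ s M := by
      rw [hs, ← center_tensor_braid M Z Y]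
      exact center_comm (t M) Y
    symm
    calc _ = (coendCoact F M ▷ Y ⊗≫ M.1 ◁ (σ.β Y).hom) ≫ M.1 ◁ (Y ◁ f) := by monoidal
      _ = (M.2.β Y).hom ≫ Y ◁ coendCoact F M ⊗≫ ((M.2.β Y).inv ▷ coendObj V ≫ _ ◁ f) ⊗≫ 𝟙 _ := by
          rw [hσ]; monoidal
      _ = ((M.2.β Y).hom ≫ Y ◁ (coendCoact F M ≫ M.1 ◁ f)) ⊗≫ (M.2.β Y).inv ▷ Z.1 ⊗≫ 𝟙 _ := by
          rw [← whisker_exchange]; monoidal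
      _ = s M ▷ Y ⊗≫ M.1 ◁ (Z.2.β Y).hom ⊗≫
          ((M.2.β Y).hom ≫ (M.2.β Y).inv) ▷ Z.1 ⊗≫ 𝟙 _ := by
          rw [hf', ← h1]; monoidal
      _ = _ := by rw [Iso.hom_inv_id, ← hf']; monoidal
  ext Z f g h := Center.ext _ _ <| (isUniversalCoaction_forget F hV).ext Z.1 f.f g.f fun M =>
    congrArg Center.Hom.f (h M)

/-- The universal dinatural transformation as a morphism of the center. -/
noncomputable def coendHom {σ : HalfBraiding (coendObj V)}
    (hσ : ∀ (M : Center C) (Y : C), coendCoact F M ▷ Y ⊗≫ M.1 ◁ (σ.β Y).hom =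
      (M.2.β Y).hom ≫ Y ◁ coendCoact F M ⊗≫ (M.2.β Y).inv ▷ coendObj V ⊗≫ 𝟙 _) (M : Center C) :
    ld M ⊗ M ⟶ coendCenter V σ :=
  ld M ◁ coactHom F hσ M ≫ (α_ _ _ _).inv ≫ ε_ M (ld M) ▷ coendCenter V σ ≫ (λ_ _).hom

lemma unhat_hat {D : Type u} [Category.{v} D] [MonoidalCategory.{v} D] (A A' : D)
    [ExactPairing A A'] {X Z : D} (g : A' ⊗ X ⟶ Z) :
    A' ◁ hat A A' g ≫ (α_ _ _ _).inv ≫ ε_ A A' ▷ Z ≫ (λ_ Z).hom = g := by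
  calc _ = 𝟙 _ ⊗≫ (A' ◁ η_ A A') ▷ X ⊗≫ (((A' ⊗ A) ◁ g) ≫ ε_ A A' ▷ Z) ⊗≫ 𝟙 Z := by
        unfold hat; monoidal
    _ = 𝟙 _ ⊗≫ (A' ◁ η_ A A' ⊗≫ ε_ A A' ▷ A') ▷ X ⊗≫ g := by
        rw [whisker_exchange]; monoidal
    _ = _ := by rw [ExactPairing.coevaluation_evaluation'']; monoidal

lemma hat_unhat {D : Type u} [Category.{v} D] [MonoidalCategory.{v} D] (A A' : D)
    [ExactPairing A A'] {X Z : D} (g : X ⟶ A ⊗ Z) :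
    hat A A' (A' ◁ g ≫ (α_ _ _ _).inv ≫ ε_ A A' ▷ Z ≫ (λ_ Z).hom) = g := by
  obtain ⟨f, rfl⟩ := exists_hat_eq A A' g
  rw [unhat_hat]

lemma coendHom_f {σ : HalfBraiding (coendObj V)}
    (hσ : ∀ (M : Center C) (Y : C), coendCoact F M ▷ Y ⊗≫ M.1 ◁ (σ.β Y).hom =
      (M.2.β Y).hom ≫ Y ◁ coendCoact F M ⊗≫ (M.2.β Y).inv ▷ coendObj V ⊗≫ 𝟙 _) (M : Center C) :
    (coendHom F hσ M).f = coendMap F M := by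
  have h : (coendHom F hσ M).f = ld M.1 ◁ coendCoact F M ≫ (α_ _ _ _).inv ≫
      ε_ M.1 (ld M.1) ▷ coendObj V ≫ (λ_ _).hom := by
    unfold coendHom
    rw [Center.comp_f, Center.comp_f, Center.comp_f, Center.associator_inv_f,
      Center.leftUnitor_hom_f, Center.whiskerLeft_f, Center.whiskerRight_f]
    rfl
  rw [h, coendCoact, unhat_hat]

lemma coaction_coendHom {σ : HalfBraiding (coendObj V)}
    (hσ : ∀ (M : Center C) (Y : C), coendCoact F M ▷ Y ⊗≫ M.1 ◁ (σ.β Y).hom =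
      (M.2.β Y).hom ≫ Y ◁ coendCoact F M ⊗≫ (M.2.β Y).inv ▷ coendObj V ⊗≫ 𝟙 _) (M : Center C) :
    coaction (coendHom F hσ) M = coactHom F hσ M := by
  rw [coaction_eq_hat, coendHom, hat_unhat]

lemma exists_coend_center (hV : IsFusion k V) : ∃ (σ : HalfBraiding (coendObj V))
    (ι : ∀ M : Center C, ld M ⊗ M ⟶ coendCenter V σ),
    (∀ (M : Center C) (Y : C), coendCoact F M ▷ Y ⊗≫ M.1 ◁ (σ.β Y).hom =
      (M.2.β Y).hom ≫ Y ◁ coendCoact F M ⊗≫ (M.2.β Y).inv ▷ coendObj V ⊗≫ 𝟙 _) ∧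
    (∀ M, (ι M).f = coendMap F M) ∧ (∀ M, (coaction ι M).f = coendCoact F M) ∧
    IsUniversalCoaction (𝟭 (Center C)) (K := coendCenter V σ) (fun M => coaction ι M) := by
  obtain ⟨σ, hσ⟩ := exists_halfBraiding F hV
  refine ⟨σ, coendHom F hσ, hσ, coendHom_f F hσ, fun M => ?_, ?_⟩
  · rw [coaction_coendHom]; rfl
  · simp only [coaction_coendHom]
    exact isUniversalCoaction_center F hV hσ

end Coend
end CenterCoend


set_option linter.unusedSectionVars false

namespace CenterCoend
open Limits

/-! ### Right evaluations and traces of a sovereign structure -/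

section Sovereign
variable {D : Type u} [Category.{v} D] [MonoidalCategory.{v} D]

/-- A dual of a morphism to the unit, for a dual pair, is given by the coevaluation. -/
lemma dualMap_ε (X X' X'' : D) [ExactPairing X X'] [ExactPairing X' X''] :
    dualMap (X' ⊗ X'') (𝟙_ D) (ε_ X X') = η_ X' X'' := by
  symm
  apply dualMap_unique
  rw [eval_tensor, eval_unit]
  calc _ = 𝟙 (𝟙_ D ⊗ (X' ⊗ X)) ⊗≫ (η_ X' X'' ▷ X' ⊗≫ X' ◁ ε_ X' X'') ▷ X ⊗≫ ε_ X X' := by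
        monoidal
    _ = _ := by rw [ExactPairing.evaluation_coevaluation'']; monoidal

variable [RightRigidCategory D]

lemma ldTensor_comp {X Y Z W : D} (f : X ⊗ Y ⟶ Z ⊗ W) :
    dualMap (ld Y ⊗ ld X) (ld W ⊗ ld Z) f ≫ ldTensor X Y =
      ldTensor Z W ≫ dualMap (ld (X ⊗ Y)) (ld (Z ⊗ W)) f := by
  rw [ldTensor, ← dualMap_comp, ldTensor, ← dualMap_comp, Category.id_comp, Category.comp_id]

lemma ldTensor_inv (X Y : D) :
    ldTensor X Y ≫ dualMap (ld Y ⊗ ld X) (ld (X ⊗ Y)) (𝟙 (X ⊗ Y)) = 𝟙 _ := by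
  rw [ldTensor, ← dualMap_comp, Category.id_comp, dualMap_id]

lemma ldTensor_inv' (X Y : D) :
    dualMap (ld Y ⊗ ld X) (ld (X ⊗ Y)) (𝟙 (X ⊗ Y)) ≫ ldTensor X Y = 𝟙 _ := by
  rw [ldTensor, ← dualMap_comp, Category.id_comp, dualMap_id]

namespace SovereignStructure
variable (φ : SovereignStructure D)

/-- The evaluation of the right dual. -/
def evt (X : D) : X ⊗ ld X ⟶ 𝟙_ D := (φ.iso X).hom ▷ ld X ≫ ε_ (ld X) (ld (ld X))

/-- The coevaluation of the right dual. -/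
def coevt (X : D) : 𝟙_ D ⟶ ld X ⊗ X := η_ (ld X) (ld (ld X)) ≫ ld X ◁ (φ.iso X).inv

lemma coevt_evt (X : D) : φ.coevt X ▷ ld X ⊗≫ ld X ◁ φ.evt X = ⊗𝟙.hom := by
  calc _ = η_ (ld X) (ld (ld X)) ▷ ld X ⊗≫ ld X ◁ ((φ.iso X).inv ≫ (φ.iso X).hom) ▷ ld X ⊗≫
        ld X ◁ ε_ (ld X) (ld (ld X)) := by unfold evt coevt; monoidal
    _ = η_ (ld X) (ld (ld X)) ▷ ld X ⊗≫ ld X ◁ ε_ (ld X) (ld (ld X)) := by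
        rw [Iso.inv_hom_id]; monoidal
    _ = _ := ExactPairing.evaluation_coevaluation'' _ _

lemma evt_ext {X W : D} {a b : W ⟶ X} (h : a ▷ ld X ≫ φ.evt X = b ▷ ld X ≫ φ.evt X) : a = b := by
  rw [← cancel_mono (φ.iso X).hom]
  apply dual_ext (X := ld X) (ld (ld X))
  simpa [evt] using h

lemma evt_dinat {X Y : D} (f : X ⟶ Y) :
    X ◁ dualMap (ld X) (ld Y) f ≫ φ.evt X = f ▷ ld Y ≫ φ.evt Y := by
  unfold evt
  rw [← comp_whiskerRight_assoc, φ.naturality, comp_whiskerRight, Category.assoc, dualMap_eval,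
    whisker_exchange_assoc]

lemma coevt_dinat {X Y : D} (f : X ⟶ Y) :
    φ.coevt Y ≫ dualMap (ld X) (ld Y) f ▷ Y = φ.coevt X ≫ ld X ◁ f := by
  have n : (φ.iso X).inv ≫ f = dualMap (ld (ld Y)) (ld (ld X)) (dualMap (ld X) (ld Y) f) ≫
      (φ.iso Y).inv := by
    rw [Iso.inv_comp_eq, ← Category.assoc, ← φ.naturality, Category.assoc, Iso.hom_inv_id,
      Category.comp_id]
  unfold coevt
  rw [Category.assoc, Category.assoc, ← MonoidalCategory.whiskerLeft_comp, n, whisker_exchange,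
    MonoidalCategory.whiskerLeft_comp, reassoc_of% coeval_dualMap]

/-- The monoidality of the sovereign structure, expressed by nested evaluations. -/
lemma evt_tensor (X Y : D) : (X ⊗ Y) ◁ ldTensor X Y ≫ φ.evt (X ⊗ Y) =
    𝟙 _ ⊗≫ X ◁ φ.evt Y ▷ ld X ⊗≫ φ.evt X := by
  have h := dualMap_eval (ld (ld X) ⊗ ld (ld Y)) (ld (ld (X ⊗ Y))) (ldTensor X Y)
  calc _ = (φ.iso (X ⊗ Y)).hom ▷ (ld Y ⊗ ld X) ≫ (ld (ld (X ⊗ Y)) ◁ ldTensor X Y ≫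
        ε_ (ld (X ⊗ Y)) (ld (ld (X ⊗ Y)))) := by
        unfold evt; rw [whisker_exchange_assoc]
    _ = ((φ.iso (X ⊗ Y)).hom ≫ lldTensor X Y) ▷ (ld Y ⊗ ld X) ≫
        ε_ (ld Y ⊗ ld X) (ld (ld X) ⊗ ld (ld Y)) := by
        rw [← h, comp_whiskerRight, Category.assoc]; rfl
    _ = 𝟙 ((X ⊗ Y) ⊗ (ld Y ⊗ ld X)) ⊗≫ X ◁ φ.evt Y ▷ ld X ⊗≫ φ.evt X := by
        rw [φ.tensor, eval_tensor, MonoidalCategory.tensorHom_def']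
        calc _ = 𝟙 ((X ⊗ Y) ⊗ (ld Y ⊗ ld X)) ⊗≫ X ◁ (φ.iso Y).hom ▷ (ld Y ⊗ ld X) ⊗≫
              ((φ.iso X).hom ▷ ((ld (ld Y) ⊗ ld Y) ⊗ ld X) ≫
              ld (ld X) ◁ (ε_ (ld Y) (ld (ld Y)) ▷ ld X)) ⊗≫ ε_ (ld X) (ld (ld X)) := by
              monoidal
          _ = _ := by rw [← whisker_exchange]; unfold evt; monoidal

lemma evt_unit : 𝟙_ D ◁ ldUnit ≫ φ.evt (𝟙_ D) = (λ_ (𝟙_ D)).hom := by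
  have h := dualMap_eval (𝟙_ D) (ld (ld (𝟙_ D))) (ldUnit (D := D))
  calc _ = (φ.iso (𝟙_ D)).hom ▷ 𝟙_ D ≫ (ld (ld (𝟙_ D)) ◁ ldUnit ≫
        ε_ (ld (𝟙_ D)) (ld (ld (𝟙_ D)))) := by
        unfold evt; rw [whisker_exchange_assoc]
    _ = ((φ.iso (𝟙_ D)).hom ≫ lldUnit) ▷ 𝟙_ D ≫ ε_ (𝟙_ D) (𝟙_ D) := by
        rw [← h, comp_whiskerRight, Category.assoc]; rfl
    _ = _ := by rw [φ.unit, eval_unit]; monoidal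

/-- Dinaturality of the right evaluations along `f` itself, together with their values on tensor
products and on the unit, expresses any pairing through its dual. -/
lemma pairing_eq {X Y : D} (f : X ⊗ Y ⟶ 𝟙_ D) :
    f = (ρ_ _).inv ≫ (X ⊗ Y) ◁ dualMap (ld Y ⊗ ld X) (𝟙_ D) f ⊗≫ X ◁ φ.evt Y ▷ ld X ⊗≫
      φ.evt X := by
  have h := φ.evt_dinat f
  have h1 : dualMap (ld Y ⊗ ld X) (𝟙_ D) f ≫ ldTensor X Y =
      ldUnit ≫ dualMap (ld (X ⊗ Y)) (ld (𝟙_ D)) f := by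
    rw [ldTensor, ← dualMap_comp, ldUnit, ← dualMap_comp, Category.id_comp, Category.comp_id]
  symm
  calc _ = (ρ_ _).inv ≫ (X ⊗ Y) ◁ dualMap (ld Y ⊗ ld X) (𝟙_ D) f ≫ (X ⊗ Y) ◁ ldTensor X Y ≫
        φ.evt (X ⊗ Y) := by rw [evt_tensor]; monoidal
    _ = (ρ_ _).inv ≫ ((X ⊗ Y) ◁ ldUnit ≫ f ▷ ld (𝟙_ D)) ≫ φ.evt (𝟙_ D) := by
        rw [← MonoidalCategory.whiskerLeft_comp_assoc, h1,
          MonoidalCategory.whiskerLeft_comp_assoc, h, Category.assoc]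
    _ = (ρ_ _).inv ≫ f ▷ 𝟙_ D ≫ 𝟙_ D ◁ ldUnit ≫ φ.evt (𝟙_ D) := by
        rw [whisker_exchange, Category.assoc]
    _ = _ := by rw [evt_unit]; monoidal

/-- It says that the component at `ld X` is inverse to the dual of the component at `X`. It follows
from `pairing_eq` for the evaluation, whose dual is a coevaluation; the zigzag identity finishes. -/
lemma evt_ld (X : D) : ld X ◁ (φ.iso X).hom ≫ φ.evt (ld X) = ε_ X (ld X) := by
  have h := φ.pairing_eq (ε_ X (ld X))
  rw [dualMap_ε X (ld X) (ld (ld X))] at h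
  rw [h]
  symm
  calc _ = 𝟙 (ld X ⊗ X) ⊗≫ ld X ◁ (X ◁ η_ (ld X) (ld (ld X)) ⊗≫ φ.evt X ▷ ld (ld X)) ⊗≫
        φ.evt (ld X) := by monoidal
    _ = 𝟙 (ld X ⊗ X) ⊗≫ ld X ◁ ((X ◁ η_ (ld X) (ld (ld X)) ≫ (φ.iso X).hom ▷ _) ⊗≫
        ε_ (ld X) (ld (ld X)) ▷ ld (ld X)) ⊗≫ φ.evt (ld X) := by unfold evt; monoidal
    _ = 𝟙 (ld X ⊗ X) ⊗≫ ld X ◁ ((φ.iso X).hom ⊗≫ (ld (ld X) ◁ η_ (ld X) (ld (ld X)) ⊗≫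
        ε_ (ld X) (ld (ld X)) ▷ ld (ld X))) ⊗≫ φ.evt (ld X) := by
        rw [whisker_exchange]; monoidal
    _ = _ := by rw [ExactPairing.coevaluation_evaluation'']; monoidal

lemma rightTrace_eq {X : D} (f : X ⟶ X) :
    φ.rightTrace f = η_ X (ld X) ≫ f ▷ ld X ≫ φ.evt X := by
  unfold rightTrace evt
  rw [comp_whiskerRight, Category.assoc]

lemma leftTrace_eq {X : D} (f : X ⟶ X) :
    φ.leftTrace f = φ.coevt X ≫ ld X ◁ f ≫ ε_ X (ld X) := by
  unfold leftTrace coevt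
  rw [MonoidalCategory.whiskerLeft_comp, Category.assoc, Category.assoc]

lemma rightTrace_comm {X Y : D} (f : X ⟶ Y) (g : Y ⟶ X) :
    φ.rightTrace (f ≫ g) = φ.rightTrace (g ≫ f) := by
  rw [rightTrace_eq, rightTrace_eq, comp_whiskerRight, Category.assoc, ← φ.evt_dinat g,
    ← whisker_exchange_assoc, reassoc_of% coeval_dualMap (ld Y) (ld X) g, comp_whiskerRight,
    Category.assoc]

lemma leftTrace_comm {X Y : D} (f : X ⟶ Y) (g : Y ⟶ X) :
    φ.leftTrace (f ≫ g) = φ.leftTrace (g ≫ f) := by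
  rw [leftTrace_eq, leftTrace_eq, MonoidalCategory.whiskerLeft_comp, Category.assoc,
    ← dualMap_eval (ld Y) (ld X) g, whisker_exchange_assoc,
    reassoc_of% φ.coevt_dinat g, MonoidalCategory.whiskerLeft_comp, Category.assoc]

/-- By `evt_ld` the right evaluation of `ld X` is the ordinary evaluation of `X` up to the sovereign
isomorphism, so closing the dual on the right closes the morphism on the left. No sphericality is
needed. -/
lemma rightTrace_dualMap {X : D} (f : X ⟶ X) :
    φ.rightTrace (dualMap (ld X) (ld X) f) = φ.leftTrace f := by
  have h : φ.evt (ld X) = ld X ◁ (φ.iso X).inv ≫ ε_ X (ld X) := by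
    rw [← φ.evt_ld, ← MonoidalCategory.whiskerLeft_comp_assoc, Iso.inv_hom_id]
    simp
  rw [rightTrace_eq, h, leftTrace_eq, ← whisker_exchange_assoc, dualMap_eval, coevt,
    Category.assoc]

end SovereignStructure
end Sovereign

/-! ### The twist as a comparison of two right evaluations -/

section BraidedTwist
variable {D : Type u} [Category.{v} D] [MonoidalCategory.{v} D] [BraidedCategory D]

/-- The evaluation `X ⊗ X' ⟶ 𝟙` obtained by means of the braiding. -/
def bev (X X' : D) [ExactPairing X X'] : X ⊗ X' ⟶ 𝟙_ D := (β_ X' X).inv ≫ ε_ X X'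

/-- The coevaluation `𝟙 ⟶ X' ⊗ X` obtained by means of the braiding. -/
def bcoev (X X' : D) [ExactPairing X X'] : 𝟙_ D ⟶ X' ⊗ X := η_ X X' ≫ (β_ X X').hom

lemma braid_inv_nat {X X' Y Y' : D} (f : X ⟶ X') (g : Y ⟶ Y') :
    (f ⊗ₘ g) ≫ (β_ Y' X').inv = (β_ Y X).inv ≫ (g ⊗ₘ f) := by
  rw [Iso.comp_inv_eq, Category.assoc, BraidedCategory.braiding_naturality, Iso.inv_hom_id_assoc]

lemma ε_braid (X X' W : D) [ExactPairing X X'] :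
    𝟙 ((X' ⊗ X) ⊗ W) ⊗≫ X' ◁ (β_ X W).hom ⊗≫ (β_ X' W).hom ▷ X ⊗≫ W ◁ ε_ X X' =
      ε_ X X' ▷ W ⊗≫ 𝟙 (W ⊗ 𝟙_ D) := by
  calc _ = (β_ (X' ⊗ X) W).hom ≫ W ◁ ε_ X X' := by rw [braiding_tensor_left]; monoidal
    _ = _ := by
      rw [← BraidedCategory.braiding_naturality_left, braiding_tensorUnit_left]; monoidal

lemma braid_η (X X' W : D) [ExactPairing X X'] :
    η_ X X' ▷ W ⊗≫ X ◁ (β_ X' W).hom ⊗≫ (β_ X W).hom ▷ X' =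
      𝟙 (𝟙_ D ⊗ W) ⊗≫ W ◁ η_ X X' ⊗≫ 𝟙 ((W ⊗ X) ⊗ X') := by
  calc _ = (η_ X X' ▷ W ≫ (β_ (X ⊗ X') W).hom) ⊗≫ 𝟙 ((W ⊗ X) ⊗ X') := by
        rw [braiding_tensor_left]; monoidal
    _ = _ := by
      rw [BraidedCategory.braiding_naturality_left, braiding_tensorUnit_left]; monoidal

lemma braid_η' (X X' W : D) [ExactPairing X X'] :
    W ◁ η_ X X' ⊗≫ (β_ W X).hom ▷ X' ⊗≫ X ◁ (β_ W X').hom =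
      𝟙 (W ⊗ 𝟙_ D) ⊗≫ η_ X X' ▷ W ⊗≫ 𝟙 (X ⊗ (X' ⊗ W)) := by
  calc _ = (W ◁ η_ X X' ≫ (β_ W (X ⊗ X')).hom) ⊗≫ 𝟙 (X ⊗ (X' ⊗ W)) := by
        rw [braiding_tensor_right]; monoidal
    _ = _ := by
      rw [BraidedCategory.braiding_naturality_right, braiding_tensorUnit_right]; monoidal

lemma bev_dinat {X Y : D} (X' Y' : D) [ExactPairing X X'] [ExactPairing Y Y'] (f : X ⟶ Y) :
    X ◁ dualMap X' Y' f ≫ bev X X' = f ▷ Y' ≫ bev Y Y' := by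
  unfold bev
  rw [← id_tensorHom, reassoc_of% braid_inv_nat, tensorHom_id, dualMap_eval, ← tensorHom_id,
    reassoc_of% braid_inv_nat, id_tensorHom]

lemma bcoev_bev (X X' : D) [ExactPairing X X'] : bcoev X X' ▷ X' ⊗≫ X' ◁ bev X X' = ⊗𝟙.hom := by
  have h : η_ X X' ▷ X' = 𝟙 _ ⊗≫ (X' ◁ η_ X X' ⊗≫ (β_ X' X).hom ▷ X' ⊗≫ X ◁ (β_ X' X').hom) ⊗≫
      𝟙 ((X ⊗ X') ⊗ X') := by rw [braid_η']; monoidal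
  calc _ = η_ X X' ▷ X' ⊗≫ (β_ X X').hom ▷ X' ⊗≫ X' ◁ (β_ X' X).inv ⊗≫ X' ◁ ε_ X X' := by
        unfold bcoev bev; monoidal
    _ = 𝟙 (𝟙_ D ⊗ X') ⊗≫ X' ◁ η_ X X' ⊗≫ ((β_ X' X).hom ▷ X' ≫ (𝟙 _ ⊗≫ X ◁ (β_ X' X').hom ⊗≫
        (β_ X X').hom ▷ X' ⊗≫ 𝟙 (X' ⊗ (X ⊗ X')))) ⊗≫ X' ◁ (β_ X' X).inv ⊗≫ X' ◁ ε_ X X' := by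
        rw [h]; monoidal
    _ = 𝟙 (𝟙_ D ⊗ X') ⊗≫ X' ◁ η_ X X' ⊗≫ ((β_ X' X).hom ▷ X' ≫ (β_ (X ⊗ X') X').hom) ⊗≫
        X' ◁ (β_ X' X).inv ⊗≫ X' ◁ ε_ X X' := by
        rw [braiding_tensor_left]
    _ = 𝟙 (𝟙_ D ⊗ X') ⊗≫ X' ◁ η_ X X' ⊗≫ (β_ (X' ⊗ X) X').hom ⊗≫
        X' ◁ ((β_ X' X).hom ≫ (β_ X' X).inv) ⊗≫ X' ◁ ε_ X X' := by
        rw [BraidedCategory.braiding_naturality_left]; monoidal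
    _ = 𝟙 (𝟙_ D ⊗ X') ⊗≫ X' ◁ η_ X X' ⊗≫ ((β_ (X' ⊗ X) X').hom ≫ X' ◁ ε_ X X') := by
        rw [Iso.hom_inv_id]; monoidal
    _ = 𝟙 (𝟙_ D ⊗ X') ⊗≫ (X' ◁ η_ X X' ⊗≫ ε_ X X' ▷ X') ⊗≫ 𝟙 _ := by
        rw [← BraidedCategory.braiding_naturality_left, braiding_tensorUnit_left]; monoidal
    _ = _ := by rw [ExactPairing.coevaluation_evaluation'']; monoidal

lemma bev_bcoev (X X' : D) [ExactPairing X X'] : X ◁ bcoev X X' ⊗≫ bev X X' ▷ X = ⊗𝟙.hom := by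
  have h : X ◁ η_ X X' = 𝟙 _ ⊗≫ (η_ X X' ▷ X ⊗≫ X ◁ (β_ X' X).hom ⊗≫ (β_ X X).hom ▷ X') ⊗≫
      𝟙 (X ⊗ (X ⊗ X')) := by rw [braid_η]; monoidal
  calc _ = X ◁ η_ X X' ⊗≫ X ◁ (β_ X X').hom ⊗≫ (β_ X' X).inv ▷ X ⊗≫ ε_ X X' ▷ X := by
        unfold bcoev bev; monoidal
    _ = 𝟙 (X ⊗ 𝟙_ D) ⊗≫ η_ X X' ▷ X ⊗≫ X ◁ (β_ X' X).hom ⊗≫ ((𝟙 (X ⊗ (X ⊗ X')) ⊗≫ (β_ X X).hom ▷ X' ⊗≫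
        X ◁ (β_ X X').hom ⊗≫ 𝟙 ((X ⊗ X') ⊗ X)) ≫ (β_ X' X).inv ▷ X) ⊗≫ ε_ X X' ▷ X := by
        rw [h]; monoidal
    _ = 𝟙 (X ⊗ 𝟙_ D) ⊗≫ η_ X X' ▷ X ⊗≫ X ◁ (β_ X' X).hom ⊗≫ ((β_ X (X ⊗ X')).hom ≫
        (β_ X' X).inv ▷ X) ⊗≫ ε_ X X' ▷ X := by
        rw [braiding_tensor_right]
    _ = 𝟙 (X ⊗ 𝟙_ D) ⊗≫ η_ X X' ▷ X ⊗≫ X ◁ ((β_ X' X).hom ≫ (β_ X' X).inv) ⊗≫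
        ((β_ X (X' ⊗ X)).hom ≫ ε_ X X' ▷ X) := by
        rw [← BraidedCategory.braiding_naturality_right]; monoidal
    _ = 𝟙 (X ⊗ 𝟙_ D) ⊗≫ (η_ X X' ▷ X ⊗≫ X ◁ ε_ X X') ⊗≫ 𝟙 _ := by
        rw [← BraidedCategory.braiding_naturality_right, braiding_tensorUnit_right,
          Iso.hom_inv_id]; monoidal
    _ = _ := by rw [ExactPairing.evaluation_coevaluation'']; monoidal

/-- The braided evaluations are not multiplicative: pulling the inner evaluation through the
crossings leaves exactly a double braiding. This is the source of the double braiding in the tensor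
rule of the twist. -/
lemma bev_tensor (X X' Y Y' : D) [ExactPairing X X'] [ExactPairing Y Y'] :
    bev (X ⊗ Y) (Y' ⊗ X') = ((β_ X Y).hom ≫ (β_ Y X).hom) ▷ (Y' ⊗ X') ⊗≫
      X ◁ bev Y Y' ▷ X' ⊗≫ bev X X' := by
  have h1 : (β_ Y' X).hom ▷ Y ⊗≫ X ◁ ε_ Y Y' =
      𝟙 _ ⊗≫ Y' ◁ (β_ Y X).inv ⊗≫ ε_ Y Y' ▷ X ⊗≫ 𝟙 _ := by
    calc _ = 𝟙 ((Y' ⊗ X) ⊗ Y) ⊗≫ Y' ◁ ((β_ Y X).inv ≫ (β_ Y X).hom) ⊗≫ (β_ Y' X).hom ▷ Y ⊗≫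
          X ◁ ε_ Y Y' := by rw [Iso.inv_hom_id]; monoidal
      _ = 𝟙 ((Y' ⊗ X) ⊗ Y) ⊗≫ Y' ◁ (β_ Y X).inv ⊗≫ (𝟙 ((Y' ⊗ Y) ⊗ X) ⊗≫ Y' ◁ (β_ Y X).hom ⊗≫
          (β_ Y' X).hom ▷ Y ⊗≫ X ◁ ε_ Y Y') := by monoidal
      _ = _ := by rw [ε_braid]
  have h2 : (β_ X' Y).hom ▷ X ⊗≫ Y ◁ ε_ X X' =
      𝟙 _ ⊗≫ X' ◁ (β_ X Y).inv ⊗≫ ε_ X X' ▷ Y ⊗≫ 𝟙 _ := by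
    calc _ = 𝟙 ((X' ⊗ Y) ⊗ X) ⊗≫ X' ◁ ((β_ X Y).inv ≫ (β_ X Y).hom) ⊗≫ (β_ X' Y).hom ▷ X ⊗≫
          Y ◁ ε_ X X' := by rw [Iso.inv_hom_id]; monoidal
      _ = 𝟙 ((X' ⊗ Y) ⊗ X) ⊗≫ X' ◁ (β_ X Y).inv ⊗≫ (𝟙 ((X' ⊗ X) ⊗ Y) ⊗≫ X' ◁ (β_ X Y).hom ⊗≫
          (β_ X' Y).hom ▷ X ⊗≫ Y ◁ ε_ X X') := by monoidal
      _ = _ := by rw [ε_braid]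
  have h3 : (β_ (Y' ⊗ X') (X ⊗ Y)).hom ⊗≫ X ◁ bev Y Y' ▷ X' ⊗≫ bev X X' =
      (Y' ⊗ X') ◁ ((β_ Y X).inv ≫ (β_ X Y).inv) ≫ ε_ (X ⊗ Y) (Y' ⊗ X') := by
    calc _ = 𝟙 ((Y' ⊗ X') ⊗ (X ⊗ Y)) ⊗≫ Y' ◁ (𝟙 (X' ⊗ (X ⊗ Y)) ⊗≫ (β_ X' X).hom ▷ Y ⊗≫
          X ◁ (β_ X' Y).hom ⊗≫ 𝟙 ((X ⊗ Y) ⊗ X')) ⊗≫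
          (β_ Y' X).hom ▷ (Y ⊗ X') ⊗≫ X ◁ ((β_ Y' Y).hom ≫ (β_ Y' Y).inv) ▷ X' ⊗≫
          X ◁ ε_ Y Y' ▷ X' ⊗≫ bev X X' := by
          rw [braiding_tensor_left, braiding_tensor_right, braiding_tensor_right]
          unfold bev
          monoidal
      _ = 𝟙 ((Y' ⊗ X') ⊗ (X ⊗ Y)) ⊗≫ Y' ◁ (β_ X' (X ⊗ Y)).hom ⊗≫
          ((β_ Y' X).hom ▷ Y ⊗≫ X ◁ ε_ Y Y') ▷ X' ⊗≫ bev X X' := by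
          rw [← braiding_tensor_right X' X Y, Iso.hom_inv_id]; monoidal
      _ = 𝟙 ((Y' ⊗ X') ⊗ (X ⊗ Y)) ⊗≫ Y' ◁ ((β_ X' (X ⊗ Y)).hom ≫ (β_ Y X).inv ▷ X') ⊗≫
          (ε_ Y Y' ▷ (X ⊗ X') ≫ 𝟙_ D ◁ bev X X') ⊗≫ 𝟙 _ := by
          rw [h1]; monoidal
      _ = 𝟙 ((Y' ⊗ X') ⊗ (X ⊗ Y)) ⊗≫ Y' ◁ (X' ◁ (β_ Y X).inv ≫ (β_ X' (Y ⊗ X)).hom) ⊗≫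
          (Y' ⊗ Y) ◁ bev X X' ⊗≫ ε_ Y Y' := by
          rw [← whisker_exchange, ← BraidedCategory.braiding_naturality_right]; monoidal
      _ = 𝟙 ((Y' ⊗ X') ⊗ (X ⊗ Y)) ⊗≫ Y' ◁ (X' ◁ (β_ Y X).inv ⊗≫ (β_ X' Y).hom ▷ X ⊗≫
          Y ◁ ((β_ X' X).hom ≫ (β_ X' X).inv) ⊗≫ Y ◁ ε_ X X') ⊗≫ ε_ Y Y' := by
          rw [braiding_tensor_right]; unfold bev; monoidal
      _ = 𝟙 ((Y' ⊗ X') ⊗ (X ⊗ Y)) ⊗≫ Y' ◁ (X' ◁ (β_ Y X).inv ⊗≫ ((β_ X' Y).hom ▷ X ⊗≫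
          Y ◁ ε_ X X')) ⊗≫ ε_ Y Y' := by
          rw [Iso.hom_inv_id]; monoidal
      _ = _ := by rw [h2, eval_tensor]; monoidal
  have h4 : (Y' ⊗ X') ◁ ((β_ X Y).hom ≫ (β_ Y X).hom) ≫ ((β_ (Y' ⊗ X') (X ⊗ Y)).hom ⊗≫
      X ◁ bev Y Y' ▷ X' ⊗≫ bev X X') = ε_ (X ⊗ Y) (Y' ⊗ X') := by
    rw [h3, ← MonoidalCategory.whiskerLeft_comp_assoc]
    simp
  rw [bev, ← h4]
  calc _ = (β_ (Y' ⊗ X') (X ⊗ Y)).inv ≫ ((Y' ⊗ X') ◁ ((β_ X Y).hom ≫ (β_ Y X).hom) ≫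
        (β_ (Y' ⊗ X') (X ⊗ Y)).hom) ⊗≫ X ◁ bev Y Y' ▷ X' ⊗≫ bev X X' := by monoidal
    _ = ((β_ (Y' ⊗ X') (X ⊗ Y)).inv ≫ (β_ (Y' ⊗ X') (X ⊗ Y)).hom) ≫
        ((β_ X Y).hom ≫ (β_ Y X).hom) ▷ (Y' ⊗ X') ⊗≫ X ◁ bev Y Y' ▷ X' ⊗≫ bev X X' := by
        rw [BraidedCategory.braiding_naturality_right]; monoidal
    _ = _ := by rw [Iso.inv_hom_id, Category.id_comp]

namespace SovereignStructure
variable [RightRigidCategory D] (φ : SovereignStructure D)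

/-- The Drinfeld morphism composed with the inverse of the sovereign structure. -/
def twistHom (X : D) : X ⟶ X :=
  𝟙 X ⊗≫ φ.coevt X ▷ X ⊗≫ ld X ◁ (β_ X X).hom ⊗≫ ε_ X (ld X) ▷ X ⊗≫ 𝟙 X

/-- The inverse of the twist. -/
def twistInv (X : D) : X ⟶ X :=
  𝟙 X ⊗≫ X ◁ bcoev X (ld X) ⊗≫ φ.evt X ▷ X ⊗≫ 𝟙 X

/-- The sovereign evaluation is nondegenerate, so this equation characterizes the twist; naturality
and the tensor rule are read off from the two evaluations. It holds because a crossing slides off a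
cap, leaving an inverse crossing. -/
lemma twistHom_evt (X : D) : φ.twistHom X ▷ ld X ≫ φ.evt X = bev X (ld X) := by
  have h : (β_ X X).hom ▷ ld X ⊗≫ X ◁ φ.evt X =
      𝟙 ((X ⊗ X) ⊗ ld X) ⊗≫ X ◁ (β_ (ld X) X).inv ⊗≫ φ.evt X ▷ X ⊗≫ 𝟙 (X ⊗ 𝟙_ D) := by
    calc _ = 𝟙 ((X ⊗ X) ⊗ ld X) ⊗≫ X ◁ ((β_ (ld X) X).inv ≫ (β_ (ld X) X).hom) ⊗≫
          (β_ X X).hom ▷ ld X ⊗≫ X ◁ φ.evt X := by rw [Iso.inv_hom_id]; monoidal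
      _ = 𝟙 ((X ⊗ X) ⊗ ld X) ⊗≫ X ◁ (β_ (ld X) X).inv ⊗≫
          ((β_ (X ⊗ ld X) X).hom ≫ X ◁ φ.evt X) := by rw [braiding_tensor_left]; monoidal
      _ = _ := by
          rw [← BraidedCategory.braiding_naturality_left, braiding_tensorUnit_left]; monoidal
  calc _ = 𝟙 (X ⊗ ld X) ⊗≫ φ.coevt X ▷ (X ⊗ ld X) ⊗≫ ld X ◁ (β_ X X).hom ▷ ld X ⊗≫
        (ε_ X (ld X) ▷ (X ⊗ ld X) ≫ 𝟙_ D ◁ φ.evt X) ⊗≫ 𝟙 (𝟙_ D) := by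
        unfold twistHom; monoidal
    _ = 𝟙 (X ⊗ ld X) ⊗≫ φ.coevt X ▷ (X ⊗ ld X) ⊗≫ ld X ◁ ((β_ X X).hom ▷ ld X ⊗≫
        X ◁ φ.evt X) ⊗≫ ε_ X (ld X) := by
        rw [← whisker_exchange]; monoidal
    _ = 𝟙 (X ⊗ ld X) ⊗≫ (φ.coevt X ▷ (X ⊗ ld X) ≫ (ld X ⊗ X) ◁ (β_ (ld X) X).inv) ⊗≫
        ld X ◁ φ.evt X ▷ X ⊗≫ ε_ X (ld X) := by
        rw [h]; monoidal
    _ = 𝟙 (X ⊗ ld X) ⊗≫ (β_ (ld X) X).inv ⊗≫ (φ.coevt X ▷ ld X ⊗≫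
        ld X ◁ φ.evt X) ▷ X ⊗≫ ε_ X (ld X) := by
        rw [← whisker_exchange]; monoidal
    _ = _ := by rw [coevt_evt]; unfold bev; monoidal

lemma twist_hom_inv (X : D) : φ.twistHom X ≫ φ.twistInv X = 𝟙 X := by
  calc _ = 𝟙 X ⊗≫ (φ.twistHom X ▷ 𝟙_ D ≫ X ◁ bcoev X (ld X)) ⊗≫ φ.evt X ▷ X ⊗≫ 𝟙 X := by
        unfold twistInv; monoidal
    _ = 𝟙 X ⊗≫ X ◁ bcoev X (ld X) ⊗≫ (φ.twistHom X ▷ ld X ≫ φ.evt X) ▷ X ⊗≫ 𝟙 X := by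
        rw [← whisker_exchange]; monoidal
    _ = 𝟙 X ⊗≫ (X ◁ bcoev X (ld X) ⊗≫ bev X (ld X) ▷ X) ⊗≫ 𝟙 X := by
        rw [twistHom_evt]; monoidal
    _ = _ := by rw [bev_bcoev]; monoidal

lemma twist_inv_hom (X : D) : φ.twistInv X ≫ φ.twistHom X = 𝟙 X := by
  apply φ.evt_ext
  rw [comp_whiskerRight, Category.assoc, twistHom_evt]
  calc _ = 𝟙 (X ⊗ ld X) ⊗≫ X ◁ bcoev X (ld X) ▷ ld X ⊗≫ (φ.evt X ▷ (X ⊗ ld X) ≫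
        𝟙_ D ◁ bev X (ld X)) ⊗≫ 𝟙 _ := by unfold twistInv; monoidal
    _ = 𝟙 (X ⊗ ld X) ⊗≫ X ◁ (bcoev X (ld X) ▷ ld X ⊗≫ ld X ◁ bev X (ld X)) ⊗≫ φ.evt X := by
        rw [← whisker_exchange]; monoidal
    _ = _ := by rw [bcoev_bev]; monoidal

/-- The twist. -/
def twistIso (X : D) : X ≅ X := ⟨φ.twistHom X, φ.twistInv X, φ.twist_hom_inv X, φ.twist_inv_hom X⟩

lemma twist_naturality {X Y : D} (f : X ⟶ Y) : f ≫ φ.twistHom Y = φ.twistHom X ≫ f := by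
  apply φ.evt_ext
  rw [comp_whiskerRight, Category.assoc, twistHom_evt, comp_whiskerRight, Category.assoc,
    ← φ.evt_dinat, ← whisker_exchange_assoc, twistHom_evt, bev_dinat]

lemma twist_tensor (X Y : D) : φ.twistHom (X ⊗ Y) =
    (β_ X Y).hom ≫ (β_ Y X).hom ≫ (φ.twistHom X ⊗ₘ φ.twistHom Y) := by
  apply φ.evt_ext
  -- The evaluations of `X ⊗ Y` are compared over the dual `ld Y ⊗ ld X`, for which their expansions
  -- into factors are available.
  have hepi : (X ⊗ Y) ◁ ldTensor X Y ≫ bev (X ⊗ Y) (ld (X ⊗ Y)) = bev (X ⊗ Y) (ld Y ⊗ ld X) := by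
    have := bev_dinat (ld Y ⊗ ld X) (ld (X ⊗ Y)) (𝟙 (X ⊗ Y))
    rw [id_whiskerRight, Category.id_comp] at this
    rw [← this, ← MonoidalCategory.whiskerLeft_comp_assoc, ldTensor_inv]
    simp
  have key : (X ⊗ Y) ◁ ldTensor X Y ≫ φ.twistHom (X ⊗ Y) ▷ ld (X ⊗ Y) ≫ φ.evt (X ⊗ Y) =
      (X ⊗ Y) ◁ ldTensor X Y ≫ ((β_ X Y).hom ≫ (β_ Y X).hom ≫
        (φ.twistHom X ⊗ₘ φ.twistHom Y)) ▷ ld (X ⊗ Y) ≫ φ.evt (X ⊗ Y) := by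
    rw [twistHom_evt, hepi, bev_tensor, whisker_exchange_assoc, evt_tensor,
      MonoidalCategory.tensorHom_def']
    symm
    calc _ = ((β_ X Y).hom ≫ (β_ Y X).hom) ▷ (ld Y ⊗ ld X) ⊗≫
          X ◁ φ.twistHom Y ▷ (ld Y ⊗ ld X) ⊗≫
          (φ.twistHom X ▷ ((Y ⊗ ld Y) ⊗ ld X) ≫ X ◁ (φ.evt Y ▷ ld X)) ⊗≫ φ.evt X := by monoidal
      _ = ((β_ X Y).hom ≫ (β_ Y X).hom) ▷ (ld Y ⊗ ld X) ⊗≫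
          X ◁ (φ.twistHom Y ▷ ld Y ≫ φ.evt Y) ▷ ld X ⊗≫
          (φ.twistHom X ▷ ld X ≫ φ.evt X) := by
          rw [← whisker_exchange]; monoidal
      _ = _ := by rw [twistHom_evt, twistHom_evt]
  -- The canonical isomorphism of duals is cancelled using its inverse.
  have h := congrArg (fun z => (X ⊗ Y) ◁ dualMap (ld Y ⊗ ld X) (ld (X ⊗ Y)) (𝟙 (X ⊗ Y)) ≫ z) key
  simpa only [← MonoidalCategory.whiskerLeft_comp_assoc, ldTensor_inv',
    MonoidalCategory.whiskerLeft_id, Category.id_comp] using h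

end SovereignStructure
end BraidedTwist
end CenterCoend


set_option linter.unusedSectionVars false

namespace CenterCoend
open Limits

section Explicit
variable {D : Type u} [Category.{v} D] [MonoidalCategory.{v} D]

lemma eval_tensor_eq {X Y : D} (X' Y' : D) [ExactPairing X X'] [ExactPairing Y Y'] :
    ε_ (X ⊗ Y) (Y' ⊗ X') = (α_ _ _ _).hom ≫ Y' ◁ ((α_ _ _ _).inv ≫
        ε_ X X' ▷ Y ≫ (λ_ Y).hom) ≫ ε_ Y Y' := by
  rw [eval_tensor]; monoidal

lemma SovereignStructure.twistHom_eq [BraidedCategory D] [RightRigidCategory D]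
    (φ : SovereignStructure D) (X : D) :
    φ.twistHom X = (λ_ X).inv ≫ φ.coevt X ▷ X ≫ (α_ _ _ _).hom ≫
      ld X ◁ (β_ X X).hom ≫ (α_ _ _ _).inv ≫ ε_ X (ld X) ▷ X ≫ (λ_ X).hom := by
  unfold twistHom; monoidal

lemma SovereignStructure.twistInv_eq [BraidedCategory D] [RightRigidCategory D]
    (φ : SovereignStructure D) (X : D) :
    φ.twistInv X = (ρ_ X).inv ≫ X ◁ (η_ X (ld X) ≫ (β_ X (ld X)).hom) ≫ (α_ _ _ _).inv ≫
      φ.evt X ▷ X ≫ (λ_ X).hom := by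
  unfold twistInv bcoev; monoidal

end Explicit

/-! ### The sovereign structure and the twist of the center -/

section CenterSovereign
variable {C : Type u} [Category.{v} C] [MonoidalCategory.{v} C] [RigidCategory C]

/-- The evaluations of the center are those of `C`, so the forgetful functor preserves the equation
that characterizes the dual morphism. -/
lemma center_dualMap {M N : Center C} (f : M ⟶ N) :
    (dualMap (ld M) (ld N) f).f = dualMap (ld M.1) (ld N.1) f.f := by
  refine dualMap_unique (X := M.1) (Y := N.1) (ld M.1) (ld N.1) f.f (dualMap (ld M) (ld N) f).f ?_
  have h := congrArg Center.Hom.f (dualMap_eval (ld M) (ld N) f)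
  rw [Center.comp_f, Center.comp_f, Center.whiskerLeft_f, Center.whiskerRight_f] at h
  exact h

lemma center_ldTensor (M N : Center C) : (ldTensor M N).f = ldTensor M.1 N.1 := by
  refine dualMap_unique (X := M.1 ⊗ N.1) (Y := M.1 ⊗ N.1) (ld (M.1 ⊗ N.1)) (ld N.1 ⊗ ld M.1)
    (𝟙 (M.1 ⊗ N.1)) (ldTensor M N).f ?_
  have h := congrArg Center.Hom.f (dualMap_eval (ld (M ⊗ N)) (ld N ⊗ ld M) (𝟙 (M ⊗ N)))
  rw [Center.comp_f, Center.comp_f, Center.whiskerLeft_f, Center.whiskerRight_f] at h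
  refine h.trans ?_
  have h2 : (ε_ (M ⊗ N) (ld N ⊗ ld M)).f = ε_ (M.1 ⊗ N.1) (ld N.1 ⊗ ld M.1) := by
    rw [eval_tensor_eq, eval_tensor_eq]
    simp only [Center.comp_f, Center.whiskerLeft_f, Center.whiskerRight_f,
      Center.associator_hom_f, Center.associator_inv_f, Center.leftUnitor_hom_f]
    rfl
  rw [h2]
  rfl

lemma center_lldTensor (M N : Center C) : (lldTensor M N).f = lldTensor M.1 N.1 := by
  refine dualMap_unique (X := ld N.1 ⊗ ld M.1) (Y := ld (M.1 ⊗ N.1)) (ld (ld M.1) ⊗ ld (ld N.1))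
    (ld (ld (M.1 ⊗ N.1))) (ldTensor M.1 N.1) (lldTensor M N).f ?_
  have h := congrArg Center.Hom.f (dualMap_eval (ld (ld M) ⊗ ld (ld N)) (ld (ld (M ⊗ N)))
    (ldTensor M N))
  rw [Center.comp_f, Center.comp_f, Center.whiskerLeft_f, Center.whiskerRight_f,
    center_ldTensor] at h
  refine Eq.trans ?_ h
  congr 1
  rw [eval_tensor_eq, eval_tensor_eq]
  simp only [Center.comp_f, Center.whiskerLeft_f, Center.whiskerRight_f,
    Center.associator_hom_f, Center.associator_inv_f, Center.leftUnitor_hom_f]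
  rfl

lemma center_ldUnit : (ldUnit (D := Center C)).f = ldUnit (D := C) := by
  refine dualMap_unique (X := 𝟙_ C) (Y := 𝟙_ C) (ld (𝟙_ C)) (𝟙_ C) (𝟙 (𝟙_ C))
    (ldUnit (D := Center C)).f ?_
  have h := congrArg Center.Hom.f (dualMap_eval (ld (𝟙_ (Center C))) (𝟙_ (Center C))
    (𝟙 (𝟙_ (Center C))))
  rw [Center.comp_f, Center.comp_f, Center.whiskerLeft_f, Center.whiskerRight_f] at h
  refine h.trans ?_
  rw [eval_unit, eval_unit, Center.rightUnitor_hom_f]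
  rfl

lemma center_lldUnit : (lldUnit (D := Center C)).f = lldUnit (D := C) := by
  refine dualMap_unique (X := 𝟙_ C) (Y := ld (𝟙_ C)) (𝟙_ C) (ld (ld (𝟙_ C))) ldUnit
    (lldUnit (D := Center C)).f ?_
  have h := congrArg Center.Hom.f (dualMap_eval (𝟙_ (Center C)) (ld (ld (𝟙_ (Center C))))
    (ldUnit (D := Center C)))
  rw [Center.comp_f, Center.comp_f, Center.whiskerLeft_f, Center.whiskerRight_f,
    center_ldUnit, eval_unit, Center.rightUnitor_hom_f] at h
  exact h

lemma braid_ε (M : Center C) (Y Y' : C) [ExactPairing Y Y'] :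
    𝟙 _ ⊗≫ (M.2.β Y').hom ▷ Y ⊗≫ Y' ◁ (M.2.β Y).hom ⊗≫ ε_ Y Y' ▷ M.1 =
      M.1 ◁ ε_ Y Y' ⊗≫ 𝟙 (𝟙_ C ⊗ M.1) := by
  calc _ = (M.2.β (Y' ⊗ Y)).hom ≫ ε_ Y Y' ▷ M.1 := by rw [M.2.monoidal]; monoidal
    _ = _ := by rw [← M.2.naturality, hom_one]; monoidal

lemma braid_coev (M : Center C) (Y Y' : C) [ExactPairing Y Y'] :
    M.1 ◁ η_ Y Y' ⊗≫ (M.2.β Y).hom ▷ Y' ⊗≫ Y ◁ (M.2.β Y').hom =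
      𝟙 (M.1 ⊗ 𝟙_ C) ⊗≫ η_ Y Y' ▷ M.1 ⊗≫ 𝟙 (Y ⊗ (Y' ⊗ M.1)) := by
  calc _ = (M.1 ◁ η_ Y Y' ≫ (M.2.β (Y ⊗ Y')).hom) ⊗≫ 𝟙 (Y ⊗ (Y' ⊗ M.1)) := by
        rw [M.2.monoidal]; monoidal
    _ = _ := by rw [M.2.naturality, hom_one]; monoidal

/-- The half braiding of the dual is dual to the half braiding. -/
lemma dualBraidHom_ld (M : Center C) (Y : C) :
    dualBraidHom M (ld Y) = dualMap (ld Y ⊗ ld M.1) (ld M.1 ⊗ ld Y) (M.2.β Y).hom := by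
  apply dualMap_unique
  rw [eval_tensor, eval_tensor]
  have h : ld Y ◁ (M.2.β Y).hom ⊗≫ ε_ Y (ld Y) ▷ M.1 =
      𝟙 _ ⊗≫ (M.2.β (ld Y)).inv ▷ Y ⊗≫ M.1 ◁ ε_ Y (ld Y) ⊗≫ 𝟙 (𝟙_ C ⊗ M.1) := by
    calc _ = 𝟙 (ld Y ⊗ (M.1 ⊗ Y)) ⊗≫ ((M.2.β (ld Y)).inv ≫ (M.2.β (ld Y)).hom) ▷ Y ⊗≫
          ld Y ◁ (M.2.β Y).hom ⊗≫ ε_ Y (ld Y) ▷ M.1 := by rw [Iso.inv_hom_id]; monoidal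
      _ = 𝟙 (ld Y ⊗ (M.1 ⊗ Y)) ⊗≫ (M.2.β (ld Y)).inv ▷ Y ⊗≫ (𝟙 (M.1 ⊗ (ld Y ⊗ Y)) ⊗≫
          (M.2.β (ld Y)).hom ▷ Y ⊗≫ ld Y ◁ (M.2.β Y).hom ⊗≫ ε_ Y (ld Y) ▷ M.1) := by monoidal
      _ = _ := by rw [braid_ε]
  calc _ = 𝟙 ((ld M.1 ⊗ ld Y) ⊗ M.1 ⊗ Y) ⊗≫ (dualBraidHom M (ld Y) ▷ M.1 ⊗≫
        ld Y ◁ ε_ M.1 (ld M.1)) ▷ Y ⊗≫ ε_ Y (ld Y) := by monoidal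
    _ = 𝟙 ((ld M.1 ⊗ ld Y) ⊗ M.1 ⊗ Y) ⊗≫ ld M.1 ◁ (M.2.β (ld Y)).inv ▷ Y ⊗≫
        (ε_ M.1 (ld M.1) ▷ (ld Y ⊗ Y) ≫ 𝟙_ C ◁ ε_ Y (ld Y)) ⊗≫ 𝟙 _ := by
        rw [dualKey]; monoidal
    _ = 𝟙 ((ld M.1 ⊗ ld Y) ⊗ M.1 ⊗ Y) ⊗≫ ld M.1 ◁ (𝟙 (ld Y ⊗ (M.1 ⊗ Y)) ⊗≫
        (M.2.β (ld Y)).inv ▷ Y ⊗≫ M.1 ◁ ε_ Y (ld Y) ⊗≫ 𝟙 (𝟙_ C ⊗ M.1)) ⊗≫ ε_ M.1 (ld M.1) := by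
        rw [← whisker_exchange]; monoidal
    _ = _ := by rw [← h]; monoidal

lemma SovereignStructure.naturality_tensor {D : Type u} [Category.{v} D] [MonoidalCategory.{v} D]
    [RightRigidCategory D] (φ : SovereignStructure D) {X Y Z W : D} (f : X ⊗ Y ⟶ Z ⊗ W) :
    f ≫ ((φ.iso Z).hom ⊗ₘ (φ.iso W).hom) = ((φ.iso X).hom ⊗ₘ (φ.iso Y).hom) ≫
      dualMap (ld (ld Z) ⊗ ld (ld W)) (ld (ld X) ⊗ ld (ld Y))
        (dualMap (ld Y ⊗ ld X) (ld W ⊗ ld Z) f) := by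
  rw [← φ.tensor, ← φ.tensor, ← Category.assoc, φ.naturality, Category.assoc, Category.assoc]
  congr 1
  rw [lldTensor, lldTensor, ← dualMap_comp, ← dualMap_comp, ldTensor_comp]

/-- The half braiding of the double dual. -/
def lldBraid (M : Center C) (Y : C) : ld (ld M.1) ⊗ Y ⟶ Y ⊗ ld (ld M.1) :=
  dualBraidHom (centerLd M) Y

/-- Naturality is applied to the half braiding `M ⊗ Y ⟶ Y ⊗ M` itself. Its double dual is the half
braiding of the double dual of `M` at that of `Y`; the component at `Y` slides through and cancels.
-/
lemma SovereignStructure.center_comm (φ : SovereignStructure C) (M : Center C) (Y : C) :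
    (φ.iso M.1).hom ▷ Y ≫ lldBraid M Y = (M.2.β Y).hom ≫ Y ◁ (φ.iso M.1).hom := by
  have h := φ.naturality_tensor (M.2.β Y).hom
  have h1 : dualMap (ld (ld Y) ⊗ ld (ld M.1)) (ld (ld M.1) ⊗ ld (ld Y))
      (dualMap (ld Y ⊗ ld M.1) (ld M.1 ⊗ ld Y) (M.2.β Y).hom) = lldBraid M (ld (ld Y)) := by
    rw [← dualBraidHom_ld]
    exact (dualBraidHom_ld (centerLd M) (ld Y)).symm
  have h2 : ld (ld M.1) ◁ (φ.iso Y).hom ≫ lldBraid M (ld (ld Y)) =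
      lldBraid M Y ≫ (φ.iso Y).hom ▷ ld (ld M.1) :=
    (dualLax (centerLd M)).nat (φ.iso Y).hom
  rw [h1, MonoidalCategory.tensorHom_def', MonoidalCategory.tensorHom_def, Category.assoc, h2,
    ← Category.assoc] at h
  rw [← cancel_mono ((φ.iso Y).hom ▷ ld (ld M.1)), Category.assoc, Category.assoc]
  exact h.symm.trans (Category.assoc _ _ _)

lemma SovereignStructure.center_comm_inv (φ : SovereignStructure C) (M : Center C) (Y : C) :
    (φ.iso M.1).inv ▷ Y ≫ (M.2.β Y).hom = lldBraid M Y ≫ Y ◁ (φ.iso M.1).inv := by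
  rw [← cancel_epi ((φ.iso M.1).hom ▷ Y), reassoc_of% φ.center_comm M Y,
    ← comp_whiskerRight_assoc, Iso.hom_inv_id, ← MonoidalCategory.whiskerLeft_comp,
    Iso.hom_inv_id]
  simp

/-- The sovereign structure on the center. -/
noncomputable def SovereignStructure.center (φ : SovereignStructure C) : SovereignStructure (Center C) where
  iso M :=
    { hom := ⟨(φ.iso M.1).hom, fun Y => φ.center_comm M Y⟩
      inv := ⟨(φ.iso M.1).inv, fun Y => φ.center_comm_inv M Y⟩
      hom_inv_id := Center.ext _ _ (φ.iso M.1).hom_inv_id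
      inv_hom_id := Center.ext _ _ (φ.iso M.1).inv_hom_id }
  naturality {M N} f := by
    apply Center.ext
    rw [Center.comp_f, Center.comp_f]
    refine (φ.naturality f.f).trans ?_
    rw [← center_dualMap]
    congr 1
    exact (center_dualMap (dualMap (ld M) (ld N) f)).symm
  tensor M N := by
    apply Center.ext
    rw [Center.comp_f, center_lldTensor, Center.tensor_f]
    exact φ.tensor M.1 N.1
  unit := by
    apply Center.ext
    rw [Center.comp_f, center_lldUnit]
    exact φ.unit

lemma SovereignStructure.center_evt (φ : SovereignStructure C) (M : Center C) :
    (φ.center.evt M).f = φ.evt M.1 := by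
  unfold evt
  rw [Center.comp_f, Center.whiskerRight_f]
  rfl

lemma SovereignStructure.center_coevt (φ : SovereignStructure C) (M : Center C) :
    (φ.center.coevt M).f = φ.coevt M.1 := by
  unfold coevt
  rw [Center.comp_f, Center.whiskerLeft_f]
  rfl

lemma SovereignStructure.center_twistHom (φ : SovereignStructure C) (M : Center C) :
    (φ.center.twistHom M).f = canonicalTwist φ M := by
  rw [φ.center.twistHom_eq]
  simp only [Center.comp_f, Center.whiskerLeft_f, Center.whiskerRight_f, φ.center_coevt,
    Center.associator_hom_f, Center.associator_inv_f, Center.leftUnitor_hom_f,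
    Center.leftUnitor_inv_f]
  change (λ_ M.1).inv ≫ φ.coevt M.1 ▷ M.1 ≫ (α_ (ld M.1) M.1 M.1).hom ≫
    ld M.1 ◁ (M.2.β M.1).hom ≫ (α_ _ _ _).inv ≫ ε_ M.1 (ld M.1) ▷ M.1 ≫ (λ_ M.1).hom = _
  unfold canonicalTwist centerAction coevt
  monoidal

/-- The inverse of the half braiding of the dual. -/
lemma dualBraid_inv (φ : SovereignStructure C) (M : Center C) (Y : C) :
    laxInv (dualLax M) Y = 𝟙 (Y ⊗ ld M.1) ⊗≫ φ.coevt M.1 ▷ (Y ⊗ ld M.1) ⊗≫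
      ld M.1 ◁ (M.2.β Y).hom ▷ ld M.1 ⊗≫ (ld M.1 ⊗ Y) ◁ φ.evt M.1 ⊗≫ 𝟙 (ld M.1 ⊗ Y) := by
  have h : φ.coevt M.1 ▷ Y ⊗≫ ld M.1 ◁ (M.2.β Y).hom =
      𝟙 (𝟙_ C ⊗ Y) ⊗≫ Y ◁ φ.coevt M.1 ⊗≫ laxInv (dualLax M) Y ▷ M.1 ⊗≫
        𝟙 (ld M.1 ⊗ (Y ⊗ M.1)) := by
    have h1 : φ.coevt M.1 ▷ Y ≫ (𝟙 ((ld M.1 ⊗ M.1) ⊗ Y) ⊗≫ ld M.1 ◁ (M.2.β Y).hom ⊗≫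
        dualBraidHom M Y ▷ M.1 ⊗≫ 𝟙 (Y ⊗ (ld M.1 ⊗ M.1))) =
        ((λ_ Y).hom ≫ (ρ_ Y).inv) ≫ Y ◁ φ.coevt M.1 := by
      have h2 := (φ.center.coevt M).comm Y
      rw [φ.center_coevt] at h2
      refine Eq.trans ?_ h2
      congr 1
      exact (center_tensor_braid (centerLd M) M Y).symm
    have h3 : dualBraidHom M Y ≫ laxInv (dualLax M) Y = 𝟙 _ := lax_hom_inv (dualLax M) Y
    symm
    calc _ = 𝟙 (𝟙_ C ⊗ Y) ⊗≫ (((λ_ Y).hom ≫ (ρ_ Y).inv) ≫ Y ◁ φ.coevt M.1) ⊗≫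
          laxInv (dualLax M) Y ▷ M.1 ⊗≫ 𝟙 (ld M.1 ⊗ (Y ⊗ M.1)) := by monoidal
      _ = φ.coevt M.1 ▷ Y ⊗≫ ld M.1 ◁ (M.2.β Y).hom ⊗≫ (dualBraidHom M Y ≫
          laxInv (dualLax M) Y) ▷ M.1 ⊗≫ 𝟙 (ld M.1 ⊗ (Y ⊗ M.1)) := by
          rw [← h1]; monoidal
      _ = _ := by rw [h3]; monoidal
  symm
  calc _ = 𝟙 (Y ⊗ ld M.1) ⊗≫ (φ.coevt M.1 ▷ Y ⊗≫ ld M.1 ◁ (M.2.β Y).hom) ▷ ld M.1 ⊗≫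
        (ld M.1 ⊗ Y) ◁ φ.evt M.1 ⊗≫ 𝟙 (ld M.1 ⊗ Y) := by monoidal
    _ = 𝟙 (Y ⊗ ld M.1) ⊗≫ Y ◁ φ.coevt M.1 ▷ ld M.1 ⊗≫
        (laxInv (dualLax M) Y ▷ (M.1 ⊗ ld M.1) ≫ (ld M.1 ⊗ Y) ◁ φ.evt M.1) ⊗≫
        𝟙 (ld M.1 ⊗ Y) := by
        rw [h]; monoidal
    _ = 𝟙 (Y ⊗ ld M.1) ⊗≫ Y ◁ (φ.coevt M.1 ▷ ld M.1 ⊗≫ ld M.1 ◁ φ.evt M.1) ⊗≫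
        laxInv (dualLax M) Y ⊗≫ 𝟙 (ld M.1 ⊗ Y) := by
        rw [← whisker_exchange]; monoidal
    _ = _ := by rw [φ.coevt_evt]; monoidal

lemma braid_ld_inv (M : Center C) (Y Y' : C) [ExactPairing Y Y'] :
    (M.2.β Y').inv = 𝟙 (Y' ⊗ M.1) ⊗≫ (Y' ⊗ M.1) ◁ η_ Y Y' ⊗≫ Y' ◁ (M.2.β Y).hom ▷ Y' ⊗≫
      ε_ Y Y' ▷ (M.1 ⊗ Y') ⊗≫ 𝟙 (M.1 ⊗ Y') := by
  have h : M.1 ◁ η_ Y Y' ⊗≫ (M.2.β Y).hom ▷ Y' =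
      𝟙 (M.1 ⊗ 𝟙_ C) ⊗≫ η_ Y Y' ▷ M.1 ⊗≫ Y ◁ (M.2.β Y').inv ⊗≫ 𝟙 ((Y ⊗ M.1) ⊗ Y') := by
    calc _ = (M.1 ◁ η_ Y Y' ⊗≫ (M.2.β Y).hom ▷ Y' ⊗≫ Y ◁ (M.2.β Y').hom) ⊗≫
          Y ◁ (M.2.β Y').inv ⊗≫ 𝟙 ((Y ⊗ M.1) ⊗ Y') := by
          symm
          calc _ = M.1 ◁ η_ Y Y' ⊗≫ (M.2.β Y).hom ▷ Y' ⊗≫ Y ◁ ((M.2.β Y').hom ≫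
                (M.2.β Y').inv) ⊗≫ 𝟙 ((Y ⊗ M.1) ⊗ Y') := by monoidal
            _ = _ := by rw [Iso.hom_inv_id]; monoidal
      _ = _ := by rw [braid_coev]; monoidal
  symm
  calc _ = 𝟙 (Y' ⊗ M.1) ⊗≫ Y' ◁ (M.1 ◁ η_ Y Y' ⊗≫ (M.2.β Y).hom ▷ Y') ⊗≫
      ε_ Y Y' ▷ (M.1 ⊗ Y') ⊗≫ 𝟙 (M.1 ⊗ Y') := by monoidal
    _ = 𝟙 (Y' ⊗ M.1) ⊗≫ Y' ◁ η_ Y Y' ▷ M.1 ⊗≫ ((Y' ⊗ Y) ◁ (M.2.β Y').inv ≫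
      ε_ Y Y' ▷ (M.1 ⊗ Y')) ⊗≫ 𝟙 (M.1 ⊗ Y') := by rw [h]; monoidal
    _ = 𝟙 (Y' ⊗ M.1) ⊗≫ (Y' ◁ η_ Y Y' ⊗≫ ε_ Y Y' ▷ Y') ▷ M.1 ⊗≫ (M.2.β Y').inv := by
      rw [whisker_exchange]; monoidal
    _ = _ := by rw [ExactPairing.coevaluation_evaluation'']; monoidal

lemma eq_of_inv {X Y : C} (f : X ⟶ Y) (g g' : Y ⟶ X) (h : f ≫ g = 𝟙 X) (h' : g' ≫ f = 𝟙 Y) :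
    g = g' := by
  rw [← Category.id_comp g, ← h', Category.assoc, h, Category.comp_id]

lemma canonicalTwist_evt (φ : SovereignStructure C) (M : Center C) :
    canonicalTwist φ M ▷ ld M.1 ≫ φ.evt M.1 = laxInv (dualLax M) M.1 ≫ ε_ M.1 (ld M.1) := by
  have h := congrArg Center.Hom.f (φ.center.twistHom_evt M)
  rw [bev, Center.comp_f, Center.whiskerRight_f, φ.center_evt, φ.center_twistHom,
    Center.comp_f] at h
  have hi : (β_ (ld M) M).inv.f = laxInv (dualLax M) M.1 := by
    have h1 : dualBraidHom M M.1 ≫ (β_ (ld M) M).inv.f = 𝟙 (ld M.1 ⊗ M.1) :=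
      congrArg Center.Hom.f (β_ (ld M) M).hom_inv_id
    have h2 : laxInv (dualLax M) M.1 ≫ dualBraidHom M M.1 = 𝟙 _ := lax_inv_hom (dualLax M) M.1
    exact eq_of_inv _ _ _ h1 h2
  rw [hi] at h
  exact h

/-- Both traces are one closed diagram: the crossing of `M` with itself, one strand closed on the
left and the other on the right. The only difference is whether `g` sits before or after the
crossing, and naturality of the half braiding moves it through. -/
lemma trace_twist (φ : SovereignStructure C) (M : Center C) (g : M.1 ⟶ M.1) :
    φ.rightTrace (g ≫ canonicalTwist φ M) =
      φ.rightTrace (dualMap (ld M.1) (ld M.1) g ≫ canonicalTwist φ (centerLd M)) := by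
  obtain ⟨b, hb⟩ : ∃ b : M.1 ⊗ M.1 ⟶ M.1 ⊗ M.1, b = (M.2.β M.1).hom := ⟨_, rfl⟩
  have hbn : M.1 ◁ g ≫ b = b ≫ g ▷ M.1 := by rw [hb]; exact M.2.naturality g
  have h1 : φ.rightTrace (g ≫ canonicalTwist φ M) =
      𝟙 (𝟙_ C) ⊗≫ η_ M.1 (ld M.1) ⊗≫ φ.coevt M.1 ▷ (M.1 ⊗ ld M.1) ⊗≫
      ld M.1 ◁ (M.1 ◁ g ≫ b) ▷ ld M.1 ⊗≫ (ld M.1 ⊗ M.1) ◁ φ.evt M.1 ⊗≫ ε_ M.1 (ld M.1) := by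
    rw [φ.rightTrace_eq, comp_whiskerRight, Category.assoc, canonicalTwist_evt,
      dualBraid_inv φ M M.1, ← hb]
    calc _ = 𝟙 (𝟙_ C) ⊗≫ η_ M.1 (ld M.1) ⊗≫ (𝟙_ C ◁ (g ▷ ld M.1) ≫
        φ.coevt M.1 ▷ (M.1 ⊗ ld M.1)) ⊗≫
        ld M.1 ◁ b ▷ ld M.1 ⊗≫ (ld M.1 ⊗ M.1) ◁ φ.evt M.1 ⊗≫ ε_ M.1 (ld M.1) := by monoidal
      _ = _ := by rw [whisker_exchange]; monoidal
  have h2 : φ.rightTrace (dualMap (ld M.1) (ld M.1) g ≫ canonicalTwist φ (centerLd M)) =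
      φ.coevt M.1 ≫ dualMap (ld M.1) (ld M.1) g ▷ M.1 ≫ (M.2.β (ld M.1)).inv ≫ φ.evt M.1 := by
    obtain ⟨t, ht⟩ : ∃ t : ld M.1 ⟶ ld M.1, t = canonicalTwist φ (centerLd M) := ⟨_, rfl⟩
    obtain ⟨r, hr⟩ : ∃ r : ld M.1 ⊗ ld (ld M.1) ⟶ ld (ld M.1) ⊗ ld M.1,
      r = laxInv (dualLax (centerLd M)) (ld M.1) := ⟨_, rfl⟩
    have e : t ▷ ld (ld M.1) ≫ φ.evt (ld M.1) = r ≫ ε_ (ld M.1) (ld (ld M.1)) := by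
      rw [ht, hr]
      exact canonicalTwist_evt φ (centerLd M)
    have hr' : lldBraid M (ld M.1) ≫ r = 𝟙 _ := by
      rw [hr]
      exact lax_hom_inv (dualLax (centerLd M)) (ld M.1)
    have n : ld M.1 ◁ (φ.iso M.1).hom ≫ r =
        (M.2.β (ld M.1)).inv ≫ (φ.iso M.1).hom ▷ ld M.1 := by
      rw [← cancel_epi (M.2.β (ld M.1)).hom, ← reassoc_of% φ.center_comm M (ld M.1), hr',
        Iso.hom_inv_id_assoc, Category.comp_id]
    change φ.rightTrace (dualMap (ld M.1) (ld M.1) g ≫ canonicalTwist φ (centerLd M) :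
      ld M.1 ⟶ ld M.1) = _
    rw [← ht]
    have c : η_ (ld M.1) (ld (ld M.1)) = φ.coevt M.1 ≫ ld M.1 ◁ (φ.iso M.1).hom := by
      rw [SovereignStructure.coevt, Category.assoc, ← MonoidalCategory.whiskerLeft_comp,
        Iso.inv_hom_id]
      simp
    rw [φ.rightTrace_eq, comp_whiskerRight, Category.assoc, e, c, Category.assoc,
      whisker_exchange_assoc, reassoc_of% n]
    rfl
  have h3 : φ.coevt M.1 ≫ dualMap (ld M.1) (ld M.1) g ▷ M.1 ≫ (M.2.β (ld M.1)).inv ≫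
      φ.evt M.1 = 𝟙 (𝟙_ C) ⊗≫ φ.coevt M.1 ⊗≫ (ld M.1 ⊗ M.1) ◁ η_ M.1 (ld M.1) ⊗≫
      ld M.1 ◁ b ▷ ld M.1 ⊗≫ (dualMap (ld M.1) (ld M.1) g ▷ M.1 ≫ ε_ M.1 (ld M.1)) ▷ (M.1 ⊗ ld M.1) ⊗≫
      φ.evt M.1 := by
    rw [braid_ld_inv M M.1 (ld M.1), ← hb]
    calc _ = 𝟙 (𝟙_ C) ⊗≫ φ.coevt M.1 ⊗≫ (dualMap (ld M.1) (ld M.1) g ▷ (M.1 ⊗ 𝟙_ C) ≫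
          ld M.1 ◁ (M.1 ◁ η_ M.1 (ld M.1))) ⊗≫
          ld M.1 ◁ b ▷ ld M.1 ⊗≫ ε_ M.1 (ld M.1) ▷ (M.1 ⊗ ld M.1) ⊗≫ φ.evt M.1 := by monoidal
      _ = 𝟙 (𝟙_ C) ⊗≫ φ.coevt M.1 ⊗≫ (ld M.1 ⊗ M.1) ◁ η_ M.1 (ld M.1) ⊗≫
          (dualMap (ld M.1) (ld M.1) g ▷ ((M.1 ⊗ M.1) ⊗ ld M.1) ≫ ld M.1 ◁ (b ▷ ld M.1)) ⊗≫
          ε_ M.1 (ld M.1) ▷ (M.1 ⊗ ld M.1) ⊗≫ φ.evt M.1 := by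
          rw [← whisker_exchange]; monoidal
      _ = _ := by rw [← whisker_exchange]; monoidal
  rw [h1, h2, h3, dualMap_eval, hbn]
  calc _ = 𝟙 (𝟙_ C) ⊗≫ (𝟙_ C ◁ η_ M.1 (ld M.1) ≫ φ.coevt M.1 ▷ (M.1 ⊗ ld M.1)) ⊗≫
        ld M.1 ◁ b ▷ ld M.1 ⊗≫ ((ld M.1 ◁ g) ▷ (M.1 ⊗ ld M.1) ≫ (ld M.1 ⊗ M.1) ◁ φ.evt M.1)
          ⊗≫ ε_ M.1 (ld M.1) := by monoidal
    _ = 𝟙 (𝟙_ C) ⊗≫ (𝟙_ C ◁ η_ M.1 (ld M.1) ≫ φ.coevt M.1 ▷ (M.1 ⊗ ld M.1)) ⊗≫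
        ld M.1 ◁ b ▷ ld M.1 ⊗≫ ((ld M.1 ⊗ M.1) ◁ φ.evt M.1 ≫ (ld M.1 ◁ g ≫ ε_ M.1 (ld M.1)) ▷ 𝟙_ C)
          ⊗≫ 𝟙 (𝟙_ C) := by
        rw [← whisker_exchange (ld M.1 ◁ g) (φ.evt M.1)]; monoidal
    _ = _ := by
        rw [whisker_exchange (φ.coevt M.1) (η_ M.1 (ld M.1)),
          whisker_exchange (ld M.1 ◁ g ≫ ε_ M.1 (ld M.1)) (φ.evt M.1)]
        monoidal

end CenterSovereign

/-! ### Nondegeneracy of the trace form and self-duality of the twist -/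

section TraceForm
variable {k : Type w'} [CommRing k] {C : Type u} [Category.{v} C] [Preadditive C]
    [Linear k C] [MonoidalCategory.{v} C] [MonoidalPreadditive C] [MonoidalLinear k C]
    [RigidCategory C] [HasFiniteBiproducts C] {I : Type w} [Fintype I] {V : I → C}
    (φ : SovereignStructure C)

lemma SovereignStructure.rightTrace_add {X : C} (f g : X ⟶ X) :
    φ.rightTrace (f + g) = φ.rightTrace f + φ.rightTrace g := by
  simp [rightTrace_eq, MonoidalPreadditive.add_whiskerRight]

lemma SovereignStructure.rightTrace_sub {X : C} (f g : X ⟶ X) :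
    φ.rightTrace (f - g) = φ.rightTrace f - φ.rightTrace g :=
  map_sub (AddMonoidHom.mk' φ.rightTrace φ.rightTrace_add) f g

lemma SovereignStructure.rightTrace_sum {X : C} {J : Type*} (s : Finset J) (f : J → (X ⟶ X)) :
    φ.rightTrace (∑ j ∈ s, f j) = ∑ j ∈ s, φ.rightTrace (f j) :=
  map_sum (AddMonoidHom.mk' φ.rightTrace φ.rightTrace_add) f s

lemma SovereignStructure.rightTrace_smul {X : C} (a : k) (f : X ⟶ X) :
    φ.rightTrace (a • f) = a • φ.rightTrace f := by
  simp [rightTrace_eq, MonoidalLinear.smul_whiskerRight]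

/-- Rotation identifies such pairings with endomorphisms of `V i`, which are scalars. -/
lemma SovereignStructure.exists_smul_evt (hV : IsFusion k V) (i : I)
    (g : V i ⊗ ld (V i) ⟶ 𝟙_ C) : ∃ s : k, g = s • φ.evt (V i) := by
  let g' : V i ⟶ V i := 𝟙 (V i) ⊗≫ V i ◁ φ.coevt (V i) ⊗≫ g ▷ V i ⊗≫ 𝟙 (V i)
  obtain ⟨s, hs⟩ := hV.exists_smul g'
  refine ⟨s, ?_⟩
  have h : g' ▷ ld (V i) ≫ φ.evt (V i) = g := by
    calc _ = 𝟙 (V i ⊗ ld (V i)) ⊗≫ V i ◁ φ.coevt (V i) ▷ ld (V i) ⊗≫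
          (g ▷ (V i ⊗ ld (V i)) ≫ 𝟙_ C ◁ φ.evt (V i)) ⊗≫ 𝟙 (𝟙_ C) := by
          simp only [g']; monoidal
      _ = 𝟙 (V i ⊗ ld (V i)) ⊗≫ V i ◁ (φ.coevt (V i) ▷ ld (V i) ⊗≫ ld (V i) ◁ φ.evt (V i)) ⊗≫ g := by
          rw [← whisker_exchange]; monoidal
      _ = _ := by rw [φ.coevt_evt]; monoidal
  rw [← h, hs, MonoidalLinear.smul_whiskerRight, Linear.smul_comp]
  simp

/-- The dimensions of the members of the family are cancellable. -/
lemma SovereignStructure.smul_dim_eq_zero (hV : IsFusion k V) (i : I) {c : k}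
    (hc : c • φ.rightTrace (𝟙 (V i)) = 0) : c = 0 := by
  obtain ⟨F⟩ := hV.nonempty_choices
  let d := F.dec (V i ⊗ ld (V i))
  -- The coevaluation of `V i` factors through the unit summands of `V i ⊗ ld (V i)`, and each
  -- projection onto the unit is a multiple of the right evaluation. If `c` kills the dimension, it
  -- kills the coevaluation, and by the zigzag identity also the identity of `V i`.
  choose s hs using fun α => φ.exists_smul_evt hV i (d.p F.o α ≫ F.unitIso.hom)
  rw [rightTrace_eq, id_whiskerRight, Category.id_comp] at hc
  have h0 : c • η_ (V i) (ld (V i)) = 0 := by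
    calc c • η_ (V i) (ld (V i)) = c • (η_ (V i) (ld (V i)) ≫ ∑ j, ∑ α, d.p j α ≫ d.q j α) := by
          rw [d.sum_p_q, Category.comp_id]
      _ = c • ∑ j, ∑ α, (η_ (V i) (ld (V i)) ≫ d.p j α) ≫ d.q j α := by
          simp only [Preadditive.comp_sum, Category.assoc]
      _ = c • ∑ α, (η_ (V i) (ld (V i)) ≫ d.p F.o α) ≫ d.q F.o α := by
          congr 1
          apply Finset.sum_eq_single F.o
          · intro j _ hj
            apply Finset.sum_eq_zero
            intro α _
            have h1 := hV.hom_ne F.o j hj.symm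
              (F.unitIso.hom ≫ η_ (V i) (ld (V i)) ≫ d.p j α)
            have h2 : η_ (V i) (ld (V i)) ≫ d.p j α = 0 := by
              rw [← cancel_epi F.unitIso.hom, h1, comp_zero]
            rw [h2, zero_comp]
          · simp
      _ = ∑ α, s α • ((c • (η_ (V i) (ld (V i)) ≫ φ.evt (V i))) ≫ F.unitIso.inv ≫
            d.q F.o α) := by
          rw [Finset.smul_sum]
          apply Finset.sum_congr rfl
          intro α _
          have h3 : d.p F.o α = (s α • φ.evt (V i)) ≫ F.unitIso.inv := by
            rw [← hs, Category.assoc, Iso.hom_inv_id, Category.comp_id]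
          rw [h3]
          simp only [Linear.smul_comp, Linear.comp_smul, Category.assoc]
          rw [smul_comm]
      _ = 0 := by simp only [hc, zero_comp, smul_zero, Finset.sum_const_zero]
  apply hV.smul_eq_zero (i := i)
  have h1 : 𝟙 (V i) = (λ_ _).inv ≫ (η_ (V i) (ld (V i)) ▷ V i) ≫ (α_ _ _ _).hom ≫
      V i ◁ ε_ (V i) (ld (V i)) ≫ (ρ_ _).hom := by
    rw [ExactPairing.evaluation_coevaluation_assoc]; simp
  have h2 : (c • η_ (V i) (ld (V i))) ▷ V i = 0 := by rw [h0]; simp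
  rw [MonoidalLinear.smul_whiskerRight] at h2
  rw [h1, ← Linear.comp_smul, ← Linear.smul_comp, h2]
  simp

/-- The trace form is nondegenerate. -/
lemma SovereignStructure.trace_ext (hV : IsFusion k V) {X : C} {a b : X ⟶ X}
    (h : ∀ g : X ⟶ X, φ.rightTrace (g ≫ a) = φ.rightTrace (g ≫ b)) : a = b := by
  obtain ⟨d⟩ := hV.nonempty_decomp X
  rw [← sub_eq_zero]
  have h' (g : X ⟶ X) : φ.rightTrace (g ≫ (a - b)) = 0 := by
    rw [Preadditive.comp_sub, rightTrace_sub, h, sub_self]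
  have hz (i j α β) : d.q i α ≫ (a - b) ≫ d.p j β = 0 := by
    by_cases hij : i = j
    · subst hij
      obtain ⟨c, hc⟩ := hV.exists_smul (d.q i α ≫ (a - b) ≫ d.p i β)
      -- This test endomorphism isolates one matrix entry: by cyclicity its trace with `a - b` is
      -- the scalar entry `c` times the dimension of `V i`, which is cancellable.
      have h1 := h' (d.p i β ≫ d.q i α)
      rw [Category.assoc, φ.rightTrace_comm, Category.assoc, hc, rightTrace_smul] at h1
      rw [hc, φ.smul_dim_eq_zero hV i h1, zero_smul]
    · exact hV.hom_ne i j hij _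
  calc a - b = (∑ i, ∑ α, d.p i α ≫ d.q i α) ≫ (a - b) ≫ ∑ j, ∑ β, d.p j β ≫ d.q j β := by
        rw [d.sum_p_q, Category.id_comp, Category.comp_id]
    _ = ∑ j, ∑ β, ∑ i, ∑ α, d.p i α ≫ (d.q i α ≫ (a - b) ≫ d.p j β) ≫ d.q j β := by
        simp only [Preadditive.sum_comp, Preadditive.comp_sum, Category.assoc]
    _ = 0 := by simp only [hz, zero_comp, comp_zero, Finset.sum_const_zero]

/-- The ribbon structure on the center. -/
noncomputable def SovereignStructure.ribbon (hV : IsFusion k V) (hφ : φ.IsSpherical) :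
    RibbonStructure (Center C) where
  twist := φ.center.twistIso
  naturality f := φ.center.twist_naturality f
  tensor X Y := φ.center.twist_tensor X Y
  self_dual M := by
    apply Center.ext
    change (dualMap (ld M) (ld M) (φ.center.twistHom M)).f = (φ.center.twistHom (ld M)).f
    rw [center_dualMap, φ.center_twistHom, φ.center_twistHom]
    change dualMap (ld M.1) (ld M.1) _ = canonicalTwist φ (centerLd M)
    -- It suffices to compare traces against duals of endomorphisms of `M`. On the left, dualization
    -- turns the right trace into a left trace and sphericality turns it back; `trace_twist` handles
    -- the other side.
    apply φ.trace_ext hV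
    intro h
    obtain ⟨g, rfl⟩ := exists_dualMap_eq (X := M.1) (Y := M.1) (ld M.1) (ld M.1) h
    refine Eq.trans ?_ (trace_twist φ M g)
    rw [← dualMap_comp, φ.rightTrace_dualMap, hφ, φ.rightTrace_comm]

end TraceForm
end CenterCoend


set_option linter.unusedSectionVars false

namespace CenterCoend
open Limits

section Hat
variable {D : Type u} [Category.{v} D] [MonoidalCategory.{v} D]

lemma dualMap_conj (P P' P'' W W' W'' X X' : D) [ExactPairing P P'] [ExactPairing P' P'']
    [ExactPairing W W'] [ExactPairing W' W''] [ExactPairing X X'] (b : W ⟶ P) (c : P ⟶ W) :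
    dualMap ((W' ⊗ X') ⊗ W'') ((P' ⊗ X') ⊗ P'') (dualMap P' W' c ⊗ₘ X ◁ b) =
      dualMap W' P' b ▷ X' ⊗ₘ dualMap W'' P'' (dualMap P' W' c) := by
  rw [MonoidalCategory.tensorHom_def, MonoidalCategory.tensorHom_def]
  refine (dualMap_comp ((W' ⊗ X') ⊗ W'') ((W' ⊗ X') ⊗ P'') ((P' ⊗ X') ⊗ P'')
    (dualMap P' W' c ▷ (X ⊗ W)) (P' ◁ (X ◁ b))).trans ?_
  congr 1
  · refine (dualMap_whiskerLeft (W' ⊗ X') (P' ⊗ X') P'' (X ◁ b)).trans ?_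
    rw [dualMap_whiskerLeft W' P' X' b]
  · exact dualMap_whiskerRight W'' P'' (W' ⊗ X') (dualMap P' W' c)

/-- Conjugation of `hat` by morphisms. -/
lemma hat_conj (P P' P'' W W' W'' X X' : D) [ExactPairing P P'] [ExactPairing P' P'']
    [ExactPairing W W'] [ExactPairing W' W''] [ExactPairing X X'] (b : W ⟶ P) (c : P ⟶ W) {U Z : D}
    (g : ((W' ⊗ X') ⊗ W'') ⊗ U ⟶ Z) :
    hat (P' ⊗ (X ⊗ P)) ((P' ⊗ X') ⊗ P'') ((dualMap W' P' b ▷ X' ⊗ₘ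
      dualMap W'' P'' (dualMap P' W' c)) ▷ U ≫ g) =
    hat (W' ⊗ (X ⊗ W)) ((W' ⊗ X') ⊗ W'') g ≫ (dualMap P' W' c ⊗ₘ X ◁ b) ▷ Z := by
  rw [← dualMap_conj P P' P'' W W' W'' X X' b c, hat_whiskerRight _ _ (P' ⊗ (X ⊗ P)) ((P' ⊗ X') ⊗ P'')]

end Hat

/-! ### Expansion of the coaction over the labels -/

section Coend
variable {k : Type w'} [CommRing k] {C : Type u} [Category.{v} C] [Preadditive C]
    [Linear k C] [MonoidalCategory.{v} C] [MonoidalPreadditive C] [MonoidalLinear k C]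
    [RigidCategory C] [HasFiniteBiproducts C] {I : Type w} [Fintype I] {V : I → C}
    (F : FusionChoices V)

lemma hatS_sum {i j : I} {Z : C} {J : Type*} (s : Finset J) (g : J → (summand V i j ⟶ Z)) :
    hatS (∑ t ∈ s, g t) = ∑ t ∈ s, hatS (g t) := by
  unfold hatS
  rw [← hat_sum]
  simp only [monoidalComp, Preadditive.comp_sum]

lemma inc_prj [DecidableEq I] {Z : C} (i j i' j' : I) (f : summand V i' j' ⟶ Z) :
    inc V i j ≫ prj V i' j' ≫ f = if h : i = i' ∧ j = j' then
      eqToHom (by rw [h.1, h.2]) ≫ f else 0 := by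
  unfold inc prj
  rw [biproduct.ι_π_assoc]
  split_ifs with h1 h2 h2
  · rfl
  · exact absurd ⟨congrArg Prod.fst h1, congrArg Prod.snd h1⟩ h2
  · exact absurd (Prod.ext h2.1 h2.2) h1
  · rw [zero_comp]

lemma inc_sum_prj {Z : C} (i j : I) (f : ∀ i j, summand V i j ⟶ Z) :
    inc V i j ≫ ∑ i, ∑ j, prj V i j ≫ f i j = f i j := by
  classical
  simp only [Preadditive.comp_sum, inc_prj]
  rw [Finset.sum_eq_single i, Finset.sum_eq_single j]
  · simp
  · intro b _ hb
    rw [dif_neg]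
    exact fun h => hb h.2.symm
  · simp
  · intro a _ ha
    apply Finset.sum_eq_zero
    intro b _
    rw [dif_neg]
    exact fun h => ha h.1.symm
  · simp

lemma inc_whiskerRight_sum_prj {Y Z : C} (i j : I) (f : ∀ i j, summand V i j ⊗ Y ⟶ Z) :
    inc V i j ▷ Y ≫ ∑ i, ∑ j, prj V i j ▷ Y ≫ f i j = f i j := by
  classical
  have h (i' j' : I) : inc V i j ▷ Y ≫ prj V i' j' ▷ Y ≫ f i' j' =
      if h : i = i' ∧ j = j' then eqToHom (by rw [h.1, h.2]) ≫ f i' j' else 0 := by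
    rw [← comp_whiskerRight_assoc, ← Category.comp_id (prj V i' j'), inc_prj]
    split_ifs with h
    · obtain ⟨rfl, rfl⟩ := h
      simp
    · simp
  simp only [Preadditive.comp_sum, h]
  rw [Finset.sum_eq_single i, Finset.sum_eq_single j]
  · simp
  · intro b _ hb
    rw [dif_neg]
    exact fun h => hb h.2.symm
  · simp
  · intro a _ ha
    apply Finset.sum_eq_zero
    intro b _
    rw [dif_neg]
    exact fun h => ha h.1.symm
  · simp

lemma coendObj_id : ∑ i, ∑ j, prj V i j ≫ inc V i j = 𝟙 (coendObj V) := by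
  apply coendObj_hom_ext
  intro i j
  rw [inc_sum_prj, Category.comp_id]

/-- The value of the coaction on a member of the family. -/
lemma comp_coendCoact (hV : IsFusion k V) (M : Center C) {j : I} (x : V j ⟶ M.1) :
    x ≫ coendCoact F M = ∑ i, hatS (inc V i j) ≫
      (ld (V i) ◁ (x ▷ V i) ≫ act M (V i) (ld (V i))) ▷ coendObj V := by
  rw [coendCoact_eq, Preadditive.comp_sum]
  apply Finset.sum_congr rfl
  intro i _
  rw [reassoc_of% kapHat_nat F hV i (ld (V j)) (ld M.1) x, kapHat_self F hV, ← comp_whiskerRight]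

/-- The device behind the verification of the formulas. After restriction to `V j` the second label
is fixed, so a formula is tested on the summands `(i,j)` with `i` varying, each followed by the
action of `V i`. -/
lemma comp_coendCoact_comp (hV : IsFusion k V) (M : Center C) {j : I} (x : V j ⟶ M.1) {Z : C}
    (f : coendObj V ⟶ Z) : x ≫ coendCoact F M ≫ M.1 ◁ f = ∑ i, hatS (inc V i j ≫ f) ≫
      (ld (V i) ◁ (x ▷ V i) ≫ act M (V i) (ld (V i))) ▷ Z := by
  rw [← Category.assoc, comp_coendCoact F hV, Preadditive.sum_comp]
  apply Finset.sum_congr rfl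
  intro i _
  rw [← hatS_comp, Category.assoc, Category.assoc, whisker_exchange]

lemma comp_coendCoact_whiskerRight (hV : IsFusion k V) (M : Center C) {j : I} (x : V j ⟶ M.1)
    {Y Z : C} (f : coendObj V ⊗ Y ⟶ Z) : x ▷ Y ≫ (coendCoact F M ▷ Y ⊗≫ M.1 ◁ f) =
      ∑ i, hat (ld (V i) ⊗ (V j ⊗ V i)) ((ld (V i) ⊗ ld (V j)) ⊗ ld (ld (V i)))
        (𝟙 (((ld (V i) ⊗ ld (V j)) ⊗ ld (ld (V i))) ⊗ (V j ⊗ Y)) ⊗≫ inc V i j ▷ Y ≫ f) ≫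
      (ld (V i) ◁ (x ▷ V i) ≫ act M (V i) (ld (V i))) ▷ Z := by
  calc _ = (x ≫ coendCoact F M) ▷ Y ⊗≫ M.1 ◁ f := by monoidal
    _ = ∑ i, (hatS (inc V i j) ≫
      (ld (V i) ◁ (x ▷ V i) ≫ act M (V i) (ld (V i))) ▷ coendObj V) ▷ Y ⊗≫ M.1 ◁ f := by
        rw [comp_coendCoact F hV]
        simp only [sum_whiskerRight, monoidalComp, Preadditive.sum_comp]
    _ = _ := by
        apply Finset.sum_congr rfl
        intro i _
        calc _ = hatS (inc V i j) ▷ Y ⊗≫ ((ld (V i) ◁ (x ▷ V i) ≫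
              act M (V i) (ld (V i))) ▷ (coendObj V ⊗ Y) ≫ M.1 ◁ f) := by monoidal
          _ = _ := by rw [← whisker_exchange]; unfold hatS hat; monoidal

lemma Decomp.whiskerRight_hom_ext {X Y Z : C} (d : Decomp V X) {s t : X ⊗ Y ⟶ Z}
    (h : ∀ j (x : V j ⟶ X), x ▷ Y ≫ s = x ▷ Y ≫ t) : s = t := by
  have e (s : X ⊗ Y ⟶ Z) : s = ∑ j, ∑ α, d.p j α ▷ Y ≫ d.q j α ▷ Y ≫ s := by
    simp only [← comp_whiskerRight_assoc, ← Preadditive.sum_comp, ← sum_whiskerRight, d.sum_p_q]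
    simp
  rw [e s, e t]
  simp only [h]

/-- The expansion of the action of a tensor product of members of the family. -/
lemma act_decomp (M : Center C) (Y Y' : C) [ExactPairing Y Y'] (d : Decomp V Y) :
    act M Y Y' = ∑ i, ∑ α, (dualMap (ld (V i)) Y' (d.q i α) ⊗ₘ M.1 ◁ d.p i α) ≫
      act M (V i) (ld (V i)) := by
  calc _ = Y' ◁ (M.1 ◁ (∑ i, ∑ α, d.p i α ≫ d.q i α)) ≫ act M Y Y' := by
        rw [d.sum_p_q]; simp
    _ = ∑ i, ∑ α, Y' ◁ (M.1 ◁ d.p i α) ≫ Y' ◁ (M.1 ◁ d.q i α) ≫ act M Y Y' := by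
        simp only [whiskerLeft_sum, Preadditive.sum_comp, MonoidalCategory.whiskerLeft_comp,
          Category.assoc]
    _ = _ := by
        refine Finset.sum_congr rfl fun i _ => Finset.sum_congr rfl fun α _ => ?_
        rw [← act_dinat M (ld (V i)) Y', ← Category.assoc]
        congr 1
        exact (MonoidalCategory.tensorHom_def' _ _).symm

end Coend
end CenterCoend


set_option linter.unusedSectionVars false

namespace CenterCoend
open Limits

/-! ### The counit and the form of the twist -/

section Abstract
variable {D : Type u} [Category.{v} D] [MonoidalCategory.{v} D]

lemma hat_unit_counit (X X' : D) [ExactPairing X X'] :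
    hat (𝟙_ D ⊗ (X ⊗ 𝟙_ D)) ((𝟙_ D ⊗ X') ⊗ 𝟙_ D) (𝟙 (((𝟙_ D ⊗ X') ⊗ 𝟙_ D) ⊗ X) ⊗≫ ε_ X X') =
      𝟙 X ⊗≫ 𝟙 ((𝟙_ D ⊗ (X ⊗ 𝟙_ D)) ⊗ 𝟙_ D) := by
  unfold hat
  rw [coeval_tensor, coeval_tensor, coeval_unit]
  calc _ = 𝟙 X ⊗≫ (η_ X X' ▷ X ⊗≫ X ◁ ε_ X X') ⊗≫ 𝟙 ((𝟙_ D ⊗ (X ⊗ 𝟙_ D)) ⊗ 𝟙_ D) := by monoidal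
    _ = _ := by rw [ExactPairing.evaluation_coevaluation'']; monoidal

variable [RightRigidCategory D] (φ : SovereignStructure D)

lemma SovereignStructure.evt_ld_eq (X : D) :
    φ.evt (ld X) = ld X ◁ (φ.iso X).inv ≫ ε_ X (ld X) := by
  rw [← φ.evt_ld, ← MonoidalCategory.whiskerLeft_comp_assoc, Iso.inv_hom_id]
  simp

lemma SovereignStructure.coev_evt_ld (X : D) : η_ X (ld X) ▷ ld (ld X) ⊗≫ X ◁ φ.evt (ld X) =
    𝟙 (𝟙_ D ⊗ ld (ld X)) ⊗≫ (φ.iso X).inv ⊗≫ 𝟙 (X ⊗ 𝟙_ D) := by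
  rw [φ.evt_ld_eq]
  calc _ = (η_ X (ld X) ▷ ld (ld X) ≫ (X ⊗ ld X) ◁ (φ.iso X).inv) ⊗≫ X ◁ ε_ X (ld X) := by
        monoidal
    _ = 𝟙 (𝟙_ D ⊗ ld (ld X)) ⊗≫ (φ.iso X).inv ⊗≫ (η_ X (ld X) ▷ X ⊗≫ X ◁ ε_ X (ld X)) := by
        rw [← whisker_exchange]; monoidal
    _ = _ := by rw [ExactPairing.evaluation_coevaluation'']; monoidal

/-- Rotation unfolds the nested evaluations: what is left is the coevaluation of the right dual
inserted before `X`, which is how the canonical twist begins. -/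
lemma SovereignStructure.hat_twistPos (X : D) :
    hat (ld X ⊗ (X ⊗ X)) ((ld X ⊗ ld X) ⊗ ld (ld X)) (𝟙 (((ld X ⊗ ld X) ⊗ ld (ld X)) ⊗ X) ⊗≫
      ld X ◁ φ.evt (ld X) ▷ X ⊗≫ ε_ X (ld X)) = 𝟙 X ⊗≫ φ.coevt X ▷ X ⊗≫
        𝟙 ((ld X ⊗ (X ⊗ X)) ⊗ 𝟙_ D) := by
  unfold hat
  rw [coeval_tensor, coeval_tensor]
  calc _ = 𝟙 X ⊗≫ η_ (ld X) (ld (ld X)) ▷ X ⊗≫ ld X ◁ (η_ X (ld X) ▷ (ld (ld X) ⊗ X)) ⊗≫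
        ld X ◁ (X ◁ ((η_ X (ld X) ▷ (ld X ⊗ ld (ld X)) ≫ (X ⊗ ld X) ◁ φ.evt (ld X)) ▷ X)) ⊗≫
        ld X ◁ (X ◁ (X ◁ ε_ X (ld X))) ⊗≫ 𝟙 ((ld X ⊗ (X ⊗ X)) ⊗ 𝟙_ D) := by monoidal
    _ = 𝟙 X ⊗≫ η_ (ld X) (ld (ld X)) ▷ X ⊗≫ ld X ◁ ((η_ X (ld X) ▷ ld (ld X) ⊗≫
        X ◁ φ.evt (ld X)) ▷ X) ⊗≫
        ld X ◁ (X ◁ (η_ X (ld X) ▷ X ⊗≫ X ◁ ε_ X (ld X))) ⊗≫ 𝟙 ((ld X ⊗ (X ⊗ X)) ⊗ 𝟙_ D) := by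
        rw [← whisker_exchange]; monoidal
    _ = _ := by
        rw [φ.coev_evt_ld, ExactPairing.evaluation_coevaluation'']
        unfold SovereignStructure.coevt
        monoidal

lemma SovereignStructure.hat_twistNeg {X Y : D} (b : ld X ⟶ Y) (a : Y ⟶ ld X) :
    hat (ld X ⊗ (Y ⊗ X)) ((ld X ⊗ ld Y) ⊗ ld (ld X)) (𝟙 (((ld X ⊗ ld Y) ⊗ ld (ld X)) ⊗ Y) ⊗≫
      ((ld X ◁ dualMap (ld (ld X)) (ld Y) b ≫ φ.evt (ld X)) ⊗ₘ
        (ld (ld X) ◁ a ≫ ε_ (ld X) (ld (ld X)))) ≫ (λ_ (𝟙_ D)).hom) =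
      𝟙 Y ⊗≫ a ⊗≫ ld X ◁ (φ.coevt X ≫ b ▷ X) ⊗≫ 𝟙 ((ld X ⊗ (Y ⊗ X)) ⊗ 𝟙_ D) := by
  unfold hat
  rw [coeval_tensor, coeval_tensor]
  have h : η_ Y (ld Y) ⊗≫ Y ◁ (η_ X (ld X) ▷ ld Y) ⊗≫ Y ◁ (X ◁ (ld X ◁ dualMap (ld (ld X)) (ld Y) b ≫
      φ.evt (ld X))) = φ.coevt X ⊗≫ b ▷ X ⊗≫ 𝟙 (Y ⊗ (X ⊗ 𝟙_ D)) := by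
    calc _ = η_ Y (ld Y) ⊗≫ Y ◁ (η_ X (ld X) ▷ ld Y ≫ (X ⊗ ld X) ◁ dualMap (ld (ld X)) (ld Y) b) ⊗≫
          Y ◁ (X ◁ φ.evt (ld X)) := by monoidal
      _ = (η_ Y (ld Y) ≫ Y ◁ dualMap (ld (ld X)) (ld Y) b) ⊗≫ Y ◁ (η_ X (ld X) ▷ ld (ld X) ⊗≫
          X ◁ φ.evt (ld X)) := by rw [← whisker_exchange]; monoidal
      _ = η_ (ld X) (ld (ld X)) ≫ (b ▷ ld (ld X) ≫ Y ◁ (φ.iso X).inv) ⊗≫ 𝟙 (Y ⊗ (X ⊗ 𝟙_ D)) := by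
          rw [coeval_dualMap (ld (ld X)) (ld Y) b, φ.coev_evt_ld]; monoidal
      _ = _ := by
          rw [← whisker_exchange]
          unfold SovereignStructure.coevt
          monoidal
  calc _ = 𝟙 Y ⊗≫ η_ (ld X) (ld (ld X)) ▷ Y ⊗≫ ld X ◁ (((η_ Y (ld Y) ⊗≫ Y ◁ (η_ X (ld X) ▷ ld Y) ⊗≫
        Y ◁ (X ◁ (ld X ◁ dualMap (ld (ld X)) (ld Y) b ≫ φ.evt (ld X)))) ▷ (ld (ld X) ⊗ Y)) ≫
        (Y ⊗ (X ⊗ 𝟙_ D)) ◁ (ld (ld X) ◁ a ≫ ε_ (ld X) (ld (ld X)))) ⊗≫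
        𝟙 ((ld X ⊗ (Y ⊗ X)) ⊗ 𝟙_ D) := by
        rw [MonoidalCategory.tensorHom_def]; monoidal
    _ = 𝟙 Y ⊗≫ (η_ (ld X) (ld (ld X)) ▷ Y ≫ (ld X ⊗ ld (ld X)) ◁ a) ⊗≫
        ld X ◁ (ε_ (ld X) (ld (ld X))) ⊗≫ ld X ◁ (φ.coevt X ⊗≫ b ▷ X ⊗≫ 𝟙 (Y ⊗ (X ⊗ 𝟙_ D))) ⊗≫
        𝟙 ((ld X ⊗ (Y ⊗ X)) ⊗ 𝟙_ D) := by
        rw [← whisker_exchange, h]; monoidal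
    _ = 𝟙 Y ⊗≫ a ⊗≫ (η_ (ld X) (ld (ld X)) ▷ ld X ⊗≫
        ld X ◁ (ε_ (ld X) (ld (ld X)))) ⊗≫ ld X ◁ (φ.coevt X ⊗≫ b ▷ X ⊗≫ 𝟙 (Y ⊗ (X ⊗ 𝟙_ D))) ⊗≫
        𝟙 ((ld X ⊗ (Y ⊗ X)) ⊗ 𝟙_ D) := by
        rw [← whisker_exchange]; monoidal
    _ = _ := by rw [ExactPairing.evaluation_coevaluation'']; monoidal

end Abstract

section Coend
variable {k : Type w'} [CommRing k] {C : Type u} [Category.{v} C] [Preadditive C]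
    [Linear k C] [MonoidalCategory.{v} C] [MonoidalPreadditive C] [MonoidalLinear k C]
    [RigidCategory C] [HasFiniteBiproducts C] {I : Type w} [Fintype I] {V : I → C}
    (F : FusionChoices V)

lemma inc_sum_prj_of_injective {J : Type*} [Fintype J] {Z : C} {a b : J → I}
    (hab : ∀ s t, a s = a t → b s = b t → s = t) (f : ∀ t, summand V (a t) (b t) ⟶ Z) (t : J) :
    inc V (a t) (b t) ≫ ∑ s, prj V (a s) (b s) ≫ f s = f t := by
  classical
  simp only [Preadditive.comp_sum, inc_prj]
  rw [Finset.sum_eq_single t]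
  · simp
  · intro s _ hs
    rw [dif_neg]
    exact fun h => hs (hab _ _ h.1 h.2).symm
  · simp

lemma inc_sum_prj_eq_zero {J : Type*} [Fintype J] {Z : C} {a b : J → I} {i j : I}
    (h : ∀ t, ¬(i = a t ∧ j = b t)) (f : ∀ t, summand V (a t) (b t) ⟶ Z) :
    inc V i j ≫ ∑ s, prj V (a s) (b s) ≫ f s = 0 := by
  classical
  simp only [Preadditive.comp_sum, inc_prj]
  apply Finset.sum_eq_zero
  intro s _
  rw [dif_neg (h s)]

lemma hatS_zero {i j : I} {Z : C} : hatS (0 : summand V i j ⟶ Z) = 0 := by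
  have := hatS_sum (V := V) (i := i) (j := j) (Z := Z) (∅ : Finset Empty) (fun _ => 0)
  simpa using this

lemma hatS_counitAux (j : I) : hatS (counitAux F j) = 𝟙 (V j) ⊗≫
    (dualMap (ld (V F.o)) (𝟙_ C) F.unitIso.hom ⊗ₘ V j ◁ F.unitIso.inv) ▷ 𝟙_ C := by
  have h := hat_conj (V F.o) (ld (V F.o)) (ld (ld (V F.o))) (𝟙_ C) (𝟙_ C) (𝟙_ C) (V j) (ld (V j))
    F.unitIso.inv F.unitIso.hom (𝟙 (((𝟙_ C ⊗ ld (V j)) ⊗ 𝟙_ C) ⊗ V j) ⊗≫ ε_ (V j) (ld (V j)))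
  rw [hat_unit_counit] at h
  refine Eq.trans ?_ (h.trans ?_)
  · unfold hatS counitAux
    congr 1
    simp only [MonoidalCategory.tensorHom_def]
    monoidal
  · simp only [MonoidalCategory.tensorHom_def]
    monoidal

/-- Only the label of the unit contributes. The identification with the unit object cancels by
dinaturality of the action, and the unit acts trivially. -/
lemma counit_formula (hV : IsFusion k V) (M : Center C) :
    coendCoact F M ≫ M.1 ◁ counitFormula F = (ρ_ M.1).inv := by
  apply (F.dec M.1).hom_ext
  intro j α
  generalize (F.dec M.1).q j α = x
  rw [comp_coendCoact_comp F hV, Finset.sum_eq_single F.o]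
  · have h1 : inc V F.o j ≫ counitFormula F = counitAux F j :=
      inc_sum_prj_of_injective (a := fun _ => F.o) (b := id) (fun s t _ h => h)
        (fun j => counitAux F j) j
    have h2 := act_dinat M (ld (V F.o)) (𝟙_ C) F.unitIso.hom
    rw [h1, hatS_counitAux]
    calc _ = 𝟙 (V j) ⊗≫ ((dualMap (ld (V F.o)) (𝟙_ C) F.unitIso.hom ▷ (V j ⊗ 𝟙_ C) ≫
          ld (V F.o) ◁ (V j ◁ F.unitIso.inv ≫ x ▷ V F.o)) ≫
          act M (V F.o) (ld (V F.o))) ▷ 𝟙_ C := by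
          rw [MonoidalCategory.tensorHom_def]; monoidal
      _ = 𝟙 (V j) ⊗≫ (𝟙_ C ◁ (x ▷ 𝟙_ C) ≫ 𝟙_ C ◁ (M.1 ◁ F.unitIso.inv) ≫
          dualMap (ld (V F.o)) (𝟙_ C) F.unitIso.hom ▷ (M.1 ⊗ V F.o) ≫
          act M (V F.o) (ld (V F.o))) ▷ 𝟙_ C := by
          rw [whisker_exchange, ← whisker_exchange, MonoidalCategory.whiskerLeft_comp]
          simp only [Category.assoc]
      _ = 𝟙 (V j) ⊗≫ (𝟙_ C ◁ (x ▷ 𝟙_ C) ≫ 𝟙_ C ◁ (M.1 ◁ (F.unitIso.inv ≫ F.unitIso.hom)) ≫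
          act M (𝟙_ C) (𝟙_ C)) ▷ 𝟙_ C := by
          rw [h2]; monoidal
      _ = _ := by rw [Iso.inv_hom_id, act_unit]; monoidal
  · intro i _ hi
    have h1 : inc V i j ≫ counitFormula F = 0 :=
      inc_sum_prj_eq_zero (a := fun _ => F.o) (b := id) (fun t h => hi h.1) _
    rw [h1, hatS_zero, zero_comp]
  · simp

/-- Restricted to `V j`, only the label `j` contributes, giving a coevaluation of `V j` followed by
its action. Dinaturality along the map from `V j` replaces `V j` by `M`, which is the canonical
twist. -/
lemma twistPos_formula (φ : SovereignStructure C) (hV : IsFusion k V) (M : Center C) :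
    coendCoact F M ≫ M.1 ◁ twistPosFormula φ V = canonicalTwist φ M ≫ (ρ_ M.1).inv := by
  apply (F.dec M.1).hom_ext
  intro j α
  generalize (F.dec M.1).q j α = x
  rw [comp_coendCoact_comp F hV, Finset.sum_eq_single j]
  · have h1 : inc V j j ≫ twistPosFormula φ V = twistPosAux φ V j :=
      inc_sum_prj_of_injective (a := id) (b := id) (fun s t h _ => h)
        (fun j => twistPosAux φ V j) j
    have h2 := act_dinat M (ld (V j)) (ld M.1) x
    have h3 : hatS (twistPosAux φ V j) = 𝟙 (V j) ⊗≫ φ.coevt (V j) ▷ V j ⊗≫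
        𝟙 ((ld (V j) ⊗ (V j ⊗ V j)) ⊗ 𝟙_ C) := by
      rw [← φ.hat_twistPos]
      unfold hatS twistPosAux
      congr 1
      unfold SovereignStructure.evt
      monoidal
    have h4 : canonicalTwist φ M = 𝟙 M.1 ⊗≫ φ.coevt M.1 ▷ M.1 ⊗≫ act M M.1 (ld M.1) := by
      unfold canonicalTwist SovereignStructure.coevt centerAction act
      monoidal
    rw [h1, h3, h4]
    symm
    calc _ = 𝟙 (V j) ⊗≫ (𝟙_ C ◁ x ≫ φ.coevt M.1 ▷ M.1) ⊗≫ act M M.1 (ld M.1) ⊗≫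
          𝟙 (M.1 ⊗ 𝟙_ C) := by monoidal
      _ = 𝟙 (V j) ⊗≫ φ.coevt M.1 ▷ V j ⊗≫ (ld M.1 ◁ (M.1 ◁ x) ≫ act M M.1 (ld M.1)) ⊗≫
          𝟙 (M.1 ⊗ 𝟙_ C) := by rw [whisker_exchange]; monoidal
      _ = 𝟙 (V j) ⊗≫ (φ.coevt M.1 ≫ dualMap (ld (V j)) (ld M.1) x ▷ M.1) ▷ V j ⊗≫
          act M (V j) (ld (V j)) ⊗≫ 𝟙 (M.1 ⊗ 𝟙_ C) := by rw [← h2]; monoidal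
      _ = _ := by rw [φ.coevt_dinat]; monoidal
  · intro i _ hi
    have h1 : inc V i j ≫ twistPosFormula φ V = 0 :=
      inc_sum_prj_eq_zero (a := id) (b := id) (fun t h => hi (h.1.trans h.2.symm)) _
    rw [h1, hatS_zero, zero_comp]
  · simp

/-- Decompositions by means of the duals of the members of the family. -/
lemma sum_dual (hV : IsFusion k V) {X : C} (d : Decomp V X) :
    ∑ i, ∑ α, (d.p (F.dual i) α ≫ (F.dualIso i).hom) ≫ (F.dualIso i).inv ≫ d.q (F.dual i) α =
      𝟙 X := by
  simp only [Category.assoc, Iso.hom_inv_id_assoc]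
  -- Over a nontrivial ring the map `F.dual` is injective, hence a permutation of the finite set of
  -- labels, and reindexes the decomposition. Over the zero ring all morphisms are equal.
  rcases subsingleton_or_nontrivial k with hk | hk
  · rw [← one_smul k (𝟙 X), Subsingleton.elim (1 : k) 0, zero_smul, ← one_smul k (∑ i, _),
      Subsingleton.elim (1 : k) 0, zero_smul]
  · rw [← d.sum_p_q]
    exact Fintype.sum_bijective F.dual
      (Finite.injective_iff_bijective.1 (hV.dual_injective F)) _ _ fun _ => rfl

/-- The expansion of the coaction. -/
lemma coendCoact_comp (hV : IsFusion k V) (M : Center C) {Z : C}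
    (f : coendObj V ⟶ Z) : coendCoact F M ≫ M.1 ◁ f =
      ∑ i, ∑ j, ∑ α, (F.dec M.1).p j α ≫ hatS (inc V i j ≫ f) ≫
        (ld (V i) ◁ ((F.dec M.1).q j α ▷ V i) ≫ act M (V i) (ld (V i))) ▷ Z := by
  calc _ = (∑ j, ∑ α, (F.dec M.1).p j α ≫ (F.dec M.1).q j α) ≫ coendCoact F M ≫ M.1 ◁ f := by
        rw [(F.dec M.1).sum_p_q, Category.id_comp]
    _ = ∑ j, ∑ α, ∑ i, (F.dec M.1).p j α ≫ hatS (inc V i j ≫ f) ≫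
        (ld (V i) ◁ ((F.dec M.1).q j α ▷ V i) ≫ act M (V i) (ld (V i))) ▷ Z := by
        simp only [Preadditive.sum_comp, Category.assoc, comp_coendCoact_comp F hV,
          Preadditive.comp_sum]
    _ = _ := by
        rw [Finset.sum_comm]
        refine Finset.sum_congr rfl fun j _ => ?_
        rw [Finset.sum_comm]

end Coend
end CenterCoend


set_option linter.unusedSectionVars false

namespace CenterCoend
open Limits

/-! ### The form of the inverse twist -/

section Twist
variable {C : Type u} [Category.{v} C] [MonoidalCategory.{v} C] [RigidCategory C]

lemma SovereignStructure.center_twistInv (φ : SovereignStructure C) (M : Center C) :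
    (φ.center.twistInv M).f = 𝟙 M.1 ⊗≫ M.1 ◁ (η_ M.1 (ld M.1) ≫ (M.2.β (ld M.1)).hom) ⊗≫
      φ.evt M.1 ▷ M.1 ⊗≫ 𝟙 M.1 := by
  rw [φ.center.twistInv_eq]
  simp only [Center.comp_f, Center.whiskerLeft_f, Center.whiskerRight_f, φ.center_evt,
    Center.associator_inv_f, Center.leftUnitor_hom_f, Center.rightUnitor_inv_f]
  change (ρ_ M.1).inv ≫ M.1 ◁ (η_ M.1 (ld M.1) ≫ (M.2.β (ld M.1)).hom) ≫ (α_ _ _ _).inv ≫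
    φ.evt M.1 ▷ M.1 ≫ (λ_ M.1).hom = _
  monoidal

/-- Sliding `b` and the sovereign isomorphism around the loop turns the action of `X` into a
crossing with `ld M`. Here `a` and `b` occur only through `a ≫ b`, so sums over a decomposition
collapse. -/
lemma SovereignStructure.act_coevt (φ : SovereignStructure C) (M : Center C) (X : C)
    (a : M.1 ⟶ ld X) (b : ld X ⟶ M.1) :
    𝟙 M.1 ⊗≫ a ⊗≫ ld X ◁ (φ.coevt X ≫ b ▷ X) ⊗≫ act M X (ld X) =
      𝟙 M.1 ⊗≫ M.1 ◁ (η_ M.1 (ld M.1) ≫ (M.2.β (ld M.1)).hom) ⊗≫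
      ((a ≫ b) ▷ ld M.1 ≫ φ.evt M.1) ▷ M.1 ⊗≫ 𝟙 M.1 := by
  have h1 : φ.coevt X ≫ b ▷ X = η_ M.1 (ld M.1) ≫
      M.1 ◁ (dualMap (ld (ld X)) (ld M.1) b ≫ (φ.iso X).inv) := by
    rw [SovereignStructure.coevt, Category.assoc, whisker_exchange,
      ← reassoc_of% coeval_dualMap (ld (ld X)) (ld M.1) b, MonoidalCategory.whiskerLeft_comp]
  have h2 : ld X ◁ (dualMap (ld (ld X)) (ld M.1) b ≫ (φ.iso X).inv) ≫ ε_ X (ld X) =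
      b ▷ ld M.1 ≫ φ.evt M.1 := by
    rw [MonoidalCategory.whiskerLeft_comp, Category.assoc, ← φ.evt_ld_eq]
    exact φ.evt_dinat b
  rw [h1]
  generalize dualMap (ld (ld X)) (ld M.1) b ≫ (φ.iso X).inv = y at h2
  calc _ = 𝟙 M.1 ⊗≫ a ⊗≫ ld X ◁ (η_ M.1 (ld M.1)) ⊗≫ ld X ◁ (M.1 ◁ y ≫ (M.2.β X).hom) ⊗≫
        ε_ X (ld X) ▷ M.1 ⊗≫ 𝟙 M.1 := by unfold act; monoidal
    _ = 𝟙 M.1 ⊗≫ (a ▷ 𝟙_ C ≫ ld X ◁ (η_ M.1 (ld M.1) ≫ (M.2.β (ld M.1)).hom)) ⊗≫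
        (ld X ◁ y ≫ ε_ X (ld X)) ▷ M.1 ⊗≫ 𝟙 M.1 := by
        rw [M.2.naturality]; monoidal
    _ = _ := by rw [← whisker_exchange, h2]; monoidal

end Twist

section Coend
variable {k : Type w'} [CommRing k] {C : Type u} [Category.{v} C] [Preadditive C]
    [Linear k C] [MonoidalCategory.{v} C] [MonoidalPreadditive C] [MonoidalLinear k C]
    [RigidCategory C] [HasFiniteBiproducts C] {I : Type w} [Fintype I] {V : I → C}
    (F : FusionChoices V)

lemma hatS_twistNegAux (φ : SovereignStructure C) (i : I) : hatS (twistNegAux F φ i) =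
    𝟙 (V (F.dual i)) ⊗≫ (F.dualIso i).hom ⊗≫ ld (V i) ◁ (φ.coevt (V i) ≫
      (F.dualIso i).inv ▷ V i) ⊗≫ 𝟙 ((ld (V i) ⊗ (V (F.dual i) ⊗ V i)) ⊗ 𝟙_ C) := by
  rw [← φ.hat_twistNeg (F.dualIso i).inv (F.dualIso i).hom]
  unfold hatS twistNegAux
  congr 1
  have h : ((φ.iso (ld (V i))).hom ⊗ₘ
      dualMap (ld (ld (V i))) (ld (V (F.dual i))) (F.dualIso i).inv) ≫
      ε_ (ld (ld (V i))) (ld (ld (ld (V i)))) = ld (V i) ◁ dualMap (ld (ld (V i)))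
        (ld (V (F.dual i))) (F.dualIso i).inv ≫ φ.evt (ld (V i)) := by
    rw [MonoidalCategory.tensorHom_def', Category.assoc]
    rfl
  rw [h]
  simp only [MonoidalCategory.tensorHom_def]
  monoidal

lemma twistNeg_formula (φ : SovereignStructure C) (hV : IsFusion k V) (M : Center C) :
    coendCoact F M ≫ M.1 ◁ twistNegFormula F φ = (φ.center.twistInv M).f ≫ (ρ_ M.1).inv := by
  rw [coendCoact_comp F hV, φ.center_twistInv]
  have h0 (i : I) : inc V i (F.dual i) ≫ twistNegFormula F φ = twistNegAux F φ i :=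
    inc_sum_prj_of_injective (a := id) (b := F.dual) (fun s t h _ => h)
      (fun j => twistNegAux F φ j) i
  have h1 (i : I) : ∑ j, ∑ α, (F.dec M.1).p j α ≫ hatS (inc V i j ≫ twistNegFormula F φ) ≫
      (ld (V i) ◁ ((F.dec M.1).q j α ▷ V i) ≫ act M (V i) (ld (V i))) ▷ 𝟙_ C =
      ∑ α, (𝟙 M.1 ⊗≫ M.1 ◁ (η_ M.1 (ld M.1) ≫ (M.2.β (ld M.1)).hom) ⊗≫
      ((((F.dec M.1).p (F.dual i) α ≫ (F.dualIso i).hom) ≫ (F.dualIso i).inv ≫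
        (F.dec M.1).q (F.dual i) α) ▷ ld M.1 ≫ φ.evt M.1) ▷ M.1 ⊗≫ 𝟙 M.1) ≫ (ρ_ M.1).inv := by
    -- The form lives on the summands `(i, F.dual i)`, so only this second label survives. The sum
    -- over `i` then runs over a decomposition into duals, handled by `sum_dual`.
    rw [Finset.sum_eq_single (F.dual i)]
    · refine Finset.sum_congr rfl fun α _ => ?_
      rw [h0, hatS_twistNegAux, ← φ.act_coevt]
      generalize (F.dec M.1).p (F.dual i) α = p
      generalize (F.dec M.1).q (F.dual i) α = q
      monoidal
    · intro j _ hj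
      have h1 : inc V i j ≫ twistNegFormula F φ = 0 :=
        inc_sum_prj_eq_zero (a := id) (b := F.dual) (fun t h => hj (h.2.trans (by rw [h.1]; rfl))) _
      simp only [h1, hatS_zero, zero_comp, comp_zero, Finset.sum_const_zero]
    · simp
  simp only [h1]
  have h2 := sum_dual F hV (F.dec M.1)
  generalize hc : η_ M.1 (ld M.1) ≫ (M.2.β (ld M.1)).hom = c
  calc _ = (𝟙 M.1 ⊗≫ M.1 ◁ c ⊗≫
      ((∑ i, ∑ α, ((F.dec M.1).p (F.dual i) α ≫ (F.dualIso i).hom) ≫ (F.dualIso i).inv ≫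
        (F.dec M.1).q (F.dual i) α) ▷ ld M.1 ≫ φ.evt M.1) ▷ M.1 ⊗≫ 𝟙 M.1) ≫ (ρ_ M.1).inv := by
        simp only [sum_whiskerRight, Preadditive.sum_comp, Preadditive.comp_sum, monoidalComp]
    _ = _ := by rw [h2, id_whiskerRight, Category.id_comp]

end Coend
end CenterCoend


set_option linter.unusedSectionVars false

namespace CenterCoend
open Limits

/-! ### The coproduct -/

section Abstract
variable {D : Type u} [Category.{v} D] [MonoidalCategory.{v} D]

lemma hat_hat (S S' T T' : D) [ExactPairing S S'] [ExactPairing T T'] {X Z₁ Z₂ : D}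
    (g : T' ⊗ X ⟶ Z₁) (h : S' ⊗ T ⟶ Z₂) :
    hat T T' g ≫ hat S S' h ▷ Z₁ =
      hat S S' (S' ◁ hat T T' g ≫ (α_ _ _ _).inv ≫ h ▷ Z₁) ≫ (α_ _ _ _).inv := by
  rw [← comp_hat]
  unfold hat
  monoidal

/-- The two tensor decompositions of an iterated conjugate give the same coevaluation. -/
lemma hat_tensor (P P' P'' Q Q' Q'' X X' : D) [ExactPairing P P'] [ExactPairing P' P'']
    [ExactPairing Q Q'] [ExactPairing Q' Q''] [ExactPairing X X'] {U Z : D}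
    (g : ((Q' ⊗ ((P' ⊗ X') ⊗ P'')) ⊗ Q'') ⊗ U ⟶ Z) :
    hat ((Q' ⊗ P') ⊗ (X ⊗ (P ⊗ Q))) (((Q' ⊗ P') ⊗ X') ⊗ (P'' ⊗ Q''))
      (𝟙 ((((Q' ⊗ P') ⊗ X') ⊗ (P'' ⊗ Q'')) ⊗ U) ⊗≫ g) =
    hat (Q' ⊗ ((P' ⊗ (X ⊗ P)) ⊗ Q)) ((Q' ⊗ ((P' ⊗ X') ⊗ P'')) ⊗ Q'') g ⊗≫
      𝟙 (((Q' ⊗ P') ⊗ (X ⊗ (P ⊗ Q))) ⊗ Z) := by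
  unfold hat
  simp only [coeval_tensor]
  monoidal

/-- The coevaluation of `N` followed by the dual of `p` equals that of `T` followed by `p`. So `p`
and the dual of `q` stand as in `kap`, with the rest rotated into `hat`. -/
lemma comul_term (Q' Q'' N N' T T' X : D) [ExactPairing N N'] [ExactPairing T T']
    {Z₁ Z₂ : D} (p : T ⟶ N) (q : N ⟶ T) (f₁ : Q' ⊗ N' ⊗ Q'' ⊗ N ⟶ Z₁) (f₂ : T' ⊗ X ⟶ Z₂) :
    Q' ◁ (dualMap N' T' q ▷ (Q'' ⊗ X)) ⊗≫ (Q' ⊗ N' ⊗ Q'') ◁ (η_ N N' ▷ X) ⊗≫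
      (Q' ⊗ N' ⊗ Q'' ⊗ N) ◁ (dualMap T' N' p ▷ X) ⊗≫ f₁ ▷ (T' ⊗ X) ⊗≫ Z₁ ◁ f₂ =
    𝟙 (Q' ⊗ (T' ⊗ (Q'' ⊗ X))) ⊗≫ ((Q' ⊗ T') ⊗ Q'') ◁ hat T T' f₂ ⊗≫
      (((Q' ◁ dualMap N' T' q) ▷ Q'' ⊗ₘ p) ⊗≫ f₁) ▷ Z₂ ⊗≫ 𝟙 (Z₁ ⊗ Z₂) := by
  symm
  rw [MonoidalCategory.tensorHom_def']
  generalize dualMap N' T' q = d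
  unfold hat
  calc _ = 𝟙 (Q' ⊗ (T' ⊗ (Q'' ⊗ X))) ⊗≫ ((Q' ⊗ T') ⊗ Q'') ◁ (η_ T T' ▷ X) ⊗≫
        ((Q' ⊗ T') ⊗ Q'') ◁ (T ◁ f₂ ≫ p ▷ Z₂) ⊗≫
        (Q' ◁ d ▷ (Q'' ⊗ N) ⊗≫ f₁) ▷ Z₂ ⊗≫ 𝟙 (Z₁ ⊗ Z₂) := by monoidal
    _ = 𝟙 (Q' ⊗ (T' ⊗ (Q'' ⊗ X))) ⊗≫ ((Q' ⊗ T') ⊗ Q'') ◁ ((η_ T T' ≫ p ▷ T') ▷ X) ⊗≫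
        (((Q' ⊗ T') ⊗ (Q'' ⊗ N)) ◁ f₂ ≫
        (Q' ◁ d) ▷ (Q'' ⊗ N) ▷ Z₂) ⊗≫ f₁ ▷ Z₂ ⊗≫ 𝟙 (Z₁ ⊗ Z₂) := by
        rw [whisker_exchange]; monoidal
    _ = 𝟙 (Q' ⊗ (T' ⊗ (Q'' ⊗ X))) ⊗≫ ((Q' ⊗ T') ⊗ Q'') ◁ ((η_ N N' ≫ N ◁ dualMap T' N' p) ▷ X) ⊗≫
        (Q' ◁ d) ▷ (Q'' ⊗ N) ▷ (T' ⊗ X) ⊗≫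
        ((Q' ⊗ N' ⊗ Q'' ⊗ N) ◁ f₂ ≫ f₁ ▷ Z₂) ⊗≫ 𝟙 (Z₁ ⊗ Z₂) := by
        rw [coeval_dualMap T' N' p, whisker_exchange ((Q' ◁ d) ▷ (Q'' ⊗ N)) f₂]
        monoidal
    _ = 𝟙 (Q' ⊗ (T' ⊗ (Q'' ⊗ X))) ⊗≫ (((Q' ⊗ T') ⊗ Q'') ◁ (η_ N N' ▷ X ⊗≫ N ◁ dualMap T' N' p ▷ X) ≫
        (Q' ◁ d) ▷ Q'' ▷ (N ⊗ (T' ⊗ X))) ⊗≫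
        f₁ ▷ (T' ⊗ X) ⊗≫ Z₁ ◁ f₂ := by rw [whisker_exchange]; monoidal
    _ = _ := by rw [whisker_exchange]; monoidal

end Abstract

section Coend
variable {k : Type w'} [CommRing k] {C : Type u} [Category.{v} C] [Preadditive C]
    [Linear k C] [MonoidalCategory.{v} C] [MonoidalPreadditive C] [MonoidalLinear k C]
    [RigidCategory C] [HasFiniteBiproducts C] {I : Type w} [Fintype I] {V : I → C}
    (F : FusionChoices V)

/-- The part of the coproduct which does not depend on the first choice of a decomposition. -/
noncomputable def comulCore (j m k : I) :
    (((ld (V m) ⊗ ld (V k)) ⊗ ld (V j)) ⊗ (ld (ld (V k)) ⊗ ld (ld (V m)))) ⊗ V j ⟶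
      coendObj V ⊗ coendObj V :=
  𝟙 _ ⊗≫ ((ld (V m) ⊗ ((ld (V k) ⊗ ld (V j)) ⊗ ld (ld (V k)))) ⊗ ld (ld (V m))) ◁
    hatS (inc V k j) ⊗≫ kap F m (ld (V k) ⊗ (V j ⊗ V k))
      ((ld (V k) ⊗ ld (V j)) ⊗ ld (ld (V k))) ▷ coendObj V

/-- The sums over `n` and `β` form the universal map `kap` at `ld (V k) ⊗ V j ⊗ V k`; only the
decomposition of `V k ⊗ V m` remains. -/
lemma sum_comulAux (i j m k : I) : ∑ n, comulAux F i j m n k ≫ (inc V m n ⊗ₘ inc V k j) =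
    ∑ α, 𝟙 (summand V i j) ⊗≫ (dualMap (ld (V m) ⊗ ld (V k)) (ld (V i))
      ((F.dec (V k ⊗ V m)).p i α) ▷ ld (V j) ⊗ₘ
        dualMap (ld (ld (V k)) ⊗ ld (ld (V m))) (ld (ld (V i)))
        (dualMap (ld (V i)) (ld (V m) ⊗ ld (V k)) ((F.dec (V k ⊗ V m)).q i α))) ▷ V j ≫
      comulCore F j m k := by
  simp only [comulAux, Preadditive.sum_comp]
  rw [Finset.sum_comm]
  refine Finset.sum_congr rfl fun α _ => ?_
  have h : comulCore F j m k = ∑ n, ∑ β, 𝟙 _ ⊗≫ (ld (V m) ◁ (dualMap (ld (V n))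
      ((ld (V k) ⊗ ld (V j)) ⊗ ld (ld (V k)))
      ((F.dec (ld (V k) ⊗ V j ⊗ V k)).q n β) ▷ (ld (ld (V m)) ⊗ V j)) ⊗≫
      (ld (V m) ⊗ ld (V n) ⊗ ld (ld (V m))) ◁ (η_ (V n) (ld (V n)) ▷ V j) ⊗≫
      (ld (V m) ⊗ ld (V n) ⊗ ld (ld (V m)) ⊗ V n) ◁
      (dualMap ((ld (V k) ⊗ ld (V j)) ⊗ ld (ld (V k))) (ld (V n))
        ((F.dec (ld (V k) ⊗ V j ⊗ V k)).p n β) ▷ V j) ⊗≫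
      inc V m n ▷ (((ld (V k) ⊗ ld (V j)) ⊗ ld (ld (V k))) ⊗ V j) ⊗≫ coendObj V ◁
        (𝟙 (((ld (V k) ⊗ ld (V j)) ⊗ ld (ld (V k))) ⊗ V j) ⊗≫ inc V k j)) := by
    simp only [comul_term]
    unfold comulCore kap
    simp only [monoidalComp, sum_whiskerRight, Preadditive.comp_sum]
    refine Finset.sum_congr rfl fun n _ => Finset.sum_congr rfl fun β _ => ?_
    have e : dualMap ((ld (V m) ⊗ ld (V n)) ⊗ ld (ld (V m)))
        ((ld (V m) ⊗ ((ld (V k) ⊗ ld (V j)) ⊗ ld (ld (V k)))) ⊗ ld (ld (V m)))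
        (ld (V m) ◁ ((F.dec (ld (V k) ⊗ V j ⊗ V k)).q n β ▷ V m)) =
        (ld (V m) ◁ dualMap (ld (V n)) ((ld (V k) ⊗ ld (V j)) ⊗ ld (ld (V k)))
          ((F.dec (ld (V k) ⊗ V j ⊗ V k)).q n β)) ▷ ld (ld (V m)) := by
      refine (dualMap_whiskerLeft (ld (V m) ⊗ ld (V n)) (ld (V m) ⊗ ((ld (V k) ⊗ ld (V j)) ⊗ ld (ld (V k))))
        (ld (ld (V m))) ((F.dec (ld (V k) ⊗ V j ⊗ V k)).q n β ▷ V m)).trans ?_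
      congr 1
      exact dualMap_whiskerRight _ _ _ _
    rw [e]
    unfold hatS
    simp only [MonoidalCategory.tensorHom_def]
    monoidal
  rw [h]
  simp only [monoidalComp, Preadditive.comp_sum]
  refine Finset.sum_congr rfl fun n _ => Finset.sum_congr rfl fun β _ => ?_
  simp only [MonoidalCategory.tensorHom_def]
  monoidal

/-- The iterated coaction acts with `V k` and then with `V m`. By `act_tensor` this is the action of
`V k ⊗ V m`, and decomposing the latter into labels `i` yields the coproduct formula. The second
coaction is moved across the first action by naturality of `kapHat`. -/
lemma comul_formula (hV : IsFusion k V) (M : Center C) :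
    coendCoact F M ≫ M.1 ◁ comulFormula F =
      coendCoact F M ≫ coendCoact F M ▷ coendObj V ≫ (α_ _ _ _).hom := by
  apply (F.dec M.1).hom_ext
  intro j α
  generalize (F.dec M.1).q j α = x
  have h0 (i : I) : inc V i j ≫ comulFormula F =
      ∑ k, ∑ m, ∑ n, comulAux F i j m n k ≫ (inc V m n ⊗ₘ inc V k j) := by
    simp only [comulFormula, ← Preadditive.comp_sum]
    exact inc_sum_prj i j fun i j => ∑ k, ∑ m, ∑ n, comulAux F i j m n k ≫ (inc V m n ⊗ₘ inc V k j)
  have h1 (i : I) : hatS (inc V i j ≫ comulFormula F) = ∑ k, ∑ m, ∑ α,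
      hat ((ld (V m) ⊗ ld (V k)) ⊗ (V j ⊗ (V k ⊗ V m)))
        (((ld (V m) ⊗ ld (V k)) ⊗ ld (V j)) ⊗ (ld (ld (V k)) ⊗ ld (ld (V m)))) (comulCore F j m k) ≫
      (dualMap (ld (V i)) (ld (V m) ⊗ ld (V k)) ((F.dec (V k ⊗ V m)).q i α) ⊗ₘ
        V j ◁ (F.dec (V k ⊗ V m)).p i α) ▷ (coendObj V ⊗ coendObj V) := by
    rw [h0]
    simp only [hatS_sum, sum_comulAux]
    refine Finset.sum_congr rfl fun k _ => Finset.sum_congr rfl fun m _ =>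
      Finset.sum_congr rfl fun α _ => ?_
    rw [← hat_conj (V i) (ld (V i)) (ld (ld (V i))) (V k ⊗ V m) (ld (V m) ⊗ ld (V k))
      (ld (ld (V k)) ⊗ ld (ld (V m))) (V j) (ld (V j))]
    unfold hatS
    congr 1
    monoidal
  have h2 (m k : I) : hat ((ld (V m) ⊗ ld (V k)) ⊗ (V j ⊗ (V k ⊗ V m)))
        (((ld (V m) ⊗ ld (V k)) ⊗ ld (V j)) ⊗ (ld (ld (V k)) ⊗ ld (ld (V m)))) (comulCore F j m k) =
      hatS (inc V k j) ≫ kapHat F m (ld (V k) ⊗ (V j ⊗ V k))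
        ((ld (V k) ⊗ ld (V j)) ⊗ ld (ld (V k))) ▷ coendObj V ⊗≫ 𝟙 _ := by
    have h := hat_hat (ld (V m) ⊗ ((ld (V k) ⊗ (V j ⊗ V k)) ⊗ V m))
      ((ld (V m) ⊗ ((ld (V k) ⊗ ld (V j)) ⊗ ld (ld (V k)))) ⊗ ld (ld (V m)))
      (ld (V k) ⊗ (V j ⊗ V k)) ((ld (V k) ⊗ ld (V j)) ⊗ ld (ld (V k)))
      (𝟙 (((ld (V k) ⊗ ld (V j)) ⊗ ld (ld (V k))) ⊗ V j) ⊗≫ inc V k j)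
      (kap F m (ld (V k) ⊗ (V j ⊗ V k)) ((ld (V k) ⊗ ld (V j)) ⊗ ld (ld (V k))))
    have e : comulCore F j m k = 𝟙 ((((ld (V m) ⊗ ld (V k)) ⊗ ld (V j)) ⊗
        (ld (ld (V k)) ⊗ ld (ld (V m)))) ⊗ V j) ⊗≫
        (((ld (V m) ⊗ ((ld (V k) ⊗ ld (V j)) ⊗ ld (ld (V k)))) ⊗ ld (ld (V m))) ◁
          hatS (inc V k j) ≫ (α_ _ _ _).inv ≫ kap F m (ld (V k) ⊗ (V j ⊗ V k))
            ((ld (V k) ⊗ ld (V j)) ⊗ ld (ld (V k))) ▷ coendObj V) := by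
      unfold comulCore
      monoidal
    have h' : hatS (inc V k j) ≫ kapHat F m (ld (V k) ⊗ (V j ⊗ V k))
        ((ld (V k) ⊗ ld (V j)) ⊗ ld (ld (V k))) ▷ coendObj V =
        hat (ld (V m) ⊗ ((ld (V k) ⊗ (V j ⊗ V k)) ⊗ V m))
          ((ld (V m) ⊗ ((ld (V k) ⊗ ld (V j)) ⊗ ld (ld (V k)))) ⊗ ld (ld (V m)))
          (((ld (V m) ⊗ ((ld (V k) ⊗ ld (V j)) ⊗ ld (ld (V k)))) ⊗ ld (ld (V m))) ◁
            hatS (inc V k j) ≫ (α_ _ _ _).inv ≫ kap F m (ld (V k) ⊗ (V j ⊗ V k))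
            ((ld (V k) ⊗ ld (V j)) ⊗ ld (ld (V k))) ▷ coendObj V) ≫ (α_ _ _ _).inv := h
    have h'' := hat_tensor (V k) (ld (V k)) (ld (ld (V k))) (V m) (ld (V m)) (ld (ld (V m)))
      (V j) (ld (V j)) (((ld (V m) ⊗ ((ld (V k) ⊗ ld (V j)) ⊗ ld (ld (V k)))) ⊗ ld (ld (V m))) ◁
            hatS (inc V k j) ≫ (α_ _ _ _).inv ≫ kap F m (ld (V k) ⊗ (V j ⊗ V k))
            ((ld (V k) ⊗ ld (V j)) ⊗ ld (ld (V k))) ▷ coendObj V)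
    rw [e]
    refine h''.trans ?_
    generalize hat (ld (V m) ⊗ ((ld (V k) ⊗ (V j ⊗ V k)) ⊗ V m))
      ((ld (V m) ⊗ ((ld (V k) ⊗ ld (V j)) ⊗ ld (ld (V k)))) ⊗ ld (ld (V m))) (X := V j)
      (((ld (V m) ⊗ ((ld (V k) ⊗ ld (V j)) ⊗ ld (ld (V k)))) ⊗ ld (ld (V m))) ◁
        hatS (inc V k j) ≫ (α_ _ _ _).inv ≫ kap F m (ld (V k) ⊗ (V j ⊗ V k))
        ((ld (V k) ⊗ ld (V j)) ⊗ ld (ld (V k))) ▷ coendObj V) = z at h' ⊢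
    have e1 := congrArg (fun t => t ⊗≫ 𝟙 (((ld (V m) ⊗ ld (V k)) ⊗ (V j ⊗ (V k ⊗ V m))) ⊗
      (coendObj V ⊗ coendObj V))) h'
    refine Eq.trans ?_ (e1.symm.trans ?_)
    · monoidal
    · monoidal
  -- Summing over `i` and `α` reassembles the action of `V k ⊗ V m`, which is two successive
  -- actions.
  have h3 (k m : I) : ∑ i, ∑ α, (dualMap (ld (V i)) (ld (V m) ⊗ ld (V k)) ((F.dec (V k ⊗ V m)).q i α) ⊗ₘ
        V j ◁ (F.dec (V k ⊗ V m)).p i α) ≫ ld (V i) ◁ (x ▷ V i) ≫ act M (V i) (ld (V i)) =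
      𝟙 ((ld (V m) ⊗ ld (V k)) ⊗ (V j ⊗ (V k ⊗ V m))) ⊗≫
        ld (V m) ◁ ((ld (V k) ◁ (x ▷ V k) ≫ act M (V k) (ld (V k))) ▷ V m) ≫ act M (V m) (ld (V m)) := by
    have e := act_tensor M (V k) (ld (V k)) (V m) (ld (V m))
    have e' := act_decomp M (V k ⊗ V m) (ld (V m) ⊗ ld (V k)) (F.dec (V k ⊗ V m))
    calc _ = (ld (V m) ⊗ ld (V k)) ◁ (x ▷ (V k ⊗ V m)) ≫ act M (V k ⊗ V m) (ld (V m) ⊗ ld (V k)) := by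
          rw [e']
          simp only [Preadditive.comp_sum]
          refine Finset.sum_congr rfl fun i _ => Finset.sum_congr rfl fun α _ => ?_
          rw [MonoidalCategory.tensorHom_def', MonoidalCategory.tensorHom_def']
          simp only [Category.assoc, ← whisker_exchange_assoc,
            ← MonoidalCategory.whiskerLeft_comp_assoc]
          rw [whisker_exchange]
      _ = _ := by rw [e]; monoidal
  rw [comp_coendCoact_comp F hV]
  simp only [h1, h2]
  have h4 : x ≫ coendCoact F M ≫ coendCoact F M ▷ coendObj V ≫ (α_ _ _ _).hom =
      ∑ k, ∑ m, hatS (inc V k j) ≫ kapHat F m (ld (V k) ⊗ (V j ⊗ V k))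
        ((ld (V k) ⊗ ld (V j)) ⊗ ld (ld (V k))) ▷ coendObj V ≫
        (ld (V m) ◁ ((ld (V k) ◁ (x ▷ V k) ≫ act M (V k) (ld (V k))) ▷ V m) ≫
          act M (V m) (ld (V m))) ▷ coendObj V ▷ coendObj V ≫ (α_ _ _ _).hom := by
    rw [← Category.assoc, comp_coendCoact F hV]
    simp only [Preadditive.sum_comp]
    refine Finset.sum_congr rfl fun k _ => ?_
    obtain ⟨y, hy⟩ : ∃ y : ld (V k) ⊗ (V j ⊗ V k) ⟶ M.1,
      y = ld (V k) ◁ (x ▷ V k) ≫ act M (V k) (ld (V k)) := ⟨_, rfl⟩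
    have e : y ≫ coendCoact F M = ∑ m, kapHat F m (ld (V k) ⊗ (V j ⊗ V k))
        ((ld (V k) ⊗ ld (V j)) ⊗ ld (ld (V k))) ≫
        (ld (V m) ◁ (y ▷ V m) ≫ act M (V m) (ld (V m))) ▷ coendObj V := by
      rw [coendCoact_eq, Preadditive.comp_sum]
      refine Finset.sum_congr rfl fun m _ => ?_
      rw [reassoc_of% kapHat_nat F hV m ((ld (V k) ⊗ ld (V j)) ⊗ ld (ld (V k))) (ld M.1) y,
        ← comp_whiskerRight]
    rw [← hy, Category.assoc, ← comp_whiskerRight_assoc, e]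
    simp only [sum_whiskerRight, Preadditive.sum_comp, Preadditive.comp_sum, comp_whiskerRight,
      Category.assoc]
  rw [h4]
  simp only [Preadditive.sum_comp]
  rw [Finset.sum_comm]
  refine Finset.sum_congr rfl fun k _ => ?_
  rw [Finset.sum_comm]
  refine Finset.sum_congr rfl fun m _ => ?_
  calc _ = (hatS (inc V k j) ≫ kapHat F m (ld (V k) ⊗ (V j ⊗ V k))
        ((ld (V k) ⊗ ld (V j)) ⊗ ld (ld (V k))) ▷ coendObj V ⊗≫
          𝟙 (((ld (V m) ⊗ ld (V k)) ⊗ (V j ⊗ (V k ⊗ V m))) ⊗ (coendObj V ⊗ coendObj V))) ≫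
      (∑ i, ∑ α, (dualMap (ld (V i)) (ld (V m) ⊗ ld (V k)) ((F.dec (V k ⊗ V m)).q i α) ⊗ₘ
        V j ◁ (F.dec (V k ⊗ V m)).p i α) ≫ ld (V i) ◁ (x ▷ V i) ≫
          act M (V i) (ld (V i))) ▷ (coendObj V ⊗ coendObj V) := by
        simp only [sum_whiskerRight, Preadditive.comp_sum, comp_whiskerRight, Category.assoc]
    _ = _ := by rw [h3]; monoidal

end Coend

end CenterCoend


set_option linter.unusedSectionVars false

namespace CenterCoend
open Limits

/-! ### The braiding -/

section Abstract
variable {D : Type u} [Category.{v} D] [MonoidalCategory.{v} D]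

/-- Coevaluation with a conjugate by `Y` on the left and its right dual `R` on the right. -/
lemma hat_braid (Y Y' Y'' R A A' A'' X X' : D) [ExactPairing Y Y'] [ExactPairing Y' Y'']
    [ExactPairing R Y] [ExactPairing A A'] [ExactPairing A' A''] [ExactPairing X X'] {Z : D}
    (g : ((A' ⊗ ((Y' ⊗ X') ⊗ Y'')) ⊗ A'') ⊗ (Y' ⊗ (X ⊗ Y)) ⟶ Z) :
    hat (((Y ⊗ A') ⊗ Y') ⊗ (X ⊗ (Y ⊗ (A ⊗ R)))) ((((Y ⊗ A') ⊗ Y') ⊗ X') ⊗ (Y'' ⊗ (A'' ⊗ Y')))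
      (𝟙 (((((Y ⊗ A') ⊗ Y') ⊗ X') ⊗ (Y'' ⊗ (A'' ⊗ Y'))) ⊗ (X ⊗ Y)) ⊗≫ Y ◁ g) =
    𝟙 (X ⊗ Y) ⊗≫ η_ Y Y' ▷ (X ⊗ Y) ⊗≫
      Y ◁ hat (A' ⊗ ((Y' ⊗ (X ⊗ Y)) ⊗ A)) ((A' ⊗ ((Y' ⊗ X') ⊗ Y'')) ⊗ A'') g ⊗≫
      (Y ⊗ (A' ⊗ ((Y' ⊗ (X ⊗ Y)) ⊗ A))) ◁ η_ R Y ▷ Z ⊗≫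
      𝟙 ((((Y ⊗ A') ⊗ Y') ⊗ (X ⊗ (Y ⊗ (A ⊗ R)))) ⊗ (Y ⊗ Z)) := by
  symm
  unfold hat
  calc _ = 𝟙 (X ⊗ Y) ⊗≫ η_ Y Y' ▷ (X ⊗ Y) ⊗≫
      Y ◁ (η_ (A' ⊗ ((Y' ⊗ (X ⊗ Y)) ⊗ A)) ((A' ⊗ ((Y' ⊗ X') ⊗ Y'')) ⊗ A'') ▷ (Y' ⊗ (X ⊗ Y))) ⊗≫
      (Y ⊗ (A' ⊗ ((Y' ⊗ (X ⊗ Y)) ⊗ A))) ◁ (𝟙_ D ◁ g ≫ η_ R Y ▷ Z) ⊗≫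
      𝟙 ((((Y ⊗ A') ⊗ Y') ⊗ (X ⊗ (Y ⊗ (A ⊗ R)))) ⊗ (Y ⊗ Z)) := by monoidal
    _ = _ := by
      rw [whisker_exchange]
      simp only [coeval_tensor]
      monoidal

end Abstract

section Coend
variable {k : Type w'} [CommRing k] {C : Type u} [Category.{v} C] [Preadditive C]
    [Linear k C] [MonoidalCategory.{v} C] [MonoidalPreadditive C] [MonoidalLinear k C]
    [RigidCategory C] [HasFiniteBiproducts C] {I : Type w} [Fintype I] {V : I → C}
    (F : FusionChoices V)

lemma sum_sum_comm {X : Type*} [AddCommMonoid X] {J : Type*} [Fintype J] {A : J → Type*}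
    [∀ m, Fintype (A m)] {L : Type*} [Fintype L] (f : ∀ m, A m → L → X) :
    ∑ m, ∑ α, ∑ i, f m α i = ∑ i, ∑ m, ∑ α, f m α i := by
  rw [Finset.sum_comm]
  exact Finset.sum_congr rfl fun m _ => Finset.sum_comm

/-- The part of the braiding with `V m` which does not depend on the last choice of a
decomposition. -/
noncomputable def braidCore (j a m : I) :
    ((((V m ⊗ ld (V a)) ⊗ ld (V m)) ⊗ ld (V j)) ⊗ (ld (ld (V m)) ⊗ (ld (ld (V a)) ⊗ ld (V m)))) ⊗
      (V j ⊗ V m) ⟶ V m ⊗ coendObj V :=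
  𝟙 _ ⊗≫ V m ◁ kap F a (ld (V m) ⊗ (V j ⊗ V m)) ((ld (V m) ⊗ ld (V j)) ⊗ ld (ld (V m)))

/-- The component at `(i,j)` of the half braiding of the coend with `V m`, with values in the
summands `(a,b)`. -/
noncomputable def braidPart (i j a m : I) : summand V i j ⊗ V m ⟶ V m ⊗ coendObj V :=
  ∑ γ : Fin ((F.dec (V m ⊗ V a ⊗ rd (V m))).N i),
    𝟙 (summand V i j ⊗ V m) ⊗≫
      (dualMap ((V m ⊗ ld (V a)) ⊗ ld (V m)) (ld (V i)) ((F.dec (V m ⊗ V a ⊗ rd (V m))).p i γ) ▷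
        ld (V j) ⊗ₘ (dualMap (ld (ld (V m)) ⊗ (ld (ld (V a)) ⊗ ld (V m))) (ld (ld (V i)))
      (dualMap (ld (V i)) ((V m ⊗ ld (V a)) ⊗ ld (V m))
        ((F.dec (V m ⊗ V a ⊗ rd (V m))).q i γ)))) ▷ (V j ⊗ V m) ≫ braidCore F j a m

/-- The second tensor factor is split into simple objects `V m`. The sums over `b` and `β` are
absorbed in `kap`, leaving the half braiding with `V m` applied to one summand. -/
lemma braidAux_comp (i j k l a : I) : ∑ b, braidAux F i j k l a b ≫ (inc V k l ⊗ₘ inc V a b) =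
    ∑ m, ∑ α, summand V i j ◁ ((F.dec (summand V k l)).p m α) ≫ braidPart F i j a m ≫
    ((F.dec (summand V k l)).q m α ≫ inc V k l) ▷ coendObj V := by
  unfold braidPart
  simp only [braidAux, Preadditive.sum_comp, Preadditive.comp_sum]
  rw [Finset.sum_comm]
  refine Finset.sum_congr rfl fun m _ => ?_
  rw [Finset.sum_comm]
  refine Finset.sum_congr rfl fun α _ => ?_
  simp only [braidCore, kap]
  conv_lhs => enter [2, b]; rw [Finset.sum_comm]
  rw [Finset.sum_comm]
  refine Finset.sum_congr rfl fun γ _ => ?_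
  simp only [monoidalComp, whiskerLeft_sum, Preadditive.comp_sum, Preadditive.sum_comp]
  refine Finset.sum_congr rfl fun b _ => Finset.sum_congr rfl fun β _ => ?_
  unfold braidTerm
  generalize (F.dec (V m ⊗ V a ⊗ rd (V m))).p i γ = p₂
  generalize (F.dec (V m ⊗ V a ⊗ rd (V m))).q i γ = q₂
  generalize (F.dec (summand V k l)).p m α = p
  generalize (F.dec (summand V k l)).q m α = q
  generalize (F.dec (ld (V m) ⊗ V j ⊗ V m)).p b β = p₁
  generalize (F.dec (ld (V m) ⊗ V j ⊗ V m)).q b β = q₁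
  have e : dualMap ((ld (V a) ⊗ ld (V b)) ⊗ ld (ld (V a)))
        ((ld (V a) ⊗ ((ld (V m) ⊗ ld (V j)) ⊗ ld (ld (V m)))) ⊗ ld (ld (V a)))
        (ld (V a) ◁ (q₁ ▷ V a)) =
        (ld (V a) ◁ dualMap (ld (V b)) ((ld (V m) ⊗ ld (V j)) ⊗ ld (ld (V m))) q₁) ▷
          ld (ld (V a)) := by
      refine (dualMap_whiskerLeft (ld (V a) ⊗ ld (V b)) (ld (V a) ⊗ ((ld (V m) ⊗ ld (V j)) ⊗ ld (ld (V m))))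
        (ld (ld (V a))) (q₁ ▷ V a)).trans ?_
      congr 1
      exact dualMap_whiskerRight _ _ _ _
  rw [e]
  generalize dualMap (ld (V b)) ((ld (V m) ⊗ ld (V j)) ⊗ ld (ld (V m))) q₁ = d₁
  generalize dualMap (ld (ld (V m)) ⊗ (ld (ld (V a)) ⊗ ld (V m))) (ld (ld (V i)))
      (dualMap (ld (V i)) ((V m ⊗ ld (V a)) ⊗ ld (V m)) q₂) = d₂
  generalize dualMap ((V m ⊗ ld (V a)) ⊗ ld (V m)) (ld (V i)) p₂ = d₃
  simp only [MonoidalCategory.tensorHom_def]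
  calc _ = summand V i j ◁ p ⊗≫ d₃ ▷ (ld (V j) ⊗ (ld (ld (V i)) ⊗ (V j ⊗ V m))) ⊗≫
      ((V m ⊗ ld (V a)) ⊗ (ld (V m) ⊗ ld (V j))) ◁ d₂ ▷ (V j ⊗ V m) ⊗≫
      (V m ⊗ ld (V a)) ◁ (d₁ ▷ (ld (ld (V a)) ⊗ ld (V m) ⊗ V j ⊗ V m)) ⊗≫
      ((V m ⊗ ld (V a) ⊗ ld (V b) ⊗ ld (ld (V a))) ◁ p₁) ⊗≫
      ((q ≫ inc V k l) ▷ summand V a b ≫ coendObj V ◁ inc V a b) := by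
        monoidal
    _ = _ := by
      rw [← whisker_exchange]
      monoidal

/-- Summing over `i` and `γ` gives the action of `V m ⊗ V a ⊗ rd (V m)`, that is, of its three
factors in turn. The first supplies the half braiding with `V m`, the middle one the coaction, and
the last the inverse half braiding: together, the conjugated coaction. -/
lemma braidPart_spec (hV : IsFusion k V) (M : Center C) {j : I} (x : V j ⟶ M.1) (m : I) :
    ∑ i, hat (ld (V i) ⊗ (V j ⊗ V i)) ((ld (V i) ⊗ ld (V j)) ⊗ ld (ld (V i)))
        (𝟙 (((ld (V i) ⊗ ld (V j)) ⊗ ld (ld (V i))) ⊗ (V j ⊗ V m)) ⊗≫ ∑ a, braidPart F i j a m) ≫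
      (ld (V i) ◁ (x ▷ V i) ≫ act M (V i) (ld (V i))) ▷ (V m ⊗ coendObj V) =
    x ▷ V m ≫ ((M.2.β (V m)).hom ≫ V m ◁ coendCoact F M ⊗≫ (M.2.β (V m)).inv ▷ coendObj V ⊗≫
      𝟙 (M.1 ⊗ V m ⊗ coendObj V)) := by
  have h1 (i : I) : hat (ld (V i) ⊗ (V j ⊗ V i)) ((ld (V i) ⊗ ld (V j)) ⊗ ld (ld (V i)))
        (𝟙 (((ld (V i) ⊗ ld (V j)) ⊗ ld (ld (V i))) ⊗ (V j ⊗ V m)) ⊗≫ ∑ a, braidPart F i j a m) =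
      ∑ a, ∑ γ, hat (((V m ⊗ ld (V a)) ⊗ ld (V m)) ⊗ (V j ⊗ (V m ⊗ V a ⊗ rd (V m))))
        ((((V m ⊗ ld (V a)) ⊗ ld (V m)) ⊗ ld (V j)) ⊗ (ld (ld (V m)) ⊗ (ld (ld (V a)) ⊗ ld (V m))))
        (braidCore F j a m) ≫
        (dualMap (ld (V i)) ((V m ⊗ ld (V a)) ⊗ ld (V m)) ((F.dec (V m ⊗ V a ⊗ rd (V m))).q i γ) ⊗ₘ
        V j ◁ (F.dec (V m ⊗ V a ⊗ rd (V m))).p i γ) ▷ (V m ⊗ coendObj V) := by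
    simp only [braidPart, monoidalComp, Preadditive.comp_sum, hat_sum]
    refine Finset.sum_congr rfl fun a _ => Finset.sum_congr rfl fun γ _ => ?_
    rw [← hat_conj (V i) (ld (V i)) (ld (ld (V i))) (V m ⊗ V a ⊗ rd (V m))
      ((V m ⊗ ld (V a)) ⊗ ld (V m))
      (ld (ld (V m)) ⊗ (ld (ld (V a)) ⊗ ld (V m))) (V j) (ld (V j))]
    congr 1
    monoidal
  obtain ⟨t, ht⟩ : ∃ t : ld (V m) ⊗ (V j ⊗ V m) ⟶ M.1,
    t = ld (V m) ◁ (x ▷ V m) ≫ act M (V m) (ld (V m)) := ⟨_, rfl⟩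
  have h2 (a : I) : ∑ i, ∑ γ,
        (dualMap (ld (V i)) ((V m ⊗ ld (V a)) ⊗ ld (V m)) ((F.dec (V m ⊗ V a ⊗ rd (V m))).q i γ) ⊗ₘ
        V j ◁ (F.dec (V m ⊗ V a ⊗ rd (V m))).p i γ) ≫
        ld (V i) ◁ (x ▷ V i) ≫ act M (V i) (ld (V i)) =
      ((V m ⊗ ld (V a)) ⊗ ld (V m)) ◁ (x ▷ (V m ⊗ V a ⊗ rd (V m))) ≫
        act M (V m ⊗ V a ⊗ rd (V m)) ((V m ⊗ ld (V a)) ⊗ ld (V m)) := by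
    rw [act_decomp M (V m ⊗ V a ⊗ rd (V m)) ((V m ⊗ ld (V a)) ⊗ ld (V m))
      (F.dec (V m ⊗ V a ⊗ rd (V m)))]
    simp only [Preadditive.comp_sum]
    refine Finset.sum_congr rfl fun i _ => Finset.sum_congr rfl fun α _ => ?_
    rw [MonoidalCategory.tensorHom_def', MonoidalCategory.tensorHom_def']
    simp only [Category.assoc, ← whisker_exchange_assoc,
      ← MonoidalCategory.whiskerLeft_comp_assoc]
    rw [whisker_exchange]
  have h3 (a : I) : ((V m ⊗ ld (V a)) ⊗ ld (V m)) ◁ (x ▷ (V m ⊗ V a ⊗ rd (V m))) ≫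
        act M (V m ⊗ V a ⊗ rd (V m)) ((V m ⊗ ld (V a)) ⊗ ld (V m)) =
      𝟙 (((V m ⊗ ld (V a)) ⊗ ld (V m)) ⊗ (V j ⊗ (V m ⊗ V a ⊗ rd (V m)))) ⊗≫
        V m ◁ (ld (V a) ◁ (t ▷ V a) ≫ act M (V a) (ld (V a))) ▷ rd (V m) ⊗≫
        act M (rd (V m)) (V m) := by
    rw [act_tensor M (V m) (ld (V m)) (V a ⊗ rd (V m)) (V m ⊗ ld (V a)),
      act_tensor M (V a) (ld (V a)) (rd (V m)) (V m), ht]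
    monoidal
  have h4 : t ≫ coendCoact F M = ∑ a, kapHat F a (ld (V m) ⊗ (V j ⊗ V m))
        ((ld (V m) ⊗ ld (V j)) ⊗ ld (ld (V m))) ≫
        (ld (V a) ◁ (t ▷ V a) ≫ act M (V a) (ld (V a))) ▷ coendObj V := by
    rw [coendCoact_eq, Preadditive.comp_sum]
    refine Finset.sum_congr rfl fun a _ => ?_
    rw [reassoc_of% kapHat_nat F hV a ((ld (V m) ⊗ ld (V j)) ⊗ ld (ld (V m))) (ld M.1) t,
      ← comp_whiskerRight]
  have h5 (a : I) : hat (((V m ⊗ ld (V a)) ⊗ ld (V m)) ⊗ (V j ⊗ (V m ⊗ V a ⊗ rd (V m))))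
        ((((V m ⊗ ld (V a)) ⊗ ld (V m)) ⊗ ld (V j)) ⊗ (ld (ld (V m)) ⊗ (ld (ld (V a)) ⊗ ld (V m))))
        (braidCore F j a m) = 𝟙 (V j ⊗ V m) ⊗≫ η_ (V m) (ld (V m)) ▷ (V j ⊗ V m) ⊗≫
      V m ◁ kapHat F a (ld (V m) ⊗ (V j ⊗ V m)) ((ld (V m) ⊗ ld (V j)) ⊗ ld (ld (V m))) ⊗≫
      (V m ⊗ (ld (V a) ⊗ ((ld (V m) ⊗ (V j ⊗ V m)) ⊗ V a))) ◁ η_ (rd (V m)) (V m) ▷ coendObj V ⊗≫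
      𝟙 ((((V m ⊗ ld (V a)) ⊗ ld (V m)) ⊗ (V j ⊗ (V m ⊗ (V a ⊗ rd (V m))))) ⊗ (V m ⊗ coendObj V)) :=
    hat_braid (V m) (ld (V m)) (ld (ld (V m))) (rd (V m)) (V a) (ld (V a)) (ld (ld (V a)))
      (V j) (ld (V j)) (kap F a (ld (V m) ⊗ (V j ⊗ V m)) ((ld (V m) ⊗ ld (V j)) ⊗ ld (ld (V m))))
  have h6 : x ▷ V m ≫ (M.2.β (V m)).hom = 𝟙 (V j ⊗ V m) ⊗≫ η_ (V m) (ld (V m)) ▷ (V j ⊗ V m) ⊗≫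
      V m ◁ t := by
    rw [braid_eq_act M (V m) (ld (V m)), ht]
    calc _ = 𝟙 (V j ⊗ V m) ⊗≫ (𝟙_ C ◁ (x ▷ V m) ≫ η_ (V m) (ld (V m)) ▷ (M.1 ⊗ V m)) ⊗≫
          V m ◁ act M (V m) (ld (V m)) := by monoidal
      _ = _ := by rw [whisker_exchange]; monoidal
  have h7 : (M.2.β (V m)).inv = 𝟙 (V m ⊗ M.1) ⊗≫ (V m ⊗ M.1) ◁ η_ (rd (V m)) (V m) ⊗≫
      act M (rd (V m)) (V m) ▷ V m := by
    rw [braid_ld_inv M (rd (V m)) (V m)]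
    unfold act
    monoidal
  symm
  calc _ = 𝟙 (V j ⊗ V m) ⊗≫ η_ (V m) (ld (V m)) ▷ (V j ⊗ V m) ⊗≫
      V m ◁ (t ≫ coendCoact F M) ⊗≫ (M.2.β (V m)).inv ▷ coendObj V ⊗≫
      𝟙 (M.1 ⊗ V m ⊗ coendObj V) := by
        rw [← Category.assoc, h6]; monoidal
    _ = ∑ a, hat (((V m ⊗ ld (V a)) ⊗ ld (V m)) ⊗ (V j ⊗ (V m ⊗ V a ⊗ rd (V m))))
        ((((V m ⊗ ld (V a)) ⊗ ld (V m)) ⊗ ld (V j)) ⊗ (ld (ld (V m)) ⊗ (ld (ld (V a)) ⊗ ld (V m))))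
        (braidCore F j a m) ≫ (((V m ⊗ ld (V a)) ⊗ ld (V m)) ◁ (x ▷ (V m ⊗ V a ⊗ rd (V m))) ≫
        act M (V m ⊗ V a ⊗ rd (V m)) ((V m ⊗ ld (V a)) ⊗ ld (V m))) ▷ (V m ⊗ coendObj V) := by
        rw [h4]
        simp only [monoidalComp, whiskerLeft_sum, Preadditive.sum_comp, Preadditive.comp_sum]
        refine Finset.sum_congr rfl fun a _ => ?_
        rw [h5, h3, h7]
        generalize kapHat F a (ld (V m) ⊗ (V j ⊗ V m)) ((ld (V m) ⊗ ld (V j)) ⊗ ld (ld (V m))) = z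
        generalize act M (rd (V m)) (V m) = r
        generalize ld (V a) ◁ (t ▷ V a) ≫ act M (V a) (ld (V a)) = s
        calc _ = 𝟙 (V j ⊗ V m) ⊗≫ η_ (V m) (ld (V m)) ▷ (V j ⊗ V m) ⊗≫ V m ◁ z ⊗≫
              V m ◁ (s ▷ (𝟙_ C ⊗ coendObj V) ≫ M.1 ◁ (η_ (rd (V m)) (V m) ▷ coendObj V)) ⊗≫
              r ▷ (V m ⊗ coendObj V) := by monoidal
          _ = _ := by rw [← whisker_exchange]; monoidal
    _ = _ := by
        simp only [← h2, h1, sum_whiskerRight, Preadditive.comp_sum, Preadditive.sum_comp,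
          Category.assoc, comp_whiskerRight]
        rw [Finset.sum_comm]

/-- The half braiding of the coend is determined by the equation of `braidPart_spec`, by uniqueness
with parameter `V m`. -/
lemma sum_braidPart (hV : IsFusion k V) {σ : HalfBraiding (coendObj V)}
    (hσ : ∀ (M : Center C) (Y : C), coendCoact F M ▷ Y ⊗≫ M.1 ◁ (σ.β Y).hom =
      (M.2.β Y).hom ≫ Y ◁ coendCoact F M ⊗≫ (M.2.β Y).inv ▷ coendObj V ⊗≫ 𝟙 _) (m : I) :
    ∑ i, ∑ j, prj V i j ▷ V m ≫ ∑ a, braidPart F i j a m = (σ.β (V m)).hom := by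
  refine (isUniversalCoaction_forget F hV).extRight (W := V m) (W' := ld (V m)) ?_
  intro M
  change coendCoact F M ▷ V m ⊗≫ M.1 ◁ _ = coendCoact F M ▷ V m ⊗≫ M.1 ◁ _
  refine Eq.trans ?_ (hσ M (V m)).symm
  apply (F.dec M.1).whiskerRight_hom_ext
  intro j x
  refine (comp_coendCoact_whiskerRight F hV M x _).trans ((Finset.sum_congr rfl fun i _ => ?_).trans
    (braidPart_spec F hV M x m))
  rw [inc_whiskerRight_sum_prj i j fun i j => ∑ a, braidPart F i j a m]

/-- The formula for the braiding. -/
lemma braid_formula (hV : IsFusion k V) {σ : HalfBraiding (coendObj V)}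
    (hσ : ∀ (M : Center C) (Y : C), coendCoact F M ▷ Y ⊗≫ M.1 ◁ (σ.β Y).hom =
      (M.2.β Y).hom ≫ Y ◁ coendCoact F M ⊗≫ (M.2.β Y).inv ▷ coendObj V ⊗≫ 𝟙 _) :
    (σ.β (coendObj V)).hom = braidFormula F := by
  -- The identity of the second copy of the coend is resolved through the objects `V m`; naturality
  -- of the half braiding then reduces to these.
  have e : ∑ k, ∑ l, ∑ m, ∑ α, (prj V k l ≫ (F.dec (summand V k l)).p m α) ≫
      (F.dec (summand V k l)).q m α ≫ inc V k l = 𝟙 (coendObj V) := by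
    rw [← coendObj_id]
    refine Finset.sum_congr rfl fun k _ => Finset.sum_congr rfl fun l _ => ?_
    have := congrArg (fun t => prj V k l ≫ t ≫ inc V k l) (F.dec (summand V k l)).sum_p_q
    simpa only [Preadditive.sum_comp, Preadditive.comp_sum, Category.assoc, Category.id_comp]
      using this
  calc _ = coendObj V ◁ 𝟙 _ ≫ (σ.β (coendObj V)).hom := by simp
    _ = ∑ k, ∑ l, ∑ m, ∑ α, coendObj V ◁ (prj V k l ≫ (F.dec (summand V k l)).p m α) ≫
        (σ.β (V m)).hom ≫ ((F.dec (summand V k l)).q m α ≫ inc V k l) ▷ coendObj V := by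
        rw [← e]
        simp only [whiskerLeft_sum, Preadditive.sum_comp]
        refine Finset.sum_congr rfl fun k _ => Finset.sum_congr rfl fun l _ =>
          Finset.sum_congr rfl fun m _ => Finset.sum_congr rfl fun α _ => ?_
        rw [MonoidalCategory.whiskerLeft_comp, Category.assoc, σ.naturality]
    _ = ∑ k, ∑ l, ∑ i, ∑ j, ∑ a, (prj V i j ⊗ₘ prj V k l) ≫ ∑ b, braidAux F i j k l a b ≫
        (inc V k l ⊗ₘ inc V a b) := by
        refine Finset.sum_congr rfl fun k _ => Finset.sum_congr rfl fun l _ => ?_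
        simp only [← sum_braidPart F hV hσ, braidAux_comp, Preadditive.sum_comp,
          Preadditive.comp_sum]
        rw [sum_sum_comm]
        refine Finset.sum_congr rfl fun i _ => ?_
        rw [sum_sum_comm]
        refine Finset.sum_congr rfl fun j _ => ?_
        rw [sum_sum_comm]
        refine Finset.sum_congr rfl fun a _ => Finset.sum_congr rfl fun m _ =>
          Finset.sum_congr rfl fun α _ => ?_
        rw [MonoidalCategory.tensorHom_def]
        simp only [Category.assoc]
        calc _ = coendObj V ◁ prj V k l ≫ (coendObj V ◁ (F.dec (summand V k l)).p m α ≫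
              prj V i j ▷ V m) ≫ braidPart F i j a m ≫
              ((F.dec (summand V k l)).q m α ≫ inc V k l) ▷ coendObj V := by
              simp only [MonoidalCategory.whiskerLeft_comp, Category.assoc]
          _ = _ := by
              rw [whisker_exchange, Category.assoc, whisker_exchange_assoc]
    _ = _ := by
        unfold braidFormula
        simp only [Preadditive.comp_sum]
        rw [sum_sum_comm]
        refine Finset.sum_congr rfl fun i _ => ?_
        rw [sum_sum_comm]

end Coend

end CenterCoend


set_option linter.unusedSectionVars false

namespace CenterCoend
open Limits

/-! ### The pairing -/

section Abstract
variable {D : Type u} [Category.{v} D] [MonoidalCategory.{v} D]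

/-- The part of the pairing which precedes the last evaluation. -/
def pairPart (A A' Z Z' Q : D) [ExactPairing A A'] [ExactPairing Z Z'] {S B L : D} (d : S ⟶ Z')
    (a : A' ⊗ B ⊗ A ⟶ Z) (v : A ⟶ Z ⊗ Q ⊗ Z') (w : L ⟶ A) : (S ⊗ B) ⊗ L ⟶ Q :=
  (d ▷ B ⊗ₘ w) ⊗≫ Z' ◁ (η_ A A' ▷ (B ⊗ A)) ⊗≫ Z' ◁ (v ⊗ₘ a) ⊗≫
    ε_ Z Z' ▷ (Q ⊗ Z' ⊗ Z) ⊗≫ Q ◁ ε_ Z Z' ⊗≫ 𝟙 Q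

/-- Braiding `w` past `B`, then applying `a`. -/
def pairBraid (A A' : D) [ExactPairing A A'] {B L Z : D} (a : A' ⊗ B ⊗ A ⟶ Z) (v : A ⟶ L)
    (w : L ⟶ A) : B ⊗ L ⟶ L ⊗ Z :=
  B ◁ w ⊗≫ η_ A A' ▷ (B ⊗ A) ⊗≫ (v ⊗ₘ a)

lemma half_braid_snake {Z Z' L Q : D} [ExactPairing Z Z'] (h : L ⊗ Z ⟶ Z ⊗ L) (c : L ⟶ Q) :
    (𝟙 L ⊗≫ L ◁ η_ Z Z' ⊗≫ h ▷ Z' ⊗≫ (Z ◁ c) ▷ Z') ▷ Z ⊗≫ (Z ⊗ Q) ◁ ε_ Z Z' =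
      h ≫ Z ◁ c ⊗≫ 𝟙 ((Z ⊗ Q) ⊗ 𝟙_ D) := by
  calc _ = 𝟙 (L ⊗ Z) ⊗≫ L ◁ η_ Z Z' ▷ Z ⊗≫ ((h ≫ Z ◁ c) ▷ (Z' ⊗ Z) ≫ (Z ⊗ Q) ◁ ε_ Z Z') := by
        monoidal
    _ = 𝟙 (L ⊗ Z) ⊗≫ L ◁ (η_ Z Z' ▷ Z ⊗≫ Z ◁ ε_ Z Z') ⊗≫ h ⊗≫ Z ◁ c ⊗≫ 𝟙 ((Z ⊗ Q) ⊗ 𝟙_ D) := by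
        rw [← whisker_exchange]; monoidal
    _ = _ := by rw [ExactPairing.evaluation_coevaluation'']; monoidal

/-- One leg of the pairing ends in a rotated half braiding; the inner evaluation straightens it to
`h`. The pairing thereby becomes two consecutive crossings. -/
lemma pairPart_comp (A A' Z Z' Q : D) [ExactPairing A A'] [ExactPairing Z Z'] {S B L : D}
    (d : S ⟶ Z') (a : A' ⊗ B ⊗ A ⟶ Z) (v : A ⟶ L) (w : L ⟶ A) (h : L ⊗ Z ⟶ Z ⊗ L)
    (c : L ⟶ Q) : pairPart A A' Z Z' Q d a (v ≫
      (𝟙 L ⊗≫ L ◁ η_ Z Z' ⊗≫ h ▷ Z' ⊗≫ (Z ◁ c) ▷ Z') ≫ (α_ Z Q Z').hom) w =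
    𝟙 ((S ⊗ B) ⊗ L) ⊗≫ d ▷ (B ⊗ L) ≫ Z' ◁ (pairBraid A A' a v w ≫ h) ⊗≫ ε_ Z Z' ▷ L ⊗≫ c := by
  have hs := half_braid_snake (Z' := Z') h c
  generalize 𝟙 L ⊗≫ L ◁ η_ Z Z' ⊗≫ h ▷ Z' ⊗≫ (Z ◁ c) ▷ Z' = s at hs ⊢
  unfold pairPart pairBraid
  simp only [MonoidalCategory.tensorHom_def]
  calc _ = 𝟙 ((S ⊗ B) ⊗ L) ⊗≫ d ▷ (B ⊗ L) ≫ Z' ◁ (B ◁ w ⊗≫ η_ A A' ▷ (B ⊗ A)) ⊗≫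
        Z' ◁ (v ▷ (A' ⊗ B ⊗ A) ≫ s ▷ (A' ⊗ B ⊗ A) ≫ ((Z ⊗ Q) ⊗ Z') ◁ a) ⊗≫
        (ε_ Z Z' ▷ (Q ⊗ (Z' ⊗ Z)) ≫ 𝟙_ D ◁ (Q ◁ ε_ Z Z')) ⊗≫ 𝟙 Q := by monoidal
    _ = 𝟙 ((S ⊗ B) ⊗ L) ⊗≫ d ▷ (B ⊗ L) ≫ Z' ◁ (B ◁ w ⊗≫ η_ A A' ▷ (B ⊗ A)) ⊗≫
        Z' ◁ (v ▷ (A' ⊗ B ⊗ A) ≫ L ◁ a) ≫ Z' ◁ (s ▷ Z ⊗≫ (Z ⊗ Q) ◁ ε_ Z Z') ⊗≫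
        ε_ Z Z' ▷ Q ⊗≫ 𝟙 Q := by
        rw [← whisker_exchange s, ← whisker_exchange (ε_ Z Z')]; monoidal
    _ = 𝟙 ((S ⊗ B) ⊗ L) ⊗≫ d ▷ (B ⊗ L) ≫ Z' ◁ (B ◁ w ⊗≫ η_ A A' ▷ (B ⊗ A)) ⊗≫
        Z' ◁ (v ▷ (A' ⊗ B ⊗ A) ≫ L ◁ a) ≫ Z' ◁ h ⊗≫ ((Z' ⊗ Z) ◁ c ≫
        ε_ Z Z' ▷ Q) ⊗≫ 𝟙 Q := by
        rw [hs]; monoidal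
    _ = _ := by rw [whisker_exchange]; monoidal

lemma hat_pairPart (T T' Z Z' N L : D) [ExactPairing T T'] [ExactPairing Z Z']
    [ExactPairing N L] {B : D} (b : Z ⟶ T) (f : B ⊗ L ⟶ Z ⊗ L) :
    hat T T' (X := B ⊗ (L ⊗ N)) (𝟙 (T' ⊗ (B ⊗ (L ⊗ N))) ⊗≫ (dualMap Z' T' b ▷ (B ⊗ L) ≫
      Z' ◁ f ⊗≫ ε_ Z Z' ▷ L) ▷ N ⊗≫ ε_ N L) =
    𝟙 (B ⊗ (L ⊗ N)) ⊗≫ (f ≫ b ▷ L) ▷ N ⊗≫ T ◁ ε_ N L := by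
  calc _ = hat T T' (dualMap Z' T' b ▷ (B ⊗ (L ⊗ N)) ≫ (Z' ◁ (𝟙 (B ⊗ (L ⊗ N)) ⊗≫ f ▷ N ⊗≫
        𝟙 (Z ⊗ (L ⊗ N))) ⊗≫ (ε_ Z Z' ▷ (L ⊗ N) ≫ 𝟙_ D ◁ ε_ N L) ⊗≫ 𝟙 (𝟙_ D))) := by
        congr 1; monoidal
    _ = 𝟙 (B ⊗ (L ⊗ N)) ⊗≫ f ▷ N ⊗≫ (η_ Z Z' ▷ Z ⊗≫ Z ◁ ε_ Z Z') ▷ (L ⊗ N) ⊗≫ Z ◁ ε_ N L ⊗≫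
        b ▷ 𝟙_ D := by
        rw [← hat_whiskerRight Z Z' T T']
        unfold hat
        generalize η_ Z Z' = e
        generalize ε_ Z Z' = e'
        calc _ = 𝟙 (B ⊗ (L ⊗ N)) ⊗≫ (e ▷ (B ⊗ (L ⊗ N)) ≫
              (Z ⊗ Z') ◁ (𝟙 (B ⊗ (L ⊗ N)) ⊗≫ f ▷ N ⊗≫ 𝟙 (Z ⊗ (L ⊗ N)))) ⊗≫
              Z ◁ e' ▷ (L ⊗ N) ⊗≫ Z ◁ ε_ N L ⊗≫ b ▷ 𝟙_ D := by monoidal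
          _ = _ := by rw [← whisker_exchange]; monoidal
    _ = _ := by
        rw [ExactPairing.evaluation_coevaluation'']
        calc _ = 𝟙 (B ⊗ (L ⊗ N)) ⊗≫ f ▷ N ⊗≫ (Z ◁ ε_ N L ≫ b ▷ 𝟙_ D) := by monoidal
          _ = _ := by rw [whisker_exchange]; monoidal

lemma comp_tensorRightHomEquiv (Y Y' : D) [ExactPairing Y Y'] {X X₁ Z : D} (x : X₁ ⟶ X)
    (f : X ⊗ Y ⟶ Z) :
    x ≫ tensorRightHomEquiv X Y Y' Z f = tensorRightHomEquiv X₁ Y Y' Z (x ▷ Y ≫ f) := by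
  change x ≫ (ρ_ _).inv ≫ _ ◁ η_ _ _ ≫ (α_ _ _ _).inv ≫ _ ▷ _ =
    (ρ_ _).inv ≫ _ ◁ η_ _ _ ≫ (α_ _ _ _).inv ≫ _ ▷ _
  calc _ = (ρ_ _).inv ≫ (x ▷ 𝟙_ D ≫ X ◁ η_ Y Y') ≫ (α_ _ _ _).inv ≫ f ▷ Y' := by monoidal
    _ = _ := by rw [← whisker_exchange]; monoidal

end Abstract

section Center
variable {C : Type u} [Category.{v} C] [MonoidalCategory.{v} C] [RigidCategory C]

/-- The dual of the action, by means of the half braiding of the dual. -/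
lemma dualMap_act (M : Center C) (Y Y' Y'' : C) [ExactPairing Y Y'] [ExactPairing Y' Y''] :
    dualMap ((Y' ⊗ ld M.1) ⊗ Y'') (ld M.1) (act M Y Y') =
      𝟙 (ld M.1) ⊗≫ ld M.1 ◁ η_ Y' Y'' ⊗≫ dualBraidHom M Y' ▷ Y'' := by
  symm
  apply dualMap_unique
  have h1 : (𝟙 (ld M.1) ⊗≫ ld M.1 ◁ η_ Y' Y'' ⊗≫ dualBraidHom M Y' ▷ Y'') ▷ Y' ⊗≫
      (Y' ⊗ ld M.1) ◁ ε_ Y' Y'' = dualBraidHom M Y' ⊗≫ 𝟙 ((Y' ⊗ ld M.1) ⊗ 𝟙_ C) := by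
    have := half_braid_snake (Z' := Y'') (dualBraidHom M Y') (𝟙 (ld M.1))
    simp only [MonoidalCategory.whiskerLeft_id, id_whiskerRight] at this
    refine Eq.trans ?_ (this.trans ?_)
    · monoidal
    · monoidal
  have h2 := dualKey M Y'
  have h3 := braid_ε M Y Y'
  simp only [eval_tensor]
  generalize 𝟙 (ld M.1) ⊗≫ ld M.1 ◁ η_ Y' Y'' ⊗≫ dualBraidHom M Y' ▷ Y'' = s at h1 ⊢
  calc _ = 𝟙 _ ⊗≫ (s ▷ Y' ⊗≫ (Y' ⊗ ld M.1) ◁ ε_ Y' Y'') ▷ (M.1 ⊗ Y) ⊗≫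
        Y' ◁ ε_ M.1 (ld M.1) ▷ Y ⊗≫ ε_ Y Y' := by monoidal
    _ = 𝟙 _ ⊗≫ (dualBraidHom M Y' ▷ M.1 ⊗≫ Y' ◁ ε_ M.1 (ld M.1)) ▷ Y ⊗≫ ε_ Y Y' := by
        rw [h1]; monoidal
    _ = 𝟙 _ ⊗≫ ld M.1 ◁ (M.2.β Y').inv ▷ Y ⊗≫ (ε_ M.1 (ld M.1) ▷ (Y' ⊗ Y) ≫
        𝟙_ C ◁ ε_ Y Y') ⊗≫ 𝟙 (𝟙_ C) := by rw [h2]; monoidal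
    _ = 𝟙 _ ⊗≫ ld M.1 ◁ (M.2.β Y').inv ▷ Y ⊗≫ ld M.1 ◁ (M.1 ◁ ε_ Y Y' ⊗≫ 𝟙 (𝟙_ C ⊗ M.1)) ⊗≫
        ε_ M.1 (ld M.1) := by rw [← whisker_exchange]; monoidal
    _ = 𝟙 _ ⊗≫ ld M.1 ◁ ((M.2.β Y').inv ≫ (M.2.β Y').hom) ▷ Y ⊗≫
        ld M.1 ◁ (Y' ◁ (M.2.β Y).hom ⊗≫ ε_ Y Y' ▷ M.1) ⊗≫
        ε_ M.1 (ld M.1) := by rw [← h3]; monoidal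
    _ = _ := by rw [Iso.inv_hom_id]; unfold act; monoidal

end Center

section Coend
variable {k : Type w'} [CommRing k] {C : Type u} [Category.{v} C] [Preadditive C]
    [Linear k C] [MonoidalCategory.{v} C] [MonoidalPreadditive C] [MonoidalLinear k C]
    [RigidCategory C] [HasFiniteBiproducts C] {I : Type w} [Fintype I] {V : I → C}
    (F : FusionChoices V)

lemma pairingTerm_eq {i j k l : I} {N L : C} (f : L ⟶ (ld (V k) ⊗ ld (V l)) ⊗ ld (ld (V k)))
    (y : N ⟶ V l)
    (p : ld (V i) ⊗ V j ⊗ V i ⟶ ld (V k)) (q : ld (V k) ⟶ ld (V i) ⊗ V j ⊗ V i)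
    (p' : ld (V k) ⊗ ld (V l) ⊗ ld (ld (V k)) ⟶ V i)
    (q' : V i ⟶ ld (V k) ⊗ ld (V l) ⊗ ld (ld (V k))) :
    summand V i j ◁ ((f ⊗ₘ y) ⊗≫ 𝟙 (summand V k l)) ≫ pairingTerm p q p' q' =
      𝟙 (summand V i j ⊗ (L ⊗ N)) ⊗≫ pairPart (V i) (ld (V i)) (ld (V k)) (ld (ld (V k)))
        (ld (V l)) (dualMap (ld (ld (V k))) ((ld (V i) ⊗ ld (V j)) ⊗ ld (ld (V i))) q) p q'
        ((f ≫ (α_ _ _ _).hom) ≫ p') ▷ N ⊗≫ ld (V l) ◁ y ≫ ε_ (V l) (ld (V l)) := by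
  unfold pairingTerm pairPart
  generalize dualMap (ld (ld (V k))) ((ld (V i) ⊗ ld (V j)) ⊗ ld (ld (V i))) q = d
  simp only [MonoidalCategory.tensorHom_def]
  calc _ = 𝟙 (summand V i j ⊗ (L ⊗ N)) ⊗≫ (((ld (V i) ⊗ ld (V j)) ⊗ ld (ld (V i))) ⊗ V j) ◁ f ▷ N ⊗≫
        (((((ld (V i) ⊗ ld (V j)) ⊗ ld (ld (V i))) ⊗ V j) ⊗
          ((ld (V k) ⊗ ld (V l)) ⊗ ld (ld (V k)))) ◁ y ≫
        (𝟙 ((((ld (V i) ⊗ ld (V j)) ⊗ ld (ld (V i))) ⊗ V j) ⊗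
          ((ld (V k) ⊗ ld (V l)) ⊗ ld (ld (V k)))) ⊗≫
        d ▷ (V j ⊗ ((ld (V k) ⊗ ld (V l)) ⊗ ld (ld (V k)))) ⊗≫
        ld (ld (V k)) ◁ V j ◁ p' ⊗≫ ld (ld (V k)) ◁ (η_ (V i) (ld (V i)) ▷ (V j ⊗ V i)) ⊗≫
        ld (ld (V k)) ◁ (q' ▷ (ld (V i) ⊗ V j ⊗ V i) ≫ (ld (V k) ⊗ ld (V l) ⊗ ld (ld (V k))) ◁ p) ⊗≫
        ε_ (ld (V k)) (ld (ld (V k))) ▷ (ld (V l) ⊗ ld (ld (V k)) ⊗ ld (V k)) ⊗≫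
        ld (V l) ◁ ε_ (ld (V k)) (ld (ld (V k))) ⊗≫ 𝟙 (ld (V l))) ▷ V l) ≫ ε_ (V l) (ld (V l)) := by
        monoidal
    _ = 𝟙 (summand V i j ⊗ (L ⊗ N)) ⊗≫
        (𝟙 ((((ld (V i) ⊗ ld (V j)) ⊗ ld (ld (V i))) ⊗ V j) ⊗ L) ⊗≫
        (((ld (V i) ⊗ ld (V j)) ⊗ ld (ld (V i))) ◁ (V j ◁ f) ≫
        d ▷ (V j ⊗ ((ld (V k) ⊗ ld (V l)) ⊗ ld (ld (V k))))) ⊗≫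
        ld (ld (V k)) ◁ V j ◁ p' ⊗≫ ld (ld (V k)) ◁ (η_ (V i) (ld (V i)) ▷ (V j ⊗ V i)) ⊗≫
        ld (ld (V k)) ◁ (q' ▷ (ld (V i) ⊗ V j ⊗ V i) ≫ (ld (V k) ⊗ ld (V l) ⊗ ld (ld (V k))) ◁ p) ⊗≫
        ε_ (ld (V k)) (ld (ld (V k))) ▷ (ld (V l) ⊗ ld (ld (V k)) ⊗ ld (V k)) ⊗≫
        ld (V l) ◁ ε_ (ld (V k)) (ld (ld (V k))) ⊗≫ 𝟙 (ld (V l))) ▷ N ⊗≫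
        ld (V l) ◁ y ≫ ε_ (V l) (ld (V l)) := by
        rw [whisker_exchange]; monoidal
    _ = _ := by
        rw [whisker_exchange]; monoidal

lemma isBilin_pairPart {i j m l : I} {N L : C}
    (d : (ld (V i) ⊗ ld (V j)) ⊗ ld (ld (V i)) ⟶ ld (ld (V m)))
    (a : ld (V i) ⊗ V j ⊗ V i ⟶ ld (V m)) (y : N ⟶ V l) :
    IsBilin k (fun (v : V i ⟶ ld (V m) ⊗ ld (V l) ⊗ ld (ld (V m))) (w : L ⟶ V i) =>
      𝟙 (summand V i j ⊗ (L ⊗ N)) ⊗≫ pairPart (V i) (ld (V i)) (ld (V m))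
        (ld (ld (V m))) (ld (V l)) d a v w ▷ N ⊗≫ ld (V l) ◁ y ≫ ε_ (V l) (ld (V l))) := by
  constructor
  · intro x y z
    simp only [pairPart, monoidalComp, MonoidalPreadditive.add_tensor, Preadditive.add_comp,
      Preadditive.comp_add, MonoidalPreadditive.whiskerLeft_add,
      MonoidalPreadditive.add_whiskerRight]
  · intro x y z
    simp only [pairPart, monoidalComp, MonoidalPreadditive.tensor_add, Preadditive.add_comp,
      Preadditive.comp_add, MonoidalPreadditive.add_whiskerRight]
  · intro a x y
    simp only [pairPart, MonoidalCategory.tensorHom_def, MonoidalLinear.smul_whiskerRight,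
      MonoidalLinear.whiskerLeft_smul, monoidalComp, Linear.smul_comp, Linear.comp_smul]
  · intro a x y
    simp only [pairPart, MonoidalCategory.tensorHom_def, MonoidalLinear.smul_whiskerRight,
      MonoidalLinear.whiskerLeft_smul, monoidalComp, Linear.smul_comp, Linear.comp_smul]

/-- The pairing at `(i,j)` and a fixed label `m`, composed with the universal dinatural
transformation. -/
lemma sum_pairingAux (hV : IsFusion k V) (N : Center C) (i j m : I) :
    ∑ l, summand V i j ◁ coendMapAux F N m l ≫ pairingAux F i j m l =
      ∑ α, ∑ β, 𝟙 (summand V i j ⊗ (ld N.1 ⊗ N.1)) ⊗≫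
        (dualMap (ld (ld (V m))) ((ld (V i) ⊗ ld (V j)) ⊗ ld (ld (V i))) ((F.dualIso m).inv ≫
          (F.dec (ld (V i) ⊗ V j ⊗ V i)).q (F.dual m) α) ▷ (V j ⊗ ld N.1) ≫
        ld (ld (V m)) ◁ (pairBraid (V i) (ld (V i))
          ((F.dec (ld (V i) ⊗ V j ⊗ V i)).p (F.dual m) α ≫ (F.dualIso m).hom)
          ((F.dec (ld N.1)).q i β) ((F.dec (ld N.1)).p i β) ≫ dualBraidHom N (ld (V m))) ⊗≫
        ε_ (ld (V m)) (ld (ld (V m))) ▷ ld N.1) ▷ N.1 ⊗≫ ε_ N.1 (ld N.1) := by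
  have h1 (l : I) (γ : Fin ((F.dec N.1).N l)) : dualMap ((ld (V m) ⊗ ld (V l)) ⊗ ld (ld (V m))) (ld N.1)
      (ld (V m) ◁ ((F.dec N.1).q l γ ▷ V m) ≫ act N (V m) (ld (V m))) =
      𝟙 (ld N.1) ⊗≫ ld N.1 ◁ η_ (ld (V m)) (ld (ld (V m))) ⊗≫
        dualBraidHom N (ld (V m)) ▷ ld (ld (V m)) ⊗≫
        (ld (V m) ◁ dualMap (ld (V l)) (ld N.1) ((F.dec N.1).q l γ)) ▷ ld (ld (V m)) := by
    refine (dualMap_comp _ ((ld (V m) ⊗ ld N.1) ⊗ ld (ld (V m))) (ld N.1)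
      (ld (V m) ◁ ((F.dec N.1).q l γ ▷ V m)) (act N (V m) (ld (V m)))).trans ?_
    rw [dualMap_act N (V m) (ld (V m)) (ld (ld (V m))), dualMap_whiskerLeft (ld (V m) ⊗ ld (V l))
      (ld (V m) ⊗ ld N.1) (ld (ld (V m))) ((F.dec N.1).q l γ ▷ V m),
      dualMap_whiskerRight (ld (V l)) (ld N.1) (ld (V m)) ((F.dec N.1).q l γ)]
    monoidal
  have h2 (l : I) : summand V i j ◁ coendMapAux F N m l ≫ pairingAux F i j m l =
      ∑ α, ∑ γ, ∑ β, 𝟙 (summand V i j ⊗ (ld N.1 ⊗ N.1)) ⊗≫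
        (dualMap (ld (ld (V m))) ((ld (V i) ⊗ ld (V j)) ⊗ ld (ld (V i))) ((F.dualIso m).inv ≫
          (F.dec (ld (V i) ⊗ V j ⊗ V i)).q (F.dual m) α) ▷ (V j ⊗ ld N.1) ≫
        ld (ld (V m)) ◁ (pairBraid (V i) (ld (V i))
          ((F.dec (ld (V i) ⊗ V j ⊗ V i)).p (F.dual m) α ≫ (F.dualIso m).hom)
          ((F.dec (ld N.1)).q i β) ((F.dec (ld N.1)).p i β) ≫ dualBraidHom N (ld (V m))) ⊗≫
        ε_ (ld (V m)) (ld (ld (V m))) ▷ ld N.1) ▷ N.1 ⊗≫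
        ld N.1 ◁ ((F.dec N.1).p l γ ≫ (F.dec N.1).q l γ) ≫ ε_ N.1 (ld N.1) := by
    simp only [coendMapAux, whiskerLeft_sum, Preadditive.sum_comp]
    simp only [pairingAux, Preadditive.comp_sum]
    rw [Finset.sum_comm]
    refine Finset.sum_congr rfl fun α _ => Finset.sum_congr rfl fun γ _ => ?_
    simp only [pairingTerm_eq]
    -- Dinaturality trades the decomposition of `ld (V m) ⊗ ld (V l) ⊗ ld (ld (V m))` for one of `ld
    -- N`, which no longer involves `l`.
    rw [← hV.exchange _ (F.dec (ld N.1)) (F.dec (ld (V m) ⊗ ld (V l) ⊗ ld (ld (V m)))) i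
      (isBilin_pairPart (k := k) _ _ _)]
    refine Finset.sum_congr rfl fun β _ => ?_
    have h3 := pairPart_comp (V i) (ld (V i)) (ld (V m)) (ld (ld (V m))) (ld (V l))
      (dualMap (ld (ld (V m))) ((ld (V i) ⊗ ld (V j)) ⊗ ld (ld (V i))) ((F.dualIso m).inv ≫
          (F.dec (ld (V i) ⊗ V j ⊗ V i)).q (F.dual m) α))
      ((F.dec (ld (V i) ⊗ V j ⊗ V i)).p (F.dual m) α ≫ (F.dualIso m).hom)
      ((F.dec (ld N.1)).q i β) ((F.dec (ld N.1)).p i β) (dualBraidHom N (ld (V m)))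
      (dualMap (ld (V l)) (ld N.1) ((F.dec N.1).q l γ))
    rw [← h1 l γ] at h3
    refine (congrArg (fun t => 𝟙 (summand V i j ⊗ (ld N.1 ⊗ N.1)) ⊗≫ t ▷ N.1 ⊗≫
      ld (V l) ◁ (F.dec N.1).p l γ ≫ ε_ (V l) (ld (V l))) h3).trans ?_
    have h4 := dualMap_eval (ld (V l)) (ld N.1) ((F.dec N.1).q l γ)
    generalize dualMap (ld (V l)) (ld N.1) ((F.dec N.1).q l γ) = c at h4 ⊢
    generalize dualMap (ld (ld (V m))) ((ld (V i) ⊗ ld (V j)) ⊗ ld (ld (V i)))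
      ((F.dualIso m).inv ≫ (F.dec (ld (V i) ⊗ V j ⊗ V i)).q (F.dual m) α) = d
    generalize pairBraid (V i) (ld (V i))
      ((F.dec (ld (V i) ⊗ V j ⊗ V i)).p (F.dual m) α ≫ (F.dualIso m).hom)
      ((F.dec (ld N.1)).q i β) ((F.dec (ld N.1)).p i β) ≫ dualBraidHom N (ld (V m)) = b
    generalize (F.dec N.1).p l γ = y
    generalize (F.dec N.1).q l γ = x at h4 ⊢
    calc _ = 𝟙 (summand V i j ⊗ (ld N.1 ⊗ N.1)) ⊗≫ (d ▷ (V j ⊗ ld N.1) ≫ ld (ld (V m)) ◁ b ⊗≫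
          ε_ (ld (V m)) (ld (ld (V m))) ▷ ld N.1) ▷ N.1 ⊗≫ (c ▷ N.1 ≫ ld (V l) ◁ y) ≫
          ε_ (V l) (ld (V l)) := by monoidal
      _ = 𝟙 (summand V i j ⊗ (ld N.1 ⊗ N.1)) ⊗≫ (d ▷ (V j ⊗ ld N.1) ≫ ld (ld (V m)) ◁ b ⊗≫
          ε_ (ld (V m)) (ld (ld (V m))) ▷ ld N.1) ▷ N.1 ⊗≫ ld N.1 ◁ y ≫
          (c ▷ V l ≫ ε_ (V l) (ld (V l))) := by rw [← whisker_exchange, Category.assoc]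
      _ = _ := by rw [h4]; monoidal
  simp only [h2]
  rw [Finset.sum_comm]
  refine Finset.sum_congr rfl fun α _ => ?_
  -- With `l` isolated, the sums over `l` and `γ` are the decomposition of the identity of `N`.
  simp only [monoidalComp, ← Preadditive.comp_sum, ← Preadditive.sum_comp]
  simp only [← whiskerLeft_sum, (F.dec N.1).sum_p_q, MonoidalCategory.whiskerLeft_id,
    Category.id_comp]

lemma pairBraid_whiskerLeft {A A' B L Z Z₁ : C} [ExactPairing A A'] (a : A' ⊗ B ⊗ A ⟶ Z)
    (v : A ⟶ L) (w : L ⟶ A) (b : Z ⟶ Z₁) :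
    pairBraid A A' a v w ≫ L ◁ b = pairBraid A A' (a ≫ b) v w := by
  unfold pairBraid
  simp only [MonoidalCategory.tensorHom_def]
  monoidal

lemma pairBraid_sum {A A' B L Z : C} [ExactPairing A A'] {J : Type*} (s : Finset J)
    (a : J → (A' ⊗ B ⊗ A ⟶ Z)) (v : A ⟶ L) (w : L ⟶ A) :
    pairBraid A A' (∑ j ∈ s, a j) v w = ∑ j ∈ s, pairBraid A A' (a j) v w := by
  simp only [pairBraid, MonoidalCategory.tensorHom_def, whiskerLeft_sum, Preadditive.comp_sum,
    monoidalComp]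

/-- The half braiding in terms of the actions of the members of the family. -/
lemma sum_pairBraid_act (M : Center C) {j : I} (x : V j ⟶ M.1) {L : C} (d : Decomp V L) :
    ∑ i, ∑ β, pairBraid (V i) (ld (V i)) (ld (V i) ◁ (x ▷ V i) ≫ act M (V i) (ld (V i)))
      (d.q i β) (d.p i β) = x ▷ L ≫ (M.2.β L).hom := by
  have h (i : I) (β) : pairBraid (V i) (ld (V i))
      (ld (V i) ◁ (x ▷ V i) ≫ act M (V i) (ld (V i))) (d.q i β) (d.p i β) =
      x ▷ L ≫ M.1 ◁ (d.p i β ≫ d.q i β) ≫ (M.2.β L).hom := by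
    unfold pairBraid
    rw [MonoidalCategory.tensorHom_def']
    calc _ = V j ◁ d.p i β ≫ (𝟙 (V j ⊗ V i) ⊗≫ (η_ (V i) (ld (V i)) ▷ (V j ⊗ V i) ≫
          (V i ⊗ ld (V i)) ◁ (x ▷ V i)) ⊗≫ V i ◁ act M (V i) (ld (V i)) ⊗≫ 𝟙 (V i ⊗ M.1)) ≫
          d.q i β ▷ M.1 := by monoidal
      _ = V j ◁ d.p i β ≫ x ▷ V i ≫ (𝟙 (M.1 ⊗ V i) ⊗≫ η_ (V i) (ld (V i)) ▷ (M.1 ⊗ V i) ⊗≫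
          V i ◁ act M (V i) (ld (V i)) ⊗≫ 𝟙 (V i ⊗ M.1)) ≫ d.q i β ▷ M.1 := by
          rw [← whisker_exchange]; monoidal
      _ = (V j ◁ d.p i β ≫ x ▷ V i) ≫ (M.2.β (V i)).hom ≫ d.q i β ▷ M.1 := by
          rw [← braid_eq_act M (V i) (ld (V i)), Category.assoc]
      _ = _ := by
          rw [whisker_exchange, ← M.2.naturality]
          simp only [MonoidalCategory.whiskerLeft_comp, Category.assoc]
  simp only [h, ← Preadditive.comp_sum, ← Preadditive.sum_comp, ← whiskerLeft_sum, d.sum_p_q]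
  simp

lemma sum_inc_prj {Z : C} (f : ∀ i j, Z ⟶ summand V i j) (i j : I) :
    (∑ i, ∑ j, f i j ≫ inc V i j) ≫ prj V i j = f i j := by
  obtain ⟨g, hg⟩ : ∃ g : Z ⟶ coendObj V, ∀ i j, g ≫ prj V i j = f i j :=
    ⟨biproduct.lift fun x => f x.1 x.2, fun i j => by simp [prj]⟩
  rw [← hg i j]
  congr 1
  rw [← Category.comp_id g, ← coendObj_id]
  simp only [Preadditive.comp_sum, ← Category.assoc, hg]

lemma inc_whiskerRight_pairing (N : Center C) (i j : I) :
    inc V i j ▷ (ld N.1 ⊗ N.1) ≫ coendObj V ◁ coendMap F N ≫ pairingFormula F =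
      ∑ m, ∑ l, summand V i j ◁ coendMapAux F N m l ≫ pairingAux F i j m l := by
  rw [← whisker_exchange_assoc]
  have h : inc V i j ▷ coendObj V ≫ pairingFormula F =
      ∑ m, ∑ l, summand V i j ◁ prj V m l ≫ pairingAux F i j m l := by
    rw [← inc_whiskerRight_sum_prj i j fun i j => ∑ m, ∑ l, summand V i j ◁ prj V m l ≫
      pairingAux F i j m l]
    simp only [pairingFormula, MonoidalCategory.tensorHom_def, Preadditive.comp_sum, Category.assoc]
  rw [h]
  simp only [Preadditive.comp_sum]
  refine Finset.sum_congr rfl fun m _ => Finset.sum_congr rfl fun l _ => ?_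
  rw [← MonoidalCategory.whiskerLeft_comp_assoc]
  rw [coendMap, sum_inc_prj]

/-- The sum over the dual labels `m` is the identity of `ld (V i) ⊗ V j ⊗ V i`. The sum over `i`
turns the actions into the half braiding of `M` at `ld N`, and the half braiding of the dual of `N`
supplies the second crossing: together, the double braiding. -/
lemma coact_pairing (hV : IsFusion k V) (M N : Center C) :
    coendCoact F M ▷ (ld N.1 ⊗ N.1) ⊗≫ M.1 ◁ (coendObj V ◁ coendMap F N ≫ pairingFormula F) =
      𝟙 (M.1 ⊗ (ld N.1 ⊗ N.1)) ⊗≫ ((M.2.β (ld N.1)).hom ≫ dualBraidHom N M.1) ▷ N.1 ⊗≫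
        M.1 ◁ ε_ N.1 (ld N.1) := by
  apply (F.dec M.1).whiskerRight_hom_ext
  intro j x
  refine (comp_coendCoact_whiskerRight F hV M x _).trans ?_
  have h1 (i : I) : hat (ld (V i) ⊗ (V j ⊗ V i)) ((ld (V i) ⊗ ld (V j)) ⊗ ld (ld (V i)))
        (𝟙 (((ld (V i) ⊗ ld (V j)) ⊗ ld (ld (V i))) ⊗ (V j ⊗ (ld N.1 ⊗ N.1))) ⊗≫
          inc V i j ▷ (ld N.1 ⊗ N.1) ≫ coendObj V ◁ coendMap F N ≫ pairingFormula F) =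
      ∑ β, 𝟙 (V j ⊗ (ld N.1 ⊗ N.1)) ⊗≫ (pairBraid (V i) (ld (V i)) (𝟙 _) ((F.dec (ld N.1)).q i β)
        ((F.dec (ld N.1)).p i β) ≫ dualBraidHom N (ld (V i) ⊗ V j ⊗ V i)) ▷ N.1 ⊗≫
        (ld (V i) ⊗ (V j ⊗ V i)) ◁ ε_ N.1 (ld N.1) := by
    rw [inc_whiskerRight_pairing]
    simp only [sum_pairingAux F hV]
    have h3 (m : I) (α) (β) : hat (ld (V i) ⊗ (V j ⊗ V i)) ((ld (V i) ⊗ ld (V j)) ⊗ ld (ld (V i)))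
        (𝟙 (((ld (V i) ⊗ ld (V j)) ⊗ ld (ld (V i))) ⊗ (V j ⊗ (ld N.1 ⊗ N.1))) ⊗≫
          (𝟙 (summand V i j ⊗ (ld N.1 ⊗ N.1)) ⊗≫
        (dualMap (ld (ld (V m))) ((ld (V i) ⊗ ld (V j)) ⊗ ld (ld (V i))) ((F.dualIso m).inv ≫
          (F.dec (ld (V i) ⊗ V j ⊗ V i)).q (F.dual m) α) ▷ (V j ⊗ ld N.1) ≫
        ld (ld (V m)) ◁ (pairBraid (V i) (ld (V i))
          ((F.dec (ld (V i) ⊗ V j ⊗ V i)).p (F.dual m) α ≫ (F.dualIso m).hom)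
          ((F.dec (ld N.1)).q i β) ((F.dec (ld N.1)).p i β) ≫ dualBraidHom N (ld (V m))) ⊗≫
        ε_ (ld (V m)) (ld (ld (V m))) ▷ ld N.1) ▷ N.1 ⊗≫ ε_ N.1 (ld N.1))) =
        𝟙 (V j ⊗ (ld N.1 ⊗ N.1)) ⊗≫ (pairBraid (V i) (ld (V i))
          (((F.dec (ld (V i) ⊗ V j ⊗ V i)).p (F.dual m) α ≫ (F.dualIso m).hom) ≫
          (F.dualIso m).inv ≫ (F.dec (ld (V i) ⊗ V j ⊗ V i)).q (F.dual m) α)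
          ((F.dec (ld N.1)).q i β)
        ((F.dec (ld N.1)).p i β) ≫ dualBraidHom N (ld (V i) ⊗ V j ⊗ V i)) ▷ N.1 ⊗≫
        (ld (V i) ⊗ (V j ⊗ V i)) ◁ ε_ N.1 (ld N.1) := by
      have e (b : ld (V m) ⟶ ld (V i) ⊗ V j ⊗ V i) : ld N.1 ◁ b ≫ dualBraidHom N (ld (V i) ⊗ V j ⊗ V i) =
        dualBraidHom N (ld (V m)) ≫ b ▷ ld N.1 := (dualLax N).nat b
      rw [← pairBraid_whiskerLeft _ _ _ ((F.dualIso m).inv ≫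
        (F.dec (ld (V i) ⊗ V j ⊗ V i)).q (F.dual m) α), Category.assoc, e, ← Category.assoc]
      refine Eq.trans ?_ ((hat_pairPart (ld (V i) ⊗ (V j ⊗ V i))
        ((ld (V i) ⊗ ld (V j)) ⊗ ld (ld (V i))) (ld (V m)) (ld (ld (V m))) N.1 (ld N.1)
        ((F.dualIso m).inv ≫ (F.dec (ld (V i) ⊗ V j ⊗ V i)).q (F.dual m) α)
        (pairBraid (V i) (ld (V i))
          ((F.dec (ld (V i) ⊗ V j ⊗ V i)).p (F.dual m) α ≫ (F.dualIso m).hom)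
          ((F.dec (ld N.1)).q i β) ((F.dec (ld N.1)).p i β) ≫ dualBraidHom N (ld (V m)))).trans ?_)
      · congr 1
        monoidal
      · monoidal
    calc _ = ∑ m, ∑ α, ∑ β, 𝟙 (V j ⊗ (ld N.1 ⊗ N.1)) ⊗≫ (pairBraid (V i) (ld (V i))
          (((F.dec (ld (V i) ⊗ V j ⊗ V i)).p (F.dual m) α ≫ (F.dualIso m).hom) ≫
          (F.dualIso m).inv ≫ (F.dec (ld (V i) ⊗ V j ⊗ V i)).q (F.dual m) α)
          ((F.dec (ld N.1)).q i β)
        ((F.dec (ld N.1)).p i β) ≫ dualBraidHom N (ld (V i) ⊗ V j ⊗ V i)) ▷ N.1 ⊗≫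
        (ld (V i) ⊗ (V j ⊗ V i)) ◁ ε_ N.1 (ld N.1) := by
          simp only [← h3]
          simp only [← hat_sum]
          simp only [monoidalComp, Preadditive.comp_sum]
      _ = _ := by
          rw [sum_sum_comm]
          refine Finset.sum_congr rfl fun β _ => ?_
          rw [← sum_dual F hV (F.dec (ld (V i) ⊗ V j ⊗ V i))]
          simp only [pairBraid_sum, monoidalComp, Preadditive.comp_sum, Preadditive.sum_comp,
            sum_whiskerRight]
  simp only [h1]
  have h2 (i : I) (β) : (𝟙 (V j ⊗ (ld N.1 ⊗ N.1)) ⊗≫ (pairBraid (V i) (ld (V i)) (𝟙 _)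
        ((F.dec (ld N.1)).q i β) ((F.dec (ld N.1)).p i β) ≫
        dualBraidHom N (ld (V i) ⊗ V j ⊗ V i)) ▷ N.1 ⊗≫
        (ld (V i) ⊗ (V j ⊗ V i)) ◁ ε_ N.1 (ld N.1)) ≫
        (ld (V i) ◁ (x ▷ V i) ≫ act M (V i) (ld (V i))) ▷ 𝟙_ C =
      𝟙 (V j ⊗ (ld N.1 ⊗ N.1)) ⊗≫ (pairBraid (V i) (ld (V i))
        (ld (V i) ◁ (x ▷ V i) ≫ act M (V i) (ld (V i)))
        ((F.dec (ld N.1)).q i β) ((F.dec (ld N.1)).p i β) ≫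
        dualBraidHom N M.1) ▷ N.1 ⊗≫ M.1 ◁ ε_ N.1 (ld N.1) := by
    have e' := pairBraid_whiskerLeft (A' := ld (V i)) (𝟙 (ld (V i) ⊗ V j ⊗ V i)) ((F.dec (ld N.1)).q i β)
      ((F.dec (ld N.1)).p i β) (ld (V i) ◁ (x ▷ V i) ≫ act M (V i) (ld (V i)))
    rw [Category.id_comp] at e'
    rw [← e', Category.assoc]
    generalize pairBraid (V i) (ld (V i)) (𝟙 (ld (V i) ⊗ V j ⊗ V i)) ((F.dec (ld N.1)).q i β)
      ((F.dec (ld N.1)).p i β) = b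
    obtain ⟨r, hr⟩ : ∃ r : ld (V i) ⊗ (V j ⊗ V i) ⟶ M.1,
      r = ld (V i) ◁ (x ▷ V i) ≫ act M (V i) (ld (V i)) := ⟨_, rfl⟩
    have e : ld N.1 ◁ r ≫ dualBraidHom N M.1 =
      dualBraidHom N (ld (V i) ⊗ V j ⊗ V i) ≫ r ▷ ld N.1 := (dualLax N).nat r
    rw [← hr, e]
    calc _ = 𝟙 (V j ⊗ (ld N.1 ⊗ N.1)) ⊗≫ (b ≫ dualBraidHom N (ld (V i) ⊗ V j ⊗ V i)) ▷ N.1 ⊗≫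
        ((ld (V i) ⊗ (V j ⊗ V i)) ◁ ε_ N.1 (ld N.1) ≫ r ▷ 𝟙_ C) := by monoidal
      _ = _ := by rw [whisker_exchange]; monoidal
  calc _ = 𝟙 (V j ⊗ (ld N.1 ⊗ N.1)) ⊗≫ ((∑ i, ∑ β, pairBraid (V i) (ld (V i))
        (ld (V i) ◁ (x ▷ V i) ≫ act M (V i) (ld (V i)))
        ((F.dec (ld N.1)).q i β) ((F.dec (ld N.1)).p i β)) ≫
        dualBraidHom N M.1) ▷ N.1 ⊗≫ M.1 ◁ ε_ N.1 (ld N.1) := by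
        simp only [Preadditive.sum_comp, h2]
        simp only [monoidalComp, Preadditive.comp_sum, Preadditive.sum_comp, sum_whiskerRight]
    _ = _ := by
        rw [sum_pairBraid_act]
        monoidal

/-- The formula for the pairing. -/
lemma pairing_formula (hV : IsFusion k V) (M N : Center C) :
    (coendMap F M ⊗ₘ coendMap F N) ≫ pairingFormula F =
      𝟙 ((ld M.1 ⊗ M.1) ⊗ (ld N.1 ⊗ N.1)) ⊗≫
        ld M.1 ◁ (((M.2.β (ld N.1)).hom ≫ dualBraidHom N M.1) ▷ N.1) ⊗≫
        (ε_ M.1 (ld M.1) ⊗ₘ ε_ N.1 (ld N.1)) ≫ (λ_ (𝟙_ C)).hom := by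
  have h := coact_pairing F hV M N
  have e : coendMap F M = ld M.1 ◁ coendCoact F M ⊗≫ ε_ M.1 (ld M.1) ▷ coendObj V ⊗≫
      𝟙 (coendObj V) := by
    symm
    calc _ = 𝟙 (ld M.1 ⊗ M.1) ⊗≫ ld M.1 ◁ η_ M.1 (ld M.1) ▷ M.1 ⊗≫
          ((ld M.1 ⊗ M.1) ◁ coendMap F M ≫ ε_ M.1 (ld M.1) ▷ coendObj V) ⊗≫ 𝟙 (coendObj V) := by
          unfold coendCoact hat; monoidal
      _ = 𝟙 (ld M.1 ⊗ M.1) ⊗≫ (ld M.1 ◁ η_ M.1 (ld M.1) ⊗≫ ε_ M.1 (ld M.1) ▷ ld M.1) ▷ M.1 ⊗≫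
          coendMap F M := by rw [whisker_exchange]; monoidal
      _ = _ := by rw [ExactPairing.coevaluation_evaluation'']; monoidal
  rw [MonoidalCategory.tensorHom_def, MonoidalCategory.tensorHom_def, e]
  generalize coendCoact F M = δ at h ⊢
  generalize coendMap F N = c at h ⊢
  generalize pairingFormula F = ω at h ⊢
  calc _ = 𝟙 ((ld M.1 ⊗ M.1) ⊗ (ld N.1 ⊗ N.1)) ⊗≫ ld M.1 ◁ δ ▷ (ld N.1 ⊗ N.1) ⊗≫
        (ε_ M.1 (ld M.1) ▷ (coendObj V ⊗ (ld N.1 ⊗ N.1)) ≫ 𝟙_ C ◁ (coendObj V ◁ c ≫ ω)) ⊗≫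
        𝟙 (𝟙_ C) := by monoidal
    _ = 𝟙 ((ld M.1 ⊗ M.1) ⊗ (ld N.1 ⊗ N.1)) ⊗≫ ld M.1 ◁ (δ ▷ (ld N.1 ⊗ N.1) ⊗≫
        M.1 ◁ (coendObj V ◁ c ≫ ω)) ⊗≫ ε_ M.1 (ld M.1) ▷ 𝟙_ C ⊗≫ 𝟙 (𝟙_ C) := by
        rw [← whisker_exchange]; monoidal
    _ = 𝟙 ((ld M.1 ⊗ M.1) ⊗ (ld N.1 ⊗ N.1)) ⊗≫
        ld M.1 ◁ (((M.2.β (ld N.1)).hom ≫ dualBraidHom N M.1) ▷ N.1) ⊗≫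
        ((ld M.1 ⊗ M.1) ◁ ε_ N.1 (ld N.1) ≫ ε_ M.1 (ld M.1) ▷ 𝟙_ C) ⊗≫ 𝟙 (𝟙_ C) := by
        rw [h]; monoidal
    _ = _ := by rw [whisker_exchange]; monoidal

lemma hom_ext_coendMap (hV : IsFusion k V) {Z : C} {f g : coendObj V ⟶ Z}
    (h : ∀ M : Center C, coendMap F M ≫ f = coendMap F M ≫ g) : f = g := by
  apply (isUniversalCoaction_forget F hV).ext
  intro M
  refine (hat_comp M.1 (ld M.1) (coendMap F M) f).trans
    (Eq.trans ?_ (hat_comp M.1 (ld M.1) (coendMap F M) g).symm)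
  rw [h]

/-- Duality removes one variable at a time, reducing to joint detection by the dinatural maps in a
single variable. -/
lemma hom_ext_coendMap_tensor (hV : IsFusion k V) {Z : C} {f g : coendObj V ⊗ coendObj V ⟶ Z}
    (h : ∀ M N : Center C, (coendMap F M ⊗ₘ coendMap F N) ≫ f =
      (coendMap F M ⊗ₘ coendMap F N) ≫ g) : f = g := by
  apply hat_injective (rd (coendObj V)) (coendObj V)
  apply hom_ext_coendMap F hV
  intro N
  rw [comp_hat, comp_hat]
  congr 1
  apply (tensorRightHomEquiv (coendObj V) (ld N.1 ⊗ N.1) (ld N.1 ⊗ ld (ld N.1)) Z).injective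
  apply hom_ext_coendMap F hV
  intro M
  rw [comp_tensorRightHomEquiv, comp_tensorRightHomEquiv]
  congr 1
  simpa only [MonoidalCategory.tensorHom_def, Category.assoc] using h M N

end Coend
end CenterCoend


set_option linter.unusedSectionVars false

namespace CenterCoend
open Limits

/-! ### The antipode: its coevaluations as a capped rotation -/

section Abstract
variable {D : Type u} [Category.{v} D] [MonoidalCategory.{v} D]
  {B B₁ B₂ E E₁ E₂ A₁ A₂ A₃ : D} [ExactPairing B B₁] [ExactPairing B₁ B₂] [ExactPairing E E₁]
  [ExactPairing E₁ E₂] [ExactPairing A₁ A₂] [ExactPairing A₂ A₃]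

/-- The first half of the evaluation in the antipode. -/
def antEvalLeft (d : (B ⊗ E₁) ⊗ B₁ ⟶ A₂) : ((B ⊗ E₁) ⊗ B₁) ⊗ A₁ ⟶ 𝟙_ D :=
  d ▷ A₁ ≫ ε_ A₁ A₂

/-- The second half of the evaluation in the antipode. -/
def antEvalRight (p : A₂ ⟶ (B ⊗ E₁) ⊗ B₁) : B₁ ⊗ (A₂ ⊗ (B ⊗ E)) ⟶ 𝟙_ D :=
  B₁ ◁ (p ▷ (B ⊗ E)) ⊗≫ ε_ B B₁ ▷ ((E₁ ⊗ B₁) ⊗ (B ⊗ E)) ⊗≫ ε_ (B ⊗ E) (E₁ ⊗ B₁)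

/-- The evaluation in the antipode. -/
def antEval (p : A₂ ⟶ (B ⊗ E₁) ⊗ B₁) (d : (B ⊗ E₁) ⊗ B₁ ⟶ A₂) :
    B ⊗ (E₁ ⊗ ((B₁ ⊗ (A₁ ⊗ (B₁ ⊗ (A₂ ⊗ B)))) ⊗ E)) ⟶ 𝟙_ D :=
  𝟙 _ ⊗≫ antEvalLeft (A₁ := A₁) d ▷ (B₁ ⊗ (A₂ ⊗ (B ⊗ E))) ⊗≫ antEvalRight (E := E) p

lemma coev_antEvalRight (p : A₂ ⟶ (B ⊗ E₁) ⊗ B₁) :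
    η_ (B₁ ⊗ (A₂ ⊗ (B ⊗ E))) (((E₁ ⊗ B₁) ⊗ A₃) ⊗ B₂) ≫
      antEvalRight (E := E) p ▷ (((E₁ ⊗ B₁) ⊗ A₃) ⊗ B₂) =
    η_ B₁ B₂ ⊗≫ B₁ ◁ ((η_ A₂ A₃ ≫ p ▷ A₃) ▷ B₂) ⊗≫ ε_ B B₁ ▷ (((E₁ ⊗ B₁) ⊗ A₃) ⊗ B₂) := by
  unfold antEvalRight
  rw [coeval_tensor (X := B₁) (Y := A₂ ⊗ (B ⊗ E)) B₂ ((E₁ ⊗ B₁) ⊗ A₃),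
    coeval_tensor (X := A₂) (Y := B ⊗ E) A₃ (E₁ ⊗ B₁)]
  calc _ = η_ B₁ B₂ ⊗≫ B₁ ◁ (η_ A₂ A₃ ▷ B₂) ⊗≫ B₁ ◁ (A₂ ◁ η_ (B ⊗ E) (E₁ ⊗ B₁) ≫
          p ▷ ((B ⊗ E) ⊗ (E₁ ⊗ B₁))) ▷ (A₃ ⊗ B₂) ⊗≫
        ε_ B B₁ ▷ ((E₁ ⊗ B₁) ⊗ (((B ⊗ E) ⊗ (E₁ ⊗ B₁)) ⊗ (A₃ ⊗ B₂))) ⊗≫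
        ε_ (B ⊗ E) (E₁ ⊗ B₁) ▷ ((E₁ ⊗ B₁) ⊗ (A₃ ⊗ B₂)) ⊗≫ 𝟙 _ := by
        monoidal
    _ = η_ B₁ B₂ ⊗≫ B₁ ◁ ((η_ A₂ A₃ ≫ p ▷ A₃) ▷ B₂) ⊗≫
        ((B₁ ⊗ B) ◁ ((E₁ ⊗ B₁) ◁ η_ (B ⊗ E) (E₁ ⊗ B₁) ▷ (A₃ ⊗ B₂)) ≫
        ε_ B B₁ ▷ ((E₁ ⊗ B₁) ⊗ (((B ⊗ E) ⊗ (E₁ ⊗ B₁)) ⊗ (A₃ ⊗ B₂)))) ⊗≫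
        ε_ (B ⊗ E) (E₁ ⊗ B₁) ▷ ((E₁ ⊗ B₁) ⊗ (A₃ ⊗ B₂)) ⊗≫ 𝟙 _ := by
        rw [whisker_exchange p]; monoidal
    _ = η_ B₁ B₂ ⊗≫ B₁ ◁ ((η_ A₂ A₃ ≫ p ▷ A₃) ▷ B₂) ⊗≫
        ε_ B B₁ ▷ ((E₁ ⊗ B₁) ⊗ (A₃ ⊗ B₂)) ⊗≫
        ((E₁ ⊗ B₁) ◁ η_ (B ⊗ E) (E₁ ⊗ B₁) ⊗≫
        ε_ (B ⊗ E) (E₁ ⊗ B₁) ▷ (E₁ ⊗ B₁)) ▷ (A₃ ⊗ B₂) ⊗≫ 𝟙 _ := by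
        rw [whisker_exchange (ε_ B B₁)]; monoidal
    _ = _ := by
        have h : (E₁ ⊗ B₁) ◁ η_ (B ⊗ E) (E₁ ⊗ B₁) ⊗≫ ε_ (B ⊗ E) (E₁ ⊗ B₁) ▷ (E₁ ⊗ B₁) =
            (ρ_ (E₁ ⊗ B₁)).hom ≫ (λ_ (E₁ ⊗ B₁)).inv := by
          rw [← ExactPairing.coevaluation_evaluation (B ⊗ E) (E₁ ⊗ B₁)]
          monoidal
        rw [h]; monoidal

lemma coev_antEvalLeft (d : (B ⊗ E₁) ⊗ B₁ ⟶ A₂) :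
    η_ ((B ⊗ E₁) ⊗ B₁) (B₂ ⊗ (E₂ ⊗ B₁)) ⊗≫
      ((B ⊗ E₁) ⊗ B₁) ◁ (η_ A₁ A₂ ▷ (B₂ ⊗ (E₂ ⊗ B₁))) ⊗≫
      antEvalLeft (A₁ := A₁) d ▷ (A₂ ⊗ (B₂ ⊗ (E₂ ⊗ B₁))) =
    (η_ A₂ A₃ ≫ A₂ ◁ dualMap (B₂ ⊗ (E₂ ⊗ B₁)) A₃ d) ⊗≫ 𝟙 _ := by
  rw [coeval_dualMap (B₂ ⊗ (E₂ ⊗ B₁)) A₃ d]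
  unfold antEvalLeft
  calc _ = η_ ((B ⊗ E₁) ⊗ B₁) (B₂ ⊗ (E₂ ⊗ B₁)) ⊗≫
      (((B ⊗ E₁) ⊗ B₁) ◁ η_ A₁ A₂ ≫ d ▷ (A₁ ⊗ A₂)) ▷ (B₂ ⊗ (E₂ ⊗ B₁)) ⊗≫
      ε_ A₁ A₂ ▷ (A₂ ⊗ (B₂ ⊗ (E₂ ⊗ B₁))) := by monoidal
    _ = η_ ((B ⊗ E₁) ⊗ B₁) (B₂ ⊗ (E₂ ⊗ B₁)) ⊗≫ d ▷ (B₂ ⊗ (E₂ ⊗ B₁)) ⊗≫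
      (A₂ ◁ η_ A₁ A₂ ⊗≫ ε_ A₁ A₂ ▷ A₂) ▷ (B₂ ⊗ (E₂ ⊗ B₁)) ⊗≫ 𝟙 _ := by
        rw [whisker_exchange]; monoidal
    _ = _ := by rw [ExactPairing.coevaluation_evaluation'' A₁ A₂]; monoidal

/-- The coevaluations in the antipode. -/
def antCoev (p : A₂ ⟶ (B ⊗ E₁) ⊗ B₁) (d : A₃ ⟶ B₂ ⊗ (E₂ ⊗ B₁)) :
    𝟙_ D ⟶ ((E₁ ⊗ ((((B₁ ⊗ A₃) ⊗ B₂) ⊗ A₂) ⊗ B₂)) ⊗ E₂) ⊗ B₁ :=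
  η_ B₁ B₂ ⊗≫ (B₁ ⊗ B₂) ◁ η_ A₂ A₃ ⊗≫ B₁ ◁ (η_ A₂ A₃ ▷ (B₂ ⊗ A₂ ⊗ A₃)) ⊗≫
    B₁ ◁ (p ▷ (A₃ ⊗ B₂ ⊗ A₂ ⊗ A₃)) ⊗≫
    (B₁ ⊗ B ⊗ E₁ ⊗ B₁ ⊗ A₃ ⊗ B₂ ⊗ A₂) ◁ d ⊗≫
    ε_ B B₁ ▷ (E₁ ⊗ B₁ ⊗ A₃ ⊗ B₂ ⊗ A₂ ⊗ B₂ ⊗ E₂ ⊗ B₁) ⊗≫ 𝟙 _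

/-- The coevaluations of the antipode formula are those of one conjugated object, partly closed by
`antEval`. The two halves of the cap straighten separately by zigzags and are then exchanged. -/
lemma coev_antEval (p : A₂ ⟶ (B ⊗ E₁) ⊗ B₁) (d : (B ⊗ E₁) ⊗ B₁ ⟶ A₂) :
    η_ B B₁ ⊗≫ B ◁ (η_ (E₁ ⊗ ((B₁ ⊗ (A₁ ⊗ (B₁ ⊗ (A₂ ⊗ B)))) ⊗ E))
      ((E₁ ⊗ ((((B₁ ⊗ A₃) ⊗ B₂) ⊗ A₂) ⊗ B₂)) ⊗ E₂) ▷ B₁) ⊗≫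
      antEval (A₁ := A₁) (E := E) p d ▷ (((E₁ ⊗ ((((B₁ ⊗ A₃) ⊗ B₂) ⊗ A₂) ⊗ B₂)) ⊗ E₂) ⊗ B₁) ⊗≫ 𝟙 _ =
    antCoev p (dualMap (B₂ ⊗ (E₂ ⊗ B₁)) A₃ d) := by
  unfold antEval antCoev
  have hl := coev_antEvalLeft (A₁ := A₁) (A₃ := A₃) (B₂ := B₂) (E₂ := E₂) d
  have hr := coev_antEvalRight (B₂ := B₂) (E := E) (A₃ := A₃) p
  have hS : η_ (B₁ ⊗ (A₂ ⊗ (B ⊗ E))) (((E₁ ⊗ B₁) ⊗ A₃) ⊗ B₂) =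
      η_ B₁ B₂ ⊗≫ B₁ ◁ (η_ A₂ A₃ ⊗≫ A₂ ◁ (η_ B B₁ ⊗≫ B ◁ η_ E E₁ ▷ B₁) ▷ A₃) ▷ B₂ ⊗≫ 𝟙 _ := by
    simp only [coeval_tensor]; monoidal
  have hQ : η_ ((B ⊗ E₁) ⊗ B₁) (B₂ ⊗ (E₂ ⊗ B₁)) =
      η_ B B₁ ⊗≫ B ◁ (η_ E₁ E₂ ⊗≫ E₁ ◁ η_ B₁ B₂ ▷ E₂) ▷ B₁ ⊗≫ 𝟙 _ := by
    simp only [coeval_tensor]; monoidal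
  have hT : η_ (E₁ ⊗ ((B₁ ⊗ (A₁ ⊗ (B₁ ⊗ (A₂ ⊗ B)))) ⊗ E))
      ((E₁ ⊗ ((((B₁ ⊗ A₃) ⊗ B₂) ⊗ A₂) ⊗ B₂)) ⊗ E₂) =
      η_ E₁ E₂ ⊗≫ E₁ ◁ (η_ B₁ B₂ ⊗≫ B₁ ◁ (η_ A₁ A₂ ⊗≫ A₁ ◁ (η_ B₁ B₂ ⊗≫
        B₁ ◁ (η_ A₂ A₃ ⊗≫ A₂ ◁ (η_ B B₁ ⊗≫ B ◁ η_ E E₁ ▷ B₁) ▷ A₃) ▷ B₂) ▷ A₂) ▷ B₂) ▷ E₂ ⊗≫ 𝟙 _ := by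
    simp only [coeval_tensor]; monoidal
  rw [hT]
  generalize antEvalLeft (A₁ := A₁) d = l at *
  generalize antEvalRight (E := E) p = r at *
  generalize dualMap (B₂ ⊗ (E₂ ⊗ B₁)) A₃ d = dd at *
  calc _ = (η_ B B₁ ⊗≫ B ◁ (η_ E₁ E₂ ⊗≫ E₁ ◁ η_ B₁ B₂ ▷ E₂) ▷ B₁ ⊗≫
          𝟙 (((B ⊗ E₁) ⊗ B₁) ⊗ (B₂ ⊗ (E₂ ⊗ B₁)))) ⊗≫
        ((B ⊗ E₁) ⊗ B₁) ◁ (η_ A₁ A₂ ▷ (B₂ ⊗ (E₂ ⊗ B₁))) ⊗≫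
        (((((B ⊗ E₁) ⊗ B₁) ⊗ A₁) ◁ (η_ B₁ B₂ ⊗≫ B₁ ◁ (η_ A₂ A₃ ⊗≫
          A₂ ◁ (η_ B B₁ ⊗≫ B ◁ η_ E E₁ ▷ B₁) ▷ A₃) ▷ B₂ ⊗≫
          𝟙 ((B₁ ⊗ (A₂ ⊗ (B ⊗ E))) ⊗ (((E₁ ⊗ B₁) ⊗ A₃) ⊗ B₂))) ≫
        l ▷ ((B₁ ⊗ (A₂ ⊗ (B ⊗ E))) ⊗ (((E₁ ⊗ B₁) ⊗ A₃) ⊗ B₂))) ⊗≫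
        r ▷ (((E₁ ⊗ B₁) ⊗ A₃) ⊗ B₂)) ▷ (A₂ ⊗ (B₂ ⊗ (E₂ ⊗ B₁))) ⊗≫ 𝟙 _ := by
        monoidal
    _ = (η_ ((B ⊗ E₁) ⊗ B₁) (B₂ ⊗ (E₂ ⊗ B₁)) ⊗≫
      ((B ⊗ E₁) ⊗ B₁) ◁ (η_ A₁ A₂ ▷ (B₂ ⊗ (E₂ ⊗ B₁))) ⊗≫
      l ▷ (A₂ ⊗ (B₂ ⊗ (E₂ ⊗ B₁)))) ⊗≫
        (η_ (B₁ ⊗ (A₂ ⊗ (B ⊗ E))) (((E₁ ⊗ B₁) ⊗ A₃) ⊗ B₂) ≫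
        r ▷ (((E₁ ⊗ B₁) ⊗ A₃) ⊗ B₂)) ▷ (A₂ ⊗ (B₂ ⊗ (E₂ ⊗ B₁))) ⊗≫ 𝟙 _ := by
        rw [← hS, ← hQ, whisker_exchange]; monoidal
    _ = 𝟙 _ ⊗≫ 𝟙_ D ◁ (η_ A₂ A₃ ≫ A₂ ◁ dd) ≫
        (η_ B₁ B₂ ⊗≫ B₁ ◁ ((η_ A₂ A₃ ≫ p ▷ A₃) ▷ B₂) ⊗≫
          ε_ B B₁ ▷ (((E₁ ⊗ B₁) ⊗ A₃) ⊗ B₂)) ▷ (A₂ ⊗ (B₂ ⊗ (E₂ ⊗ B₁))) ⊗≫ 𝟙 _ := by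
        rw [hr, hl]; monoidal
    _ = η_ A₂ A₃ ⊗≫ (𝟙_ D ◁ (A₂ ◁ dd) ≫
        (η_ B₁ B₂ ⊗≫ B₁ ◁ ((η_ A₂ A₃ ≫ p ▷ A₃) ▷ B₂) ⊗≫
          ε_ B B₁ ▷ (((E₁ ⊗ B₁) ⊗ A₃) ⊗ B₂) ⊗≫ 𝟙 (((E₁ ⊗ B₁) ⊗ A₃) ⊗ B₂)) ▷
            (A₂ ⊗ (B₂ ⊗ (E₂ ⊗ B₁)))) ⊗≫ 𝟙 _ := by
        monoidal
    _ = 𝟙 _ ⊗≫ (𝟙_ D ◁ η_ A₂ A₃ ≫ η_ B₁ B₂ ▷ (A₂ ⊗ A₃)) ⊗≫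
        (B₁ ◁ ((η_ A₂ A₃ ≫ p ▷ A₃) ▷ B₂)) ▷ (A₂ ⊗ A₃) ⊗≫
        (ε_ B B₁ ▷ (E₁ ⊗ B₁ ⊗ A₃ ⊗ B₂ ⊗ A₂ ⊗ A₃) ≫
          𝟙_ D ◁ (E₁ ◁ B₁ ◁ A₃ ◁ B₂ ◁ A₂ ◁ dd)) ⊗≫ 𝟙 _ := by
        rw [whisker_exchange]; monoidal
    _ = _ := by
        rw [← whisker_exchange (ε_ B B₁), whisker_exchange (η_ B₁ B₂)]; monoidal

/-- The morphism `A₁ ⊗ B₁ ⊗ A₂ ⊗ B ⟶ Z` defined by `h`. -/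
def antTerm (p : A₂ ⟶ (B ⊗ E₁) ⊗ B₁) (d : A₃ ⟶ B₂ ⊗ (E₂ ⊗ B₁)) {Z : D}
    (h : ((E₁ ⊗ ((((B₁ ⊗ A₃) ⊗ B₂) ⊗ A₂) ⊗ B₂)) ⊗ E₂) ⊗ (B₁ ⊗ (A₁ ⊗ (B₁ ⊗ (A₂ ⊗ B)))) ⟶ Z) :
    A₁ ⊗ (B₁ ⊗ (A₂ ⊗ B)) ⟶ Z :=
  𝟙 _ ⊗≫ antCoev p d ▷ (A₁ ⊗ (B₁ ⊗ (A₂ ⊗ B))) ⊗≫ h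

/-- Rewriting the coevaluations this way puts `h` under `hat`; applied to `kap` it produces
`kapHat`, whose naturality can then be used. -/
lemma antTerm_eq (p : A₂ ⟶ (B ⊗ E₁) ⊗ B₁) (d : (B ⊗ E₁) ⊗ B₁ ⟶ A₂) {Z : D}
    (h : ((E₁ ⊗ ((((B₁ ⊗ A₃) ⊗ B₂) ⊗ A₂) ⊗ B₂)) ⊗ E₂) ⊗ (B₁ ⊗ (A₁ ⊗ (B₁ ⊗ (A₂ ⊗ B)))) ⟶ Z) :
    antTerm p (dualMap (B₂ ⊗ (E₂ ⊗ B₁)) A₃ d) h =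
    𝟙 _ ⊗≫ η_ B B₁ ▷ (A₁ ⊗ (B₁ ⊗ (A₂ ⊗ B))) ⊗≫
      B ◁ hat (E₁ ⊗ ((B₁ ⊗ (A₁ ⊗ (B₁ ⊗ (A₂ ⊗ B)))) ⊗ E))
        ((E₁ ⊗ ((((B₁ ⊗ A₃) ⊗ B₂) ⊗ A₂) ⊗ B₂)) ⊗ E₂) h ⊗≫
      antEval (A₁ := A₁) (E := E) p d ▷ Z ⊗≫ 𝟙 Z := by
  unfold antTerm hat
  rw [← coev_antEval (A₁ := A₁) (E := E)]
  generalize antEval (A₁ := A₁) (E := E) p d = g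
  symm
  calc _ = 𝟙 _ ⊗≫ η_ B B₁ ▷ (A₁ ⊗ (B₁ ⊗ (A₂ ⊗ B))) ⊗≫
      B ◁ (η_ (E₁ ⊗ ((B₁ ⊗ (A₁ ⊗ (B₁ ⊗ (A₂ ⊗ B)))) ⊗ E))
        ((E₁ ⊗ ((((B₁ ⊗ A₃) ⊗ B₂) ⊗ A₂) ⊗ B₂)) ⊗ E₂) ▷ (B₁ ⊗ (A₁ ⊗ (B₁ ⊗ (A₂ ⊗ B))))) ⊗≫
      ((B ⊗ (E₁ ⊗ ((B₁ ⊗ (A₁ ⊗ (B₁ ⊗ (A₂ ⊗ B)))) ⊗ E))) ◁ h ≫ g ▷ Z) ⊗≫ 𝟙 Z := by monoidal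
    _ = _ := by rw [whisker_exchange]; monoidal

end Abstract
section Antipode
variable {C : Type u} [Category.{v} C] [Preadditive C] [MonoidalCategory.{v} C]
  [MonoidalPreadditive C] [RigidCategory C] {I : Type w} [Fintype I] [HasFiniteBiproducts C]
  {k : Type w'} [CommRing k] [Linear k C] [MonoidalLinear k C] {V : I → C} (F : FusionChoices V)

lemma antipodeTerm_comp {i j k l : I}
    (p : V j ⊗ V k ⊗ rd (V j) ⟶ ld (V i)) (q : ld (V i) ⟶ V j ⊗ V k ⊗ rd (V j))
    (p' : ld (V j) ⊗ summand V i j ⟶ V l) (q' : V l ⟶ ld (V j) ⊗ summand V i j) {Z : C}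
    (h : summand V k l ⟶ Z) :
    antipodeTerm p q p' q' ≫ h =
    antTerm (dualMap ((V j ⊗ ld (V k)) ⊗ ld (V j)) (ld (ld (V i))) p)
      (dualMap (ld (ld (V j)) ⊗ (ld (ld (V k)) ⊗ ld (V j))) (ld (ld (ld (V i))))
        (dualMap (ld (ld (V i))) ((V j ⊗ ld (V k)) ⊗ ld (V j)) q))
      (((dualMap ((ld (V k) ⊗ ld (V l)) ⊗ ld (ld (V k)))
          ((ld (V k) ⊗ ((((ld (V j) ⊗ ld (ld (ld (V i)))) ⊗ ld (ld (V j))) ⊗ ld (ld (V i))) ⊗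
            ld (ld (V j)))) ⊗ ld (ld (V k)))
        (ld (V k) ◁ (q' ▷ V k)) ⊗ₘ p') ⊗≫ 𝟙 (summand V k l)) ≫ h) := by
  unfold antipodeTerm antTerm antCoev
  rw [dualMap_whiskerLeft, dualMap_whiskerRight]
  simp only [MonoidalCategory.tensorHom_def]
  generalize dualMap ((V j ⊗ ld (V k)) ⊗ ld (V j)) (ld (ld (V i))) p = pp
  generalize dualMap (ld (ld (V j)) ⊗ (ld (ld (V k)) ⊗ ld (V j))) (ld (ld (ld (V i))))
        (dualMap (ld (ld (V i))) ((V j ⊗ ld (V k)) ⊗ ld (V j)) q) = dd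
  generalize dualMap (ld (V l))
      ((((ld (V j) ⊗ ld (ld (ld (V i)))) ⊗ ld (ld (V j))) ⊗ ld (ld (V i))) ⊗ ld (ld (V j))) q' = qq
  monoidal

end Antipode
end CenterCoend


set_option linter.unusedSectionVars false

namespace CenterCoend
open Limits

/-! ### The antipode: comparison with the coaction of the dual -/

section Abstract
variable {D : Type u} [Category.{v} D] [MonoidalCategory.{v} D]
  {B B₁ E E₁ A₁ A₂ L : D} [ExactPairing B B₁] [ExactPairing E E₁] [ExactPairing A₁ A₂]

/-- The evaluation of `L` moved past `(B ⊗ E₁) ⊗ B₁` by `t`. -/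
def antEnd (t : ((B ⊗ E₁) ⊗ B₁) ⊗ L ⟶ L ⊗ ((B ⊗ E₁) ⊗ B₁)) (y : L ⟶ B₁) :
    B ⊗ (E₁ ⊗ ((B₁ ⊗ (L ⊗ B)) ⊗ E)) ⟶ 𝟙_ D :=
  𝟙 _ ⊗≫ t ▷ (B ⊗ E) ⊗≫ (y ▷ B ≫ ε_ B B₁) ▷ ((E₁ ⊗ B₁) ⊗ (B ⊗ E)) ⊗≫ ε_ (B ⊗ E) (E₁ ⊗ B₁)

/-- Evaluating the strand `A₁` straightens the rotated half braiding `s` into a crossing of `A₂`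
with `L`, conjugated by `d` and `p`; the map `y` slides to the end. -/
lemma antEval_conj (p : A₂ ⟶ (B ⊗ E₁) ⊗ B₁) (d : (B ⊗ E₁) ⊗ B₁ ⟶ A₂)
    (s : L ⟶ (A₁ ⊗ L) ⊗ A₂) (y : L ⟶ B₁) :
    B ◁ (E₁ ◁ ((B₁ ◁ ((s ≫ (A₁ ◁ y) ▷ A₂) ▷ B ⊗≫ 𝟙 (A₁ ⊗ (B₁ ⊗ (A₂ ⊗ B))))) ▷ E)) ≫
      antEval p d =
    antEnd (d ▷ L ≫ (A₂ ◁ s ⊗≫ ε_ A₁ A₂ ▷ (L ⊗ A₂) ⊗≫ 𝟙 (L ⊗ A₂)) ≫ L ◁ p) y := by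
  unfold antEval antEnd antEvalLeft antEvalRight
  calc _ = 𝟙 _ ⊗≫ (((B ⊗ E₁) ⊗ B₁) ◁ (s ≫ (A₁ ◁ y) ▷ A₂) ≫ d ▷ ((A₁ ⊗ B₁) ⊗ A₂)) ▷ (B ⊗ E) ⊗≫
      ε_ A₁ A₂ ▷ (B₁ ⊗ (A₂ ⊗ (B ⊗ E))) ⊗≫ B₁ ◁ (p ▷ (B ⊗ E)) ⊗≫
      ε_ B B₁ ▷ ((E₁ ⊗ B₁) ⊗ (B ⊗ E)) ⊗≫ ε_ (B ⊗ E) (E₁ ⊗ B₁) := by monoidal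
    _ = 𝟙 _ ⊗≫ d ▷ L ▷ (B ⊗ E) ⊗≫ (A₂ ◁ s) ▷ (B ⊗ E) ⊗≫
      ((A₂ ⊗ A₁) ◁ (y ▷ A₂) ≫ ε_ A₁ A₂ ▷ (B₁ ⊗ A₂)) ▷ (B ⊗ E) ⊗≫ B₁ ◁ (p ▷ (B ⊗ E)) ⊗≫
      ε_ B B₁ ▷ ((E₁ ⊗ B₁) ⊗ (B ⊗ E)) ⊗≫ ε_ (B ⊗ E) (E₁ ⊗ B₁) := by
        rw [whisker_exchange d]; monoidal
    _ = 𝟙 _ ⊗≫ d ▷ L ▷ (B ⊗ E) ⊗≫ (A₂ ◁ s) ▷ (B ⊗ E) ⊗≫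
      (ε_ A₁ A₂ ▷ (L ⊗ A₂)) ▷ (B ⊗ E) ⊗≫ (y ▷ A₂ ≫ B₁ ◁ p) ▷ (B ⊗ E) ⊗≫
      ε_ B B₁ ▷ ((E₁ ⊗ B₁) ⊗ (B ⊗ E)) ⊗≫ ε_ (B ⊗ E) (E₁ ⊗ B₁) := by
        rw [whisker_exchange (ε_ A₁ A₂)]; monoidal
    _ = _ := by rw [← whisker_exchange y]; monoidal

end Abstract

section Braid
variable {C : Type u} [Category.{v} C] [MonoidalCategory.{v} C] [RigidCategory C]

lemma act_eq_inv (N : Center C) (Y Y' : C) [ExactPairing Y Y'] :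
    act N Y Y' = 𝟙 _ ⊗≫ (N.2.β Y').inv ▷ Y ⊗≫ N.1 ◁ ε_ Y Y' ⊗≫ 𝟙 N.1 := by
  have h := braid_ε N Y Y'
  unfold act
  calc _ = 𝟙 _ ⊗≫ ((N.2.β Y').inv ≫ (N.2.β Y').hom) ▷ Y ⊗≫ Y' ◁ (N.2.β Y).hom ⊗≫
        ε_ Y Y' ▷ N.1 ⊗≫ 𝟙 N.1 := by rw [Iso.inv_hom_id]; monoidal
    _ = 𝟙 _ ⊗≫ (N.2.β Y').inv ▷ Y ⊗≫ (𝟙 (N.1 ⊗ (Y' ⊗ Y)) ⊗≫ (N.2.β Y').hom ▷ Y ⊗≫ Y' ◁ (N.2.β Y).hom ⊗≫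
        ε_ Y Y' ▷ N.1) ⊗≫ 𝟙 N.1 := by monoidal
    _ = _ := by rw [h]; monoidal

/-- The hexagon splits the inverse crossing. The part past `E₁ ⊗ B₁`, closed by the evaluation, is
the action of `B` followed by that of `E`. -/
lemma antEnd_braid (N : Center C) (B B₁ E E₁ : C) [ExactPairing B B₁] [ExactPairing E E₁]
    (y : N.1 ⟶ B₁) : antEnd (E := E) (N.2.β ((B ⊗ E₁) ⊗ B₁)).inv y =
      B ◁ (E₁ ◁ (act N B B₁ ▷ E) ≫ act N E E₁) ≫ (N.2.β B).inv ≫ y ▷ B ≫ ε_ B B₁ := by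
  have h1 : (N.2.β ((B ⊗ E₁) ⊗ B₁)).inv = 𝟙 _ ⊗≫ B ◁ (N.2.β (E₁ ⊗ B₁)).inv ⊗≫
      (N.2.β B).inv ▷ (E₁ ⊗ B₁) ⊗≫ 𝟙 _ := by
    have h := inv_nat N (α_ B E₁ B₁).hom
    rw [inv_mon] at h
    calc _ = ((N.2.β ((B ⊗ E₁) ⊗ B₁)).inv ≫ N.1 ◁ (α_ B E₁ B₁).hom) ≫
          N.1 ◁ (α_ B E₁ B₁).inv := by
          rw [Category.assoc, ← MonoidalCategory.whiskerLeft_comp, Iso.hom_inv_id]; simp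
      _ = _ := by rw [← h]; monoidal
  have h2 : E₁ ◁ (act N B B₁ ▷ E) ≫ act N E E₁ =
      𝟙 _ ⊗≫ (N.2.β (E₁ ⊗ B₁)).inv ▷ (B ⊗ E) ⊗≫ N.1 ◁ ε_ (B ⊗ E) (E₁ ⊗ B₁) ⊗≫ 𝟙 N.1 := by
    calc _ = 𝟙 _ ⊗≫ act N (B ⊗ E) (E₁ ⊗ B₁) := by rw [act_tensor]; monoidal
      _ = _ := by rw [act_eq_inv]; monoidal
  unfold antEnd
  rw [h1, h2]
  generalize (N.2.β (E₁ ⊗ B₁)).inv = a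
  generalize (N.2.β B).inv = b
  symm
  calc _ = 𝟙 _ ⊗≫ (B ◁ a) ▷ (B ⊗ E) ⊗≫ ((B ⊗ N.1) ◁ ε_ (B ⊗ E) (E₁ ⊗ B₁) ≫
        (b ≫ y ▷ B ≫ ε_ B B₁) ▷ 𝟙_ C) ⊗≫ 𝟙 _ := by monoidal
    _ = _ := by rw [whisker_exchange]; monoidal

end Braid
section Antipode
variable {k : Type w'} [CommRing k] {C : Type u} [Category.{v} C] [Preadditive C]
    [Linear k C] [MonoidalCategory.{v} C] [MonoidalPreadditive C] [MonoidalLinear k C]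
    [RigidCategory C] [HasFiniteBiproducts C] {I : Type w} [Fintype I] {V : I → C}
    (F : FusionChoices V)

lemma sum_antipodeTerm {i j k : I}
    (p : V j ⊗ V k ⊗ rd (V j) ⟶ ld (V i)) (q : ld (V i) ⟶ V j ⊗ V k ⊗ rd (V j)) :
    ∑ l, ∑ β, antipodeTerm p q ((F.dec (ld (V j) ⊗ summand V i j)).p l β)
      ((F.dec (ld (V j) ⊗ summand V i j)).q l β) ≫ inc V k l =
    𝟙 _ ⊗≫ η_ (V j) (ld (V j)) ▷ summand V i j ⊗≫
      V j ◁ kapHat F k (ld (V j) ⊗ summand V i j)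
        ((((ld (V j) ⊗ ld (ld (ld (V i)))) ⊗ ld (ld (V j))) ⊗ ld (ld (V i))) ⊗ ld (ld (V j))) ⊗≫
      antEval (A₁ := ld (V i)) (E := V k) (dualMap ((V j ⊗ ld (V k)) ⊗ ld (V j)) (ld (ld (V i))) p)
        (dualMap (ld (ld (V i))) ((V j ⊗ ld (V k)) ⊗ ld (V j)) q) ▷ coendObj V ⊗≫
      𝟙 (coendObj V) := by
  refine Eq.trans ?_ (antTerm_eq (B := V j) (B₁ := ld (V j)) (B₂ := ld (ld (V j))) (E := V k)
    (E₁ := ld (V k)) (E₂ := ld (ld (V k))) (A₁ := ld (V i)) (A₂ := ld (ld (V i)))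
    (A₃ := ld (ld (ld (V i))))
    (dualMap ((V j ⊗ ld (V k)) ⊗ ld (V j)) (ld (ld (V i))) p)
    (dualMap (ld (ld (V i))) ((V j ⊗ ld (V k)) ⊗ ld (V j)) q) (kap F k _ _))
  simp only [antipodeTerm_comp, antTerm, kap, monoidalComp, Preadditive.comp_sum]

/-- The half braiding of the left dual, as a sum over the labels. -/
lemma sum_dual_braid (hV : IsFusion k V) (N : Center C) {Q Q' : C} [ExactPairing Q Q']
    (d : Decomp V Q) :
    ∑ i, ∑ α, (dualMap (ld (ld (V i))) Q' ((F.dualIso i).inv ≫ d.q (F.dual i) α) ▷ N.1 ≫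
      (N.2.β (ld (ld (V i)))).inv ≫
      N.1 ◁ dualMap Q' (ld (ld (V i))) (d.p (F.dual i) α ≫ (F.dualIso i).hom)) =
    (N.2.β Q').inv := by
  have h (i : I) (α) : dualMap (ld (ld (V i))) Q' ((F.dualIso i).inv ≫ d.q (F.dual i) α) ▷ N.1 ≫
      (N.2.β (ld (ld (V i)))).inv ≫
      N.1 ◁ dualMap Q' (ld (ld (V i))) (d.p (F.dual i) α ≫ (F.dualIso i).hom) =
      (N.2.β Q').inv ≫ N.1 ◁ dualMap Q' Q' ((d.p (F.dual i) α ≫ (F.dualIso i).hom) ≫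
        (F.dualIso i).inv ≫ d.q (F.dual i) α) := by
    rw [dualMap_comp Q' (ld (ld (V i))) Q', MonoidalCategory.whiskerLeft_comp,
      ← Category.assoc, inv_nat, Category.assoc]
  simp only [h, ← Preadditive.comp_sum, ← whiskerLeft_sum, ← dualMap_sum, sum_dual F hV]
  simp [dualMap_id]

/-- The part of the antipode at the labels `j` and `k`, applied to the conjugates of the action of
an object `N` of the center. -/
lemma sum_antEval (hV : IsFusion k V) (N : Center C) (j k : I) (y : N.1 ⟶ ld (V j)) :
    ∑ i, ∑ α, V j ◁ (ld (V k) ◁ ((ld (V j) ◁ (((𝟙 N.1 ⊗≫ N.1 ◁ η_ (ld (V i)) (ld (ld (V i))) ⊗≫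
        (N.2.β (ld (V i))).hom ▷ ld (ld (V i))) ≫ (ld (V i) ◁ y) ▷ ld (ld (V i))) ▷ V j ⊗≫
        𝟙 (summand V i j))) ▷ V k)) ≫
      antEval (A₁ := ld (V i)) (E := V k) (dualMap ((V j ⊗ ld (V k)) ⊗ ld (V j)) (ld (ld (V i)))
          ((F.dec (V j ⊗ V k ⊗ rd (V j))).p (F.dual i) α ≫ (F.dualIso i).hom))
        (dualMap (ld (ld (V i))) ((V j ⊗ ld (V k)) ⊗ ld (V j))
          ((F.dualIso i).inv ≫ (F.dec (V j ⊗ V k ⊗ rd (V j))).q (F.dual i) α)) =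
    V j ◁ (ld (V k) ◁ (act N (V j) (ld (V j)) ▷ V k) ≫ act N (V k) (ld (V k))) ≫
      (N.2.β (V j)).inv ≫ y ▷ V j ≫ ε_ (V j) (ld (V j)) := by
  -- Naturality of the inverse half braiding and the resolution of `V j ⊗ V k ⊗ rd (V j)` into duals
  -- of simple objects collapse the sums over `i` and `α`.
  rw [← antEnd_braid, ← sum_dual_braid F hV N (F.dec (V j ⊗ V k ⊗ rd (V j)))]
  have h (i : I) : ld (ld (V i)) ◁ (𝟙 N.1 ⊗≫ N.1 ◁ η_ (ld (V i)) (ld (ld (V i))) ⊗≫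
        (N.2.β (ld (V i))).hom ▷ ld (ld (V i))) ⊗≫
        ε_ (ld (V i)) (ld (ld (V i))) ▷ (N.1 ⊗ ld (ld (V i))) ⊗≫ 𝟙 (N.1 ⊗ ld (ld (V i))) =
      (N.2.β (ld (ld (V i)))).inv := by
    rw [braid_ld_inv N (ld (V i)) (ld (ld (V i)))]; monoidal
  simp only [antEval_conj, h]
  simp only [antEnd, monoidalComp, Preadditive.comp_sum, Preadditive.sum_comp, sum_whiskerRight]

lemma whiskerLeft_coendMap (hV : IsFusion k V) (M : Center C) {j : I} (x : V j ⟶ M.1) :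
    ld M.1 ◁ x ≫ coendMap F M = ∑ i,
      (((𝟙 (ld M.1) ⊗≫ ld M.1 ◁ η_ (ld (V i)) (ld (ld (V i))) ⊗≫
        dualBraidHom M (ld (V i)) ▷ ld (ld (V i))) ≫
        (ld (V i) ◁ dualMap (ld (V j)) (ld M.1) x) ▷ ld (ld (V i))) ▷ V j ⊗≫
        𝟙 (summand V i j)) ≫ inc V i j := by
  rw [coendMap_eq, Preadditive.comp_sum]
  refine Finset.sum_congr rfl fun i _ => ?_
  rw [dualMap_act, whisker_exchange_assoc, ← kap_dinat F hV i (ld (V j)) (ld M.1) x,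
    kap_self F hV, dualMap_whiskerLeft, dualMap_whiskerRight]
  monoidal

lemma comp_antipodeTerm {i j m : I} {X : C} (X' : C) [ExactPairing X X'] (hV : IsFusion k V)
    (f : X ⟶ summand V i j)
    (p : V j ⊗ V m ⊗ rd (V j) ⟶ ld (V i)) (q : ld (V i) ⟶ V j ⊗ V m ⊗ rd (V j)) :
    f ≫ ∑ l, ∑ β, antipodeTerm p q ((F.dec (ld (V j) ⊗ summand V i j)).p l β)
      ((F.dec (ld (V j) ⊗ summand V i j)).q l β) ≫ inc V m l =
    𝟙 _ ⊗≫ η_ (V j) (ld (V j)) ▷ X ⊗≫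
      V j ◁ kapHat F m (ld (V j) ⊗ X) (X' ⊗ ld (ld (V j))) ⊗≫
      (V j ◁ (ld (V m) ◁ ((ld (V j) ◁ f) ▷ V m)) ≫ antEval (A₁ := ld (V i)) (E := V m)
        (dualMap ((V j ⊗ ld (V m)) ⊗ ld (V j)) (ld (ld (V i))) p)
        (dualMap (ld (ld (V i))) ((V j ⊗ ld (V m)) ⊗ ld (V j)) q)) ▷ coendObj V ⊗≫
      𝟙 (coendObj V) := by
  rw [sum_antipodeTerm]
  have h := kapHat_nat F hV m (X' ⊗ ld (ld (V j)))
    ((((ld (V j) ⊗ ld (ld (ld (V i)))) ⊗ ld (ld (V j))) ⊗ ld (ld (V i))) ⊗ ld (ld (V j)))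
    (ld (V j) ◁ f)
  generalize kapHat F m (ld (V j) ⊗ summand V i j)
    ((((ld (V j) ⊗ ld (ld (ld (V i)))) ⊗ ld (ld (V j))) ⊗ ld (ld (V i))) ⊗ ld (ld (V j))) = κ at *
  generalize antEval (A₁ := ld (V i)) (E := V m)
        (dualMap ((V j ⊗ ld (V m)) ⊗ ld (V j)) (ld (ld (V i))) p)
        (dualMap (ld (ld (V i))) ((V j ⊗ ld (V m)) ⊗ ld (V j)) q) = e
  calc _ = 𝟙 _ ⊗≫ (𝟙_ C ◁ f ≫ η_ (V j) (ld (V j)) ▷ summand V i j) ⊗≫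
      V j ◁ κ ⊗≫ e ▷ coendObj V ⊗≫ 𝟙 (coendObj V) := by monoidal
    _ = 𝟙 _ ⊗≫ η_ (V j) (ld (V j)) ▷ X ⊗≫ V j ◁ (ld (V j) ◁ f ≫ κ) ⊗≫
      e ▷ coendObj V ⊗≫ 𝟙 (coendObj V) := by rw [whisker_exchange]; monoidal
    _ = _ := by rw [h]; monoidal

lemma comp_antipodeFormula {i j : I} {X : C} (f : X ⟶ summand V i j) :
    (f ≫ inc V i j) ≫ antipodeFormula F = ∑ k, ∑ α, f ≫ ∑ l, ∑ β, antipodeTerm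
      ((F.dec (V j ⊗ V k ⊗ rd (V j))).p (F.dual i) α ≫ (F.dualIso i).hom)
      ((F.dualIso i).inv ≫ (F.dec (V j ⊗ V k ⊗ rd (V j))).q (F.dual i) α)
      ((F.dec (ld (V j) ⊗ summand V i j)).p l β)
      ((F.dec (ld (V j) ⊗ summand V i j)).q l β) ≫ inc V k l := by
  have h : inc V i j ≫ antipodeFormula F = ∑ k, ∑ l, antipodeAux F i j k l ≫ inc V k l := by
    rw [← inc_sum_prj i j fun i j => ∑ k, ∑ l, antipodeAux F i j k l ≫ inc V k l]
    simp only [antipodeFormula, Preadditive.comp_sum]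
  rw [Category.assoc, h]
  simp only [antipodeAux, Preadditive.sum_comp, Preadditive.comp_sum]
  refine Finset.sum_congr rfl fun k _ => ?_
  rw [Finset.sum_comm]

/-- The coaction conjugated by the half braiding, as a sum over the labels. -/
lemma act_coendCoact (hV : IsFusion k V) (N : Center C) (j : I) :
    (N.2.β (V j)).hom ≫ V j ◁ coendCoact F N = ∑ k, (𝟙 _ ⊗≫ η_ (V j) (ld (V j)) ▷ (N.1 ⊗ V j) ⊗≫
      V j ◁ kapHat F k (ld (V j) ⊗ (N.1 ⊗ V j)) ((ld (V j) ⊗ ld N.1) ⊗ ld (ld (V j))) ⊗≫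
      (V j ◁ (ld (V k) ◁ (act N (V j) (ld (V j)) ▷ V k) ≫ act N (V k) (ld (V k)))) ▷ coendObj V ⊗≫
      𝟙 (V j ⊗ (N.1 ⊗ coendObj V))) := by
  rw [braid_eq_act N (V j) (ld (V j)), coendCoact_eq, whiskerLeft_sum, Preadditive.comp_sum]
  refine Finset.sum_congr rfl fun k _ => ?_
  have h := kapHat_nat F hV k ((ld (V j) ⊗ ld N.1) ⊗ ld (ld (V j))) (ld N.1)
    (act N (V j) (ld (V j)))
  calc _ = 𝟙 _ ⊗≫ η_ (V j) (ld (V j)) ▷ (N.1 ⊗ V j) ⊗≫ V j ◁ (act N (V j) (ld (V j)) ≫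
      kapHat F k N.1 (ld N.1)) ⊗≫ V j ◁ (act N (V k) (ld (V k)) ▷ coendObj V) := by monoidal
    _ = _ := by rw [h]; monoidal

lemma sum_monoidalComp {W X Y Z : C} [MonoidalCoherence X Y] {J : Type*} (s : Finset J)
    (f : J → (W ⟶ X)) (g : Y ⟶ Z) : (∑ j ∈ s, f j) ⊗≫ g = ∑ j ∈ s, f j ⊗≫ g := by
  simp only [monoidalComp, Preadditive.sum_comp]

/-- The sums over `l` and `β` give `kapHat`, those over `i` and `α` an inverse crossing and two
actions. By `act_coendCoact` these assemble into a coaction of `N` conjugated by its half braiding;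
`N` will be the dual of `M`. -/
lemma sum_antipode (hV : IsFusion k V) (N : Center C) (j : I) (y : N.1 ⟶ ld (V j)) :
    (∑ i, (((𝟙 N.1 ⊗≫ N.1 ◁ η_ (ld (V i)) (ld (ld (V i))) ⊗≫
        (N.2.β (ld (V i))).hom ▷ ld (ld (V i))) ≫ (ld (V i) ◁ y) ▷ ld (ld (V i))) ▷ V j ⊗≫
        𝟙 (summand V i j)) ≫ inc V i j) ≫ antipodeFormula F =
    ((N.2.β (V j)).hom ≫ V j ◁ coendCoact F N) ⊗≫
      ((N.2.β (V j)).inv ≫ y ▷ V j ≫ ε_ (V j) (ld (V j))) ▷ coendObj V ⊗≫ 𝟙 (coendObj V) := by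
  rw [act_coendCoact F hV, Preadditive.sum_comp]
  simp only [comp_antipodeFormula, comp_antipodeTerm F (X := N.1 ⊗ V j) (ld (V j) ⊗ ld N.1) hV]
  rw [Finset.sum_comm, sum_monoidalComp]
  refine Finset.sum_congr rfl fun m _ => ?_
  calc _ = 𝟙 (N.1 ⊗ V j) ⊗≫ η_ (V j) (ld (V j)) ▷ (N.1 ⊗ V j) ⊗≫
      V j ◁ kapHat F m (ld (V j) ⊗ (N.1 ⊗ V j)) ((ld (V j) ⊗ ld N.1) ⊗ ld (ld (V j))) ⊗≫
      (V j ◁ (ld (V m) ◁ (act N (V j) (ld (V j)) ▷ V m) ≫ act N (V m) (ld (V m))) ≫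
      (N.2.β (V j)).inv ≫ y ▷ V j ≫ ε_ (V j) (ld (V j))) ▷ coendObj V ⊗≫ 𝟙 (coendObj V) := by
        rw [← sum_antEval F hV N j m y]
        simp only [monoidalComp, Preadditive.comp_sum, Preadditive.sum_comp, sum_whiskerRight]
        refine Finset.sum_congr rfl fun i _ => Finset.sum_congr rfl fun α _ => ?_
        monoidal
    _ = _ := by monoidal

/-- The formula for the antipode. -/
lemma antipode_formula (hV : IsFusion k V) (M : Center C) :
    coendMap F M ≫ antipodeFormula F =
      (dualBraidHom M M.1 ≫ M.1 ◁ coendCoact F (centerLd M)) ⊗≫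
        (((centerLd M).2.β M.1).inv ≫ ε_ M.1 (ld M.1)) ▷ coendObj V ⊗≫ 𝟙 (coendObj V) := by
  apply (F.dec M.1).whiskerLeft_hom_ext
  intro j α
  generalize (F.dec M.1).q j α = x
  rw [← Category.assoc, whiskerLeft_coendMap F hV]
  refine (sum_antipode F hV (centerLd M) j (dualMap (ld (V j)) (ld M.1) x)).trans ?_
  have h1 : ld M.1 ◁ x ≫ dualBraidHom M M.1 = dualBraidHom M (V j) ≫ x ▷ ld M.1 :=
    (dualLax M).nat x
  have h3 := dualMap_eval (ld (V j)) (ld M.1) x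
  obtain ⟨a, ha⟩ : ∃ a : V j ⊗ ld M.1 ⟶ ld M.1 ⊗ V j, a = ((centerLd M).2.β (V j)).inv := ⟨_, rfl⟩
  obtain ⟨b, hb⟩ : ∃ b : M.1 ⊗ ld M.1 ⟶ ld M.1 ⊗ M.1, b = ((centerLd M).2.β M.1).inv := ⟨_, rfl⟩
  obtain ⟨c, hc⟩ : ∃ c : ld M.1 ⟶ ld M.1 ⊗ coendObj V, c = coendCoact F (centerLd M) := ⟨_, rfl⟩
  have h2 : x ▷ ld M.1 ≫ b = a ≫ ld M.1 ◁ x := by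
    rw [ha, hb]
    exact inv_nat (centerLd M) x
  rw [← hb, ← hc]
  refine Eq.trans (b := (dualBraidHom M (V j) ≫ V j ◁ c) ⊗≫
    (a ≫ dualMap (ld (V j)) (ld M.1) x ▷ V j ≫ ε_ (V j) (ld (V j))) ▷ coendObj V ⊗≫
    𝟙 (coendObj V)) ?_ ?_
  · rw [ha, hc]; rfl
  rw [h3]
  generalize dualBraidHom M (V j) = t at *
  calc _ = t ≫ V j ◁ c ⊗≫ (a ≫ ld M.1 ◁ x) ▷ coendObj V ⊗≫
        ε_ M.1 (ld M.1) ▷ coendObj V ⊗≫ 𝟙 (coendObj V) := by monoidal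
    _ = t ≫ (V j ◁ c ≫ x ▷ (ld M.1 ⊗ coendObj V)) ⊗≫ b ▷ coendObj V ⊗≫
        ε_ M.1 (ld M.1) ▷ coendObj V ⊗≫ 𝟙 (coendObj V) := by rw [← h2]; monoidal
    _ = (t ≫ x ▷ ld M.1) ≫ M.1 ◁ c ⊗≫ b ▷ coendObj V ⊗≫
        ε_ M.1 (ld M.1) ▷ coendObj V ⊗≫ 𝟙 (coendObj V) := by rw [whisker_exchange]; monoidal
    _ = _ := by rw [← h1]; monoidal

end Antipode
end CenterCoend


set_option linter.unusedSectionVars false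

namespace CenterCoend
open Limits

/-! ### Independence of the sovereign structure and the dimension formula -/

section Invariance
variable {D : Type u} [Category.{v} D] [MonoidalCategory.{v} D] [RightRigidCategory D]

/-- The components of two sovereign structures at an object with a universal coaction agree. -/
lemma SovereignStructure.iso_eq_of_isUniversalCoaction (φ ψ : SovereignStructure D) {K : D}
    {δ : ∀ X : D, X ⟶ X ⊗ K} (h : IsUniversalCoaction (𝟭 D) (K := K) (fun X => δ X)) :
    (ψ.iso K).hom = (φ.iso K).hom := by
  have n {X Y : D} (f : X ⟶ Y) : f ≫ δ Y = δ X ≫ f ▷ K := h.nat f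
  -- The quotient of two sovereign structures is a natural automorphism of the identity functor; the
  -- next step records that it is monoidal.
  have gn {X Y : D} (f : X ⟶ Y) : f ≫ (ψ.iso Y).hom ≫ (φ.iso Y).inv =
      ((ψ.iso X).hom ≫ (φ.iso X).inv) ≫ f := by
    rw [← Category.assoc, Iso.comp_inv_eq, Category.assoc, Category.assoc, φ.naturality,
      Iso.inv_hom_id_assoc, ψ.naturality]
  have gm (X Y : D) : (ψ.iso (X ⊗ Y)).hom ≫ (φ.iso (X ⊗ Y)).inv =
      ((ψ.iso X).hom ≫ (φ.iso X).inv) ⊗ₘ ((ψ.iso Y).hom ≫ (φ.iso Y).inv) := by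
    have h1 : lldTensor X Y = (φ.iso (X ⊗ Y)).inv ≫ ((φ.iso X).hom ⊗ₘ (φ.iso Y).hom) := by
      rw [← φ.tensor, Iso.inv_hom_id_assoc]
    have h2 := ψ.tensor X Y
    rw [h1, ← Category.assoc] at h2
    rw [← cancel_mono ((φ.iso X).hom ⊗ₘ (φ.iso Y).hom), h2, MonoidalCategory.tensorHom_comp_tensorHom]
    simp
  have key : (ψ.iso K).hom ≫ (φ.iso K).inv = 𝟙 K := by
    apply h.ext
    intro X
    change δ X ≫ X ◁ _ = δ X ≫ X ◁ _
    -- Naturality at the coaction gives the factors at `X` and at `K` on one side and, since the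
    -- coaction is natural, only the factor at `X` on the other. Cancelling it shows that the factor
    -- at `K` is trivial.
    have h1 := gn (δ X)
    rw [gm, MonoidalCategory.tensorHom_def, n ((ψ.iso X).hom ≫ (φ.iso X).inv),
      ← whisker_exchange] at h1
    rw [← cancel_mono (((ψ.iso X).hom ≫ (φ.iso X).inv) ▷ K), Category.assoc, h1]
    simp
  rw [← Category.comp_id (φ.iso K).hom, ← cancel_mono (φ.iso K).inv, key]
  simp

lemma SovereignStructure.rightTrace_id_congr (φ : SovereignStructure D) {X Y : D} (e : X ≅ Y) :
    φ.rightTrace (𝟙 X) = φ.rightTrace (𝟙 Y) := by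
  rw [← e.hom_inv_id, φ.rightTrace_comm, e.inv_hom_id]

lemma SovereignStructure.leftTrace_id_congr (φ : SovereignStructure D) {X Y : D} (e : X ≅ Y) :
    φ.leftTrace (𝟙 X) = φ.leftTrace (𝟙 Y) := by
  rw [← e.hom_inv_id, φ.leftTrace_comm, e.inv_hom_id]

/-- The dimension of a sovereign category can be computed from any sovereign structure. -/
lemma SovereignStructure.hasDimension_of_isUniversalCoaction (φ ψ : SovereignStructure D) {K : D}
    (ι : ∀ X : D, ld X ⊗ X ⟶ K)
    (h : IsUniversalCoaction (𝟭 D) (K := K) (fun X => coaction ι X)) {d : 𝟙_ D ⟶ 𝟙_ D}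
    (hl : φ.leftTrace (𝟙 K) = d) (hr : φ.rightTrace (𝟙 K) = d) : ψ.HasDimension d := by
  have hι := isCoend_of_isUniversalCoaction ι h
  refine ⟨⟨K, ι, hι⟩, fun L κ hκ => ?_⟩
  obtain ⟨e⟩ := hκ.nonempty_iso hι
  have he := φ.iso_eq_of_isUniversalCoaction ψ h
  have he' : (ψ.iso K).inv = (φ.iso K).inv := by
    rw [← cancel_epi (ψ.iso K).hom, Iso.hom_inv_id, he, Iso.hom_inv_id]
  rw [ψ.leftTrace_id_congr e, ψ.rightTrace_id_congr e, ← hl]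
  refine ⟨?_, ?_⟩
  · rw [SovereignStructure.leftTrace, SovereignStructure.leftTrace, he']
  · rw [hl, ← hr, SovereignStructure.rightTrace, SovereignStructure.rightTrace, he]

lemma SovereignStructure.rightTrace_tensor (φ : SovereignStructure D) (X Y : D) :
    φ.rightTrace (𝟙 (X ⊗ Y)) =
      η_ X (ld X) ⊗≫ X ◁ φ.rightTrace (𝟙 Y) ▷ ld X ⊗≫ φ.evt X := by
  have h1 : η_ (X ⊗ Y) (ld (X ⊗ Y)) = η_ (X ⊗ Y) (ld Y ⊗ ld X) ≫ (X ⊗ Y) ◁ ldTensor X Y := by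
    have := coeval_dualMap (ld (X ⊗ Y)) (ld Y ⊗ ld X) (𝟙 (X ⊗ Y))
    rw [id_whiskerRight, Category.comp_id] at this
    exact this.symm
  rw [φ.rightTrace_eq, φ.rightTrace_eq, id_whiskerRight, id_whiskerRight, Category.id_comp,
    Category.id_comp, h1, Category.assoc, φ.evt_tensor, coeval_tensor]
  monoidal

end Invariance

section Dimension
variable {k : Type w'} [CommRing k] {C : Type u} [Category.{v} C] [Preadditive C]
    [Linear k C] [MonoidalCategory.{v} C] [MonoidalPreadditive C] [MonoidalLinear k C]
    [RigidCategory C] [HasFiniteBiproducts C] {I : Type w} [Fintype I] {V : I → C}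
    (F : FusionChoices V) (φ : SovereignStructure C)

/-- The universal dinatural transformation of a fusion category. -/
noncomputable def fusionCoendMap (X : C) : ld X ⊗ X ⟶ freeObj V (𝟙_ C) :=
  ld X ◁ (λ_ X).inv ≫ freeIn F (𝟙_ C) X (ld X)

/-- The coend of `C` is the coend underlying the free object on the unit, a finite sum over `V`.
Restriction to the members of `V` determines a coaction and may be prescribed freely. -/
lemma isUniversalCoaction_fusionCoendMap (hV : IsFusion k V) :
    IsUniversalCoaction (𝟭 C) (K := freeObj V (𝟙_ C))
      (fun X => coaction (fusionCoendMap F) X) := by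
  have nat {X Y : C} (f : X ⟶ Y) : f ≫ coaction (fusionCoendMap F) Y =
      coaction (fusionCoendMap F) X ≫ f ▷ freeObj V (𝟙_ C) := by
    rw [coaction_eq_hat, coaction_eq_hat, comp_hat, hat_whiskerRight _ _ Y (ld Y),
      fusionCoendMap, fusionCoendMap, ← whisker_exchange_assoc, freeIn_dinat F hV,
      ← MonoidalCategory.whiskerLeft_comp_assoc, ← MonoidalCategory.whiskerLeft_comp_assoc,
      leftUnitor_inv_naturality]
  have self (i : I) {Z : C} (g : freeObj V (𝟙_ C) ⟶ Z) :
      coaction (fusionCoendMap F) (V i) ≫ V i ◁ g = hat (V i) (ld (V i))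
        (ld (V i) ◁ (λ_ (V i)).inv ≫ biproduct.ι (fun i => ld (V i) ⊗ (𝟙_ C ⊗ V i)) i ≫ g) := by
    rw [coaction_eq_hat, hat_comp, fusionCoendMap, freeIn_self F hV, Category.assoc]
  refine ⟨fun f => nat f, fun Z t ht => ?_, fun Z f g h => ?_⟩
  · choose s hs using fun i => exists_hat_eq (V i) (ld (V i)) (t (V i))
    refine ⟨biproduct.desc fun i => ld (V i) ◁ (λ_ (V i)).hom ≫ s i, fun X => ?_⟩
    change coaction (fusionCoendMap F) X ≫ X ◁ _ = t X
    apply (F.dec X).hom_ext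
    intro i α
    rw [reassoc_of% nat, ← whisker_exchange, reassoc_of% self, biproduct.ι_desc,
      ← MonoidalCategory.whiskerLeft_comp_assoc, Iso.inv_hom_id,
      MonoidalCategory.whiskerLeft_id, Category.id_comp, hs]
    exact (ht _).symm
  · apply biproduct.hom_ext'
    intro i
    have h1 : coaction (fusionCoendMap F) (V i) ≫ V i ◁ f =
      coaction (fusionCoendMap F) (V i) ≫ V i ◁ g := h (V i)
    rw [self, self] at h1
    have h2 := hat_injective _ _ h1
    rwa [cancel_epi] at h2

lemma IsFusion.exists_smul_unit (hV : IsFusion k V) (f : 𝟙_ C ⟶ 𝟙_ C) :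
    ∃ a : k, f = a • 𝟙 (𝟙_ C) := by
  obtain ⟨i, ⟨u⟩⟩ := hV.unit
  obtain ⟨a, ha⟩ := hV.exists_smul (u.hom ≫ f ≫ u.inv)
  refine ⟨a, ?_⟩
  calc f = u.inv ≫ (u.hom ≫ f ≫ u.inv) ≫ u.hom := by simp
    _ = _ := by rw [ha]; simp

lemma SovereignStructure.rightTrace_tensor_smul {X Y : C} {a b : k}
    (hX : φ.rightTrace (𝟙 X) = a • 𝟙 (𝟙_ C)) (hY : φ.rightTrace (𝟙 Y) = b • 𝟙 (𝟙_ C)) :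
    φ.rightTrace (𝟙 (X ⊗ Y)) = (a * b) • 𝟙 (𝟙_ C) := by
  rw [φ.rightTrace_tensor, hY, mul_comm, mul_smul, ← hX, φ.rightTrace_eq]
  have e : η_ X (ld X) ⊗≫ X ◁ (𝟙 (𝟙_ C)) ▷ ld X ⊗≫ φ.evt X = η_ X (ld X) ≫ φ.evt X := by monoidal
  rw [id_whiskerRight, Category.id_comp, ← e]
  simp only [monoidalComp, MonoidalLinear.smul_whiskerRight, MonoidalLinear.whiskerLeft_smul,
    Linear.smul_comp, Linear.comp_smul]

lemma SovereignStructure.rightTrace_biproduct {J : Type*} [Fintype J] (f : J → C) :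
    φ.rightTrace (𝟙 (⨁ f)) = ∑ j, φ.rightTrace (𝟙 (f j)) := by
  rw [← sum_π_ι, φ.rightTrace_sum]
  refine Finset.sum_congr rfl fun j _ => ?_
  rw [φ.rightTrace_comm, biproduct.ι_π_self]

lemma SovereignStructure.rightTrace_ld (hφ : φ.IsSpherical) (X : C) :
    φ.rightTrace (𝟙 (ld X)) = φ.rightTrace (𝟙 X) := by
  rw [← hφ X, ← φ.rightTrace_dualMap, dualMap_id]

/-- The dimension of the coend of the center. -/
lemma SovereignStructure.rightTrace_coendObj (hφ : φ.IsSpherical) (hV : IsFusion k V) :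
    φ.rightTrace (𝟙 (coendObj V)) =
      φ.rightTrace (𝟙 (freeObj V (𝟙_ C))) ≫ φ.rightTrace (𝟙 (freeObj V (𝟙_ C))) := by
  -- Dimensions are multiples of the identity of the unit object; sphericality makes a dual have the
  -- same scalar. The summand `(i,j)` then has dimension `a i * a j * a i * a j`.
  choose a ha using fun i => hV.exists_smul_unit (φ.rightTrace (𝟙 (V i)))
  have ha' (i : I) : φ.rightTrace (𝟙 (ld (V i))) = a i • 𝟙 (𝟙_ C) := by
    rw [φ.rightTrace_ld hφ, ha]
  have ha'' (i : I) : φ.rightTrace (𝟙 (ld (ld (V i)))) = a i • 𝟙 (𝟙_ C) := by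
    rw [φ.rightTrace_ld hφ, ha']
  have h1 : φ.rightTrace (𝟙 (freeObj V (𝟙_ C))) = (∑ i, a i * a i) • 𝟙 (𝟙_ C) := by
    rw [φ.rightTrace_biproduct, Finset.sum_smul]
    refine Finset.sum_congr rfl fun i _ => ?_
    rw [φ.rightTrace_id_congr (whiskerLeftIso (ld (V i)) (λ_ (V i))),
      φ.rightTrace_tensor_smul (ha' i) (ha i)]
  have h2 : φ.rightTrace (𝟙 (coendObj V)) =
      (∑ x : I × I, a x.1 * (a x.2 * (a x.1 * a x.2))) • 𝟙 (𝟙_ C) := by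
    rw [φ.rightTrace_biproduct, Finset.sum_smul]
    refine Finset.sum_congr rfl fun x _ => ?_
    exact φ.rightTrace_tensor_smul (ha' x.1) (φ.rightTrace_tensor_smul (ha' x.2)
      (φ.rightTrace_tensor_smul (ha'' x.1) (ha x.2)))
  rw [h1, h2, Linear.smul_comp, Linear.comp_smul, Category.id_comp, smul_smul,
    Finset.sum_mul_sum, Fintype.sum_prod_type]
  refine congrArg (· • _) (Finset.sum_congr rfl fun i _ => Finset.sum_congr rfl fun j _ => ?_)
  change a i * (a j * (a i * a j)) = _
  ring

/-- Traces in the center have the traces of `C` as underlying morphisms, so sphericality gives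
equality of left and right dimensions for the structure induced by `φ`; invariance extends this to
every sovereign structure on the center. -/
lemma SovereignStructure.exists_hasDimension (hφ : φ.IsSpherical) (hV : IsFusion k V) {σ : HalfBraiding (coendObj V)}
    (ι : ∀ M : Center C, ld M ⊗ M ⟶ coendCenter V σ)
    (h : IsUniversalCoaction (𝟭 (Center C)) (K := coendCenter V σ) (fun M => coaction ι M)) :
    ∃ (δ : 𝟙_ C ⟶ 𝟙_ C) (δZ : 𝟙_ (Center C) ⟶ 𝟙_ (Center C)), φ.HasDimension δ ∧
      (∀ ψ : SovereignStructure (Center C), ψ.HasDimension δZ) ∧ δZ.f = δ ≫ δ := by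
  obtain ⟨F⟩ := hV.nonempty_choices
  have hr (M : Center C) : (φ.center.rightTrace (𝟙 M)).f = φ.rightTrace (𝟙 M.1) := by
    rw [φ.center.rightTrace_eq, φ.rightTrace_eq, Center.comp_f, Center.comp_f,
      Center.whiskerRight_f, φ.center_evt]
    rfl
  have hl (M : Center C) : (φ.center.leftTrace (𝟙 M)).f = φ.leftTrace (𝟙 M.1) := by
    rw [φ.center.leftTrace_eq, φ.leftTrace_eq, Center.comp_f, Center.comp_f,
      Center.whiskerLeft_f, φ.center_coevt]
    rfl
  refine ⟨φ.rightTrace (𝟙 (freeObj V (𝟙_ C))), φ.center.rightTrace (𝟙 (coendCenter V σ)),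
    φ.hasDimension_of_isUniversalCoaction φ _ (isUniversalCoaction_fusionCoendMap F hV)
      (hφ _ _) rfl,
    fun ψ => φ.center.hasDimension_of_isUniversalCoaction ψ ι h ?_ rfl, ?_⟩
  · apply Center.ext
    rw [hl, hr]
    exact hφ _ _
  · rw [hr]
    exact φ.rightTrace_coendObj hφ hV

end Dimension
end CenterCoend


set_option linter.unusedSectionVars false

namespace CenterCoend
open Limits

/-! ### Identification of the abstract structure with the formulas -/

section
variable {D : Type u} [Category.{v} D] [MonoidalCategory.{v} D] [BraidedCategory D]
  [RightRigidCategory D] {K : D}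

lemma CoendData.ι_antipode (H : CoendData K) {ι : ∀ X : D, ld X ⊗ X ⟶ K}
    (hι : H.δ = coaction ι) (X : D) : ι X ≫ H.S =
      H.δ (ld X) ▷ X ≫ (α_ (ld X) K X).hom ≫ ld X ◁ (β_ K X).hom ≫ (α_ (ld X) X K).inv ≫
        ε_ X (ld X) ▷ K ≫ (λ_ K).hom := by
  apply hat_injective X (ld X)
  rw [← hat_comp, ← coaction_eq_hat, ← hι, H.S_spec]
  unfold hat
  monoidal

lemma IsCoendPairing.eq {ι : ∀ X : D, ld X ⊗ X ⟶ K} {ω : K ⊗ K ⟶ 𝟙_ D}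
    (hω : IsCoendPairing ι ω) (X Y : D) : (ι X ⊗ₘ ι Y) ≫ ω =
      (α_ (ld X) X (ld Y ⊗ Y)).hom ≫ ld X ◁ ((α_ X (ld Y) Y).inv ≫
        ((β_ X (ld Y)).hom ≫ (β_ (ld Y) X).hom) ▷ Y ≫ (α_ X (ld Y) Y).hom) ≫
        (α_ (ld X) X (ld Y ⊗ Y)).inv ≫ (ε_ X (ld X) ⊗ₘ ε_ Y (ld Y)) ≫ (λ_ (𝟙_ D)).hom := by
  rw [hω]
  simp only [MonoidalCategory.tensorHom_def]
  monoidal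

end

lemma eq_comp_rightUnitor_inv {C : Type u} [Category.{v} C] [MonoidalCategory.{v} C] {X K : C}
    {c : X ⟶ X ⊗ K} {θ : K ⟶ 𝟙_ C} {t : X ⟶ X} (h : c ≫ X ◁ θ ≫ (ρ_ X).hom = t) :
    c ≫ X ◁ θ = t ≫ (ρ_ X).inv := by
  rw [← h]; simp

section Formulas
variable {k : Type w'} [CommRing k] {C : Type u} [Category.{v} C] [Preadditive C]
    [Linear k C] [MonoidalCategory.{v} C] [MonoidalPreadditive C] [MonoidalLinear k C]
    [RigidCategory C] [HasFiniteBiproducts C] {I : Type w} [Fintype I] {V : I → C}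
    (F : FusionChoices V)

lemma coendCoact_ext (hV : IsFusion k V) {Z : C} {f g : coendObj V ⟶ Z}
    (h : ∀ M : Center C, coendCoact F M ≫ M.1 ◁ f = coendCoact F M ≫ M.1 ◁ g) : f = g :=
  (isUniversalCoaction_forget F hV).ext Z f g h

variable {σ : HalfBraiding (coendObj V)} {ι : ∀ M : Center C, ld M ⊗ M ⟶ coendCenter V σ}
  (H : CoendData (coendCenter V σ))

/-- The explicit formula satisfies, in `C`, the equation that characterizes the abstract coproduct;
the universal coaction on the forgetful functor has unique factorizations. -/
lemma coendData_comul (hV : IsFusion k V) (hδ : ∀ M, (H.δ M).f = coendCoact F M) :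
    H.Δ.f = comulFormula F := by
  apply coendCoact_ext F hV
  intro M
  refine Eq.trans ?_ (comul_formula F hV M).symm
  have h := congrArg Center.Hom.f (H.Δ_spec M)
  rw [Center.comp_f, Center.comp_f, Center.comp_f, Center.whiskerLeft_f, Center.whiskerRight_f,
    Center.associator_hom_f, hδ] at h
  exact h

lemma coendData_counit (hV : IsFusion k V) (hδ : ∀ M, (H.δ M).f = coendCoact F M) :
    H.e.f = counitFormula F := by
  apply coendCoact_ext F hV
  intro M
  refine Eq.trans ?_ (counit_formula F hV M).symm
  have h := congrArg Center.Hom.f (H.e_spec M)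
  rw [Center.comp_f, Center.whiskerLeft_f, Center.rightUnitor_inv_f, hδ] at h
  exact h

/-- The braiding in the abstract antipode is the half braiding of the coend. Its defining equation
trades it for the conjugated coaction of the dual, the form reached by `antipode_formula`. -/
lemma coendData_antipode (hV : IsFusion k V) (hι : H.δ = coaction ι)
    (hιf : ∀ M, (ι M).f = coendMap F M) (hδ : ∀ M, (H.δ M).f = coendCoact F M)
    (hσ : ∀ (M : Center C) (Y : C), coendCoact F M ▷ Y ⊗≫ M.1 ◁ (σ.β Y).hom =
      (M.2.β Y).hom ≫ Y ◁ coendCoact F M ⊗≫ (M.2.β Y).inv ▷ coendObj V ⊗≫ 𝟙 _) :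
    H.S.f = antipodeFormula F := by
  apply hom_ext_coendMap F hV
  intro M
  refine Eq.trans ?_ (antipode_formula F hV M).symm
  have h := congrArg Center.Hom.f (H.ι_antipode hι M)
  rw [Center.comp_f, Center.comp_f, Center.comp_f, Center.comp_f, Center.comp_f, Center.comp_f,
    Center.whiskerLeft_f, Center.whiskerRight_f, Center.whiskerRight_f,
    Center.associator_hom_f, Center.associator_inv_f, Center.leftUnitor_hom_f, hδ, hιf] at h
  refine Eq.trans h ?_
  have hs := hσ (centerLd M) M.1
  obtain ⟨c, hc⟩ : ∃ c : ld M.1 ⟶ ld M.1 ⊗ coendObj V, c = coendCoact F (centerLd M) := ⟨_, rfl⟩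
  obtain ⟨b, hb⟩ : ∃ b : M.1 ⊗ ld M.1 ⟶ ld M.1 ⊗ M.1, b = ((centerLd M).2.β M.1).inv := ⟨_, rfl⟩
  have hs' : c ▷ M.1 ⊗≫ ld M.1 ◁ (σ.β M.1).hom =
      dualBraidHom M M.1 ≫ M.1 ◁ c ⊗≫ b ▷ coendObj V ⊗≫ 𝟙 (ld M.1 ⊗ M.1 ⊗ coendObj V) := by
    rw [hb, hc]
    exact hs
  have e1 : c ▷ M.1 ≫ (α_ (ld M.1) (coendObj V) M.1).hom ≫ ld M.1 ◁ (σ.β M.1).hom ≫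
      (α_ (ld M.1) M.1 (coendObj V)).inv ≫ ε_ M.1 (ld M.1) ▷ coendObj V ≫ (λ_ (coendObj V)).hom =
      (dualBraidHom M M.1 ≫ M.1 ◁ c) ⊗≫
        (b ≫ ε_ M.1 (ld M.1)) ▷ coendObj V ⊗≫ 𝟙 (coendObj V) := by
    calc _ = (c ▷ M.1 ⊗≫ ld M.1 ◁ (σ.β M.1).hom) ⊗≫ ε_ M.1 (ld M.1) ▷ coendObj V ⊗≫
          𝟙 (coendObj V) := by monoidal
      _ = _ := by rw [hs']; monoidal
  rw [hb, hc] at e1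
  exact e1

lemma coendData_pairing (hV : IsFusion k V) (hιf : ∀ M, (ι M).f = coendMap F M)
    {ω : coendCenter V σ ⊗ coendCenter V σ ⟶ 𝟙_ (Center C)} (hω : IsCoendPairing ι ω) :
    ω.f = pairingFormula F := by
  apply hom_ext_coendMap_tensor F hV
  intro M N
  refine Eq.trans ?_ (pairing_formula F hV M N).symm
  have h := congrArg Center.Hom.f (hω.eq M N)
  simp only [Center.comp_f, Center.tensor_f, Center.whiskerLeft_f, Center.whiskerRight_f,
    Center.associator_hom_f, Center.associator_inv_f, Center.leftUnitor_hom_f, hιf] at h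
  have e : (α_ (ld M.1) M.1 (ld N.1 ⊗ N.1)).hom ≫ ld M.1 ◁ ((α_ M.1 (ld N.1) N.1).inv ≫
        ((M.2.β (ld N.1)).hom ≫ dualBraidHom N M.1) ▷ N.1 ≫ (α_ M.1 (ld N.1) N.1).hom) ≫
        (α_ (ld M.1) M.1 (ld N.1 ⊗ N.1)).inv ≫ (ε_ M.1 (ld M.1) ⊗ₘ ε_ N.1 (ld N.1)) ≫
          (λ_ (𝟙_ C)).hom =
      𝟙 ((ld M.1 ⊗ M.1) ⊗ (ld N.1 ⊗ N.1)) ⊗≫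
        ld M.1 ◁ (((M.2.β (ld N.1)).hom ≫ dualBraidHom N M.1) ▷ N.1) ⊗≫
        (ε_ M.1 (ld M.1) ⊗ₘ ε_ N.1 (ld N.1)) ≫ (λ_ (𝟙_ C)).hom := by
    simp only [MonoidalCategory.tensorHom_def]
    monoidal
  exact h.trans e

lemma coendData_twistPos (φ : SovereignStructure C) (hV : IsFusion k V)
    (hδ : ∀ M, (coaction ι M).f = coendCoact F M) {t : ∀ M : Center C, M ⟶ M}
    (ht : ∀ M, (t M).f = canonicalTwist φ M) {θ : coendCenter V σ ⟶ 𝟙_ (Center C)}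
    (hθ : IsFormOf ι t θ) : θ.f = twistPosFormula φ V := by
  apply coendCoact_ext F hV
  intro M
  refine Eq.trans ?_ (twistPos_formula F φ hV M).symm
  have h := congrArg Center.Hom.f (hθ M)
  rw [Center.comp_f, Center.comp_f, Center.whiskerLeft_f, Center.rightUnitor_hom_f, hδ, ht] at h
  exact eq_comp_rightUnitor_inv h

lemma coendData_twistNeg (φ : SovereignStructure C) (hV : IsFusion k V)
    (hδ : ∀ M, (coaction ι M).f = coendCoact F M) {θ : coendCenter V σ ⟶ 𝟙_ (Center C)}
    (hθ : IsFormOf ι (fun M => φ.center.twistInv M) θ) : θ.f = twistNegFormula F φ := by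
  apply coendCoact_ext F hV
  intro M
  refine Eq.trans ?_ (twistNeg_formula F φ hV M).symm
  have h := congrArg Center.Hom.f (hθ M)
  rw [Center.comp_f, Center.comp_f, Center.whiskerLeft_f, Center.rightUnitor_hom_f, hδ] at h
  exact eq_comp_rightUnitor_inv h

end Formulas
end CenterCoend


theorem mainTheorem4 {k : Type w'} [CommRing k] {C : Type u} [Category.{v} C] [Preadditive C]
    [Linear k C] [MonoidalCategory.{v} C] [MonoidalPreadditive C] [MonoidalLinear k C]
    [RigidCategory C] [Limits.HasFiniteBiproducts C] {I : Type w} [Fintype I]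
    (V : I → C) (hV : IsFusion k V) (φ : SovereignStructure C) (hφ : φ.IsSpherical) :
    Nonempty (FusionChoices V) ∧
    (∃ (σ : HalfBraiding (coendObj V))
      (ι : ∀ M : Center C, ld M ⊗ M ⟶ coendCenter V σ)
      (_ : HopfObj (coendCenter V σ))
      (ω : coendCenter V σ ⊗ coendCenter V σ ⟶ 𝟙_ (Center C))
      (R : RibbonStructure (Center C))
      (θp θm : coendCenter V σ ⟶ 𝟙_ (Center C)),
      IsCoend ι ∧ IsCoendHopf ι ∧ IsCoendPairing ι ω ∧
      (∀ M : Center C, (R.twist M).hom.f = canonicalTwist φ M) ∧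
      IsFormOf ι (fun M => (R.twist M).hom) θp ∧
      IsFormOf ι (fun M => (R.twist M).inv) θm ∧
      θp.f = twistPosFormula φ V ∧
      ∀ F : FusionChoices V,
        (∀ M : Center C, (ι M).f = coendMap F M) ∧
        (ComonObj.comul (X := coendCenter V σ)).f = comulFormula F ∧
        (ComonObj.counit (X := coendCenter V σ)).f = counitFormula F ∧
        (HopfObj.antipode (X := coendCenter V σ)).f = antipodeFormula F ∧
        ω.f = pairingFormula F ∧
        θm.f = twistNegFormula F φ ∧
        (β_ (coendCenter V σ) (coendCenter V σ)).hom.f = braidFormula F) ∧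
    (∃ ψ : SovereignStructure (Center C), ∀ M : Center C, (ψ.iso M).hom.f = (φ.iso M.1).hom) ∧
    (∃ (δ : 𝟙_ C ⟶ 𝟙_ C) (δZ : 𝟙_ (Center C) ⟶ 𝟙_ (Center C)),
      φ.HasDimension δ ∧
      (∀ ψ : SovereignStructure (Center C), ψ.HasDimension δZ) ∧
      δZ.f = δ ≫ δ) := by
  -- One auxiliary choice serves to construct the coend; the half braiding and the Hopf structure
  -- stay fixed from here on.
  obtain ⟨F₀⟩ := hV.nonempty_choices
  obtain ⟨σ, ι, hσ, hι, hc, hu⟩ := exists_coend_center F₀ hV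
  obtain ⟨H, hH⟩ := exists_coendData hu
  -- Since the coaction does not depend on the choices, the formulas may be verified for every `F`
  -- on the coend built from `F₀`.
  have hδ (F : FusionChoices V) (M : Center C) : (H.δ M).f = coendCoact F M := by
    rw [hH, coendCoact_congr F hV F₀]
    exact hc M
  have hδ' (F : FusionChoices V) (M : Center C) : (coaction ι M).f = coendCoact F M := by
    rw [coendCoact_congr F hV F₀]
    exact hc M
  have hιf (F : FusionChoices V) (M : Center C) : (ι M).f = coendMap F M := by
    rw [coendMap_congr F hV F₀]
    exact hι M
  have hσ' (F : FusionChoices V) (M : Center C) (Y : C) :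
      coendCoact F M ▷ Y ⊗≫ M.1 ◁ (σ.β Y).hom =
        (M.2.β Y).hom ≫ Y ◁ coendCoact F M ⊗≫ (M.2.β Y).inv ▷ coendObj V ⊗≫ 𝟙 _ := by
    rw [coendCoact_congr F hV F₀]
    exact hσ M Y
  obtain ⟨ω, hω⟩ := H.exists_pairing hH
  obtain ⟨θp, hθp⟩ := H.exists_form hH φ.center.twistHom fun f => φ.center.twist_naturality f
  obtain ⟨θm, hθm⟩ := H.exists_form hH φ.center.twistInv fun {X Y} f => by
    have h := φ.center.twist_naturality f
    change f ≫ (φ.center.twistIso Y).hom = (φ.center.twistIso X).hom ≫ f at h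
    change f ≫ (φ.center.twistIso Y).inv = (φ.center.twistIso X).inv ≫ f
    rw [Iso.comp_inv_eq, Category.assoc, h, Iso.inv_hom_id_assoc]
  refine ⟨⟨F₀⟩, ⟨σ, ι, H.hopfObj, ω, φ.ribbon hV hφ, θp, θm, isCoend_of_isUniversalCoaction ι hu,
    H.isCoendHopf hH, hω, φ.center_twistHom, hθp, hθm,
    coendData_twistPos F₀ φ hV (hδ' F₀) φ.center_twistHom hθp, fun F => ⟨hιf F,
      coendData_comul F H hV (hδ F), coendData_counit F H hV (hδ F),
      coendData_antipode F H hV hH (hιf F) (hδ F) (hσ' F), coendData_pairing F hV (hιf F) hω,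
      coendData_twistNeg F φ hV (hδ' F) hθm, braid_formula F hV (hσ' F)⟩⟩,
    ⟨φ.center, fun M => rfl⟩, φ.exists_hasDimension hφ hV ι hu⟩
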